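/- **Twisted KZB connection.** Write $\mathbf e(x)=e^{2\pi i x}$. Let $\mathfrak g$ be a finite-dimensional simple complex Lie algebra with Cartan subalgebra $\mathfrak h$ and root system $R$, and let $\nu$ be a diagram automorphism of $\mathfrak g$ (it preserves $\mathfrak h$ and permutes a system of simple root vectors) of order $r$ ($r=2$, or $r=3$ for $D_4$; $r=1$ is the untwisted case). Put $\omega=\mathbf e(1/r)$, $\mathfrak h_0=\mathfrak h^\nu$, $n=\dim\mathfrak h_0$. Let $(\cdot,\cdot)$ be a nonzero multiple of the Killing form. Choose root vectors $E_\alpha$ with $(E_\alpha,E_{-\alpha})=1$, an orthonormal basis $(\varepsilon_k)$ of $\mathfrak h$ and an orthonormal basis $(\mathfrak e^0_k)_{k\le n}$ of $\mathfrak h_0$, and put, for $m\in\mathbb Z$, $$\mathfrak t^m_\alpha=\sum_{j=0}^{r-1}\omega^{-jm}\nu^jE_\alpha,\qquad \epsilon^m_k=\frac1r\sum_{j=0}^{r-1}\omega^{-jm}\nu^j\varepsilon_k .$$ Let $\theta(z|\tau)=i\sum_{k\in\mathbb Z}(-1)^k\mathbf e\big(\tfrac12(k-\tfrac12)^2\tau+(k-\tfrac12)z\big)$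 and $$\phi(u,z|\tau)=\frac{\theta'(0)\theta(u+z)}{\theta(u)\theta(z)},\quad E_1=\partial_z\log\theta,\quad E_2=-\partial_zE_1,\quad \wp=E_2-2\eta_1,\quad \eta_1=-\frac{\theta'''(0)}{6\,\theta'(0)},$$ $$\phi^{(m)}(u,z|\tau)=\mathbf e(mz/r)\,\phi(u+m\tau/r,z|\tau).$$ Let $V_1,\dots,V_l$ be finite-dimensional $\mathfrak g$-modules, $W=V_1\otimes\cdots\otimes V_l$, and write $x^a$ for the action of $x\in\mathfrak g$ on the $a$-th factor. Let $\varpi\in\mathfrak h_0$ be a constant. On the space of points $(\tau,t_1,\dots,t_l,u_1,\dots,u_n)$ with $\operatorname{Im}\tau>0$, $t_a\in\mathbb C^*$, put $\mathbf u=\sum_ku_k\mathfrak e^0_k\in\mathfrak h_0$; for $a\ne c$ let $z_{ac}$ be defined by $t_a/t_c=\mathbf e(z_{ac}/r)$ (the functions below do not depend on the choice), and let $z_{aa}=0$. Define $$r^{ac}=\frac{r}{2\pi i}\sum_{m=0}^{r-1}\Big(\frac1{r^2}\sum_{\alpha\in R}\phi^{(-m)}\big(-\alpha(\mathbf u+\varpi),z_{ac}|\tau\big)\,\mathfrak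 t^{m,a}_\alpha\,\mathfrak t^{-m,c}_{-\alpha}+\sum_k\psi_m(z_{ac})\,\epsilon^{m,a}_k\epsilon^{-m,c}_k\Big)\quad(a\ne c),$$ $$f^{bd}=\sum_{m=0}^{r-1}\Big(\frac1{r^2}\sum_{\alpha\in R}(\partial_1\phi^{(-m)})\big(-\alpha(\mathbf u+\varpi),z_{bd}|\tau\big)\,\mathfrak t^{m,b}_\alpha\,\mathfrak t^{-m,d}_{-\alpha}+\sum_k\chi_m(z_{bd})\,\epsilon^{m,b}_k\epsilon^{-m,d}_k\Big),$$ where $\partial_1$ is the derivative in the first argument, $\psi_0=E_1$, $\chi_0=\tfrac12(E_1^2-\wp)$, and $\psi_m(z)=\phi^{(-m)}(0,z|\tau)$, $\chi_m(z)=(\partial_1\phi^{(-m)})(0,z|\tau)$ for $0<m<r$. The coefficients of $f$ are regular at $z=0$, and for $b=d$ their limits there are used, namely $-E_2(v-m\tau/r)$ for $\partial_1\phi^{(-m)}(v,\cdot)$ and $-2\eta_1$ for $\chi_0$. Further let $$\hat\partial^a=-\frac r{2\pi i}\sum_{k=1}^n\mathfrak e^{0,a}_k\,\partial_{u_k},\qquad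 \Delta=\frac12\sum_{k=1}^n\partial_{u_k}^2 ,$$ $$\nabla_a=t_a\partial_{t_a}+\hat\partial^a+\sum_{c\ne a}r^{ac}\quad(1\le a\le l),\qquad \nabla_\tau=2\pi i\,\partial_\tau+\Delta+\frac12\sum_{b,d=1}^lf^{bd}.$$ Let $U$ be an open set of points with $(t_a/t_c)^r\notin\mathbf e(\mathbb Z\tau)$ for $a\neq c$ and $\alpha(\mathbf u+\varpi)+m\tau/r\notin\mathbb Z+\mathbb Z\tau$ for all $0\le m<r$ and $\alpha\in R$ with $\mathfrak t^m_\alpha\ne0$. Let $\mathcal S(U)$ be the space of holomorphic functions on $U$ with values in the zero weight space $\{w\in W:\ \sum_ah^aw=0\ \text{for all }h\in\mathfrak h_0\}$. Then $\nabla_1,\dots,\nabla_l,\nabla_\tau$ map $\mathcal S(U)$ to itself and define a flat connection on it: $$[\nabla_a,\nabla_b]=0,\qquad[\nabla_a,\nabla_\tau]=0\qquad\text{on }\mathcal S(U),\quad 1\le a,b\le l .$$ -/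

import Mathlib

open scoped TensorProduct

noncomputable section

namespace TwistedKZB

/-! ### Elliptic functions on `ℂ / (ℤ + ℤ τ)` -/

/-- `𝐞(x) = exp (2 π i x)`. -/
def ee (x : ℂ) : ℂ := Complex.exp (2 * Real.pi * Complex.I * x)

/-- The odd theta function
`θ(z|τ) = i ∑ₖ (-1)^k q^{(k-1/2)²/2} 𝐞((k-1/2) z)`, `q = 𝐞(τ)`. -/
def theta (z τ : ℂ) : ℂ :=
  Complex.I * ∑' k : ℤ, (-1 : ℂ) ^ k *
    ee (((k : ℂ) - 1 / 2) ^ 2 / 2 * τ + ((k : ℂ) - 1 / 2) * z)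

/-- The Kronecker function `φ(u,z|τ) = θ'(0) θ(u+z) / (θ(u) θ(z))`. -/
def phi (u z τ : ℂ) : ℂ :=
  deriv (fun w => theta w τ) 0 * theta (u + z) τ / (theta u τ * theta z τ)

/-- The first Eisenstein function `E₁(z|τ) = ∂_z log θ(z|τ)`. -/
def E1 (z τ : ℂ) : ℂ := logDeriv (fun w => theta w τ) z

/-- The second Eisenstein function `E₂(z|τ) = -∂_z E₁(z|τ)`. -/
def E2 (z τ : ℂ) : ℂ := -deriv (fun w => E1 w τ) z

/-- `η₁(τ) = -θ'''(0) / (6 θ'(0))`, which is `-2 π i η'(τ) / η(τ)` for the Dedekind function `η`. -/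
def eta1 (τ : ℂ) : ℂ :=
  -iteratedDeriv 3 (fun w => theta w τ) 0 / (6 * deriv (fun w => theta w τ) 0)

/-- The Weierstrass function `℘ = E₂ - 2 η₁`; its expansion at `0` is `z⁻² + O(z²)`. -/
def wp (z τ : ℂ) : ℂ := E2 z τ - 2 * eta1 τ

/-- `φ^{(m)}(u,z|τ) = 𝐞(m z / r) φ(u + m τ / r, z|τ)`. -/
def phiM (r : ℕ) (m : ℤ) (u z τ : ℂ) : ℂ :=
  ee (m * z / r) * phi (u + m * τ / r) z τ

/-- A `z` with `t = 𝐞(z / r)`.  It is unique up to `r ℤ`, and the functions of `z` it is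
substituted into below are invariant under `z ↦ z + r`. -/
def zOf (r : ℕ) (t : ℂ) : ℂ := r * Complex.log t / (2 * Real.pi * Complex.I)

/-- Coefficient of the root part of the `r`-matrix: `φ^{(-m)}(v, z)`, `t = 𝐞(z / r)`. -/
def rootCoeff (r m : ℕ) (v t τ : ℂ) : ℂ := phiM r (-m) v (zOf r t) τ

/-- `∂_v φ^{(-m)}(v, z)`, `t = 𝐞(z / r)`; it is regular at `z = 0`, where its value (the limit)
is `-E₂(v - m τ / r)`. -/
def dRootCoeff (r m : ℕ) (v t τ : ℂ) : ℂ :=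
  if t = 1 then -E2 (v - m * τ / r) τ
  else deriv (fun w => phiM r (-m) w (zOf r t) τ) v

/-- Coefficient of the Cartan part of the `r`-matrix: `E₁(z)` for `m = 0`, and `φ^{(-m)}(0, z)`
for `m ≠ 0`. -/
def cartanCoeff (r m : ℕ) (t τ : ℂ) : ℂ :=
  if m = 0 then E1 (zOf r t) τ else rootCoeff r m 0 t τ

/-- Coefficient of the Cartan part of `f`: `(E₁(z)² - ℘(z)) / 2` for `m = 0` (regular at `z = 0`,
with limit `-2 η₁`), and `∂_v φ^{(-m)}(v, z)` at `v = 0` for `m ≠ 0`. -/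
def dCartanCoeff (r m : ℕ) (t τ : ℂ) : ℂ :=
  if m = 0 then
    if t = 1 then -2 * eta1 τ else (E1 (zOf r t) τ ^ 2 - wp (zOf r t) τ) / 2
  else dRootCoeff r m 0 t τ

/-! ### Diagram automorphisms and adapted bases -/

section LieTheory

variable {𝔤 : Type*} [LieRing 𝔤] [LieAlgebra ℂ 𝔤] [FiniteDimensional ℂ 𝔤]
  [LieAlgebra.IsSimple ℂ 𝔤]

/-- `ν` is a diagram automorphism with respect to the Cartan subalgebra `H`: it preserves `H` and
permutes a system of nonzero simple root vectors. -/
def IsDiagramAut (H : LieSubalgebra ℂ 𝔤) [H.IsCartanSubalgebra] (ν : 𝔤 ≃ₗ⁅ℂ⁆ 𝔤) : Prop :=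
  (∀ x ∈ H, ν x ∈ H) ∧
  ∃ (b : (LieAlgebra.IsKilling.rootSystem H).Base) (x : b.support → 𝔤)
    (σ : Equiv.Perm b.support),
    (∀ i : b.support, x i ∈ LieAlgebra.rootSpace H i.1.1 ∧ x i ≠ 0) ∧ ∀ i, ν (x i) = x (σ i)

/-- `𝔥₀`, the `ν`-invariant part of the Cartan subalgebra. -/
def invCartan (H : LieSubalgebra ℂ 𝔤) (ν : 𝔤 ≃ₗ⁅ℂ⁆ 𝔤) : Submodule ℂ H where
  carrier := {x | ν (x : 𝔤) = x}
  add_mem' := by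
    intro x y hx hy
    simp only [Set.mem_ofPred_eq] at hx hy ⊢
    simp [hx, hy]
  zero_mem' := by simp
  smul_mem' := by
    intro c x hx
    simp only [Set.mem_ofPred_eq] at hx ⊢
    simp [hx]

/-- The choices in which the connection is written, for the invariant form
`(x, y) = c · killingForm x y`: root vectors `E_α` with `(E_α, E_{-α}) = 1`, an orthonormal basis
of the Cartan subalgebra `𝔥`, and an orthonormal basis of `𝔥₀`. -/
structure AdaptedBasis (H : LieSubalgebra ℂ 𝔤) [H.IsCartanSubalgebra] (ν : 𝔤 ≃ₗ⁅ℂ⁆ 𝔤)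
    (c : ℂ) (N n : ℕ) where
  E : LieModule.Weight ℂ H 𝔤 → 𝔤
  E_mem : ∀ α ∈ H.root, E α ∈ LieAlgebra.rootSpace H α
  E_pair : ∀ α ∈ H.root, c * killingForm ℂ 𝔤 (E α) (E (-α)) = 1
  eps : Module.Basis (Fin N) ℂ H
  eps_orthonormal : ∀ j k, c * killingForm ℂ 𝔤 (eps j : 𝔤) (eps k : 𝔤) = if j = k then 1 else 0
  e0 : Module.Basis (Fin n) ℂ (invCartan H ν)
  e0_orthonormal : ∀ j k,
    c * killingForm ℂ 𝔤 ((e0 j : H) : 𝔤) ((e0 k : H) : 𝔤) = if j = k then 1 else 0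

variable {H : LieSubalgebra ℂ 𝔤} [H.IsCartanSubalgebra] {ν : 𝔤 ≃ₗ⁅ℂ⁆ 𝔤} {c : ℂ} {N n : ℕ}

/-- `∑_{j<r} ω^{-jm} ν^j x` with `ω = 𝐞(1/r)`: an eigenvector of `ν` for the eigenvalue `ω^m`. -/
def eigSum (ν : 𝔤 ≃ₗ⁅ℂ⁆ 𝔤) (r : ℕ) (m : ℤ) (x : 𝔤) : 𝔤 :=
  ∑ j ∈ Finset.range r, ee (-(j * m) / r) • (ν^[j]) x

/-- `𝔱^m_α = ∑_{j<r} ω^{-jm} ν^j E_α`. -/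
def AdaptedBasis.t (A : AdaptedBasis H ν c N n) (r : ℕ) (m : ℤ) (α : LieModule.Weight ℂ H 𝔤) : 𝔤 :=
  eigSum ν r m (A.E α)

/-- `𝔢^m_k = (1/r) ∑_{j<r} ω^{-jm} ν^j ε_k`, the component of `ε_k` in `𝔥_m`. -/
def AdaptedBasis.e (A : AdaptedBasis H ν c N n) (r : ℕ) (m : ℤ) (k : Fin N) : 𝔤 :=
  (1 / (r : ℂ)) • eigSum ν r m (A.eps k : 𝔤)

/-- The element `𝐮 = ∑ u_k 𝔢^0_k` of `𝔥₀`. -/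
def AdaptedBasis.pt (A : AdaptedBasis H ν c N n) (u : Fin n → ℂ) : invCartan H ν :=
  ∑ k, u k • A.e0 k

/-- The points `(τ, (t_a), (u_k))`, for `l` marked points and `dim 𝔥₀ = n`. -/
abbrev Pt (l n : ℕ) : Type := ℂ × (Fin l → ℂ) × (Fin n → ℂ)

/-- The common domain of regularity: `Im τ > 0`, distinct marked points on the curve, and `𝐮`
off the singular hyperplanes of the coefficients. -/
def regularSet (A : AdaptedBasis H ν c N n) (r l : ℕ) (ϖ : invCartan H ν) : Set (Pt l n) :=
  {x | 0 < x.1.im ∧ (∀ a, x.2.1 a ≠ 0) ∧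
    (∀ a b, a ≠ b → ∀ k : ℤ, (x.2.1 a / x.2.1 b) ^ r ≠ ee (k * x.1)) ∧
    ∀ m < r, ∀ α ∈ H.root, A.t r m α ≠ 0 →
      ∀ j k : ℤ, α ((A.pt x.2.2 + ϖ : invCartan H ν) : H) + m * x.1 / r ≠ j + k * x.1}

/-! ### The connection -/

section Connection

variable {W : Type*} [NormedAddCommGroup W] [NormedSpace ℂ W] {l : ℕ}

/-- The dynamical twisted `r`-matrix `r^{ac}`, acting at the sites `a` and `c`. -/
def rMat (A : AdaptedBasis H ν c N n) (r : ℕ) (ϖ : invCartan H ν)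
    (ρ : Fin l → 𝔤 → Module.End ℂ W) (a b : Fin l) (x : Pt l n) : Module.End ℂ W :=
  ((r : ℂ) / (2 * Real.pi * Complex.I)) • ∑ m ∈ Finset.range r,
    ((∑ α ∈ H.root,
        (1 / (r : ℂ) ^ 2 * rootCoeff r m (-α ((A.pt x.2.2 + ϖ : invCartan H ν) : H))
          (x.2.1 a / x.2.1 b) x.1) • (ρ a (A.t r m α) * ρ b (A.t r (-m) (-α)))) +
      ∑ k, cartanCoeff r m (x.2.1 a / x.2.1 b) x.1 • (ρ a (A.e r m k) * ρ b (A.e r (-m) k)))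

/-- The operator `f^{bd}`, acting at the sites `b` and `d` (possibly `b = d`). -/
def fMat (A : AdaptedBasis H ν c N n) (r : ℕ) (ϖ : invCartan H ν)
    (ρ : Fin l → 𝔤 → Module.End ℂ W) (b d : Fin l) (x : Pt l n) : Module.End ℂ W :=
  ∑ m ∈ Finset.range r,
    ((∑ α ∈ H.root,
        (1 / (r : ℂ) ^ 2 * dRootCoeff r m (-α ((A.pt x.2.2 + ϖ : invCartan H ν) : H))
          (x.2.1 b / x.2.1 d) x.1) • (ρ b (A.t r m α) * ρ d (A.t r (-m) (-α)))) +
      ∑ k, dCartanCoeff r m (x.2.1 b / x.2.1 d) x.1 • (ρ b (A.e r m k) * ρ d (A.e r (-m) k)))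

/-- `∂F/∂τ`. -/
def dTau (F : Pt l n → W) (x : Pt l n) : W := fderiv ℂ F x (1, 0, 0)

/-- `∂F/∂t_a`. -/
def dT (a : Fin l) (F : Pt l n → W) (x : Pt l n) : W := fderiv ℂ F x (0, Pi.single a 1, 0)

/-- `∂F/∂u_k`. -/
def dU (k : Fin n) (F : Pt l n → W) (x : Pt l n) : W := fderiv ℂ F x (0, 0, Pi.single k 1)

/-- `∂̂^a = -(r / 2πi) ∑_k 𝔢_k^{0,a} ∂_{u_k}`. -/
def dHat (A : AdaptedBasis H ν c N n) (r : ℕ) (ρ : Fin l → 𝔤 → Module.End ℂ W) (a : Fin l)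
    (F : Pt l n → W) (x : Pt l n) : W :=
  (-((r : ℂ) / (2 * Real.pi * Complex.I))) • ∑ k, ρ a ((A.e0 k : H) : 𝔤) (dU k F x)

/-- `∇_a = t_a ∂_{t_a} + ∂̂^a + ∑_{c ≠ a} r^{ac}`. -/
def nabla (A : AdaptedBasis H ν c N n) (r : ℕ) (ϖ : invCartan H ν)
    (ρ : Fin l → 𝔤 → Module.End ℂ W) (a : Fin l) (F : Pt l n → W) (x : Pt l n) : W :=
  x.2.1 a • dT a F x + dHat A r ρ a F x +
    ∑ b ∈ Finset.univ.erase a, rMat A r ϖ ρ a b x (F x)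

/-- `∇_τ = 2πi ∂_τ + Δ + ½ ∑_{b,d} f^{bd}`, `Δ = ½ ∑_k ∂²_{u_k}`. -/
def nablaTau (A : AdaptedBasis H ν c N n) (r : ℕ) (ϖ : invCartan H ν)
    (ρ : Fin l → 𝔤 → Module.End ℂ W) (F : Pt l n → W) (x : Pt l n) : W :=
  (2 * Real.pi * Complex.I : ℂ) • dTau F x + (1 / 2 : ℂ) • ∑ k, dU k (dU k F) x +
    (1 / 2 : ℂ) • ∑ b, ∑ d, fMat A r ϖ ρ b d x (F x)

/-- The zero weight space: vectors killed by the total action `∑_a h^a` of every `h ∈ 𝔥₀`. -/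
def zeroWeight (H : LieSubalgebra ℂ 𝔤) (ν : 𝔤 ≃ₗ⁅ℂ⁆ 𝔤) (ρ : Fin l → 𝔤 → Module.End ℂ W) :
    Set W :=
  {w | ∀ h : invCartan H ν, ∑ a, ρ a ((h : H) : 𝔤) w = 0}

/-- `F` is a local section over `U`: holomorphic on `U` with values in the zero weight space. -/
def IsSection (H : LieSubalgebra ℂ 𝔤) (ν : 𝔤 ≃ₗ⁅ℂ⁆ 𝔤) (ρ : Fin l → 𝔤 → Module.End ℂ W)
    (U : Set (Pt l n)) (F : Pt l n → W) : Prop :=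
  AnalyticOnNhd ℂ F U ∧ ∀ x ∈ U, F x ∈ zeroWeight H ν ρ

end Connection

/-- The action `1 ⊗ ⋯ ⊗ x ⊗ ⋯ ⊗ 1` of `x ∈ 𝔤` on the `a`-th factor of `⨂ V_a`, transported to
`W` along `e`. -/
def siteAct {l : ℕ} {V : Fin l → Type*} [∀ a, AddCommGroup (V a)] [∀ a, Module ℂ (V a)]
    [∀ a, LieRingModule 𝔤 (V a)] [∀ a, LieModule ℂ 𝔤 (V a)]
    {W : Type*} [AddCommGroup W] [Module ℂ W] (e : (⨂[ℂ] a, V a) ≃ₗ[ℂ] W)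
    (a : Fin l) (x : 𝔤) : Module.End ℂ W :=
  e.toLinearMap ∘ₗ
    PiTensorProduct.map
      (Function.update (fun b => (LinearMap.id : V b →ₗ[ℂ] V b)) a
        (LieModule.toEnd ℂ 𝔤 (V a) x)) ∘ₗ
    e.symm.toLinearMap

end LieTheory

end TwistedKZB

end

/-! ### Joint analyticity of functions of two complex variables. -/

noncomputable section
namespace TwistedKZB
open Complex Metric Set Filter Topology

/-! Everything is written in a frame `y_i` of the Lie algebra, with dual members `y_{i*}`,
consisting of eigenvectors of `ν` that are also weight vectors for `𝔥₀`; the members with index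
`inl` form an orthonormal basis of `𝔥₀`. The frame may be overcomplete. What matters is the
expansion `x = ∑ (x, y_i) y_{i*}` (`sum_vec`), which makes `C_{ijk} = ([y_i, y_j], y_k)` structure
constants: cyclic, antisymmetric, and zero unless the degrees add up to `0` modulo `r` and the
weights to `0` (`structC_deg`, `structC_wgt`). Up to the factor `r / 2πi`, the r-matrix is `∑ κ_i(z)
y_i ⊗ y_{i*}`, and `f` is the same sum with coefficients `g_i`. Off `𝔥₀` one has `κ_i = 𝐞(-s z) φ(v
- s τ, z)` with `s = m / r` and `v` the value of the weight, and `g_i` is its derivative in `v`; on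
`𝔥₀` the coefficients are `E₁` and `(E₁² - ℘) / 2`.

Let `M_a` and `N` be the potentials of the connection. Sorting the commutators by the derivatives
that fall on the section (`ConnData.nab_comm`, `ConnData.nab_nabT_comm`) leaves three kinds of
conditions. The terms with derivatives of the section cancel because `g` is the weight derivative of
`κ`. The dependence on `t_a` and `τ` is governed by the symmetry of `M` under exchange of sites and
by the mixed heat equation `2πi ∂_τ κ = ∂_z g` at fixed `v` (`hasDerivAt_E1_tau`,
`hasDerivAt_phi_tau`, `hasFDerivAt_kap_comp`). What remains is the algebra of `[M_a, M_b]` and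
`[M_a, N]`.

A bracket of two operators that share a site produces `C_{ijk}` times a product of two coefficients.
If none of the three members lies in `𝔥₀`, the Fay identity or one of its derived or degenerate
forms makes the total coefficient vanish. If exactly one does, a degenerate identity leaves a single
function times an element of `𝔥₀` at one site (`kap_identity`, `dkap_identity`, `ekap_identity`);
two at once do not occur, as `𝔥₀` is commutative. These leftovers cancel against the `u`-derivatives
of the potentials, except for sums over all sites `s` of the same expression with the Cartan element
at `s`. There the total action of `𝔥₀` can be moved to the right (`Frame.sum_hop`), where it kills
the zero weight space (`Frame.Coeffs.commutator_M`, `Frame.Coeffs.commutator_M_N`).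

The elliptic identities all descend from the three term relation `theta_three_term`, by
specialisation and differentiation. That relation is a Plücker relation, because `θ(x+y) θ(x-y)` is
a `2 × 2` determinant (`theta_mul_theta`). Denominators are controlled by the position and
simplicity of the zeros of `θ` (`theta_eq_zero_iff`, `deriv_theta_zero_ne_zero`), and the behaviour
in `τ` by the heat equation for `θ` (`hasDerivAt_theta_tau`). -/

open Classical in
/-- A complex differentiable function of two complex variables is analytic. -/
theorem analyticAt_of_differentiableOn_prod {f : ℂ × ℂ → ℂ} {U : Set (ℂ × ℂ)} (hU : IsOpen U)
    (hf : DifferentiableOn ℂ f U) {p : ℂ × ℂ} (hp : p ∈ U) : AnalyticAt ℂ f p := by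
  obtain ⟨z₀, τ₀⟩ := p
  obtain ⟨R, hR, hRU⟩ := nhds_basis_closedBall.mem_iff.1 (hU.mem_nhds hp)
  rw [← closedBall_prod_same] at hRU
  have hc := hf.continuousOn
  set K := sphere z₀ R
  -- Freezing the second variable turns `f` into a curve in the Banach algebra of continuous
  -- functions on a circle around `z₀`. The default value `0` is not taken for `w` in the closed
  -- ball.
  let A : ℂ → C(K, ℂ) := fun w =>
    if h : Continuous (fun ζ : K => f (ζ, w)) then ⟨_, h⟩ else 0
  have hKc : ∀ w ∈ closedBall τ₀ R, Continuous (fun ζ : K => f (ζ, w)) := by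
    intro w hw
    refine hc.comp_continuous (by fun_prop) fun ζ => hRU ⟨sphere_subset_closedBall ζ.2, hw⟩
  have hAe : ∀ w ∈ closedBall τ₀ R, ∀ ζ : K, A w ζ = f (ζ, w) := by
    intro w hw ζ
    simp only [A, dif_pos (hKc w hw)]
    rfl
  have hAc : ContinuousOn A (closedBall τ₀ R) := by
    rw [continuousOn_iff_continuous_domRestrict]
    let g : C(closedBall τ₀ R × K, ℂ) := ⟨fun q => f (q.2, q.1),
      hc.comp_continuous (by fun_prop) fun q => hRU ⟨sphere_subset_closedBall q.2.2, q.1.2⟩⟩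
    have : (closedBall τ₀ R).domRestrict A = g.curry := by
      ext w ζ
      rw [domRestrict_apply, hAe w w.2 ζ]
      rfl
    rw [this]
    exact g.curry.continuous
  lift R to NNReal using hR.le
  have hR' : 0 < R := by exact_mod_cast hR
  have hAi : CircleIntegrable A τ₀ R :=
    (hAc.mono sphere_subset_closedBall).circleIntegrable R.coe_nonneg
  -- The Cauchy integral in the second variable, with values in `C(K, ℂ)`: it shows that the curve
  -- is analytic in the sup norm, for all points of the circle at once.
  let B : ℂ → C(K, ℂ) := fun τ =>
    (2 * Real.pi * I : ℂ)⁻¹ • ∮ w in C(τ₀, R), (w - τ)⁻¹ • A w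
  have hB : AnalyticAt ℂ B τ₀ := (hasFPowerSeriesOn_cauchy_integral hAi hR').analyticAt
  have hBe : ∀ τ ∈ ball τ₀ R, ∀ ζ : K, B τ ζ = f (ζ, τ) := by
    intro τ hτ ζ
    have hd : DifferentiableOn ℂ (fun w => f (ζ, w)) (closedBall τ₀ R) := by
      refine hf.comp (by fun_prop) fun w hw => hRU ⟨sphere_subset_closedBall ζ.2, hw⟩
    have h1 := two_pi_I_inv_smul_circleIntegral_sub_inv_smul_of_differentiable_on_off_countable
      (s := ∅) (by simp) hτ hd.continuousOn
      (fun w hw => (hd w (ball_subset_closedBall hw.1)).differentiableAt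
        (closedBall_mem_nhds_of_mem hw.1))
    rw [← h1]
    have hci : CircleIntegrable (fun w => (w - τ)⁻¹ • A w) τ₀ R := by
      refine ContinuousOn.circleIntegrable R.coe_nonneg ?_
      refine ContinuousOn.smul (ContinuousOn.inv₀ (f := fun w => w - τ) (by fun_prop) ?_)
        (hAc.mono sphere_subset_closedBall)
      rintro w hw h0
      rw [sub_eq_zero] at h0
      subst h0
      simp only [mem_ball, mem_sphere] at hτ hw
      linarith
    have hev := ContinuousLinearMap.intervalIntegral_comp_comm
        (ContinuousMap.evalCLM ℂ ζ) hci.out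
    simp only [B]
    have : (∮ w in C(τ₀, R), (w - τ)⁻¹ • A w) ζ
        = ContinuousMap.evalCLM ℂ ζ (∮ w in C(τ₀, R), (w - τ)⁻¹ • A w) := rfl
    rw [ContinuousMap.smul_apply, this, circleIntegral, ← hev]
    congr 1
    refine circleIntegral.integral_congr (f := fun w => (w - τ)⁻¹ • A w ζ) R.coe_nonneg
      fun w hw => ?_
    simp only [hAe w (sphere_subset_closedBall hw) ζ]
  -- The coordinate function on the circle. For `z` inside, `J - z` is invertible, so the Cauchy
  -- kernel is an analytic function of `z` with values in `C(K, ℂ)`.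
  let J : C(K, ℂ) := ⟨fun ζ => ζ, by fun_prop⟩
  have hu : ∀ z ∈ ball z₀ R, IsUnit (J - z • (1 : C(K, ℂ))) := by
    intro z hz
    rw [ContinuousMap.isUnit_iff_forall_ne_zero]
    rintro ⟨ζ, hζ⟩ h0
    have h0 : ζ - z = 0 := by simpa [J] using h0
    rw [sub_eq_zero] at h0
    subst h0
    simp only [mem_ball, K, mem_sphere] at hz hζ
    linarith
  have hk : AnalyticAt ℂ (fun z : ℂ => Ring.inverse (J - z • (1 : C(K, ℂ)))) z₀ := by
    obtain ⟨u, hu⟩ := hu z₀ (mem_ball_self hR)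
    have h1 : AnalyticAt ℂ Ring.inverse (J - z₀ • (1 : C(K, ℂ))) := hu ▸ analyticAt_inverse u
    exact AnalyticAt.fun_comp h1 (by fun_prop)
  have hkv : ∀ z ∈ ball z₀ R, ∀ ζ : K, Ring.inverse (J - z • (1 : C(K, ℂ))) ζ = (ζ - z)⁻¹ := by
    intro z hz ζ
    have h1 := congrArg (fun g : C(K, ℂ) => g ζ) (Ring.inverse_mul_cancel _ (hu z hz))
    have h2 : Ring.inverse (J - z • (1 : C(K, ℂ))) ζ * (ζ - z) = 1 := by simpa [J] using h1
    exact eq_inv_of_mul_eq_one_left h2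
  let cm : ℝ → K := fun θ => ⟨circleMap z₀ R θ, circleMap_mem_sphere z₀ R.coe_nonneg θ⟩
  have hcm : Continuous cm := (continuous_circleMap z₀ R).subtype_mk _
  have hci : ∀ g : C(K, ℂ), Continuous fun θ => deriv (circleMap z₀ R) θ * g (cm θ) := by
    intro g
    simp only [deriv_circleMap]
    have := g.continuous.comp hcm
    fun_prop
  -- Contour integration over the circle as a bounded functional; the bound is the length of the
  -- circle.
  let Λ : C(K, ℂ) →L[ℂ] ℂ := LinearMap.mkContinuous
    { toFun := fun g => ∫ θ in (0 : ℝ)..2 * Real.pi, deriv (circleMap z₀ R) θ * g (cm θ)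
      map_add' := by
        intro g h
        rw [← intervalIntegral.integral_add ((hci g).intervalIntegrable _ _)
          ((hci h).intervalIntegrable _ _)]
        simp [mul_add]
      map_smul' := by
        intro a g
        rw [RingHom.id_apply, ← intervalIntegral.integral_smul]
        congr 1
        ext θ
        simp
        ring } (R * (2 * Real.pi)) (by
      intro g
      have := intervalIntegral.norm_integral_le_of_norm_le_const (a := 0) (b := 2 * Real.pi)
        (C := R * ‖g‖) (f := fun θ => deriv (circleMap z₀ R) θ * g (cm θ)) ?_
      · refine this.trans (le_of_eq ?_)
        rw [sub_zero, abs_of_pos (by positivity)]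
        ring
      · intro θ _
        rw [norm_mul, deriv_circleMap]
        simp only [norm_mul, norm_circleMap_zero, norm_I, mul_one, NNReal.abs_eq]
        gcongr
        exact g.norm_coe_le_norm _)
  -- Combining both Cauchy formulas exhibits `f` as a bounded functional of the product of an
  -- analytic function of `z` and an analytic function of `τ`.
  have key : ∀ᶠ q : ℂ × ℂ in 𝓝 (z₀, τ₀), f q = (2 * Real.pi * I : ℂ)⁻¹ *
      Λ (Ring.inverse (J - q.1 • (1 : C(K, ℂ))) * B q.2) := by
    have hn : ball z₀ (R : ℝ) ×ˢ ball τ₀ (R : ℝ) ∈ 𝓝 (z₀, τ₀) :=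
      prod_mem_nhds (ball_mem_nhds _ hR) (ball_mem_nhds _ hR)
    filter_upwards [hn]
    rintro ⟨z, τ⟩ ⟨hz, hτ⟩
    have hd : DifferentiableOn ℂ (fun w => f (w, τ)) (closedBall z₀ R) := by
      refine hf.comp (by fun_prop) fun w hw => hRU ⟨hw, ball_subset_closedBall hτ⟩
    have h1 := two_pi_I_inv_smul_circleIntegral_sub_inv_smul_of_differentiable_on_off_countable
      (s := ∅) (by simp) hz hd.continuousOn
      (fun w hw => (hd w (ball_subset_closedBall hw.1)).differentiableAt
        (closedBall_mem_nhds_of_mem hw.1))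
    rw [← h1, smul_eq_mul]
    congr 1
    simp only [circleIntegral, Λ, LinearMap.mkContinuous_apply, LinearMap.coe_mk, AddHom.coe_mk]
    congr 1
    ext θ
    rw [ContinuousMap.mul_apply, hkv z hz, hBe τ hτ]
    rfl
  refine AnalyticAt.congr ?_ (EventuallyEq.symm key)
  refine analyticAt_const.mul ?_
  have h1 : AnalyticAt ℂ (fun q : ℂ × ℂ => Ring.inverse (J - q.1 • (1 : C(K, ℂ)))) (z₀, τ₀) :=
    AnalyticAt.comp_of_eq hk analyticAt_fst rfl
  have h2 : AnalyticAt ℂ (fun q : ℂ × ℂ => B q.2) (z₀, τ₀) :=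
    AnalyticAt.comp_of_eq (g := B) hB analyticAt_snd rfl
  exact AnalyticAt.fun_comp (Λ.analyticAt _) (h1.mul h2)

end TwistedKZB
end

noncomputable section
namespace TwistedKZB
open Complex Metric Set Filter Topology

/-! ### Theta functions -/

attribute [fun_prop] analyticAt_fst analyticAt_snd

theorem ee_add (x y : ℂ) : ee (x + y) = ee x * ee y := by
  simp only [ee, mul_add, Complex.exp_add]

theorem ee_neg (x : ℂ) : ee (-x) = (ee x)⁻¹ := by
  simp only [ee, mul_neg, Complex.exp_neg]

theorem ee_sub (x y : ℂ) : ee (x - y) = ee x * (ee y)⁻¹ := by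
  rw [sub_eq_add_neg, ee_add, ee_neg]

theorem ee_zero : ee 0 = 1 := by simp [ee]

theorem ee_ne_zero (x : ℂ) : ee x ≠ 0 := Complex.exp_ne_zero _

theorem ee_intCast (k : ℤ) : ee k = 1 := by
  rw [ee, mul_comm]
  exact Complex.exp_int_mul_two_pi_mul_I k

theorem ee_half : ee (1 / 2) = -1 := by
  rw [ee, ← Complex.exp_pi_mul_I]
  ring_nf

theorem ee_intCast_div_two (k : ℤ) : ee (k / 2) = (-1) ^ k := by
  rw [← ee_half, ee, ee, ← Complex.exp_int_mul]
  ring_nf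

theorem ee_eq_one_iff {x : ℂ} : ee x = 1 ↔ ∃ k : ℤ, x = k := by
  rw [ee, Complex.exp_eq_one_iff]
  have h := Complex.two_pi_I_ne_zero
  refine exists_congr fun k => ⟨fun h1 => ?_, fun h1 => ?_⟩
  · apply mul_left_cancel₀ h
    rw [h1]
    ring
  · rw [h1]
    ring

theorem analyticAt_ee (x : ℂ) : AnalyticAt ℂ ee x := by
  unfold ee
  fun_prop

theorem hasDerivAt_ee (x : ℂ) : HasDerivAt ee (2 * Real.pi * I * ee x) x := by
  have h := ((hasDerivAt_id x).const_mul (2 * Real.pi * I : ℂ)).cexp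
  simp only [id, mul_one] at h
  rw [mul_comm]
  exact h

theorem jacobiTheta₂_term_eq_ee (n : ℤ) (z τ : ℂ) :
    jacobiTheta₂_term n z τ = ee (n * z + n ^ 2 * τ / 2) := by
  rw [jacobiTheta₂_term, ee]
  ring_nf

theorem thetaTerm_eq (k : ℤ) (z τ : ℂ) :
    (-1 : ℂ) ^ k * ee (((k : ℂ) - 1 / 2) ^ 2 / 2 * τ + ((k : ℂ) - 1 / 2) * z) =
      ee (τ / 8 - z / 2) * jacobiTheta₂_term k (z - τ / 2 + 1 / 2) τ := by
  rw [jacobiTheta₂_term_eq_ee, ← ee_intCast_div_two, ← ee_add, ← ee_add]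
  congr 1
  ring

/-- Expanding `(k - 1/2)²` turns the half-integral exponents into a shift by `-τ/2` and a prefactor,
and the sign `(-1)^k = 𝐞(k/2)` into a shift by `1/2`. Convergence and differentiability are
inherited from `jacobiTheta₂` in this way. -/
theorem theta_eq_jacobiTheta₂ (z τ : ℂ) :
    theta z τ = I * (ee (τ / 8 - z / 2) * jacobiTheta₂ (z - τ / 2 + 1 / 2) τ) := by
  rw [theta, tsum_congr fun k => thetaTerm_eq k z τ, tsum_mul_left, jacobiTheta₂]

theorem summable_thetaTerm (z : ℂ) {τ : ℂ} (hτ : 0 < τ.im) : Summable fun k : ℤ =>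
    (-1 : ℂ) ^ k * ee (((k : ℂ) - 1 / 2) ^ 2 / 2 * τ + ((k : ℂ) - 1 / 2) * z) := by
  simp only [thetaTerm_eq]
  exact ((summable_jacobiTheta₂_term_iff _ _).2 hτ).mul_left _

theorem analyticAt_jacobiTheta₂ (z : ℂ) {τ : ℂ} (hτ : 0 < τ.im) :
    AnalyticAt ℂ (fun p : ℂ × ℂ => jacobiTheta₂ p.1 p.2) (z, τ) := by
  have ho : IsOpen {p : ℂ × ℂ | 0 < p.2.im} :=
    isOpen_lt continuous_const (Complex.continuous_im.comp continuous_snd)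
  refine analyticAt_of_differentiableOn_prod ho (fun p hp => ?_) hτ
  exact (hasFDerivAt_jacobiTheta₂ p.1 hp).differentiableAt.differentiableWithinAt

theorem analyticAt_theta (z : ℂ) {τ : ℂ} (hτ : 0 < τ.im) :
    AnalyticAt ℂ (fun p : ℂ × ℂ => theta p.1 p.2) (z, τ) := by
  simp only [theta_eq_jacobiTheta₂]
  have h1 : AnalyticAt ℂ (fun p : ℂ × ℂ => jacobiTheta₂ (p.1 - p.2 / 2 + 1 / 2) p.2) (z, τ) :=
    AnalyticAt.comp_of_eq (g := fun p : ℂ × ℂ => jacobiTheta₂ p.1 p.2)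
      (f := fun p : ℂ × ℂ => (p.1 - p.2 / 2 + 1 / 2, p.2))
      (analyticAt_jacobiTheta₂ _ hτ) (by fun_prop) rfl
  have h2 : AnalyticAt ℂ (fun p : ℂ × ℂ => ee (p.2 / 8 - p.1 / 2)) (z, τ) :=
    (analyticAt_ee _).fun_comp (f := fun p : ℂ × ℂ => p.2 / 8 - p.1 / 2) (by fun_prop)
  fun_prop

theorem theta_neg (z τ : ℂ) : theta (-z) τ = -theta z τ := by
  rw [theta, theta, ← (Equiv.subLeft (1 : ℤ)).tsum_eq, ← mul_neg, ← tsum_neg]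
  congr 2
  ext k
  rw [Equiv.subLeft_apply, zpow_sub₀ (by norm_num), ← neg_mul]
  congr 1
  · rcases Int.even_or_odd k with h | h
    · simp [h.neg_one_zpow]
    · simp [h.neg_one_zpow]
  · push_cast
    ring_nf

theorem theta_zero (τ : ℂ) : theta 0 τ = 0 := by
  have h := theta_neg 0 τ
  rw [neg_zero] at h
  linear_combination h / 2

theorem theta_add_one (z τ : ℂ) : theta (z + 1) τ = -theta z τ := by
  rw [theta, theta, ← mul_neg, ← tsum_neg]
  congr 2
  ext k
  have h : ((k : ℂ) - 1 / 2) ^ 2 / 2 * τ + ((k : ℂ) - 1 / 2) * (z + 1) =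
      (((k : ℂ) - 1 / 2) ^ 2 / 2 * τ + ((k : ℂ) - 1 / 2) * z) + (k - 1 / 2) := by ring
  rw [h, ee_add _ ((k : ℂ) - 1 / 2), ee_sub, ee_intCast, ee_half]
  norm_num

theorem theta_add_tau (z τ : ℂ) : theta (z + τ) τ = -(ee (-τ / 2 - z) * theta z τ) := by
  rw [theta, theta, ← (Equiv.addRight (1 : ℤ)).tsum_eq (fun k : ℤ => (-1 : ℂ) ^ k *
    ee (((k : ℂ) - 1 / 2) ^ 2 / 2 * τ + ((k : ℂ) - 1 / 2) * z)), mul_left_comm, ← mul_neg,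
    ← tsum_mul_left (a := ee (-τ / 2 - z)), ← tsum_neg]
  congr 2
  ext k
  rw [Equiv.coe_addRight, zpow_add₀ (by norm_num), zpow_one, mul_left_comm, ← ee_add]
  rw [mul_neg_one, neg_mul, neg_neg]
  congr 2
  push_cast
  ring

/-- The part of even index of the product expansion of theta functions. -/
def thetaEven (x τ : ℂ) : ℂ := jacobiTheta₂ (2 * x) (2 * τ)

/-- The part of odd index of the product expansion of theta functions. -/
def thetaOdd (x τ : ℂ) : ℂ := ee (τ / 4 + x) * jacobiTheta₂ (2 * x + τ) (2 * τ)

theorem hasSum_thetaEven (x : ℂ) {τ : ℂ} (hτ : 0 < τ.im) :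
    HasSum (fun n : ℤ => ee ((2 * n) ^ 2 / 4 * τ + 2 * n * x)) (thetaEven x τ) := by
  have h2 : 0 < (2 * τ).im := by simpa using hτ
  refine (hasSum_jacobiTheta₂_term (2 * x) h2).congr_fun fun n => ?_
  rw [jacobiTheta₂_term_eq_ee]
  ring_nf

theorem hasSum_thetaOdd (x : ℂ) {τ : ℂ} (hτ : 0 < τ.im) :
    HasSum (fun n : ℤ => ee ((2 * n + 1) ^ 2 / 4 * τ + (2 * n + 1) * x)) (thetaOdd x τ) := by
  have h2 : 0 < (2 * τ).im := by simpa using hτ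
  refine ((hasSum_jacobiTheta₂_term (2 * x + τ) h2).mul_left (ee (τ / 4 + x))).congr_fun
    fun n => ?_
  rw [jacobiTheta₂_term_eq_ee, ← ee_add]
  ring_nf

theorem exists_int_pair (k l : ℤ) : (∃ i j : ℤ, k = i + j + 1 ∧ l = i - j + 1) ∨
    ∃ i j : ℤ, k = i + j + 1 ∧ l = i - j := by
  rcases Int.even_or_odd (k - l) with ⟨j, hj⟩ | ⟨j, hj⟩
  · exact Or.inl ⟨k - j - 1, j, by lia, by lia⟩
  · exact Or.inr ⟨k - j - 1, j, by lia, by lia⟩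

/-- Pairs of integers, split by the parity of their difference. -/
def intPairEquiv : (ℤ × ℤ) ⊕ (ℤ × ℤ) ≃ ℤ × ℤ :=
  Equiv.ofBijective
    (Sum.elim (fun p => (p.1 + p.2 + 1, p.1 - p.2 + 1)) fun p => (p.1 + p.2 + 1, p.1 - p.2)) (by
    constructor
    · rintro (⟨i, j⟩ | ⟨i, j⟩) (⟨i', j'⟩ | ⟨i', j'⟩) h <;>
        simp only [Sum.elim_inl, Sum.elim_inr, Prod.mk.injEq, Sum.inl.injEq, Sum.inr.injEq,
          reduceCtorEq] at h ⊢ <;> lia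
    · rintro ⟨k, l⟩
      rcases exists_int_pair k l with ⟨i, j, h1, h2⟩ | ⟨i, j, h1, h2⟩
      · exact ⟨Sum.inl (i, j), by simp [h1, h2]⟩
      · exact ⟨Sum.inr (i, j), by simp [h1, h2]⟩)

theorem hasSum_intPair {f : ℤ × ℤ → ℂ} {g h : ℤ × ℤ → ℂ} {a b c : ℂ} (hf : HasSum f a)
    (hg : HasSum g b) (hh : HasSum h c)
    (h1 : ∀ i j : ℤ, f (i + j + 1, i - j + 1) = g (i, j))
    (h2 : ∀ i j : ℤ, f (i + j + 1, i - j) = h (i, j)) : a = b + c := by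
  rw [← intPairEquiv.hasSum_iff] at hf
  refine hf.unique (HasSum.sum (hg.congr_fun ?_) (hh.congr_fun ?_))
  · rintro ⟨i, j⟩
    exact h1 i j
  · rintro ⟨i, j⟩
    exact h2 i j

theorem hasSum_mul_prod {f g : ℤ → ℂ} {a b : ℂ} (hf : HasSum f a) (hg : HasSum g b) :
    HasSum (fun p : ℤ × ℤ => f p.1 * g p.2) (a * b) := by
  have hf' : Summable fun k => ‖f k‖ := hf.summable.norm
  have hg' : Summable fun k => ‖g k‖ := hg.summable.norm
  exact hf.mul hg (summable_mul_of_summable_norm hf' hg')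

/-- In the double series over `(k, l)` the exponent depends on `x` through `k + l - 1` and on `y`
through `k - l`, two integers of opposite parity. Splitting by the parity of `k - l` decouples them,
and the sign `(-1)^(k+l)` distinguishes the two halves. The determinant form is what every later
identity rests on. -/
theorem theta_mul_theta (x y : ℂ) {τ : ℂ} (hτ : 0 < τ.im) :
    theta (x + y) τ * theta (x - y) τ =
      thetaEven x τ * thetaOdd y τ - thetaOdd x τ * thetaEven y τ := by
  have hs1 := summable_thetaTerm (x + y) hτ
  have hs2 := summable_thetaTerm (x - y) hτ
  have hEx := hasSum_thetaEven x hτ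
  have hEy := hasSum_thetaEven y hτ
  have hOx := hasSum_thetaOdd x hτ
  have hOy := hasSum_thetaOdd y hτ
  have h1 := hasSum_mul_prod hOx hEy
  have h2 := (hasSum_mul_prod hEx hOy).neg
  have hL := hasSum_mul_prod hs1.hasSum hs2.hasSum
  have h3 := hasSum_intPair hL h1 h2 ?_ ?_
  · rw [theta, theta, mul_mul_mul_comm, I_mul_I, h3]
    ring
  · intro i j
    have h4 : (-1 : ℂ) ^ (i + j + 1) * (-1) ^ (i - j + 1) = 1 := by
      rw [← zpow_add₀ (by norm_num)]
      exact Even.neg_one_zpow ⟨i + 1, by ring⟩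
    rw [mul_mul_mul_comm, h4, one_mul, ← ee_add, ← ee_add]
    push_cast
    ring_nf
  · intro i j
    have h4 : (-1 : ℂ) ^ (i + j + 1) * (-1) ^ (i - j) = -1 := by
      rw [← zpow_add₀ (by norm_num)]
      exact Odd.neg_one_zpow ⟨i, by ring⟩
    rw [mul_mul_mul_comm, h4, neg_one_mul, ← ee_add, ← ee_add]
    push_cast
    ring_nf

/-- Weierstrass' three term relation. -/
theorem theta_three_term (x y z t : ℂ) {τ : ℂ} (hτ : 0 < τ.im) :
    theta (x + y) τ * theta (x - y) τ * (theta (z + t) τ * theta (z - t) τ) -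
      theta (x + z) τ * theta (x - z) τ * (theta (y + t) τ * theta (y - t) τ) +
      theta (x + t) τ * theta (x - t) τ * (theta (y + z) τ * theta (y - z) τ) = 0 := by
  -- Each product is now a `2 × 2` minor in the vectors (`thetaEven`, `thetaOdd`) at `x`, `y`, `z`,
  -- `t`; the claim is the Plücker relation.
  simp only [theta_mul_theta _ _ hτ]
  ring

end TwistedKZB
end

/-! ### Zeros of the theta function. -/

noncomputable section
namespace TwistedKZB
open Complex Metric Set Filter Topology

/-- The constant Fourier coefficient over `[0, 1]` equals `1`, so the function cannot vanish
identically. -/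
theorem exists_jacobiTheta₂_ne_zero {τ : ℂ} (hτ : 0 < τ.im) : ∃ z, jacobiTheta₂ z τ ≠ 0 := by
  by_contra! h0
  have h1 : HasSum (fun n : ℤ => ∫ x in (0 : ℝ)..1, jacobiTheta₂_term n x τ)
      (∫ x in (0 : ℝ)..1, ∑' n : ℤ, jacobiTheta₂_term n x τ) := by
    refine intervalIntegral.hasSum_intervalIntegral_of_summable_norm
      (f := fun n : ℤ => ⟨fun x : ℝ => jacobiTheta₂_term n x τ, by
        unfold jacobiTheta₂_term; fun_prop⟩) ?_
    refine Summable.of_nonneg_of_le (fun _ => norm_nonneg _) (fun n => ?_)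
      ((summable_jacobiTheta₂_term_iff 0 τ).2 hτ).norm
    refine (ContinuousMap.norm_le _ (norm_nonneg _)).2 fun x => le_of_eq ?_
    simp only [ContinuousMap.restrict_apply, ContinuousMap.coe_mk, norm_jacobiTheta₂_term]
    simp
  have h2 : ∀ x : ℝ, ∑' n : ℤ, jacobiTheta₂_term n x τ = 0 := fun x => h0 x
  simp only [h2, intervalIntegral.integral_zero] at h1
  have h3 := h1.unique (hasSum_single (0 : ℤ) fun n hn => ?_)
  · simp [jacobiTheta₂_term] at h3
  · have h4 : (2 * Real.pi * I * n : ℂ) ≠ 0 := by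
      simp [Real.pi_ne_zero, hn, I_ne_zero]
    simp only [jacobiTheta₂_term, Complex.exp_add]
    rw [intervalIntegral.integral_mul_const, integral_exp_mul_complex h4]
    have h5 : Complex.exp (2 * Real.pi * I * n * (1 : ℝ)) = 1 := by
      rw [← Complex.exp_int_mul_two_pi_mul_I n]
      push_cast
      ring_nf
    simp [h5, -ofReal_one]

theorem exists_theta_ne_zero {τ : ℂ} (hτ : 0 < τ.im) : ∃ z, theta z τ ≠ 0 := by
  obtain ⟨z, hz⟩ := exists_jacobiTheta₂_ne_zero hτ
  refine ⟨z + τ / 2 - 1 / 2, ?_⟩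
  rw [theta_eq_jacobiTheta₂]
  have : z + τ / 2 - 1 / 2 - τ / 2 + 1 / 2 = z := by ring
  rw [this]
  exact mul_ne_zero I_ne_zero (mul_ne_zero (ee_ne_zero _) hz)

theorem differentiable_theta {τ : ℂ} (hτ : 0 < τ.im) : Differentiable ℂ fun z => theta z τ :=
  fun z => ((analyticAt_theta z hτ).differentiableAt.comp z (f := fun z => (z, τ)) (by fun_prop) :)

theorem differentiable_jacobiTheta₂ {τ : ℂ} (hτ : 0 < τ.im) :
    Differentiable ℂ fun z => jacobiTheta₂ z τ :=
  fun z => differentiableAt_jacobiTheta₂_fst z hτ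

theorem differentiable_thetaEven {τ : ℂ} (hτ : 0 < τ.im) :
    Differentiable ℂ fun z => thetaEven z τ := by
  have h2 : 0 < (2 * τ).im := by simpa using hτ
  exact (differentiable_jacobiTheta₂ h2).comp (f := fun z => 2 * z) (by fun_prop)

theorem differentiable_thetaOdd {τ : ℂ} (hτ : 0 < τ.im) :
    Differentiable ℂ fun z => thetaOdd z τ := by
  have h2 : 0 < (2 * τ).im := by simpa using hτ
  refine Differentiable.mul (fun z => ?_)
    ((differentiable_jacobiTheta₂ h2).comp (f := fun z => 2 * z + τ) (by fun_prop))
  exact (analyticAt_ee _).differentiableAt.comp z (f := fun z => τ / 4 + z) (by fun_prop)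

theorem thetaEven_add_half (x τ : ℂ) : thetaEven (x + 1 / 2) τ = thetaEven x τ := by
  rw [thetaEven, thetaEven, ← jacobiTheta₂_add_left (2 * x)]
  ring_nf

theorem thetaOdd_add_half (x τ : ℂ) : thetaOdd (x + 1 / 2) τ = -thetaOdd x τ := by
  rw [thetaOdd, thetaOdd, ← jacobiTheta₂_add_left (2 * x + τ), ← add_assoc, ee_add _ (1 / 2),
    ee_half]
  ring_nf

/-- The shift by `τ/2` exchanges the even and the odd part with the same multiplier in both
directions. A common ratio of translates therefore acquires only the quotient of two such
multipliers. -/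
theorem thetaEven_add_half_tau (x τ : ℂ) :
    thetaEven (x + τ / 2) τ = ee (-τ / 4 - x) * thetaOdd x τ := by
  rw [thetaEven, thetaOdd, ← mul_assoc, ← ee_add]
  ring_nf
  simp [ee_zero]

theorem thetaOdd_add_half_tau (x τ : ℂ) :
    thetaOdd (x + τ / 2) τ = ee (-τ / 4 - x) * thetaEven x τ := by
  have h : 2 * (x + τ / 2) + τ = 2 * x + 2 * τ := by ring
  have h2 : cexp (-Real.pi * I * (2 * τ + 2 * (2 * x))) = ee (-τ - 2 * x) := by
    rw [ee]
    ring_nf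
  rw [thetaEven, thetaOdd, h, jacobiTheta₂_add_left', h2, ← mul_assoc, ← ee_add]
  ring_nf

/-- A common zero `x` would give `θ(x+y) θ(x-y) = 0` for all `y`, and then `θ = 0` by the identity
theorem. -/
theorem thetaEven_ne_zero_or (x : ℂ) {τ : ℂ} (hτ : 0 < τ.im) :
    thetaEven x τ ≠ 0 ∨ thetaOdd x τ ≠ 0 := by
  by_contra! h
  have h1 : ∀ y, theta (x + y) τ * theta (x - y) τ = 0 := fun y => by
    rw [theta_mul_theta x y hτ, h.1, h.2]
    ring
  have ha : AnalyticOnNhd ℂ (fun z => theta z τ) univ :=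
    fun z _ => (differentiable_theta hτ).analyticAt z
  have hb : AnalyticOnNhd ℂ (fun y => theta (x + y) τ) univ := fun z _ =>
    ((differentiable_theta hτ).comp (f := fun y => x + y) (by fun_prop)).analyticAt z
  have hc : AnalyticOnNhd ℂ (fun y => theta (x - y) τ) univ := fun z _ =>
    ((differentiable_theta hτ).comp (f := fun y => x - y) (by fun_prop)).analyticAt z
  obtain ⟨z, hz⟩ := exists_theta_ne_zero hτ
  rcases AnalyticOnNhd.eq_zero_or_eq_zero_of_mul_eq_zero hb hc (fun y _ => h1 y)
    isPreconnected_univ with h2 | h2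
  · exact hz (by simpa using h2 (z - x) trivial)
  · exact hz (by simpa using h2 (x - z) trivial)

/-- An entire function with period `1 / 2` and multiplier `μ` for the shift by `τ / 2` is an
exponential. -/
theorem exists_eq_of_quasiperiodic {h : ℂ → ℂ} (hd : Differentiable ℂ h) {τ μ : ℂ}
    (hτ : 0 < τ.im) (hμ : μ ≠ 0) (h1 : ∀ x, h (x + 1 / 2) = h x)
    (h2 : ∀ x, h (x + τ / 2) = μ * h x) (h0 : ∃ x, h x ≠ 0) :
    ∃ n : ℤ, μ = ee (n * τ) := by
  -- The real exponent for which `𝐞(2 s x)` has multiplier of modulus `1` along `1/2` and of modulus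
  -- `‖μ‖` along `τ/2`. Dividing by it makes the modulus of `h` doubly periodic, and Liouville's
  -- theorem applies.
  set s : ℝ := -Real.log ‖μ‖ / (2 * Real.pi * τ.im) with hs
  have hsμ : ‖ee (s * τ)‖ = ‖μ‖ := by
    rw [ee, Complex.norm_exp]
    have : (2 * Real.pi * I * (s * τ) : ℂ).re = Real.log ‖μ‖ := by
      have h3 : (2 * Real.pi * I * (s * τ) : ℂ) = ((2 * Real.pi * s : ℝ) : ℂ) * (I * τ) := by
        push_cast
        ring
      have hτ' := hτ.ne'
      rw [h3, Complex.re_ofReal_mul]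
      simp only [mul_re, I_re, I_im, hs]
      field_simp
      ring
    rw [this, Real.exp_log (norm_pos_iff.2 hμ)]
  have hs1 : ‖ee (s : ℂ)‖ = 1 := by
    rw [ee, Complex.norm_exp]
    simp
  let k : ℂ → ℂ := fun x => h x * ee (-(2 * s * x))
  have hkd : Differentiable ℂ k := by
    refine hd.mul fun x => ?_
    exact (analyticAt_ee _).differentiableAt.comp x (f := fun x : ℂ => -(2 * s * x)) (by fun_prop)
  have hk1 : ∀ x, ‖k (x + 1 / 2)‖ = ‖k x‖ := by
    intro x
    have : -(2 * s * (x + 1 / 2)) = -(2 * s * x) - (s : ℂ) := by ring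
    simp only [k, h1, this, ee_sub, norm_mul, norm_inv, hs1]
    simp
  have hk2 : ∀ x, ‖k (x + τ / 2)‖ = ‖k x‖ := by
    intro x
    have h3 : -(2 * s * (x + τ / 2)) = -(2 * s * x) - (s * τ : ℂ) := by ring
    simp only [k, h2, h3, ee_sub, norm_mul, norm_inv, hsμ]
    have := norm_pos_iff.2 hμ
    field_simp
  have hz1 : ∀ (n : ℤ) x, ‖k (x + n * (1 / 2))‖ = ‖k x‖ := by
    intro n
    induction n using Int.induction_on with
    | zero => simp
    | succ i ih =>
      intro x
      have e := hk1 (x + (i : ℤ) * (1 / 2))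
      rw [ih] at e
      rw [← e]
      push_cast
      ring_nf
    | pred i ih => intro x; rw [← ih x, ← hk1]; push_cast; ring_nf
  have hz2 : ∀ (n : ℤ) x, ‖k (x + n * (τ / 2))‖ = ‖k x‖ := by
    intro n
    induction n using Int.induction_on with
    | zero => simp
    | succ i ih =>
      intro x
      have e := hk2 (x + (i : ℤ) * (τ / 2))
      rw [ih] at e
      rw [← e]
      push_cast
      ring_nf
    | pred i ih => intro x; rw [← ih x, ← hk2]; push_cast; ring_nf
  let P : Set ℂ := (fun q : ℝ × ℝ => (q.1 : ℂ) * (1 / 2) + q.2 * (τ / 2)) '' (Icc 0 1 ×ˢ Icc 0 1)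
  have hP : IsCompact P := (isCompact_Icc.prod isCompact_Icc).image (by fun_prop)
  obtain ⟨C, hC⟩ := hP.exists_bound_of_continuousOn hkd.continuous.continuousOn
  have hb : ∀ x, ‖k x‖ ≤ C := by
    intro x
    set b : ℝ := 2 * x.im / τ.im
    set a : ℝ := 2 * (x.re - b * τ.re / 2)
    have hx : x = a * (1 / 2) + b * (τ / 2) := by
      apply Complex.ext
      · simp [a]; ring
      · simp [b]; field_simp
    have hx' : x = (Int.fract a * (1 / 2) + Int.fract b * (τ / 2)) + ⌊a⌋ * (1 / 2) + ⌊b⌋ * (τ / 2) := by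
      rw [hx]
      have e1 : (a : ℂ) = ⌊a⌋ + (Int.fract a : ℝ) := by exact_mod_cast (Int.floor_add_fract a).symm
      have e2 : (b : ℂ) = ⌊b⌋ + (Int.fract b : ℝ) := by exact_mod_cast (Int.floor_add_fract b).symm
      rw [e1, e2]
      simp
      ring
    rw [hx', hz2, hz1]
    refine hC _ ⟨(Int.fract a, Int.fract b), ⟨⟨Int.fract_nonneg _, (Int.fract_lt_one _).le⟩,
      ⟨Int.fract_nonneg _, (Int.fract_lt_one _).le⟩⟩, rfl⟩
  obtain ⟨a, ha⟩ := hkd.exists_const_forall_eq_of_bounded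
    (isBounded_iff_forall_norm_le.2 ⟨C, by rintro _ ⟨x, rfl⟩; exact hb x⟩)
  have hh : ∀ x, h x = a * ee (2 * s * x) := by
    intro x
    rw [← ha x]
    simp only [k]
    rw [mul_assoc, ← ee_add]
    simp [ee_zero]
  have ha0 : a ≠ 0 := by
    rintro rfl
    obtain ⟨x, hx⟩ := h0
    exact hx (by rw [hh]; simp)
  -- Now `h` is a nonzero multiple of `𝐞(2 s x)`. Exact periodicity along `1/2` forces `s` to be an
  -- integer, and the shift by `τ/2` then reads off `μ`.
  have e1 : ee (s : ℂ) = 1 := by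
    have := h1 0
    rw [hh, hh] at this
    have := mul_left_cancel₀ ha0 this
    rw [show (2 * s * (0 + 1 / 2) : ℂ) = s by ring, mul_zero, ee_zero] at this
    exact this
  obtain ⟨n, hn⟩ := ee_eq_one_iff.1 e1
  refine ⟨n, ?_⟩
  have := h2 0
  rw [hh, hh, mul_left_comm] at this
  have := mul_left_cancel₀ ha0 this
  rw [show (2 * s * (0 + τ / 2) : ℂ) = s * τ by ring, mul_zero, ee_zero, mul_one, hn] at this
  exact this.symm

/-- The lattice `ℤ + ℤ τ`. -/
def IsLattice (τ z : ℂ) : Prop := ∃ j k : ℤ, z = j + k * τ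

/-- At a zero `w` the determinant of (`thetaEven`, `thetaOdd`) at `x + w` and at `x` vanishes for
every `x`, so the translate by `w` multiplies both functions by a common factor `h`. This factor is
entire, has period `1/2` and multiplier `𝐞(-w)` along `τ/2`; by `exists_eq_of_quasiperiodic` that
multiplier is some `𝐞(nτ)`, so `w + nτ` is an integer. No count of zeros by contour integration is
needed. -/
theorem isLattice_of_theta_eq_zero {w τ : ℂ} (hτ : 0 < τ.im) (hw : theta w τ = 0) :
    IsLattice τ w := by
  have hEO : ∀ x, thetaEven (x + w) τ * thetaOdd x τ = thetaOdd (x + w) τ * thetaEven x τ := by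
    intro x
    have := theta_mul_theta (x + w) x hτ
    rw [show x + w - x = w by ring, hw, mul_zero] at this
    exact (sub_eq_zero.1 this.symm)
  have hE := differentiable_thetaEven hτ
  have hO := differentiable_thetaOdd hτ
  have hEw : Differentiable ℂ fun x => thetaEven (x + w) τ :=
    hE.comp (f := fun x => x + w) (by fun_prop)
  have hOw : Differentiable ℂ fun x => thetaOdd (x + w) τ :=
    hO.comp (f := fun x => x + w) (by fun_prop)
  obtain ⟨h, h1, h2⟩ : ∃ h : ℂ → ℂ, (∀ x, thetaEven (x + w) τ = h x * thetaEven x τ) ∧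
      ∀ x, thetaOdd (x + w) τ = h x * thetaOdd x τ := by
    have : ∀ x, ∃ a, thetaEven (x + w) τ = a * thetaEven x τ ∧
        thetaOdd (x + w) τ = a * thetaOdd x τ := by
      intro x
      rcases thetaEven_ne_zero_or x hτ with h | h
      · refine ⟨thetaEven (x + w) τ / thetaEven x τ, by field_simp, ?_⟩
        field_simp
        linear_combination -hEO x
      · refine ⟨thetaOdd (x + w) τ / thetaOdd x τ, ?_, by field_simp⟩
        field_simp
        linear_combination hEO x
    choose h hh using this
    exact ⟨h, fun x => (hh x).1, fun x => (hh x).2⟩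
  -- Near each point `h` is a quotient by whichever of the two functions does not vanish there.
  have hd : Differentiable ℂ h := by
    intro x
    rcases thetaEven_ne_zero_or x hτ with h0 | h0
    · have he : h =ᶠ[𝓝 x] fun x => thetaEven (x + w) τ / thetaEven x τ := by
        filter_upwards [hE.continuous.continuousAt.eventually_ne h0] with y hy
        rw [h1, mul_div_cancel_right₀ _ hy]
      exact ((hEw x).div (hE x) h0).congr_of_eventuallyEq he
    · have he : h =ᶠ[𝓝 x] fun x => thetaOdd (x + w) τ / thetaOdd x τ := by
        filter_upwards [hO.continuous.continuousAt.eventually_ne h0] with y hy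
        rw [h2, mul_div_cancel_right₀ _ hy]
      exact ((hOw x).div (hO x) h0).congr_of_eventuallyEq he
  have hp : ∀ x, h (x + 1 / 2) = h x := by
    intro x
    rcases thetaEven_ne_zero_or x hτ with h0 | h0
    · have := h1 (x + 1 / 2)
      rw [show x + 1 / 2 + w = (x + w) + 1 / 2 by ring, thetaEven_add_half, thetaEven_add_half,
        h1] at this
      exact (mul_right_cancel₀ h0 this).symm
    · have := h2 (x + 1 / 2)
      rw [show x + 1 / 2 + w = (x + w) + 1 / 2 by ring, thetaOdd_add_half, thetaOdd_add_half,
        h2] at this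
      exact (mul_right_cancel₀ h0 (by linear_combination -this)).symm
  have hq : ∀ x, h (x + τ / 2) = ee (-w) * h x := by
    intro x
    have e : ∀ x, ee (-τ / 4 - (x + w)) = ee (-τ / 4 - x) * ee (-w) := fun x => by
      rw [← ee_add]
      ring_nf
    rcases thetaEven_ne_zero_or x hτ with h0 | h0
    · have := h2 (x + τ / 2)
      rw [show x + τ / 2 + w = (x + w) + τ / 2 by ring, thetaOdd_add_half_tau,
        thetaOdd_add_half_tau, h1, e] at this
      refine mul_right_cancel₀ (mul_ne_zero (ee_ne_zero (-τ / 4 - x)) h0) ?_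
      linear_combination -this
    · have := h1 (x + τ / 2)
      rw [show x + τ / 2 + w = (x + w) + τ / 2 by ring, thetaEven_add_half_tau,
        thetaEven_add_half_tau, h2, e] at this
      refine mul_right_cancel₀ (mul_ne_zero (ee_ne_zero (-τ / 4 - x)) h0) ?_
      linear_combination -this
  have hne : ∃ x, h x ≠ 0 := by
    refine ⟨0, fun h0 => ?_⟩
    rcases thetaEven_ne_zero_or (0 + w) hτ with h3 | h3
    · exact h3 (by rw [h1, h0, zero_mul])
    · exact h3 (by rw [h2, h0, zero_mul])
  obtain ⟨n, hn⟩ := exists_eq_of_quasiperiodic hd hτ (ee_ne_zero (-w)) hp hq hne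
  have h3 : ee (w + n * τ) = 1 := by
    rw [ee_add, ← hn, ← ee_add, add_neg_cancel, ee_zero]
  obtain ⟨j, hj⟩ := ee_eq_one_iff.1 h3
  exact ⟨j, -n, by push_cast; linear_combination hj⟩

theorem theta_add_intCast_eq_zero_iff (z τ : ℂ) (j : ℤ) :
    theta (z + j) τ = 0 ↔ theta z τ = 0 := by
  induction j using Int.induction_on generalizing z with
  | zero => simp
  | succ i ih =>
    have h := theta_add_one (z + i) τ
    rw [← neg_eq_zero, ← ih z, ← neg_eq_zero (a := theta (z + (i : ℤ)) τ)]
    push_cast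
    rw [← h, neg_eq_zero, add_assoc]
  | pred i ih =>
    rw [← ih z, ← neg_eq_zero, ← theta_add_one]
    push_cast
    ring_nf

theorem theta_add_intCast_mul_tau_eq_zero_iff (z τ : ℂ) (j : ℤ) :
    theta (z + j * τ) τ = 0 ↔ theta z τ = 0 := by
  have h : ∀ z, theta (z + τ) τ = 0 ↔ theta z τ = 0 := fun z => by
    rw [theta_add_tau, neg_eq_zero, mul_eq_zero, or_iff_right (ee_ne_zero _)]
  induction j using Int.induction_on with
  | zero => simp
  | succ i ih =>
    refine Iff.trans ?_ ih
    rw [← h (z + (i : ℤ) * τ)]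
    push_cast
    ring_nf
  | pred i ih =>
    refine Iff.trans ?_ ih
    rw [← h]
    push_cast
    ring_nf

/-- The zeros of `θ` are the lattice points. -/
theorem theta_eq_zero_iff {w τ : ℂ} (hτ : 0 < τ.im) : theta w τ = 0 ↔ IsLattice τ w := by
  refine ⟨isLattice_of_theta_eq_zero hτ, ?_⟩
  rintro ⟨j, k, rfl⟩
  rw [theta_add_intCast_mul_tau_eq_zero_iff, ← zero_add (j : ℂ), theta_add_intCast_eq_zero_iff,
    theta_zero]

/-- The zero of `θ` at the origin is simple. -/
theorem deriv_theta_zero_ne_zero {τ : ℂ} (hτ : 0 < τ.im) :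
    deriv (fun w => theta w τ) 0 ≠ 0 := by
  intro h0
  have hE := differentiable_thetaEven hτ
  have hO := differentiable_thetaOdd hτ
  have ht := differentiable_theta hτ
  -- If `θ'(0) = 0`, differentiating the determinant formula in `y` at `y = x` kills the left side,
  -- so the Wronskian of the two functions vanishes identically.
  have hW : ∀ x, thetaEven x τ * deriv (fun x => thetaOdd x τ) x =
      thetaOdd x τ * deriv (fun x => thetaEven x τ) x := by
    intro x
    have h1 : HasDerivAt (fun y => theta (x + y) τ * theta (x - y) τ)
        (deriv (fun w => theta w τ) (x + x) * theta (x - x) τ +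
          theta (x + x) τ * -(deriv (fun w => theta w τ) (x - x))) x :=
      HasDerivAt.mul ((ht (x + x)).hasDerivAt.comp_const_add x x)
        ((ht (x - x)).hasDerivAt.comp_const_sub x x)
    rw [sub_self, theta_zero, h0] at h1
    have h2 : HasDerivAt (fun y => thetaEven x τ * thetaOdd y τ - thetaOdd x τ * thetaEven y τ)
        (thetaEven x τ * deriv (fun x => thetaOdd x τ) x -
          thetaOdd x τ * deriv (fun x => thetaEven x τ) x) x :=
      ((hO x).hasDerivAt.const_mul _).sub ((hE x).hasDerivAt.const_mul _)
    simp only [theta_mul_theta x _ hτ] at h1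
    have := h1.unique h2
    linear_combination -this
  -- A vanishing Wronskian makes the two functions proportional: their quotient is locally constant
  -- where the denominator is nonzero, and the identity theorem extends this to the plane. Then all
  -- the determinants vanish, in particular `θ(z)²`.
  obtain ⟨c, d, hcd, hc⟩ : ∃ c d : ℂ, (c ≠ 0 ∨ d ≠ 0) ∧
      ∀ x, c * thetaEven x τ = d * thetaOdd x τ := by
    have key : ∀ f g : ℂ → ℂ, Differentiable ℂ f → Differentiable ℂ g → f 0 ≠ 0 →
        (∀ x, f x * deriv g x = g x * deriv f x) → ∀ x, g 0 * f x = f 0 * g x := by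
      intro f g hf hg hf0 hfg
      have h1 : ∀ᶠ x in 𝓝 (0 : ℂ), f x ≠ 0 := hf.continuous.continuousAt.eventually_ne hf0
      obtain ⟨ε, hε, hb⟩ := Metric.eventually_nhds_iff_ball.1 h1
      have h2 : ∀ x ∈ ball (0 : ℂ) ε, g x / f x = g 0 / f 0 := by
        intro x hx
        refine (convex_ball (0 : ℂ) ε).is_const_of_fderivWithin_eq_zero (𝕜 := ℂ)
          (f := fun x => g x / f x) (fun y hy =>
            ((hg y).div (hf y) (hb y hy)).differentiableWithinAt) (fun y hy => ?_) hx
          (mem_ball_self hε)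
        rw [fderivWithin_of_isOpen isOpen_ball hy]
        have h3 := ((hg y).hasDerivAt.div (hf y).hasDerivAt (hb y hy))
        have h4 : deriv g y * f y - g y * deriv f y = 0 := by linear_combination hfg y
        rw [h4, zero_div] at h3
        rw [show (fun x => g x / f x) = g / f from rfl, h3.hasFDerivAt.fderiv]
        ext
        simp
      have ha : AnalyticOnNhd ℂ (fun x => g 0 * f x) univ := fun z _ =>
        (hf.const_mul _).analyticAt z
      have hb' : AnalyticOnNhd ℂ (fun x => f 0 * g x) univ := fun z _ =>
        (hg.const_mul _).analyticAt z
      have := AnalyticOnNhd.eq_of_eventuallyEq ha hb' (z₀ := 0) ?_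
      · exact fun x => congrFun this x
      · filter_upwards [ball_mem_nhds (0 : ℂ) hε] with x hx
        have h3 := h2 x hx
        rw [div_eq_div_iff (hb x hx) hf0] at h3
        linear_combination -h3
    rcases thetaEven_ne_zero_or 0 hτ with h | h
    · exact ⟨thetaOdd 0 τ, thetaEven 0 τ, Or.inr h, key _ _ hE hO h hW⟩
    · exact ⟨thetaOdd 0 τ, thetaEven 0 τ, Or.inl h, fun x =>
        (key _ _ hO hE h (fun x => (hW x).symm) x).symm⟩
  obtain ⟨z, hz⟩ := exists_theta_ne_zero hτ
  refine mul_ne_zero hz hz ?_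
  have h5 := theta_mul_theta z 0 hτ
  rw [add_zero, sub_zero] at h5
  rw [h5]
  rcases hcd with h | h
  · apply mul_left_cancel₀ h
    linear_combination thetaOdd 0 τ * hc z - thetaOdd z τ * hc 0
  · apply mul_left_cancel₀ h
    linear_combination thetaEven 0 τ * hc z - thetaEven z τ * hc 0

end TwistedKZB
end

noncomputable section
namespace TwistedKZB
open Complex Metric Set Filter Topology

/-! ### Identities between elliptic functions -/

/-- The `k`-th derivative of `θ` in the elliptic variable. -/
def thetaD (k : ℕ) (z τ : ℂ) : ℂ := iteratedDeriv k (fun w => theta w τ) z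

theorem thetaD_zero (z τ : ℂ) : thetaD 0 z τ = theta z τ := by simp [thetaD]

theorem thetaD_one (z τ : ℂ) : thetaD 1 z τ = deriv (fun w => theta w τ) z := by simp [thetaD]

section

variable {τ : ℂ}

theorem hasDerivAt_thetaD (hτ : 0 < τ.im) (k : ℕ) (z : ℂ) :
    HasDerivAt (fun w => thetaD k w τ) (thetaD (k + 1) z τ) z := by
  have h : ContDiff ℂ (k + 1 : ℕ) fun w => theta w τ := (differentiable_theta hτ).contDiff
  have h1 := (h.differentiable_iteratedDeriv k (by exact_mod_cast Nat.lt_succ_self k)) z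
  have h2 := h1.hasDerivAt
  rw [← iteratedDeriv_succ] at h2
  exact h2

theorem hasDerivAt_theta (hτ : 0 < τ.im) (z : ℂ) :
    HasDerivAt (fun w => theta w τ) (thetaD 1 z τ) z := by
  simpa only [thetaD_zero] using hasDerivAt_thetaD hτ 0 z

theorem thetaD_neg (k : ℕ) (z : ℂ) : thetaD k (-z) τ = -(-1) ^ k * thetaD k z τ := by
  have h := iteratedDeriv_comp_neg k (fun w => theta w τ) z
  have h2 : (fun w => theta (-w) τ) = fun w => -theta w τ := funext fun w => theta_neg w τ
  have h3 : iteratedDeriv k (fun w => -theta w τ) z = -thetaD k z τ := by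
    rw [thetaD]
    exact iteratedDeriv_fun_neg ..
  rw [h2, h3, smul_eq_mul] at h
  have h4 : ((-1 : ℂ) ^ k) * (-1) ^ k = 1 := by rw [← mul_pow]; simp
  have h5 : thetaD k (-z) τ = iteratedDeriv k (fun w => theta w τ) (-z) := rfl
  rw [h5]
  linear_combination (-(-1) ^ k) * h - iteratedDeriv k (fun w => theta w τ) (-z) * h4

theorem thetaD_one_neg (z : ℂ) : thetaD 1 (-z) τ = thetaD 1 z τ := by simp [thetaD_neg]

theorem thetaD_two_neg (z : ℂ) : thetaD 2 (-z) τ = -thetaD 2 z τ := by simp [thetaD_neg]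

theorem thetaD_two_zero : thetaD 2 0 τ = 0 := by
  have h := thetaD_two_neg (τ := τ) 0
  rw [neg_zero] at h
  linear_combination h / 2

theorem thetaD_one_zero_ne_zero (hτ : 0 < τ.im) : thetaD 1 0 τ ≠ 0 := by
  rw [thetaD_one]
  exact deriv_theta_zero_ne_zero hτ

/-- The three term relation with its variables chosen so that their sums and differences are the
arguments wanted here. The identities `theta_addition`, `theta_addition_deriv` and
`theta_second_addition` are its successive derivatives. -/
theorem theta_fay (hτ : 0 < τ.im) (x y a b : ℂ) :
    theta (x + a) τ * theta (y + b) τ * theta (x + y) τ * theta (b - a) τ -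
      theta (x + y + a) τ * theta (y + b - a) τ * theta x τ * theta b τ +
      theta (x + y + b) τ * theta (x + a - b) τ * theta y τ * theta a τ = 0 := by
  have h := theta_three_term ((x + 2 * y + b) / 2) ((x + b) / 2) ((x + 2 * a - b) / 2)
    ((x - b) / 2) hτ
  rw [← h]
  ring_nf

/-- The `y`-derivative of `theta_fay` at `y = 0`, with `a + c` and `a` in place of `a` and `b`; it
is the degenerate Fay identity cleared of denominators. -/
theorem theta_addition (hτ : 0 < τ.im) (x a c : ℂ) :
    theta (x + a) τ * thetaD 1 0 τ * theta (x + c) τ * theta (a + c) τ +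
      (thetaD 1 (x + a + c) τ * theta c τ - theta (x + a + c) τ * thetaD 1 c τ) *
        (theta x τ * theta a τ) -
      (thetaD 1 x τ * theta a τ + theta x τ * thetaD 1 a τ) *
        (theta (x + a + c) τ * theta c τ) = 0 := by
  have hd := hasDerivAt_theta hτ
  have hs : ∀ v : ℂ, HasDerivAt (fun y => theta (v + y) τ) (thetaD 1 v τ) 0 := fun v => by
    simpa using HasDerivAt.comp_const_add v 0 (by simpa using hd v)
  have key : ∀ y, theta (x + (a + c)) τ * (theta (a + y) τ * theta (x + y) τ) * -theta c τ -
      theta (x + (a + c) + y) τ * theta (-c + y) τ * (theta x τ * theta a τ) +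
      theta (x + a + y) τ * theta y τ * (theta (x + c) τ * theta (a + c) τ) = 0 := by
    intro y
    have h2 := theta_fay hτ x y (a + c) a
    rw [← h2, ← theta_neg]
    ring_nf
  have hy : HasDerivAt (fun y => theta y τ) (thetaD 1 0 τ) 0 := hd 0
  have h3 := (((((hs a).mul (hs x)).const_mul (theta (x + (a + c)) τ)).mul_const (-theta c τ)).sub
    (((hs (x + (a + c))).mul (hs (-c))).mul_const (theta x τ * theta a τ))).add
    (((hs (x + a)).mul hy).mul_const (theta (x + c) τ * theta (a + c) τ))
  have h4 := h3.unique ((hasDerivAt_const (0 : ℂ) (0 : ℂ)).congr_of_eventuallyEq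
    (Eventually.of_forall key))
  simp only [add_zero, theta_zero, thetaD_one_neg, theta_neg] at h4
  rw [← add_assoc] at h4
  linear_combination h4

theorem theta_addition_deriv (hτ : 0 < τ.im) (x a c : ℂ) :
    theta (x + a) τ * thetaD 1 0 τ * (thetaD 1 (x + c) τ * theta (a + c) τ +
        theta (x + c) τ * thetaD 1 (a + c) τ) +
      (thetaD 2 (x + a + c) τ * theta c τ - theta (x + a + c) τ * thetaD 2 c τ) *
        (theta x τ * theta a τ) -
      (thetaD 1 x τ * theta a τ + theta x τ * thetaD 1 a τ) *
        (thetaD 1 (x + a + c) τ * theta c τ + theta (x + a + c) τ * thetaD 1 c τ) = 0 := by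
  have hd := hasDerivAt_theta hτ
  have hd1 : ∀ z, HasDerivAt (fun w => thetaD 1 w τ) (thetaD 2 z τ) z := hasDerivAt_thetaD hτ 1
  have hs : ∀ v : ℂ, HasDerivAt (fun c => theta (v + c) τ) (thetaD 1 (v + c) τ) c := fun v =>
    HasDerivAt.comp_const_add v c (hd _)
  have hs1 : ∀ v : ℂ, HasDerivAt (fun c => thetaD 1 (v + c) τ) (thetaD 2 (v + c) τ) c := fun v =>
    HasDerivAt.comp_const_add v c (hd1 _)
  have h3 := ((((hs x).const_mul (theta (x + a) τ * thetaD 1 0 τ)).mul (hs a)).add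
    ((((hs1 (x + a)).mul (hd c)).sub ((hs (x + a)).mul (hd1 c))).mul_const
      (theta x τ * theta a τ))).sub
    (((hs (x + a)).mul (hd c)).const_mul (thetaD 1 x τ * theta a τ + theta x τ * thetaD 1 a τ))
  have h4 := h3.unique ((hasDerivAt_const c (0 : ℂ)).congr_of_eventuallyEq
    (Eventually.of_forall (theta_addition hτ x a)))
  linear_combination h4

/-- The case `c = -a` of `theta_addition_deriv`; divided by `θ(x)² θ(a)²` it expresses the product
as a difference of values of `E₂`. -/
theorem theta_mul_theta_sub (hτ : 0 < τ.im) (x a : ℂ) :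
    theta (x + a) τ * theta (x - a) τ * thetaD 1 0 τ ^ 2 =
      (thetaD 2 x τ * theta x τ - thetaD 1 x τ ^ 2) * theta a τ ^ 2 -
        (thetaD 2 a τ * theta a τ - thetaD 1 a τ ^ 2) * theta x τ ^ 2 := by
  have h := theta_addition_deriv hτ x a (-a)
  simp only [add_neg_cancel, theta_zero, theta_neg, thetaD_one_neg,
    thetaD_two_neg, ← sub_eq_add_neg, add_sub_cancel_right] at h
  linear_combination h

/-- The addition formula for the logarithmic derivative of `θ`, without denominators in
`θ(x + a)`. -/
theorem theta_second_addition (hτ : 0 < τ.im) (x a : ℂ) :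
    theta (x + a) τ * thetaD 1 0 τ * (thetaD 2 x τ * theta a τ + 2 * thetaD 1 x τ * thetaD 1 a τ +
        theta x τ * thetaD 2 a τ) +
      (thetaD 2 (x + a) τ * thetaD 1 0 τ - theta (x + a) τ * thetaD 3 0 τ) *
        (theta x τ * theta a τ) -
      2 * (thetaD 1 x τ * theta a τ + theta x τ * thetaD 1 a τ) *
        (thetaD 1 (x + a) τ * thetaD 1 0 τ) = 0 := by
  have hd := hasDerivAt_theta hτ
  have hd1 : ∀ z, HasDerivAt (fun w => thetaD 1 w τ) (thetaD 2 z τ) z := hasDerivAt_thetaD hτ 1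
  have hd2 : ∀ z, HasDerivAt (fun w => thetaD 2 w τ) (thetaD 3 z τ) z := hasDerivAt_thetaD hτ 2
  have hs : ∀ v : ℂ, HasDerivAt (fun c => theta (v + c) τ) (thetaD 1 (v + 0) τ) 0 := fun v =>
    HasDerivAt.comp_const_add v 0 (hd _)
  have hs1 : ∀ v : ℂ, HasDerivAt (fun c => thetaD 1 (v + c) τ) (thetaD 2 (v + 0) τ) 0 := fun v =>
    HasDerivAt.comp_const_add v 0 (hd1 _)
  have hs2 : ∀ v : ℂ, HasDerivAt (fun c => thetaD 2 (v + c) τ) (thetaD 3 (v + 0) τ) 0 := fun v =>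
    HasDerivAt.comp_const_add v 0 (hd2 _)
  -- One more derivative of `theta_addition_deriv` in `c`, taken at `c = 0`, where `θ` and `θ''`
  -- vanish.
  have h3 := (((((hs1 x).mul (hs a)).add ((hs x).mul (hs1 a))).const_mul
      (theta (x + a) τ * thetaD 1 0 τ)).add
    ((((hs2 (x + a)).mul (hd 0)).sub ((hs (x + a)).mul (hd2 0))).mul_const
      (theta x τ * theta a τ))).sub
    ((((hs1 (x + a)).mul (hd 0)).add ((hs (x + a)).mul (hd1 0))).const_mul
      (thetaD 1 x τ * theta a τ + theta x τ * thetaD 1 a τ))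
  have h4 := h3.unique ((hasDerivAt_const (0 : ℂ) (0 : ℂ)).congr_of_eventuallyEq
    (Eventually.of_forall (theta_addition_deriv hτ x a)))
  simp only [add_zero, theta_zero, thetaD_two_zero] at h4
  linear_combination h4

/-! ### The Kronecker function -/

theorem phi_eq (u z : ℂ) :
    phi u z τ = thetaD 1 0 τ * theta (u + z) τ / (theta u τ * theta z τ) := by
  rw [phi, thetaD_one]

theorem E1_eq (z : ℂ) : E1 z τ = thetaD 1 z τ / theta z τ := by
  rw [E1, logDeriv_apply, thetaD_one]

theorem eta1_eq : eta1 τ = -thetaD 3 0 τ / (6 * thetaD 1 0 τ) := by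
  rw [eta1, thetaD_one, thetaD]

theorem hasDerivAt_E1 (hτ : 0 < τ.im) {z : ℂ} (hz : theta z τ ≠ 0) :
    HasDerivAt (fun w => E1 w τ) (thetaD 2 z τ / theta z τ - (thetaD 1 z τ / theta z τ) ^ 2) z := by
  simp only [E1_eq]
  convert! (hasDerivAt_thetaD hτ 1 z).div (hasDerivAt_theta hτ z) hz using 1
  field_simp

theorem E2_eq (hτ : 0 < τ.im) {z : ℂ} (hz : theta z τ ≠ 0) :
    E2 z τ = (thetaD 1 z τ / theta z τ) ^ 2 - thetaD 2 z τ / theta z τ := by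
  rw [E2, (hasDerivAt_E1 hτ hz).deriv]
  ring

theorem hasDerivAt_E1' (hτ : 0 < τ.im) {z : ℂ} (hz : theta z τ ≠ 0) :
    HasDerivAt (fun w => E1 w τ) (-E2 z τ) z := by
  rw [E2_eq hτ hz, neg_sub]
  exact hasDerivAt_E1 hτ hz

theorem phi_comm (u z : ℂ) : phi u z τ = phi z u τ := by
  rw [phi, phi, add_comm, mul_comm (theta u τ)]

theorem phi_neg_neg (u z : ℂ) : phi (-u) (-z) τ = -phi u z τ := by
  rw [phi, phi, ← neg_add, theta_neg, theta_neg, theta_neg]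
  ring

theorem E1_neg (z : ℂ) : E1 (-z) τ = -E1 z τ := by
  rw [E1_eq, E1_eq, theta_neg, thetaD_one_neg, div_neg]

theorem E2_neg (z : ℂ) : E2 (-z) τ = E2 z τ := by
  have h : (fun w => E1 w τ) = fun w => -E1 (-w) τ := funext fun w => by rw [E1_neg, neg_neg]
  have h2 : deriv (fun w => E1 (-w) τ) z = -deriv (fun w => E1 w τ) (-z) :=
    deriv_comp_neg (fun w => E1 w τ) z
  rw [E2, E2]
  conv_rhs => rw [h]
  rw [deriv.fun_neg, h2, neg_neg]

/-- `∂_u φ(u, z)`. -/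
def dphi (u z τ : ℂ) : ℂ := deriv (fun w => phi w z τ) u

/-- `∂_u² φ(u, z)`. -/
def ddphi (u z τ : ℂ) : ℂ := deriv (fun w => dphi w z τ) u

/-- `E₂'(z)`. -/
def dE2 (z τ : ℂ) : ℂ := deriv (fun w => E2 w τ) z

theorem dphi_neg_neg (u z : ℂ) : dphi (-u) (-z) τ = dphi u z τ := by
  have h : (fun w => phi w z τ) = fun w => -phi (-w) (-z) τ :=
    funext fun w => by rw [phi_neg_neg, neg_neg]
  have h2 : deriv (fun w => phi (-w) (-z) τ) u = -deriv (fun w => phi w (-z) τ) (-u) :=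
    deriv_comp_neg (fun w => phi w (-z) τ) u
  rw [dphi, dphi]
  conv_rhs => rw [h]
  rw [deriv.fun_neg, h2, neg_neg]

theorem ddphi_neg_neg (u z : ℂ) : ddphi (-u) (-z) τ = -ddphi u z τ := by
  have h : (fun w => dphi w z τ) = fun w => dphi (-w) (-z) τ :=
    funext fun w => by rw [dphi_neg_neg]
  have h2 : deriv (fun w => dphi (-w) (-z) τ) u = -deriv (fun w => dphi w (-z) τ) (-u) :=
    deriv_comp_neg (fun w => dphi w (-z) τ) u
  rw [ddphi, ddphi]
  conv_rhs => rw [h]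
  rw [h2, neg_neg]

theorem dE2_neg (z : ℂ) : dE2 (-z) τ = -dE2 z τ := by
  have h : (fun w => E2 w τ) = fun w => E2 (-w) τ := funext fun w => by rw [E2_neg]
  have h2 : deriv (fun w => E2 (-w) τ) z = -deriv (fun w => E2 w τ) (-z) :=
    deriv_comp_neg (fun w => E2 w τ) z
  rw [dE2, dE2]
  conv_rhs => rw [h]
  rw [h2, neg_neg]

theorem hasDerivAt_phi_aux (hτ : 0 < τ.im) {u : ℂ} (z : ℂ) (hu : theta u τ ≠ 0) :
    HasDerivAt (fun w => phi w z τ) (thetaD 1 0 τ * thetaD 1 (u + z) τ / (theta u τ * theta z τ) -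
      phi u z τ * E1 u τ) u := by
  have hf : (fun w => phi w z τ) =
      fun w => thetaD 1 0 τ * theta (w + z) τ / theta w τ / theta z τ :=
    funext fun w => by rw [phi_eq, div_div]
  rw [hf, phi_eq, E1_eq]
  have h2 := ((((hasDerivAt_theta hτ (u + z)).comp_add_const u z).const_mul (thetaD 1 0 τ)).div
    (hasDerivAt_theta hτ u) hu).div_const (theta z τ)
  convert! h2 using 1
  -- At `θ(z) = 0` both sides are `0` by the convention for division by zero, so the formula needs
  -- no condition on `z`.
  by_cases hz : theta z τ = 0
  · simp [hz]
  · field_simp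

theorem dphi_eq (hτ : 0 < τ.im) {u : ℂ} (z : ℂ) (hu : theta u τ ≠ 0) :
    dphi u z τ = thetaD 1 0 τ * thetaD 1 (u + z) τ / (theta u τ * theta z τ) -
      phi u z τ * E1 u τ := (hasDerivAt_phi_aux hτ z hu).deriv

theorem hasDerivAt_phi (hτ : 0 < τ.im) {u : ℂ} (z : ℂ) (hu : theta u τ ≠ 0) :
    HasDerivAt (fun w => phi w z τ) (dphi u z τ) u :=
  (hasDerivAt_phi_aux hτ z hu).differentiableAt.hasDerivAt

theorem eventually_theta_ne_zero (hτ : 0 < τ.im) {u : ℂ} (hu : theta u τ ≠ 0) :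
    ∀ᶠ w in 𝓝 u, theta w τ ≠ 0 :=
  (differentiable_theta hτ).continuous.continuousAt.eventually_ne hu

theorem eventually_theta_comp_ne_zero (hτ : 0 < τ.im) {f : ℂ → ℂ} {u : ℂ} (hf : Continuous f)
    (hu : theta (f u) τ ≠ 0) : ∀ᶠ s in 𝓝 u, theta (f s) τ ≠ 0 :=
  ((differentiable_theta hτ).continuous.comp hf).continuousAt.eventually_ne hu

theorem hasDerivAt_dphi_aux (hτ : 0 < τ.im) {u : ℂ} (z : ℂ) (hu : theta u τ ≠ 0) :
    HasDerivAt (fun w => dphi w z τ)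
      (thetaD 1 0 τ * thetaD 2 (u + z) τ / (theta u τ * theta z τ) -
        2 * (thetaD 1 0 τ * thetaD 1 (u + z) τ / (theta u τ * theta z τ)) * E1 u τ +
        phi u z τ * (E1 u τ ^ 2 + E2 u τ)) u := by
  have hf : (fun w => dphi w z τ) =ᶠ[𝓝 u] fun w =>
      thetaD 1 0 τ * thetaD 1 (w + z) τ / theta w τ / theta z τ - phi w z τ * E1 w τ := by
    filter_upwards [eventually_theta_ne_zero hτ hu] with w hw
    rw [dphi_eq hτ z hw, div_div]
  refine HasDerivAt.congr_of_eventuallyEq ?_ hf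
  have h2 := ((((hasDerivAt_thetaD hτ 1 (u + z)).comp_add_const u z).const_mul (thetaD 1 0 τ)).div
    (hasDerivAt_theta hτ u) hu).div_const (theta z τ)
  convert! h2.sub ((hasDerivAt_phi_aux hτ z hu).mul (hasDerivAt_E1' hτ hu)) using 1
  rw [E1_eq]
  by_cases hz : theta z τ = 0
  · simp [hz, phi_eq]
  · field_simp
    ring

theorem ddphi_eq (hτ : 0 < τ.im) {u : ℂ} (z : ℂ) (hu : theta u τ ≠ 0) :
    ddphi u z τ = thetaD 1 0 τ * thetaD 2 (u + z) τ / (theta u τ * theta z τ) -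
        2 * (thetaD 1 0 τ * thetaD 1 (u + z) τ / (theta u τ * theta z τ)) * E1 u τ +
        phi u z τ * (E1 u τ ^ 2 + E2 u τ) := (hasDerivAt_dphi_aux hτ z hu).deriv

theorem hasDerivAt_dphi (hτ : 0 < τ.im) {u : ℂ} (z : ℂ) (hu : theta u τ ≠ 0) :
    HasDerivAt (fun w => dphi w z τ) (ddphi u z τ) u :=
  (hasDerivAt_dphi_aux hτ z hu).differentiableAt.hasDerivAt

/-- The part of the derivative that comes from `θ(u + z)` is symmetric in `u` and `z`, so only the
logarithmic derivatives of the denominators survive. -/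
theorem dphi_sub_dphi (hτ : 0 < τ.im) {u z : ℂ} (hu : theta u τ ≠ 0) (hz : theta z τ ≠ 0) :
    dphi u z τ - dphi z u τ = phi u z τ * (E1 z τ - E1 u τ) := by
  rw [dphi_eq hτ z hu, dphi_eq hτ u hz, phi_comm z u, add_comm z u, mul_comm (theta z τ)]
  ring

/-- The Fay identity. -/
theorem phi_fay (hτ : 0 < τ.im) {x y a b : ℂ} (hx : theta x τ ≠ 0) (hy : theta y τ ≠ 0)
    (hxy : theta (x + y) τ ≠ 0) (ha : theta a τ ≠ 0) (hb : theta b τ ≠ 0)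
    (hab : theta (b - a) τ ≠ 0) :
    phi x a τ * phi y b τ - phi (x + y) a τ * phi y (b - a) τ +
      phi (x + y) b τ * phi (-x) (b - a) τ = 0 := by
  have h := theta_fay hτ x y a b
  have h1 : theta (-x + (b - a)) τ = -theta (x + a - b) τ := by
    rw [← theta_neg]
    ring_nf
  simp only [phi_eq, h1, theta_neg x]
  rw [← add_sub_assoc y]
  field_simp
  linear_combination thetaD 1 0 τ ^ 2 * h

/-- The degenerate Fay identity. -/
theorem phi_mul_phi (hτ : 0 < τ.im) {x a c : ℂ} (hx : theta x τ ≠ 0) (ha : theta a τ ≠ 0)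
    (hc : theta c τ ≠ 0) (hac : theta (a + c) τ ≠ 0) :
    phi x a τ * phi x c τ = phi x (a + c) τ * (E1 a τ + E1 c τ) - dphi x (a + c) τ := by
  have h := theta_addition hτ x a c
  rw [dphi_eq hτ _ hx]
  simp only [phi_eq, E1_eq, ← add_assoc]
  field_simp
  linear_combination thetaD 1 0 τ * h

theorem phi_mul_phi_left (hτ : 0 < τ.im) {x y z : ℂ} (hx : theta x τ ≠ 0) (hy : theta y τ ≠ 0)
    (hxy : theta (x + y) τ ≠ 0) (hz : theta z τ ≠ 0) :
    phi x z τ * phi y z τ = phi (x + y) z τ * (E1 x τ + E1 y τ) - dphi z (x + y) τ := by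
  rw [phi_comm x, phi_comm y, phi_comm (x + y)]
  exact phi_mul_phi hτ hz hx hy hxy

/-- Differentiate `phi_mul_phi_left` along `(x - s, y + s)`: the sum `x + y` stays fixed, so only
the two values of `E₁` on the right vary. -/
theorem phi_mul_dphi_sub (hτ : 0 < τ.im) {x y z : ℂ} (hx : theta x τ ≠ 0) (hy : theta y τ ≠ 0)
    (hxy : theta (x + y) τ ≠ 0) (hz : theta z τ ≠ 0) :
    phi x z τ * dphi y z τ - dphi x z τ * phi y z τ =
      phi (x + y) z τ * (E2 x τ - E2 y τ) := by
  have hx' : ∀ᶠ s in 𝓝 (0 : ℂ), theta (x - s) τ ≠ 0 :=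
    eventually_theta_comp_ne_zero hτ (f := fun s => x - s) (by fun_prop) (by simpa using hx)
  have hy' : ∀ᶠ s in 𝓝 (0 : ℂ), theta (y + s) τ ≠ 0 :=
    eventually_theta_comp_ne_zero hτ (f := fun s => y + s) (by fun_prop) (by simpa using hy)
  have key : (fun s => phi (x - s) z τ * phi (y + s) z τ) =ᶠ[𝓝 0] fun s =>
      phi (x + y) z τ * (E1 (x - s) τ + E1 (y + s) τ) - dphi z (x + y) τ := by
    filter_upwards [hx', hy'] with s h1 h2
    have h3 : x - s + (y + s) = x + y := by ring
    rw [phi_mul_phi_left hτ h1 h2 (by rwa [h3]) hz, h3]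
  have hx0 : theta (x - 0) τ ≠ 0 := by simpa using hx
  have hy0 : theta (y + 0) τ ≠ 0 := by simpa using hy
  have hL := (HasDerivAt.comp_const_sub x 0 (hasDerivAt_phi hτ z hx0)).mul
    (HasDerivAt.comp_const_add y 0 (hasDerivAt_phi hτ z hy0))
  have hR := (((HasDerivAt.comp_const_sub x 0 (hasDerivAt_E1' hτ hx0)).add
    (HasDerivAt.comp_const_add y 0 (hasDerivAt_E1' hτ hy0))).const_mul (phi (x + y) z τ)).sub_const
    (dphi z (x + y) τ)
  have h := hL.unique (hR.congr_of_eventuallyEq key)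
  simp only [sub_zero, add_zero] at h
  linear_combination h

/-- The same variation `(x - s, y + s)` applied to the Fay identity; the two factors with argument
`x + y` stay constant. -/
theorem phi_fay_deriv (hτ : 0 < τ.im) {x y a b : ℂ} (hx : theta x τ ≠ 0) (hy : theta y τ ≠ 0)
    (hxy : theta (x + y) τ ≠ 0) (ha : theta a τ ≠ 0) (hb : theta b τ ≠ 0)
    (hab : theta (b - a) τ ≠ 0) :
    phi x a τ * dphi y b τ - dphi x a τ * phi y b τ - phi (x + y) a τ * dphi y (b - a) τ +
      phi (x + y) b τ * dphi (-x) (b - a) τ = 0 := by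
  have hx' : ∀ᶠ s in 𝓝 (0 : ℂ), theta (x - s) τ ≠ 0 :=
    eventually_theta_comp_ne_zero hτ (f := fun s => x - s) (by fun_prop) (by simpa using hx)
  have hy' : ∀ᶠ s in 𝓝 (0 : ℂ), theta (y + s) τ ≠ 0 :=
    eventually_theta_comp_ne_zero hτ (f := fun s => y + s) (by fun_prop) (by simpa using hy)
  have key : (fun s => phi (x - s) a τ * phi (y + s) b τ -
      phi (x + y) a τ * phi (y + s) (b - a) τ +
      phi (x + y) b τ * phi (-x + s) (b - a) τ) =ᶠ[𝓝 0] fun _ => 0 := by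
    filter_upwards [hx', hy'] with s h1 h2
    have h3 : x - s + (y + s) = x + y := by ring
    have h4 : -(x - s) = -x + s := by ring
    have := phi_fay hτ h1 h2 (by rwa [h3]) ha hb hab
    rwa [h3, h4] at this
  have hx0 : theta (x - 0) τ ≠ 0 := by simpa using hx
  have hy0 : theta (y + 0) τ ≠ 0 := by simpa using hy
  have hnx : theta (-x + 0) τ ≠ 0 := by simpa [theta_neg] using hx
  have hL := (((HasDerivAt.comp_const_sub x 0 (hasDerivAt_phi hτ a hx0)).mul
    (HasDerivAt.comp_const_add y 0 (hasDerivAt_phi hτ b hy0))).sub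
    ((HasDerivAt.comp_const_add y 0 (hasDerivAt_phi hτ (b - a) hy0)).const_mul
      (phi (x + y) a τ))).add
    ((HasDerivAt.comp_const_add (-x) 0 (hasDerivAt_phi hτ (b - a) hnx)).const_mul
      (phi (x + y) b τ))
  have h := hL.unique ((hasDerivAt_const (0 : ℂ) (0 : ℂ)).congr_of_eventuallyEq key)
  simp only [sub_zero, add_zero] at h
  linear_combination h

theorem dphi_mul_phi_add (hτ : 0 < τ.im) {x a c : ℂ} (hx : theta x τ ≠ 0) (ha : theta a τ ≠ 0)
    (hc : theta c τ ≠ 0) (hac : theta (a + c) τ ≠ 0) :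
    dphi x a τ * phi x c τ + phi x a τ * dphi x c τ =
      dphi x (a + c) τ * (E1 a τ + E1 c τ) - ddphi x (a + c) τ := by
  have key : (fun x => phi x a τ * phi x c τ) =ᶠ[𝓝 x] fun x =>
      phi x (a + c) τ * (E1 a τ + E1 c τ) - dphi x (a + c) τ := by
    filter_upwards [eventually_theta_ne_zero hτ hx] with w hw
    exact phi_mul_phi hτ hw ha hc hac
  have hL := (hasDerivAt_phi hτ a hx).mul (hasDerivAt_phi hτ c hx)
  have hR := ((hasDerivAt_phi hτ (a + c) hx).mul_const (E1 a τ + E1 c τ)).sub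
    (hasDerivAt_dphi hτ (a + c) hx)
  exact hL.unique (hR.congr_of_eventuallyEq key)

/-- The linear coefficient `(E₁² - ℘) / 2` of `φ(·, z)` at the origin. -/
def chi (z τ : ℂ) : ℂ := (E1 z τ ^ 2 - wp z τ) / 2

theorem chi_neg (z : ℂ) : chi (-z) τ = chi z τ := by
  simp only [chi, wp, E1_neg, E2_neg, neg_sq]

/-- `dphi_mul_phi_add` gives the symmetric part of the product, namely `φ_a ∂φ_c + φ_c ∂φ_a`. The
antisymmetric part comes from `phi_mul_dphi_sub` with the two arguments of `φ` exchanged, and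
`dphi_sub_dphi` brings its derivatives back to the first argument. -/
theorem phi_mul_dphi (hτ : 0 < τ.im) {x a c : ℂ} (hx : theta x τ ≠ 0) (ha : theta a τ ≠ 0)
    (hc : theta c τ ≠ 0) (hac : theta (a + c) τ ≠ 0) :
    phi x a τ * dphi x c τ = E1 a τ * dphi x (a + c) τ + (chi c τ - chi a τ) * phi x (a + c) τ -
      ddphi x (a + c) τ / 2 := by
  have h1 := dphi_mul_phi_add hτ hx ha hc hac
  have h2 := phi_mul_dphi_sub hτ ha hc hac hx
  rw [phi_comm a, phi_comm c, phi_comm (a + c)] at h2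
  have h3 := dphi_sub_dphi hτ hx ha
  have h4 := dphi_sub_dphi hτ hx hc
  have h5 := phi_mul_phi hτ hx ha hc hac
  simp only [chi, wp]
  linear_combination h1 / 2 + h2 / 2 - phi x c τ * h3 / 2 + phi x a τ * h4 / 2 +
    (E1 c τ - E1 a τ) / 2 * h5

theorem phi_mul_phi_neg (hτ : 0 < τ.im) {x a : ℂ} (hx : theta x τ ≠ 0) (ha : theta a τ ≠ 0) :
    phi x a τ * phi (-x) a τ = E2 a τ - E2 x τ := by
  have h := theta_mul_theta_sub hτ x a
  have h1 : theta (-x + a) τ = -theta (x - a) τ := by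
    rw [← theta_neg]
    ring_nf
  simp only [phi_eq, h1, theta_neg x, E2_eq hτ hx, E2_eq hτ ha]
  field_simp
  linear_combination h

theorem differentiableAt_E2 (hτ : 0 < τ.im) {x : ℂ} (hx : theta x τ ≠ 0) :
    DifferentiableAt ℂ (fun w => E2 w τ) x := by
  have hf : (fun w => E2 w τ) =ᶠ[𝓝 x] fun z =>
      (thetaD 1 z τ / theta z τ) ^ 2 - thetaD 2 z τ / theta z τ := by
    filter_upwards [eventually_theta_ne_zero hτ hx] with w hw
    exact E2_eq hτ hw
  refine DifferentiableAt.congr_of_eventuallyEq ?_ hf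
  have h0 := (hasDerivAt_theta hτ x).differentiableAt
  have h1 := (hasDerivAt_thetaD hτ 1 x).differentiableAt
  have h2 := (hasDerivAt_thetaD hτ 2 x).differentiableAt
  exact ((h1.div h0 hx).pow 2).sub (h2.div h0 hx)

theorem phi_mul_dphi_neg (hτ : 0 < τ.im) {x a : ℂ} (hx : theta x τ ≠ 0) (ha : theta a τ ≠ 0) :
    phi x a τ * dphi (-x) a τ - phi (-x) a τ * dphi x a τ = dE2 x τ := by
  have key : (fun x => phi x a τ * phi (-x) a τ) =ᶠ[𝓝 x] fun x => E2 a τ - E2 x τ := by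
    filter_upwards [eventually_theta_ne_zero hτ hx] with w hw
    exact phi_mul_phi_neg hτ hw ha
  have hnx : theta (-x) τ ≠ 0 := by simpa [theta_neg] using hx
  have h1 : HasDerivAt (fun x => phi (-x) a τ) (-dphi (-x) a τ) x := by
    convert! (hasDerivAt_phi hτ a hnx).comp x (hasDerivAt_neg x) using 1
    ring
  have hL := (hasDerivAt_phi hτ a hx).mul h1
  have hR := (differentiableAt_E2 hτ hx).hasDerivAt.const_sub (E2 a τ)
  have h := hL.unique (hR.congr_of_eventuallyEq key)
  rw [dE2]
  linear_combination -h

/-- This is `theta_second_addition` divided by its theta factors. It serves the two site terms in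
which one of the three frame members lies in `𝔥₀`. -/
theorem E1_mul_dphi (hτ : 0 < τ.im) {y z : ℂ} (hy : theta y τ ≠ 0) (hz : theta z τ ≠ 0) :
    E1 z τ * dphi y z τ - chi z τ * phi y z τ + phi y z τ * (E2 y τ - 2 * eta1 τ) =
      ddphi y z τ / 2 := by
  have h := theta_second_addition hτ y z
  have h0 := thetaD_one_zero_ne_zero hτ
  rw [ddphi_eq hτ z hy, dphi_eq hτ z hy, chi, wp, E2_eq hτ hy, E2_eq hτ hz, E1_eq, E1_eq, eta1_eq,
    phi_eq]
  field_simp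
  linear_combination (-6 * theta y τ * theta z τ) * h

end

end TwistedKZB
end

noncomputable section
namespace TwistedKZB
open Complex Metric Set Filter Topology

/-! ### Quasi-periodicity -/

section

variable {τ : ℂ}

theorem phi_add_tau (u z : ℂ) : phi (u + τ) z τ = ee (-z) * phi u z τ := by
  have h : ee (-τ / 2 - (u + z)) = ee (-τ / 2 - u) * ee (-z) := by
    rw [← ee_add]
    ring_nf
  have h0 := ee_ne_zero (-τ / 2 - u)
  rw [phi, phi, show u + τ + z = u + z + τ by ring, theta_add_tau, theta_add_tau, h]
  generalize ee (-τ / 2 - u) = A at h0 ⊢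
  field_simp

theorem phi_add_intCast (u z : ℂ) (k : ℤ) : phi u (z + k) τ = phi u z τ := by
  have h1 : ∀ z, phi u (z + 1) τ = phi u z τ := fun z => by
    rw [phi, phi, ← add_assoc, theta_add_one, theta_add_one]
    field_simp
  induction k using Int.induction_on with
  | zero => simp
  | succ i ih =>
    rw [← ih, ← h1 (z + (i : ℤ))]
    push_cast
    ring_nf
  | pred i ih =>
    rw [← ih, ← h1]
    push_cast
    ring_nf

theorem dphi_add_tau (u z : ℂ) : dphi (u + τ) z τ = ee (-z) * dphi u z τ := by
  have h : deriv (fun w => phi (w + τ) z τ) u = deriv (fun w => phi w z τ) (u + τ) :=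
    deriv_comp_add_const (fun w => phi w z τ) τ u
  rw [dphi, dphi, ← h, funext fun w => phi_add_tau (τ := τ) w z, deriv_const_mul_field]

theorem ddphi_add_tau (u z : ℂ) : ddphi (u + τ) z τ = ee (-z) * ddphi u z τ := by
  have h : deriv (fun w => dphi (w + τ) z τ) u = deriv (fun w => dphi w z τ) (u + τ) :=
    deriv_comp_add_const (fun w => dphi w z τ) τ u
  rw [ddphi, ddphi, ← h, funext fun w => dphi_add_tau (τ := τ) w z, deriv_const_mul_field]

theorem theta_add_tau_ne_zero {z : ℂ} (hz : theta z τ ≠ 0) : theta (z + τ) τ ≠ 0 := by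
  rw [theta_add_tau]
  exact neg_ne_zero.2 (mul_ne_zero (ee_ne_zero _) hz)

theorem E1_add_tau (hτ : 0 < τ.im) {z : ℂ} (hz : theta z τ ≠ 0) :
    E1 (z + τ) τ = E1 z τ - 2 * Real.pi * I := by
  have h1 := (hasDerivAt_theta hτ (z + τ)).comp_add_const z τ
  simp only [theta_add_tau] at h1
  have h2 : HasDerivAt (fun w => ee (-τ / 2 - w)) (-(2 * Real.pi * I * ee (-τ / 2 - z))) z :=
    HasDerivAt.comp_const_sub (-τ / 2) z (hasDerivAt_ee _)
  have h3 := h1.unique (h2.mul (hasDerivAt_theta hτ z)).neg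
  rw [E1_eq, E1_eq, h3, theta_add_tau]
  have h4 := ee_ne_zero (-τ / 2 - z)
  generalize ee (-τ / 2 - z) = A at h4 ⊢
  field_simp
  ring

theorem E2_add_tau (hτ : 0 < τ.im) {z : ℂ} (hz : theta z τ ≠ 0) : E2 (z + τ) τ = E2 z τ := by
  have h1 := (hasDerivAt_E1' hτ (theta_add_tau_ne_zero hz)).comp_add_const z τ
  have h2 := (hasDerivAt_E1' hτ hz).sub_const (2 * Real.pi * I : ℂ)
  have h3 := h1.unique (h2.congr_of_eventuallyEq ?_)
  · linear_combination -h3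
  · filter_upwards [eventually_theta_ne_zero hτ hz] with w hw
    exact E1_add_tau hτ hw

theorem dE2_add_tau (hτ : 0 < τ.im) {z : ℂ} (hz : theta z τ ≠ 0) : dE2 (z + τ) τ = dE2 z τ := by
  have h1 := (differentiableAt_E2 hτ (theta_add_tau_ne_zero hz)).hasDerivAt.comp_add_const z τ
  have h2 := (differentiableAt_E2 hτ hz).hasDerivAt
  refine h1.unique (h2.congr_of_eventuallyEq ?_)
  filter_upwards [eventually_theta_ne_zero hτ hz] with w hw
  exact E2_add_tau hτ hw

theorem eq_of_add_tau {f : ℂ → ℂ}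
    (hf : ∀ z, theta z τ ≠ 0 → f (z + τ) = f z) {z : ℂ} (hz : theta z τ ≠ 0) (k : ℤ) :
    f (z + k * τ) = f z := by
  have h : ∀ j : ℤ, theta (z + j * τ) τ ≠ 0 := fun j => by
    rwa [Ne, theta_add_intCast_mul_tau_eq_zero_iff]
  induction k using Int.induction_on with
  | zero => simp
  | succ i ih =>
    rw [← ih, ← hf _ (h i)]
    push_cast
    ring_nf
  | pred i ih =>
    rw [← ih, ← hf _ (h (-i - 1))]
    push_cast
    ring_nf

/-! ### Twisted kernels -/

/-- The Kronecker function twisted by the character `𝐞(-s z)`. -/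
def tw (s p z τ : ℂ) : ℂ := ee (-(s * z)) * phi p z τ

/-- `∂_p` of the twisted Kronecker function. -/
def dtw (s p z τ : ℂ) : ℂ := ee (-(s * z)) * dphi p z τ

/-- `∂_p²` of the twisted Kronecker function. -/
def ddtw (s p z τ : ℂ) : ℂ := ee (-(s * z)) * ddphi p z τ

theorem shift_eq {f : ℂ → ℂ → ℂ} (h : ∀ s p, f (s - 1) (p + τ) = f s p) (s p : ℂ) (k : ℤ) :
    f (s - k) (p + k * τ) = f s p := by
  induction k using Int.induction_on with
  | zero => simp
  | succ i ih =>
    rw [← ih, ← h (s - (i : ℤ))]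
    push_cast
    ring_nf
  | pred i ih =>
    rw [← ih, ← h]
    push_cast
    ring_nf

theorem ee_shift_mul (s z : ℂ) : ee (-((s - 1) * z)) * ee (-z) = ee (-(s * z)) := by
  rw [← ee_add]
  ring_nf

/-- The multiplier `𝐞(-z)` of `φ` under `p ↦ p + τ` is absorbed by the character. With `s = m/r` and
`p = v - mτ/r` this says that the kernel depends on `m` only modulo `r`. -/
theorem tw_shift (s p z : ℂ) (k : ℤ) : tw (s - k) (p + k * τ) z τ = tw s p z τ :=
  shift_eq (f := fun s p => tw s p z τ) (fun s p => by
    simp only [tw, phi_add_tau, ← mul_assoc, ee_shift_mul]) s p k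

theorem dtw_shift (s p z : ℂ) (k : ℤ) : dtw (s - k) (p + k * τ) z τ = dtw s p z τ :=
  shift_eq (f := fun s p => dtw s p z τ) (fun s p => by
    simp only [dtw, dphi_add_tau, ← mul_assoc, ee_shift_mul]) s p k

theorem ddtw_shift (s p z : ℂ) (k : ℤ) : ddtw (s - k) (p + k * τ) z τ = ddtw s p z τ :=
  shift_eq (f := fun s p => ddtw s p z τ) (fun s p => by
    simp only [ddtw, ddphi_add_tau, ← mul_assoc, ee_shift_mul]) s p k

/-- The data on which the coefficient functions of the connection depend: whether the component
of the Casimir element has degree `0`, the character `s` and the elliptic argument `p`. -/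
structure Channel where
  isZero : Bool
  s : ℂ
  p : ℂ

/-- `q₁` and `q₂` have opposite degrees. -/
def Channel.Opp (τ : ℂ) (q₁ q₂ : Channel) : Prop :=
  q₁.isZero = q₂.isZero ∧ ∃ k : ℤ, q₁.s + q₂.s = k ∧ q₁.p + q₂.p = -(k * τ)

/-- The degrees of `q₁`, `q₂`, `q₃` add up to zero, and at most one of them is zero. -/
def Channel.Sum (τ : ℂ) (q₁ q₂ q₃ : Channel) : Prop :=
  ¬(q₁.isZero ∧ q₂.isZero) ∧ ¬(q₂.isZero ∧ q₃.isZero) ∧ ¬(q₃.isZero ∧ q₁.isZero) ∧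
    ∃ k : ℤ, q₁.s + q₂.s + q₃.s = k ∧ q₁.p + q₂.p + q₃.p = -(k * τ)

/-- The kernels of a zero channel ignore `s` and `p`, but `Channel.Sum` does not. Fixing them to `0`
makes the other two channels of a sum opposite to each other. -/
def Channel.Regular (τ : ℂ) (q : Channel) : Prop :=
  (q.isZero → q.s = 0 ∧ q.p = 0) ∧ (¬q.isZero → theta q.p τ ≠ 0)

/-- The coefficient of the `r`-matrix. -/
def kap (q : Channel) (z τ : ℂ) : ℂ := if q.isZero then E1 z τ else tw q.s q.p z τ

/-- The coefficient of `f` at two different sites. -/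
def dkap (q : Channel) (z τ : ℂ) : ℂ := if q.isZero then chi z τ else dtw q.s q.p z τ

/-- The derivative of `dkap` in the elliptic argument. -/
def ddkap (q : Channel) (z τ : ℂ) : ℂ := if q.isZero then 0 else ddtw q.s q.p z τ

/-- The coefficient of `f` at one site. -/
def ekap (q : Channel) (τ : ℂ) : ℂ := if q.isZero then -2 * eta1 τ else -E2 q.p τ

/-- The derivative of `ekap` in the elliptic argument. -/
def dekap (q : Channel) (τ : ℂ) : ℂ := if q.isZero then 0 else -dE2 q.p τ

/-- After a shift by `k` the parameters are exactly negated, and `φ(-u, -z) = -φ(u, z)` applies. -/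
theorem tw_opp {s s' p p' : ℂ} {k : ℤ} (hs : s + s' = k) (hp : p + p' = -(k * τ)) (z : ℂ) :
    tw s' p' z τ = -tw s p (-z) τ := by
  rw [← tw_shift s' p' z k, show s' - k = -s by rw [← hs]; ring,
    show p' + k * τ = -p by linear_combination hp, tw, tw]
  have := phi_neg_neg (τ := τ) p (-z)
  rw [neg_neg] at this
  rw [this]
  simp

theorem dtw_opp {s s' p p' : ℂ} {k : ℤ} (hs : s + s' = k) (hp : p + p' = -(k * τ)) (z : ℂ) :
    dtw s' p' z τ = dtw s p (-z) τ := by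
  rw [← dtw_shift s' p' z k, show s' - k = -s by rw [← hs]; ring,
    show p' + k * τ = -p by linear_combination hp, dtw, dtw]
  have := dphi_neg_neg (τ := τ) p (-z)
  rw [neg_neg] at this
  rw [this]
  simp

theorem ddtw_opp {s s' p p' : ℂ} {k : ℤ} (hs : s + s' = k) (hp : p + p' = -(k * τ)) (z : ℂ) :
    ddtw s' p' z τ = -ddtw s p (-z) τ := by
  rw [← ddtw_shift s' p' z k, show s' - k = -s by rw [← hs]; ring,
    show p' + k * τ = -p by linear_combination hp, ddtw, ddtw]
  have := ddphi_neg_neg (τ := τ) p (-z)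
  rw [neg_neg] at this
  rw [this]
  simp

theorem E2_opp (hτ : 0 < τ.im) {p p' : ℂ} {k : ℤ} (hp : p + p' = -(k * τ))
    (h : theta p τ ≠ 0) : E2 p' τ = E2 p τ := by
  have h1 : theta (-p) τ ≠ 0 := by simpa [theta_neg] using h
  rw [show p' = -p + (-k : ℤ) * τ by push_cast; linear_combination hp,
    eq_of_add_tau (f := fun z => E2 z τ) (fun z => E2_add_tau hτ) h1, E2_neg]

theorem dE2_opp (hτ : 0 < τ.im) {p p' : ℂ} {k : ℤ} (hp : p + p' = -(k * τ))
    (h : theta p τ ≠ 0) : dE2 p' τ = -dE2 p τ := by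
  have h1 : theta (-p) τ ≠ 0 := by simpa [theta_neg] using h
  rw [show p' = -p + (-k : ℤ) * τ by push_cast; linear_combination hp,
    eq_of_add_tau (f := fun z => dE2 z τ) (fun z => dE2_add_tau hτ) h1, dE2_neg]

theorem kap_opp {q q' : Channel} (h : q.Opp τ q') (z : ℂ) : kap q' z τ = -kap q (-z) τ := by
  obtain ⟨h0, k, hs, hp⟩ := h
  rw [kap, kap, ← h0]
  split_ifs
  · rw [E1_neg, neg_neg]
  · exact tw_opp hs hp z

theorem dkap_opp {q q' : Channel} (h : q.Opp τ q') (z : ℂ) : dkap q' z τ = dkap q (-z) τ := by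
  obtain ⟨h0, k, hs, hp⟩ := h
  rw [dkap, dkap, ← h0]
  split_ifs
  · rw [chi_neg]
  · exact dtw_opp hs hp z

theorem ddkap_opp {q q' : Channel} (h : q.Opp τ q') (z : ℂ) :
    ddkap q' z τ = -ddkap q (-z) τ := by
  obtain ⟨h0, k, hs, hp⟩ := h
  rw [ddkap, ddkap, ← h0]
  split_ifs
  · simp
  · exact ddtw_opp hs hp z

theorem ekap_opp (hτ : 0 < τ.im) {q q' : Channel} (h : q.Opp τ q') (hq : q.Regular τ) :
    ekap q' τ = ekap q τ := by
  obtain ⟨h0, k, hs, hp⟩ := h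
  rw [ekap, ekap, ← h0]
  split_ifs with h1
  · rfl
  · rw [E2_opp hτ hp (hq.2 h1)]

theorem dekap_opp (hτ : 0 < τ.im) {q q' : Channel} (h : q.Opp τ q') (hq : q.Regular τ) :
    dekap q' τ = -dekap q τ := by
  obtain ⟨h0, k, hs, hp⟩ := h
  rw [dekap, dekap, ← h0]
  split_ifs with h1
  · simp
  · rw [dE2_opp hτ hp (hq.2 h1)]

/-- The product of the two characters depends only on an expression symmetric in the three sites.
All terms of the Fay identity thus carry the same character, and the twisted identity follows from
the untwisted one. -/
theorem tw_mul_tw {s₁ s₂ s₃ : ℂ} (hs : s₁ + s₂ + s₃ = 0) (a b c : ℂ) :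
    ee (-(s₂ * (a - b))) * ee (-(s₃ * (a - c))) = ee (s₁ * a + s₂ * b + s₃ * c) := by
  rw [← ee_add]
  congr 1
  linear_combination (-a) * hs

theorem tw_fay_aux (hτ : 0 < τ.im) {s₁ s₂ s₃ p₁ p₂ p₃ a b c : ℂ}
    (hs : s₁ + s₂ + s₃ = 0) (hp : p₁ + p₂ + p₃ = 0) (h1 : theta p₁ τ ≠ 0) (h2 : theta p₂ τ ≠ 0)
    (h3 : theta p₃ τ ≠ 0) (hab : theta (a - b) τ ≠ 0) (hac : theta (a - c) τ ≠ 0)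
    (hbc : theta (b - c) τ ≠ 0) :
    tw s₂ p₂ (a - b) τ * tw s₃ p₃ (a - c) τ + tw s₁ p₁ (b - a) τ * tw s₃ p₃ (b - c) τ +
        tw s₁ p₁ (c - a) τ * tw s₂ p₂ (c - b) τ = 0 ∧
      tw s₂ p₂ (a - b) τ * dtw s₃ p₃ (a - c) τ - dtw s₂ p₂ (a - b) τ * tw s₃ p₃ (a - c) τ +
        tw s₁ p₁ (b - a) τ * dtw s₃ p₃ (b - c) τ - tw s₁ p₁ (c - a) τ * dtw s₂ p₂ (c - b) τ = 0 := by
  have e1 := tw_mul_tw hs a b c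
  have e2 := tw_mul_tw (show s₂ + s₁ + s₃ = 0 by linear_combination hs) b a c
  have e3 := tw_mul_tw (show s₃ + s₁ + s₂ = 0 by linear_combination hs) c a b
  rw [show s₂ * b + s₁ * a + s₃ * c = s₁ * a + s₂ * b + s₃ * c by ring] at e2
  rw [show s₃ * c + s₁ * a + s₂ * b = s₁ * a + s₂ * b + s₃ * c by ring] at e3
  have h23 : p₂ + p₃ = -p₁ := by linear_combination hp
  have h1' : theta (p₂ + p₃) τ ≠ 0 := by simpa [h23, theta_neg] using h1
  have hcb : (a - c) - (a - b) = b - c := by ring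
  have k1 := phi_fay hτ h2 h3 h1' hab hac (by rwa [hcb])
  have k2 := phi_fay_deriv hτ h2 h3 h1' hab hac (by rwa [hcb])
  rw [hcb, h23] at k1 k2
  have n1 : phi (-p₁) (a - b) τ = -phi p₁ (b - a) τ := by rw [← phi_neg_neg]; simp
  have n2 : phi (-p₁) (a - c) τ = -phi p₁ (c - a) τ := by rw [← phi_neg_neg]; simp
  have n3 : phi (-p₂) (b - c) τ = -phi p₂ (c - b) τ := by rw [← phi_neg_neg]; simp
  have n4 : dphi (-p₂) (b - c) τ = dphi p₂ (c - b) τ := by rw [← dphi_neg_neg]; simp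
  rw [n1, n2, n3] at k1
  rw [n1, n2, n4] at k2
  simp only [tw, dtw]
  constructor
  · linear_combination ee (s₁ * a + s₂ * b + s₃ * c) * k1 +
      phi p₂ (a - b) τ * phi p₃ (a - c) τ * e1 + phi p₁ (b - a) τ * phi p₃ (b - c) τ * e2 +
      phi p₁ (c - a) τ * phi p₂ (c - b) τ * e3
  · linear_combination ee (s₁ * a + s₂ * b + s₃ * c) * k2 +
      (phi p₂ (a - b) τ * dphi p₃ (a - c) τ - dphi p₂ (a - b) τ * phi p₃ (a - c) τ) * e1 +
      phi p₁ (b - a) τ * dphi p₃ (b - c) τ * e2 - phi p₁ (c - a) τ * dphi p₂ (c - b) τ * e3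

theorem theta_add_int_mul_tau_ne_zero {p : ℂ} (h : theta p τ ≠ 0) (k : ℤ) :
    theta (p + k * τ) τ ≠ 0 := by
  rwa [Ne, theta_add_intCast_mul_tau_eq_zero_iff]

theorem tw_fay (hτ : 0 < τ.im) {s₁ s₂ s₃ p₁ p₂ p₃ a b c : ℂ} {k : ℤ}
    (hs : s₁ + s₂ + s₃ = k) (hp : p₁ + p₂ + p₃ = -(k * τ)) (h1 : theta p₁ τ ≠ 0)
    (h2 : theta p₂ τ ≠ 0)
    (h3 : theta p₃ τ ≠ 0) (hab : theta (a - b) τ ≠ 0) (hac : theta (a - c) τ ≠ 0)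
    (hbc : theta (b - c) τ ≠ 0) :
    tw s₂ p₂ (a - b) τ * tw s₃ p₃ (a - c) τ + tw s₁ p₁ (b - a) τ * tw s₃ p₃ (b - c) τ +
        tw s₁ p₁ (c - a) τ * tw s₂ p₂ (c - b) τ = 0 ∧
      tw s₂ p₂ (a - b) τ * dtw s₃ p₃ (a - c) τ - dtw s₂ p₂ (a - b) τ * tw s₃ p₃ (a - c) τ +
        tw s₁ p₁ (b - a) τ * dtw s₃ p₃ (b - c) τ -
        tw s₁ p₁ (c - a) τ * dtw s₂ p₂ (c - b) τ = 0 := by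
  rw [← tw_shift s₁ p₁ _ k, ← tw_shift s₁ p₁ _ k]
  exact tw_fay_aux hτ (by linear_combination hs) (by linear_combination hp)
    (theta_add_int_mul_tau_ne_zero h1 k) h2 h3 hab hac hbc

theorem ee_mul_ee_sub (s x y z : ℂ) (h : z = x + y) :
    ee (-(s * x)) * ee (-(s * y)) = ee (-(s * z)) := by
  rw [← ee_add, h]
  congr 1
  ring

theorem tw_mul_tw_eq (hτ : 0 < τ.im) {s p a c b : ℂ} (hb : b = a + c) (hp : theta p τ ≠ 0)
    (ha : theta a τ ≠ 0) (hc : theta c τ ≠ 0) (hb' : theta b τ ≠ 0) :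
    tw s p a τ * tw s p c τ = tw s p b τ * (E1 a τ + E1 c τ) - dtw s p b τ := by
  have e := ee_mul_ee_sub s a c b hb
  subst hb
  have h := phi_mul_phi hτ hp ha hc hb'
  simp only [tw, dtw]
  linear_combination ee (-(s * (a + c))) * h + phi p a τ * phi p c τ * e

theorem tw_mul_dtw_eq (hτ : 0 < τ.im) {s p a c b : ℂ} (hb : b = a + c) (hp : theta p τ ≠ 0)
    (ha : theta a τ ≠ 0) (hc : theta c τ ≠ 0) (hb' : theta b τ ≠ 0) :
    tw s p a τ * dtw s p c τ = E1 a τ * dtw s p b τ + (chi c τ - chi a τ) * tw s p b τ -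
      ddtw s p b τ / 2 := by
  have e := ee_mul_ee_sub s a c b hb
  subst hb
  have h := phi_mul_dphi hτ hp ha hc hb'
  simp only [tw, dtw, ddtw]
  linear_combination ee (-(s * (a + c))) * h + phi p a τ * dphi p c τ * e

theorem neg_sub_ne {a b : ℂ} (h : theta (a - b) τ ≠ 0) : theta (b - a) τ ≠ 0 := by
  rw [← neg_sub, theta_neg]
  exact neg_ne_zero.2 h

/-- The scalar identity behind the commutation of `∇_a` and `∇_b`. -/
theorem kap_identity (hτ : 0 < τ.im) {q₁ q₂ q₃ : Channel} (h : Channel.Sum τ q₁ q₂ q₃)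
    (h1 : q₁.Regular τ) (h2 : q₂.Regular τ) (h3 : q₃.Regular τ) {a b c : ℂ}
    (hab : theta (a - b) τ ≠ 0) (hac : theta (a - c) τ ≠ 0) (hbc : theta (b - c) τ ≠ 0) :
    kap q₂ (a - b) τ * kap q₃ (a - c) τ + kap q₁ (b - a) τ * kap q₃ (b - c) τ +
        kap q₁ (c - a) τ * kap q₂ (c - b) τ =
      (if q₁.isZero then dkap q₃ (b - c) τ else 0) + (if q₂.isZero then dkap q₁ (c - a) τ else 0) +
        (if q₃.isZero then dkap q₂ (a - b) τ else 0) := by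
  obtain ⟨n12, n23, n31, k, hs, hp⟩ := h
  have hba := neg_sub_ne hab
  have hca := neg_sub_ne hac
  have hcb := neg_sub_ne hbc
  -- One channel in `𝔥₀`: the other two are opposite, so all kernels can be written with the
  -- parameters of one of them and the degenerate Fay identity applies. The three cases correspond
  -- to the three positions of the zero channel.
  by_cases z1 : q₁.isZero
  · have z2 : ¬q₂.isZero := fun h => n12 ⟨z1, h⟩
    have z3 : ¬q₃.isZero := fun h => n31 ⟨h, z1⟩
    obtain ⟨s1, p1⟩ := h1.1 z1
    rw [s1, zero_add] at hs
    rw [p1, zero_add] at hp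
    have m1 := tw_mul_tw_eq hτ (s := q₃.s) (show b - c = (b - a) + (a - c) by ring) (h3.2 z3)
      hba hac hbc
    have o := tw_opp (τ := τ) (add_comm q₂.s q₃.s ▸ hs) (add_comm q₂.p q₃.p ▸ hp)
    simp only [kap, dkap, z1, z2, z3, if_true, if_false, Bool.false_eq_true, o, neg_sub]
    rw [← neg_sub a c, E1_neg]
    linear_combination -m1
  by_cases z2 : q₂.isZero
  · have z3 : ¬q₃.isZero := fun h => n23 ⟨z2, h⟩
    obtain ⟨s1, p1⟩ := h2.1 z2
    rw [s1, add_zero] at hs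
    rw [p1, add_zero] at hp
    have m1 := tw_mul_tw_eq hτ (s := q₁.s) (show c - a = (c - b) + (b - a) by ring) (h1.2 z1)
      hcb hba hca
    have o := tw_opp (τ := τ) hs hp
    simp only [kap, dkap, z1, z2, z3, if_true, if_false, Bool.false_eq_true, o, neg_sub]
    rw [← neg_sub b a, E1_neg]
    linear_combination -m1
  by_cases z3 : q₃.isZero
  · obtain ⟨s1, p1⟩ := h3.1 z3
    rw [s1, add_zero] at hs
    rw [p1, add_zero] at hp
    have m1 := tw_mul_tw_eq hτ (s := q₂.s) (show a - b = (a - c) + (c - b) by ring) (h2.2 z2)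
      hac hcb hab
    have o := tw_opp (τ := τ) (add_comm q₁.s q₂.s ▸ hs) (add_comm q₁.p q₂.p ▸ hp)
    simp only [kap, dkap, z1, z2, z3, if_true, if_false, Bool.false_eq_true, o, neg_sub]
    rw [← neg_sub c b, E1_neg]
    linear_combination -m1
  simp only [kap, z1, z2, z3, if_false, Bool.false_eq_true]
  rw [(tw_fay hτ hs hp (h1.2 z1) (h2.2 z2) (h3.2 z3) hab hac hbc).1]
  ring

/-- The scalar identity behind the three site terms of the commutator of `∇_a` and `∇_τ`. -/
theorem dkap_identity (hτ : 0 < τ.im) {q₁ q₂ q₃ : Channel} (h : Channel.Sum τ q₁ q₂ q₃)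
    (h1 : q₁.Regular τ) (h2 : q₂.Regular τ) (h3 : q₃.Regular τ) {a b c : ℂ}
    (hab : theta (a - b) τ ≠ 0) (hac : theta (a - c) τ ≠ 0) (hbc : theta (b - c) τ ≠ 0) :
    kap q₂ (a - b) τ * dkap q₃ (a - c) τ - dkap q₂ (a - b) τ * kap q₃ (a - c) τ +
        kap q₁ (b - a) τ * dkap q₃ (b - c) τ - kap q₁ (c - a) τ * dkap q₂ (c - b) τ =
      (if q₁.isZero then ddkap q₃ (b - c) τ else 0) +
        (if q₂.isZero then ddkap q₃ (a - c) τ / 2 else 0) -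
        (if q₃.isZero then ddkap q₂ (a - b) τ / 2 else 0) := by
  obtain ⟨n12, n23, n31, k, hs, hp⟩ := h
  have hba := neg_sub_ne hab
  have hca := neg_sub_ne hac
  have hcb := neg_sub_ne hbc
  by_cases z1 : q₁.isZero
  · have z2 : ¬q₂.isZero := fun h => n12 ⟨z1, h⟩
    have z3 : ¬q₃.isZero := fun h => n31 ⟨h, z1⟩
    obtain ⟨s1, p1⟩ := h1.1 z1
    rw [s1, zero_add] at hs
    rw [p1, zero_add] at hp
    have m1 := tw_mul_dtw_eq hτ (s := q₃.s) (show b - c = (b - a) + (a - c) by ring) (h3.2 z3)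
      hba hac hbc
    -- Both orders of the factors occur; in the sum the `chi` terms cancel and the two halves of the
    -- second derivative add up.
    have m2 := tw_mul_dtw_eq hτ (s := q₃.s) (show b - c = (a - c) + (b - a) by ring) (h3.2 z3)
      hac hba hbc
    have o := tw_opp (τ := τ) (add_comm q₂.s q₃.s ▸ hs) (add_comm q₂.p q₃.p ▸ hp)
    have o' := dtw_opp (τ := τ) (add_comm q₂.s q₃.s ▸ hs) (add_comm q₂.p q₃.p ▸ hp)
    simp only [kap, dkap, ddkap, z1, z2, z3, if_true, if_false, Bool.false_eq_true, o, o', neg_sub]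
    rw [← neg_sub a c, E1_neg]
    linear_combination -m1 - m2
  by_cases z2 : q₂.isZero
  · have z3 : ¬q₃.isZero := fun h => n23 ⟨z2, h⟩
    obtain ⟨s1, p1⟩ := h2.1 z2
    rw [s1, add_zero] at hs
    rw [p1, add_zero] at hp
    have m1 := tw_mul_dtw_eq hτ (s := q₃.s) (show a - c = (a - b) + (b - c) by ring) (h3.2 z3)
      hab hbc hac
    have o := tw_opp (τ := τ) (add_comm q₁.s q₃.s ▸ hs) (add_comm q₁.p q₃.p ▸ hp)
    simp only [kap, dkap, ddkap, z1, z2, z3, if_true, if_false, Bool.false_eq_true, o, neg_sub]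
    rw [← neg_sub b c, chi_neg]
    linear_combination -m1
  by_cases z3 : q₃.isZero
  · obtain ⟨s1, p1⟩ := h3.1 z3
    rw [s1, add_zero] at hs
    rw [p1, add_zero] at hp
    have m1 := tw_mul_dtw_eq hτ (s := q₂.s) (show a - b = (a - c) + (c - b) by ring) (h2.2 z2)
      hac hcb hab
    have o := tw_opp (τ := τ) (add_comm q₁.s q₂.s ▸ hs) (add_comm q₁.p q₂.p ▸ hp)
    simp only [kap, dkap, ddkap, z1, z2, z3, if_true, if_false, Bool.false_eq_true, o, neg_sub]
    rw [← neg_sub c b, chi_neg]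
    linear_combination m1
  simp only [kap, dkap, z1, z2, z3, if_false, Bool.false_eq_true]
  rw [(tw_fay hτ hs hp (h1.2 z1) (h2.2 z2) (h3.2 z3) hab hac hbc).2]
  ring

/-- The scalar identity behind the two site terms of the commutator of `∇_a` and `∇_τ`. -/
theorem ekap_identity (hτ : 0 < τ.im) {q₁ q₁' q₂ q₃ : Channel} (h : Channel.Sum τ q₁ q₂ q₃)
    (ho : q₁.Opp τ q₁')
    (h1 : q₁.Regular τ) (h2 : q₂.Regular τ) (h3 : q₃.Regular τ) {z : ℂ} (hz : theta z τ ≠ 0) :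
    kap q₂ z τ * dkap q₃ z τ - kap q₃ z τ * dkap q₂ z τ +
        kap q₁' z τ * (ekap q₂ τ - ekap q₃ τ) =
      (if q₁.isZero then -dekap q₂ τ else 0) + (if q₂.isZero then ddkap q₃ z τ / 2 else 0) -
        (if q₃.isZero then ddkap q₂ z τ / 2 else 0) := by
  obtain ⟨n12, n23, n31, k, hs, hp⟩ := h
  -- The identity for a zero channel in the second or third place. With the zero channel in the
  -- first place, the derivative of `φ(x, z) φ(-x, z) = E₂(z) - E₂(x)` in `x` is used instead.
  have key : ∀ {s p : ℂ}, theta p τ ≠ 0 → E1 z τ * dtw s p z τ - chi z τ * tw s p z τ +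
      tw s p z τ * (E2 p τ - 2 * eta1 τ) = ddtw s p z τ / 2 := by
    intro s p h
    have := E1_mul_dphi hτ h hz
    simp only [tw, dtw, ddtw]
    linear_combination ee (-(s * z)) * this
  obtain ⟨ho0, k', hs', hp'⟩ := ho
  rw [← neg_neg z] at hz
  by_cases z1 : q₁.isZero
  · have z2 : ¬q₂.isZero := fun h => n12 ⟨z1, h⟩
    have z3 : ¬q₃.isZero := fun h => n31 ⟨h, z1⟩
    obtain ⟨s1, p1⟩ := h1.1 z1
    rw [s1, zero_add] at hs
    rw [p1, zero_add] at hp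
    have hE := E2_opp hτ hp (h2.2 z2)
    have z1' : q₁'.isZero = true := ho0 ▸ z1
    have m := phi_mul_dphi_neg hτ (h2.2 z2) (neg_neg z ▸ hz)
    have e : ee (-(q₂.s * z)) * ee (-(-q₂.s * z)) = 1 := by
      rw [← ee_add]
      simp [ee_zero]
    have t1 : tw q₃.s q₃.p z τ = tw (-q₂.s) (-q₂.p) z τ := by
      rw [tw_opp hs hp, tw_opp (s := q₂.s) (p := q₂.p) (s' := -q₂.s) (p' := -q₂.p) (k := 0) (by simp)
        (by simp)]
    have t2 : dtw q₃.s q₃.p z τ = dtw (-q₂.s) (-q₂.p) z τ := by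
      rw [dtw_opp hs hp, dtw_opp (s := q₂.s) (p := q₂.p) (s' := -q₂.s) (p' := -q₂.p) (k := 0) (by simp)
        (by simp)]
    simp only [kap, dkap, ekap, dekap, z1, z1', z2, z3, if_true, if_false, Bool.false_eq_true, hE,
      t1, t2]
    simp only [tw, dtw]
    linear_combination m + (phi q₂.p z τ * dphi (-q₂.p) z τ - phi (-q₂.p) z τ * dphi q₂.p z τ) * e
  have z1' : ¬q₁'.isZero := ho0 ▸ z1
  by_cases z2 : q₂.isZero
  · have z3 : ¬q₃.isZero := fun h => n23 ⟨z2, h⟩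
    obtain ⟨s1, p1⟩ := h2.1 z2
    rw [s1, add_zero] at hs
    rw [p1, add_zero] at hp
    have t1 : tw q₁'.s q₁'.p z τ = tw q₃.s q₃.p z τ := by
      rw [tw_opp hs hp, tw_opp hs' hp']
    simp only [kap, dkap, ekap, ddkap, z1, z1', z2, z3, if_true, if_false, Bool.false_eq_true, t1]
    linear_combination key (s := q₃.s) (h3.2 z3)
  by_cases z3 : q₃.isZero
  · obtain ⟨s1, p1⟩ := h3.1 z3
    rw [s1, add_zero] at hs
    rw [p1, add_zero] at hp
    have t1 : tw q₁'.s q₁'.p z τ = tw q₂.s q₂.p z τ := by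
      rw [tw_opp hs hp, tw_opp hs' hp']
    simp only [kap, dkap, ekap, ddkap, z1, z1', z2, z3, if_true, if_false, Bool.false_eq_true, t1]
    linear_combination -key (s := q₂.s) (h2.2 z2)
  -- The channel opposite to `q₁` carries the sum of the parameters of `q₂` and `q₃` up to a period,
  -- which is the argument `x + y` in `phi_mul_dphi_sub`.
  have t1 : tw q₁'.s q₁'.p z τ = tw (q₂.s + q₃.s) (q₂.p + q₃.p) z τ := by
    rw [tw_opp hs' hp', tw_opp (s := q₁.s) (p := q₁.p) (s' := q₂.s + q₃.s) (p' := q₂.p + q₃.p)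
      (k := k) (by rw [← add_assoc, hs]) (by rw [← add_assoc, hp])]
  have h23 : theta (q₂.p + q₃.p) τ ≠ 0 := by
    have : q₂.p + q₃.p = -(q₁.p + k * τ) := by linear_combination hp
    rw [this, theta_neg]
    exact neg_ne_zero.2 (theta_add_int_mul_tau_ne_zero (h1.2 z1) k)
  have m := phi_mul_dphi_sub hτ (h2.2 z2) (h3.2 z3) h23 (neg_neg z ▸ hz)
  have e : ee (-(q₂.s * z)) * ee (-(q₃.s * z)) = ee (-((q₂.s + q₃.s) * z)) := by
    rw [← ee_add]
    ring_nf
  simp only [kap, dkap, ekap, z1, z1', z2, z3, if_false, Bool.false_eq_true, t1]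
  simp only [tw, dtw]
  linear_combination ee (-((q₂.s + q₃.s) * z)) * m + (phi q₂.p z τ * dphi q₃.p z τ -
    dphi q₂.p z τ * phi q₃.p z τ) * e

end

end TwistedKZB
end

noncomputable section
namespace TwistedKZB
open Complex Metric Set Filter Topology

/-! ### Directional derivatives of analytic functions -/

section

variable {E G : Type*} [NormedAddCommGroup E] [NormedSpace ℂ E] [NormedAddCommGroup G]
  [NormedSpace ℂ G]

theorem analyticAt_fderiv_apply [CompleteSpace G] {f : E → G} {x : E} (hf : AnalyticAt ℂ f x)
    (v : E) : AnalyticAt ℂ (fun y => fderiv ℂ f y v) x :=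
  ((ContinuousLinearMap.apply ℂ G v).analyticAt _).comp hf.fderiv

theorem fderiv_fderiv_comm [CompleteSpace G] {f : E → G} {x : E} (hf : AnalyticAt ℂ f x)
    (v w : E) :
    fderiv ℂ (fun y => fderiv ℂ f y v) x w = fderiv ℂ (fun y => fderiv ℂ f y w) x v := by
  have h : ∀ v w : E, fderiv ℂ (fun y => fderiv ℂ f y v) x w = fderiv ℂ (fderiv ℂ f) x w v := by
    intro v w
    have h1 := (hf.fderiv.differentiableAt.hasFDerivAt.clm_apply (hasFDerivAt_const v x)).fderiv
    rw [h1]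
    simp
  rw [h, h]
  exact (hf.contDiffAt (n := ⊤)).isSymmSndFDerivAt_of_omega w v

theorem hasDerivAt_fderiv_fst {f : ℂ × E → G} {x : ℂ × E} (hf : DifferentiableAt ℂ f x) :
    HasDerivAt (fun w => f (w, x.2)) (fderiv ℂ f x (1, 0)) x.1 := by
  have h1 : HasDerivAt (fun w : ℂ => (w, x.2)) ((1 : ℂ), (0 : E)) x.1 :=
    (hasDerivAt_id x.1).prodMk (hasDerivAt_const _ _)
  exact hf.hasFDerivAt.comp_hasDerivAt x.1 h1

theorem analyticAt_deriv_fst [CompleteSpace G] {f : ℂ × E → G} {x : ℂ × E}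
    (hf : AnalyticAt ℂ f x) : AnalyticAt ℂ (fun y => deriv (fun w => f (w, y.2)) y.1) x := by
  refine (analyticAt_fderiv_apply hf ((1 : ℂ), (0 : E))).congr ?_
  filter_upwards [hf.eventually_analyticAt] with y hy
  exact (hasDerivAt_fderiv_fst hy.differentiableAt).deriv.symm

/-- The chain rule for a function of three complex variables. -/
theorem hasFDerivAt_comp_three {K : ℂ × ℂ × ℂ → ℂ} {p z t : E → ℂ} {p' z' t' : E →L[ℂ] ℂ} {x : E}
    {A B C : ℂ} (hK : AnalyticAt ℂ K (p x, z x, t x))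
    (hA : HasDerivAt (fun w => K (w, z x, t x)) A (p x))
    (hB : HasDerivAt (fun w => K (p x, w, t x)) B (z x))
    (hC : HasDerivAt (fun w => K (p x, z x, w)) C (t x))
    (hp : HasFDerivAt p p' x) (hz : HasFDerivAt z z' x) (ht : HasFDerivAt t t' x) :
    HasFDerivAt (fun y => K (p y, z y, t y)) (A • p' + B • z' + C • t') x := by
  have h := hK.differentiableAt.hasFDerivAt
  set L := fderiv ℂ K (p x, z x, t x)
  have h1 := h.comp_hasDerivAt (p x) ((hasDerivAt_id (p x)).prodMk (hasDerivAt_const _ (z x, t x)))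
  have h2 := h.comp_hasDerivAt (z x) ((hasDerivAt_const _ (p x)).prodMk
    ((hasDerivAt_id (z x)).prodMk (hasDerivAt_const _ (t x))))
  have h3 := h.comp_hasDerivAt (t x) ((hasDerivAt_const _ (p x)).prodMk
    ((hasDerivAt_const _ (z x)).prodMk (hasDerivAt_id (t x))))
  have e1 : A = L (1, 0, 0) := hA.unique h1
  have e2 : B = L (0, 1, 0) := hB.unique h2
  have e3 : C = L (0, 0, 1) := hC.unique h3
  refine (h.comp x (hp.prodMk (hz.prodMk ht))).congr_fderiv ?_
  ext v
  have : ((p' v, z' v, t' v) : ℂ × ℂ × ℂ) =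
      p' v • (1, 0, 0) + z' v • (0, 1, 0) + t' v • (0, 0, 1) := by simp
  have h4 : L (p' v, z' v, t' v) = p' v * A + z' v * B + t' v * C := by
    rw [this, map_add, map_add, map_smul, map_smul, map_smul, e1, e2, e3]
    rfl
  change L (p' v, z' v, t' v) = A * p' v + B * z' v + C * t' v
  rw [h4]
  ring

end

/-! ### The heat equation -/

/-- Termwise `(2πin)² = 4πi · (πin²)`; the series of first derivatives converges uniformly on
strips, so it may be differentiated term by term. -/
theorem hasDerivAt_jacobiTheta₂'_fst (z : ℂ) {τ : ℂ} (hτ : 0 < τ.im) :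
    HasDerivAt (fun w => jacobiTheta₂' w τ) (4 * Real.pi * I * jacobiTheta₂_fderiv z τ (0, 1)) z := by
  obtain ⟨S, hz⟩ := exists_gt |z.im|
  have hU : IsOpen {w : ℂ | |w.im| < S} :=
    isOpen_lt (continuous_abs.comp Complex.continuous_im) continuous_const
  have hd : ∀ n : ℤ, ∀ w, HasDerivAt (fun w => jacobiTheta₂'_term n w τ)
      (4 * Real.pi * I * (jacobiTheta₂_term_fderiv n w τ (0, 1))) w := by
    intro n w
    have h1 : HasDerivAt (fun w => jacobiTheta₂_term n w τ)
        (jacobiTheta₂_term n w τ * (2 * Real.pi * I * n)) w := by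
      have h2 := (((hasDerivAt_id w).const_mul (2 * Real.pi * I * n : ℂ)).add_const
        (Real.pi * I * n ^ 2 * τ : ℂ)).cexp
      simpa [jacobiTheta₂_term] using h2
    convert! h1.const_mul (2 * Real.pi * I * n : ℂ) using 1
    simp [jacobiTheta₂_term_fderiv, jacobiTheta₂_term]
    ring
  have hu := (summable_pow_mul_jacobiTheta₂_term_bound S hτ 1).mul_left (2 * Real.pi)
  have hb : ∀ (n : ℤ) (w : ℂ), w ∈ {w : ℂ | |w.im| < S} → ‖jacobiTheta₂'_term n w τ‖ ≤
      2 * Real.pi * ((|n| ^ 1 : ℝ) * Real.exp (-Real.pi * (τ.im * n ^ 2 - 2 * S * |n|))) := by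
    intro n w hw
    have := norm_jacobiTheta₂'_term_le hτ (le_of_lt hw) le_rfl n
    simpa only [mul_assoc, pow_one] using this
  have h1 := hasSum_deriv_of_summable_norm hu
    (fun n w _ => (hd n w).differentiableAt.differentiableWithinAt) hU hb hz
  have hdiff : DifferentiableOn ℂ (fun w => ∑' n : ℤ, jacobiTheta₂'_term n w τ)
      {w : ℂ | |w.im| < S} := differentiableOn_tsum_of_summable_norm hu
        (fun n w _ => (hd n w).differentiableAt.differentiableWithinAt) hU hb
  have h2 := (ContinuousLinearMap.apply ℂ ℂ ((0 : ℂ), (1 : ℂ))).hasSum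
    (hasSum_jacobiTheta₂_term_fderiv z hτ)
  have h3 := h2.mul_left (4 * Real.pi * I : ℂ)
  have h4 : HasSum (fun n => deriv (fun w => jacobiTheta₂'_term n w τ) z)
      (4 * Real.pi * I * jacobiTheta₂_fderiv z τ (0, 1)) := by
    refine h3.congr_fun fun n => ?_
    rw [(hd n z).deriv]
    rfl
  rw [← h1.unique h4]
  exact (hdiff.differentiableAt (hU.mem_nhds hz)).hasDerivAt

theorem four_pi_I_ne_zero : (4 * Real.pi * I : ℂ) ≠ 0 := by
  simp [Real.pi_ne_zero]

/-- The heat equation for the theta function. -/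
theorem hasDerivAt_theta_tau (z : ℂ) {τ : ℂ} (hτ : 0 < τ.im) :
    HasDerivAt (fun t => theta z t) (thetaD 2 z τ / (4 * Real.pi * I)) τ := by
  have hz1 : ∀ w, HasDerivAt (fun w => theta w τ) (I * (ee (τ / 8 - w / 2) *
      (-(Real.pi * I) * jacobiTheta₂ (w - τ / 2 + 1 / 2) τ +
        jacobiTheta₂' (w - τ / 2 + 1 / 2) τ))) w := by
    intro w
    simp only [theta_eq_jacobiTheta₂]
    have h1 : HasDerivAt (fun w : ℂ => τ / 8 - w / 2) (-(1 / 2)) w :=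
      ((hasDerivAt_id w).div_const 2).const_sub _
    have h2 := (hasDerivAt_ee (τ / 8 - w / 2)).comp w h1
    have h3 : HasDerivAt (fun w : ℂ => w - τ / 2 + 1 / 2) 1 w :=
      ((hasDerivAt_id w).sub_const _).add_const _
    have h4 := (hasDerivAt_jacobiTheta₂_fst (w - τ / 2 + 1 / 2) hτ).comp w h3
    convert! (h2.mul h4).const_mul I using 1
    simp only [Function.comp]
    ring
  have e1 : (fun w => thetaD 1 w τ) = fun w => I * (ee (τ / 8 - w / 2) *
      (-(Real.pi * I) * jacobiTheta₂ (w - τ / 2 + 1 / 2) τ +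
        jacobiTheta₂' (w - τ / 2 + 1 / 2) τ)) := funext fun w => by
    rw [thetaD_one, (hz1 w).deriv]
  have hz2 : thetaD 2 z τ = I * (ee (τ / 8 - z / 2) *
      ((Real.pi * I) ^ 2 * jacobiTheta₂ (z - τ / 2 + 1 / 2) τ -
        2 * (Real.pi * I) * jacobiTheta₂' (z - τ / 2 + 1 / 2) τ +
        4 * Real.pi * I * jacobiTheta₂_fderiv (z - τ / 2 + 1 / 2) τ (0, 1))) := by
    have h := hasDerivAt_thetaD hτ 1 z
    rw [e1] at h
    refine h.unique ?_
    have h1 : HasDerivAt (fun w : ℂ => τ / 8 - w / 2) (-(1 / 2)) z :=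
      ((hasDerivAt_id z).div_const 2).const_sub _
    have h2 := (hasDerivAt_ee (τ / 8 - z / 2)).comp z h1
    have h3 : HasDerivAt (fun w : ℂ => w - τ / 2 + 1 / 2) 1 z :=
      ((hasDerivAt_id z).sub_const _).add_const _
    have h4 := (hasDerivAt_jacobiTheta₂_fst (z - τ / 2 + 1 / 2) hτ).comp z h3
    have h5 := (hasDerivAt_jacobiTheta₂'_fst (z - τ / 2 + 1 / 2) hτ).comp z h3
    convert! (h2.mul ((h4.const_mul (-(Real.pi * I) : ℂ)).add h5)).const_mul I using 1
    simp only [Function.comp, Pi.add_apply]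
    ring
  rw [hz2]
  simp only [theta_eq_jacobiTheta₂]
  have h1 : HasDerivAt (fun t : ℂ => t / 8 - z / 2) (1 / 8) τ :=
    ((hasDerivAt_id τ).div_const 8).sub_const _
  have h2 := (hasDerivAt_ee (τ / 8 - z / 2)).comp τ h1
  have h3 : HasDerivAt (fun t : ℂ => ((z - t / 2 + 1 / 2, t) : ℂ × ℂ)) (-(1 / 2), 1) τ :=
    ((((hasDerivAt_id τ).div_const 2).const_sub z).add_const _).prodMk (hasDerivAt_id τ)
  have h4 := HasFDerivAt.comp_hasDerivAt (f := fun t : ℂ => ((z - t / 2 + 1 / 2, t) : ℂ × ℂ)) τ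
    (hasFDerivAt_jacobiTheta₂ (z - τ / 2 + 1 / 2) hτ) h3
  have e2 : jacobiTheta₂' (z - τ / 2 + 1 / 2) τ =
      jacobiTheta₂_fderiv (z - τ / 2 + 1 / 2) τ (1, 0) :=
    (hasDerivAt_jacobiTheta₂_fst _ hτ).unique (by
      have h := hasDerivAt_fderiv_fst
        (hasFDerivAt_jacobiTheta₂ (z - τ / 2 + 1 / 2) hτ).differentiableAt
      rwa [(hasFDerivAt_jacobiTheta₂ (z - τ / 2 + 1 / 2) hτ).fderiv] at h)
  have e3 : jacobiTheta₂_fderiv (z - τ / 2 + 1 / 2) τ (-(1 / 2), 1) =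
      -(1 / 2) * jacobiTheta₂_fderiv (z - τ / 2 + 1 / 2) τ (1, 0) +
        jacobiTheta₂_fderiv (z - τ / 2 + 1 / 2) τ (0, 1) := by
    have : ((-(1 / 2), 1) : ℂ × ℂ) = (-(1 / 2) : ℂ) • ((1 : ℂ), (0 : ℂ)) + (0, 1) := by simp
    rw [this, map_add, map_smul, smul_eq_mul]
  rw [e2]
  convert! (h2.mul h4).const_mul I using 1
  rw [e3]
  have := four_pi_I_ne_zero
  simp only [Function.comp]
  field_simp
  ring_nf

theorem eventually_snd_im_pos {E : Type*} [TopologicalSpace E] {p : E × ℂ} (hτ : 0 < p.2.im) :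
    ∀ᶠ q in 𝓝 p, 0 < q.2.im :=
  (Complex.continuous_im.comp continuous_snd).continuousAt.eventually (lt_mem_nhds hτ)

theorem analyticAt_thetaD (k : ℕ) (z : ℂ) {τ : ℂ} (hτ : 0 < τ.im) :
    AnalyticAt ℂ (fun p : ℂ × ℂ => thetaD k p.1 p.2) (z, τ) := by
  induction k with
  | zero => simpa only [thetaD_zero] using analyticAt_theta z hτ
  | succ k ih =>
    refine (analyticAt_deriv_fst ih).congr ?_
    filter_upwards [eventually_snd_im_pos (p := (z, τ)) hτ] with p hp
    exact (hasDerivAt_thetaD hp k p.1).deriv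

/-- Differentiate the heat equation `k` times in `z`. The exchange of `∂_z` and `∂_τ` is the
symmetry of second derivatives, for which joint analyticity is needed. -/
theorem hasDerivAt_thetaD_tau (k : ℕ) (z : ℂ) {τ : ℂ} (hτ : 0 < τ.im) :
    HasDerivAt (fun t => thetaD k z t) (thetaD (k + 2) z τ / (4 * Real.pi * I)) τ := by
  have ht : ∀ {k : ℕ} {p : ℂ × ℂ}, 0 < p.2.im → HasDerivAt (fun t => thetaD k p.1 t)
      (fderiv ℂ (fun p : ℂ × ℂ => thetaD k p.1 p.2) p (0, 1)) p.2 := fun {k p} hp =>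
    (analyticAt_thetaD k p.1 hp).differentiableAt.hasFDerivAt.comp_hasDerivAt p.2
      ((hasDerivAt_const p.2 p.1).prodMk (hasDerivAt_id p.2))
  have hz : ∀ {k : ℕ} {p : ℂ × ℂ}, 0 < p.2.im → thetaD (k + 1) p.1 p.2 =
      fderiv ℂ (fun p : ℂ × ℂ => thetaD k p.1 p.2) p (1, 0) := fun {k p} hp =>
    (hasDerivAt_thetaD hp k p.1).unique
      (hasDerivAt_fderiv_fst (analyticAt_thetaD k p.1 hp).differentiableAt)
  induction k generalizing z τ with
  | zero => simpa only [thetaD_zero] using hasDerivAt_theta_tau z hτ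
  | succ k ih =>
    refine (ht (p := (z, τ)) hτ).congr_deriv ?_
    have e1 : (fun p : ℂ × ℂ => thetaD (k + 1) p.1 p.2) =ᶠ[𝓝 (z, τ)]
        fun p => fderiv ℂ (fun p : ℂ × ℂ => thetaD k p.1 p.2) p (1, 0) := by
      filter_upwards [eventually_snd_im_pos (p := (z, τ)) hτ] with p hp using hz hp
    have e2 : (fun p : ℂ × ℂ => fderiv ℂ (fun p : ℂ × ℂ => thetaD k p.1 p.2) p (0, 1))
        =ᶠ[𝓝 (z, τ)] fun p => thetaD (k + 2) p.1 p.2 / (4 * Real.pi * I) := by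
      filter_upwards [eventually_snd_im_pos (p := (z, τ)) hτ] with p hp
      exact (ht hp).unique (ih p.1 hp)
    rw [e1.fderiv_eq, fderiv_fderiv_comm (analyticAt_thetaD k z hτ), e2.fderiv_eq]
    have h := hasDerivAt_fderiv_fst
      (f := fun p : ℂ × ℂ => thetaD (k + 2) p.1 p.2 / (4 * Real.pi * I)) (x := (z, τ))
      (by simpa only [div_eq_mul_inv] using
        (analyticAt_thetaD (k + 2) z hτ).differentiableAt.mul_const _)
    exact h.unique ((hasDerivAt_thetaD hτ (k + 2) z).div_const _)

end TwistedKZB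
end

noncomputable section
namespace TwistedKZB
open Complex Metric Set Filter Topology

/-! ### Analyticity of the coefficient functions -/

theorem two_pi_I_ne_zero' : (2 * Real.pi * I : ℂ) ≠ 0 := Complex.two_pi_I_ne_zero

section

variable {E : Type*} [NormedAddCommGroup E] [NormedSpace ℂ E] {p z t : E → ℂ} {x : E}

theorem analyticAt_thetaD_comp (k : ℕ) (hz : AnalyticAt ℂ z x) (ht : AnalyticAt ℂ t x)
    (hτ : 0 < (t x).im) : AnalyticAt ℂ (fun y => thetaD k (z y) (t y)) x :=
  AnalyticAt.comp_of_eq (f := fun y => (z y, t y)) (analyticAt_thetaD k (z x) hτ) (hz.prod ht) rfl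

theorem analyticAt_theta_comp (hz : AnalyticAt ℂ z x) (ht : AnalyticAt ℂ t x)
    (hτ : 0 < (t x).im) : AnalyticAt ℂ (fun y => theta (z y) (t y)) x :=
  AnalyticAt.comp_of_eq (f := fun y => (z y, t y)) (analyticAt_theta (z x) hτ) (hz.prod ht) rfl

theorem analyticAt_phi_comp (hp : AnalyticAt ℂ p x) (hz : AnalyticAt ℂ z x) (ht : AnalyticAt ℂ t x)
    (hτ : 0 < (t x).im) (h1 : theta (p x) (t x) ≠ 0) (h2 : theta (z x) (t x) ≠ 0) :
    AnalyticAt ℂ (fun y => phi (p y) (z y) (t y)) x := by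
  simp only [phi_eq]
  exact ((analyticAt_thetaD_comp 1 analyticAt_const ht hτ).mul
    (analyticAt_theta_comp (hp.add hz) ht hτ)).div
    ((analyticAt_theta_comp hp ht hτ).mul (analyticAt_theta_comp hz ht hτ)) (mul_ne_zero h1 h2)

theorem analyticAt_dphi_comp (hp : AnalyticAt ℂ p x) (hz : AnalyticAt ℂ z x) (ht : AnalyticAt ℂ t x)
    (hτ : 0 < (t x).im) (h1 : theta (p x) (t x) ≠ 0) (h2 : theta (z x) (t x) ≠ 0) :
    AnalyticAt ℂ (fun y => dphi (p y) (z y) (t y)) x := by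
  have h : AnalyticAt ℂ (fun q : ℂ × ℂ × ℂ => dphi q.1 q.2.1 q.2.2) (p x, z x, t x) :=
    analyticAt_deriv_fst (f := fun q : ℂ × ℂ × ℂ => phi q.1 q.2.1 q.2.2)
      (analyticAt_phi_comp (p := fun q : ℂ × ℂ × ℂ => q.1) (z := fun q => q.2.1)
        (t := fun q => q.2.2) (by fun_prop) (by fun_prop) (by fun_prop) hτ h1 h2)
  exact AnalyticAt.comp_of_eq (f := fun y => (p y, z y, t y)) h (hp.prod (hz.prod ht)) rfl

theorem analyticAt_E1_comp (hz : AnalyticAt ℂ z x) (ht : AnalyticAt ℂ t x)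
    (hτ : 0 < (t x).im) (h2 : theta (z x) (t x) ≠ 0) :
    AnalyticAt ℂ (fun y => E1 (z y) (t y)) x := by
  simp only [E1_eq]
  exact (analyticAt_thetaD_comp 1 hz ht hτ).div (analyticAt_theta_comp hz ht hτ) h2

theorem analyticAt_E2_comp (hz : AnalyticAt ℂ z x) (ht : AnalyticAt ℂ t x)
    (hτ : 0 < (t x).im) (h2 : theta (z x) (t x) ≠ 0) :
    AnalyticAt ℂ (fun y => E2 (z y) (t y)) x := by
  have h1 : AnalyticAt ℂ (fun q : ℂ × ℂ => E1 q.1 q.2) (z x, t x) :=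
    analyticAt_E1_comp (z := Prod.fst) (t := Prod.snd) (by fun_prop) (by fun_prop) hτ h2
  have h : AnalyticAt ℂ (fun q : ℂ × ℂ => E2 q.1 q.2) (z x, t x) := (analyticAt_deriv_fst h1).neg
  exact AnalyticAt.comp_of_eq (f := fun y => (z y, t y)) h (hz.prod ht) rfl

theorem analyticAt_eta1_comp (ht : AnalyticAt ℂ t x) (hτ : 0 < (t x).im) :
    AnalyticAt ℂ (fun y => eta1 (t y)) x := by
  simp only [eta1_eq]
  exact (analyticAt_thetaD_comp 3 analyticAt_const ht hτ).neg.div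
    (analyticAt_const.mul (analyticAt_thetaD_comp 1 analyticAt_const ht hτ))
    (mul_ne_zero (by norm_num) (thetaD_one_zero_ne_zero hτ))

theorem analyticAt_chi_comp (hz : AnalyticAt ℂ z x) (ht : AnalyticAt ℂ t x)
    (hτ : 0 < (t x).im) (h2 : theta (z x) (t x) ≠ 0) :
    AnalyticAt ℂ (fun y => chi (z y) (t y)) x := by
  simp only [chi, wp]
  exact ((((analyticAt_E1_comp hz ht hτ h2).pow 2).sub ((analyticAt_E2_comp hz ht hτ h2).sub
    (analyticAt_const.mul (analyticAt_eta1_comp ht hτ))))).div analyticAt_const (by norm_num)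

theorem analyticAt_character (s : ℂ) (hz : AnalyticAt ℂ z x) :
    AnalyticAt ℂ (fun y => ee (-(s * z y))) x :=
  AnalyticAt.comp_of_eq (f := fun y => -(s * z y)) (analyticAt_ee (-(s * z x)))
    (analyticAt_const.mul hz).neg rfl

theorem analyticAt_kap_comp {b : Bool} {s : ℂ} (hp : AnalyticAt ℂ p x) (hz : AnalyticAt ℂ z x)
    (ht : AnalyticAt ℂ t x)
    (hτ : 0 < (t x).im) (h1 : b = false → theta (p x) (t x) ≠ 0) (h2 : theta (z x) (t x) ≠ 0) :
    AnalyticAt ℂ (fun y => kap ⟨b, s, p y⟩ (z y) (t y)) x := by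
  cases b
  · exact (analyticAt_character s hz).mul (analyticAt_phi_comp hp hz ht hτ (h1 rfl) h2)
  · exact analyticAt_E1_comp hz ht hτ h2

theorem analyticAt_dkap_comp {b : Bool} {s : ℂ} (hp : AnalyticAt ℂ p x) (hz : AnalyticAt ℂ z x)
    (ht : AnalyticAt ℂ t x)
    (hτ : 0 < (t x).im) (h1 : b = false → theta (p x) (t x) ≠ 0) (h2 : theta (z x) (t x) ≠ 0) :
    AnalyticAt ℂ (fun y => dkap ⟨b, s, p y⟩ (z y) (t y)) x := by
  cases b
  · exact (analyticAt_character s hz).mul (analyticAt_dphi_comp hp hz ht hτ (h1 rfl) h2)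
  · exact analyticAt_chi_comp hz ht hτ h2

theorem analyticAt_ekap_comp {b : Bool} {s : ℂ} (hp : AnalyticAt ℂ p x)
    (ht : AnalyticAt ℂ t x)
    (hτ : 0 < (t x).im) (h1 : b = false → theta (p x) (t x) ≠ 0) :
    AnalyticAt ℂ (fun y => ekap ⟨b, s, p y⟩ (t y)) x := by
  cases b
  · exact (analyticAt_E2_comp hp ht hτ (h1 rfl)).neg
  · exact analyticAt_const.mul (analyticAt_eta1_comp ht hτ)

end

/-! ### Heat equations for the coefficient functions -/

section

variable {τ : ℂ}

/-- `∂_z` of the coefficient of `f`. -/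
def zdkap (q : Channel) (z τ : ℂ) : ℂ := deriv (fun w => dkap q w τ) z

/-- `∂_z` of the coefficient of the `r`-matrix. -/
def zkap (q : Channel) (z τ : ℂ) : ℂ := deriv (fun w => kap q w τ) z

theorem zdkap_opp {q q' : Channel} (h : q.Opp τ q') (z : ℂ) :
    zdkap q' z τ = -zdkap q (-z) τ := by
  rw [zdkap, zdkap, funext fun w => dkap_opp h w, deriv_comp_neg (fun w => dkap q w τ)]

theorem zkap_opp {q q' : Channel} (h : q.Opp τ q') (z : ℂ) :
    zkap q' z τ = zkap q (-z) τ := by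
  rw [zkap, zkap, funext fun w => kap_opp h w, deriv.fun_neg,
    deriv_comp_neg (fun w => kap q w τ), neg_neg]

/-- Since `E₁² - E₂ = θ''/θ`, the function `chi` is `θ''/(2θ)` up to a constant in `z`. The heat
equation gives `∂_τ log θ = θ''/(4πi θ)`, and one takes `∂_z` of it. -/
theorem hasDerivAt_E1_tau (hτ : 0 < τ.im) {z : ℂ} (hz : theta z τ ≠ 0) :
    HasDerivAt (fun t => E1 z t) (deriv (fun w => chi w τ) z / (2 * Real.pi * I)) τ := by
  have h0 := two_pi_I_ne_zero'
  have h1 := (hasDerivAt_thetaD_tau 1 z hτ).div (hasDerivAt_theta_tau z hτ) hz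
  have hD : HasDerivAt (fun w => chi w τ)
      ((thetaD 3 z τ * theta z τ - thetaD 2 z τ * thetaD 1 z τ) / theta z τ ^ 2 / 2) z := by
    have h2 := ((hasDerivAt_thetaD hτ 2 z).div (hasDerivAt_theta hτ z) hz).add_const (2 * eta1 τ)
    refine (h2.div_const 2).congr_of_eventuallyEq ?_
    filter_upwards [eventually_theta_ne_zero hτ hz] with w hw
    simp only [chi, wp, E2_eq hτ hw, E1_eq, Pi.div_apply]
    ring
  rw [hD.deriv]
  simp only [E1_eq]
  convert! h1 using 1
  have h2 : (4 * Real.pi * I : ℂ) = 2 * (2 * Real.pi * I) := by ring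
  rw [h2]
  field_simp

/-- The mixed heat equation `2πi ∂_τ φ = ∂_z ∂_u φ`. Once the heat equation is applied to each theta
factor, it becomes `theta_second_addition`. -/
theorem hasDerivAt_phi_tau (hτ : 0 < τ.im) {u z : ℂ} (hu : theta u τ ≠ 0) (hz : theta z τ ≠ 0) :
    HasDerivAt (fun t => phi u z t) (deriv (fun w => dphi u w τ) z / (2 * Real.pi * I)) τ := by
  have h0 := two_pi_I_ne_zero'
  have h1 := ((show HasDerivAt (fun t => thetaD 1 0 t) (thetaD 3 0 τ / (4 * Real.pi * I)) τ from
    hasDerivAt_thetaD_tau 1 0 hτ).mul (hasDerivAt_theta_tau (u + z) hτ)).div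
    ((hasDerivAt_theta_tau u hτ).mul (hasDerivAt_theta_tau z hτ)) (mul_ne_zero hu hz)
  have hs : HasDerivAt (fun w => theta (u + w) τ) (thetaD 1 (u + z) τ) z :=
    HasDerivAt.comp_const_add u z (hasDerivAt_theta hτ _)
  have hs1 : HasDerivAt (fun w => thetaD 1 (u + w) τ) (thetaD 2 (u + z) τ) z :=
    HasDerivAt.comp_const_add u z (hasDerivAt_thetaD hτ 1 _)
  have hD := ((hs1.const_mul (thetaD 1 0 τ)).div ((hasDerivAt_theta hτ z).const_mul (theta u τ))
    (mul_ne_zero hu hz)).sub (((hs.const_mul (thetaD 1 0 τ)).div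
      ((hasDerivAt_theta hτ z).const_mul (theta u τ)) (mul_ne_zero hu hz)).mul_const (E1 u τ))
  have hD' : HasDerivAt (fun w => dphi u w τ) _ z := hD.congr_of_eventuallyEq
    (Eventually.of_forall fun w => by
      change dphi u w τ = _
      rw [dphi_eq hτ w hu, phi_eq]
      rfl)
  rw [hD'.deriv]
  simp only [phi_eq]
  convert! h1 using 1
  have h2 : (4 * Real.pi * I : ℂ) = 2 * (2 * Real.pi * I) := by ring
  have h3 := theta_second_addition hτ u z
  have h4 := thetaD_one_zero_ne_zero hτ
  rw [h2, E1_eq]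
  generalize (2 * Real.pi * I : ℂ) = P at h0 ⊢
  simp only [Pi.mul_apply]
  field_simp
  linear_combination h3

end

end TwistedKZB
end

noncomputable section
namespace TwistedKZB
open Complex Metric Set Filter Topology

/-! ### Periodicity in the position of the marked points -/

section

variable {τ : ℂ} {r : ℕ}

/-- The character of `q` is an `r`-torsion character. -/
def Channel.Torsion (r : ℕ) (q : Channel) : Prop := ∃ m : ℤ, q.s * r = m

theorem E1_add_intCast (z : ℂ) (k : ℤ) : E1 (z + k) τ = E1 z τ := by
  have h1 : ∀ z, E1 (z + 1) τ = E1 z τ := fun z => by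
    have h := deriv_comp_add_const (fun w => theta w τ) 1 z
    rw [E1, E1, logDeriv_apply, logDeriv_apply, ← h, funext fun w => theta_add_one w τ,
      theta_add_one, deriv.fun_neg, neg_div_neg_eq]
  induction k using Int.induction_on with
  | zero => simp
  | succ i ih =>
    rw [← ih, ← h1 (z + (i : ℤ))]
    push_cast
    ring_nf
  | pred i ih =>
    rw [← ih, ← h1]
    push_cast
    ring_nf

theorem dphi_add_intCast (u z : ℂ) (k : ℤ) : dphi u (z + k) τ = dphi u z τ := by
  simp only [dphi, phi_add_intCast]

theorem chi_add_intCast (z : ℂ) (k : ℤ) : chi (z + k) τ = chi z τ := by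
  have h := deriv_comp_add_const (fun w => E1 w τ) (k : ℂ) z
  rw [funext fun w => E1_add_intCast (τ := τ) w k] at h
  simp only [chi, wp, E2, E1_add_intCast, ← h]

theorem ee_torsion {s : ℂ} {m : ℤ} (h : s * r = m) (z : ℂ) (k : ℤ) :
    ee (-(s * (z + r * k))) = ee (-(s * z)) := by
  have : -(s * (z + r * k)) = -(s * z) + (-(m * k) : ℤ) := by
    push_cast
    rw [← h]
    ring
  rw [this, ee_add, ee_intCast, mul_one]

theorem kap_add_period {q : Channel} (hq : q.Torsion r) (z : ℂ) (k : ℤ) :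
    kap q (z + r * k) τ = kap q z τ := by
  obtain ⟨m, hm⟩ := hq
  have e : z + r * k = z + ((r * k : ℤ) : ℂ) := by push_cast; rfl
  rw [kap, kap, tw, tw, ee_torsion hm, e, E1_add_intCast, phi_add_intCast]

theorem dkap_add_period {q : Channel} (hq : q.Torsion r) (z : ℂ) (k : ℤ) :
    dkap q (z + r * k) τ = dkap q z τ := by
  obtain ⟨m, hm⟩ := hq
  have e : z + r * k = z + ((r * k : ℤ) : ℂ) := by push_cast; rfl
  rw [dkap, dkap, dtw, dtw, ee_torsion hm, e, chi_add_intCast, dphi_add_intCast]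

theorem ddkap_add_period {q : Channel} (hq : q.Torsion r) (z : ℂ) (k : ℤ) :
    ddkap q (z + r * k) τ = ddkap q z τ := by
  obtain ⟨m, hm⟩ := hq
  have e : z + r * k = z + ((r * k : ℤ) : ℂ) := by push_cast; rfl
  rw [ddkap, ddkap, ddtw, ddtw, ee_torsion hm, e, ddphi, ddphi]
  simp only [dphi_add_intCast]

theorem zkap_add_period {q : Channel} (hq : q.Torsion r) (z : ℂ) (k : ℤ) :
    zkap q (z + r * k) τ = zkap q z τ := by
  rw [zkap, ← deriv_comp_add_const (fun w => kap q w τ), zkap]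
  simp only [kap_add_period hq]

theorem zdkap_add_period {q : Channel} (hq : q.Torsion r) (z : ℂ) (k : ℤ) :
    zdkap q (z + r * k) τ = zdkap q z τ := by
  rw [zdkap, ← deriv_comp_add_const (fun w => dkap q w τ), zdkap]
  simp only [dkap_add_period hq]

theorem ee_zOf (hr : 0 < r) {t : ℂ} (ht : t ≠ 0) : ee (zOf r t / r) = t := by
  have hr' : (r : ℂ) ≠ 0 := by exact_mod_cast hr.ne'
  have : 2 * Real.pi * I * (zOf r t / r) = Complex.log t := by
    have := two_pi_I_ne_zero'
    rw [zOf]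
    generalize (2 * Real.pi * I : ℂ) = P at this ⊢
    field_simp
  rw [ee, this, Complex.exp_log ht]

theorem exists_eq_zOf_add (hr : 0 < r) {t z : ℂ} (hz : ee (z / r) = t) :
    ∃ k : ℤ, zOf r t = z + r * k := by
  have hr' : (r : ℂ) ≠ 0 := by exact_mod_cast hr.ne'
  have ht : t ≠ 0 := hz ▸ ee_ne_zero _
  have h : ee (zOf r t / r - z / r) = 1 := by
    rw [ee_sub, ee_zOf hr ht, hz, mul_inv_cancel₀ ht]
  obtain ⟨k, hk⟩ := ee_eq_one_iff.1 h
  refine ⟨k, ?_⟩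
  rw [← hk]
  field_simp
  ring

theorem ee_zOf_sub (hr : 0 < r) {t s : ℂ} (ht : t ≠ 0) (hs : s ≠ 0) :
    ee ((zOf r t - zOf r s) / r) = t / s := by
  rw [sub_div, ee_sub, ee_zOf hr ht, ee_zOf hr hs, div_eq_mul_inv]

theorem ee_natCast_mul (x : ℂ) (n : ℕ) : ee (n * x) = ee x ^ n := by
  rw [ee, ee, ← Complex.exp_nat_mul]
  ring_nf

/-- If `z = j + kτ`, then `t^r = 𝐞(z) = 𝐞(kτ)`. -/
theorem theta_zOf_ne_zero (hr : 0 < r) (hτ : 0 < τ.im) {t z : ℂ} (hz : ee (z / r) = t)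
    (h : ∀ k : ℤ, t ^ r ≠ ee (k * τ)) : theta z τ ≠ 0 := by
  have hr' : (r : ℂ) ≠ 0 := by exact_mod_cast hr.ne'
  rw [Ne, theta_eq_zero_iff hτ]
  rintro ⟨j, k, hjk⟩
  apply h k
  rw [← hz, ← ee_natCast_mul, mul_div_cancel₀ _ hr', hjk, ee_add, ee_intCast, one_mul]

end

/-! ### Derivatives of the coefficient functions -/

theorem zdkap_false {τ s : ℂ} (hτ : 0 < τ.im) {p w : ℂ} (hp : theta p τ ≠ 0)
    (hw : theta w τ ≠ 0) : zdkap ⟨false, s, p⟩ w τ =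
      ee (-(s * w)) * (deriv (fun w => dphi p w τ) w - 2 * Real.pi * I * s * dphi p w τ) := by
  have h1 : HasDerivAt (fun w => ee (-(s * w))) (2 * Real.pi * I * ee (-(s * w)) * -(s * 1)) w :=
    HasDerivAt.comp (h := fun w => -(s * w)) w (hasDerivAt_ee (-(s * w)))
      ((hasDerivAt_id w).const_mul s).fun_neg
  have h2 : HasDerivAt (fun w => dphi p w τ) (deriv (fun w => dphi p w τ) w) w :=
    (analyticAt_dphi_comp (p := fun _ => p) (z := fun w => w) (t := fun _ => τ) analyticAt_const
      analyticAt_id analyticAt_const hτ hp hw).differentiableAt.hasDerivAt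
  refine (h1.mul h2).deriv.trans ?_
  ring

section

variable {E : Type*} [NormedAddCommGroup E] [NormedSpace ℂ E]

section

variable {v z t : E → ℂ} {x : E} {v' z' t' : E →L[ℂ] ℂ} {b : Bool} {s : ℂ}

/-- The argument `v - sτ` moves with `τ` and contributes `-s ∂φ`. The character contributes the same
amount to `∂_z` of the derivative kernel divided by `2πi`, so the mixed heat equation holds
unchanged at fixed `v`. A zero channel does not depend on `v`, which accounts for the coefficient
`0`. -/
theorem hasFDerivAt_kap_comp (hv : HasFDerivAt v v' x) (hz : HasFDerivAt z z' x)
    (ht : HasFDerivAt t t' x) (hτ : 0 < (t x).im)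
    (h1 : b = false → theta (v x - s * t x) (t x) ≠ 0) (h2 : theta (z x) (t x) ≠ 0) :
    HasFDerivAt (fun y => kap ⟨b, s, v y - s * t y⟩ (z y) (t y))
      ((if b then 0 else dkap ⟨b, s, v x - s * t x⟩ (z x) (t x)) • v' +
        zkap ⟨b, s, v x - s * t x⟩ (z x) (t x) • z' +
        (zdkap ⟨b, s, v x - s * t x⟩ (z x) (t x) / (2 * Real.pi * I)) • t') x := by
  have hK : AnalyticAt ℂ (fun q : ℂ × ℂ × ℂ => kap ⟨b, s, q.1⟩ q.2.1 q.2.2)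
      (v x - s * t x, z x, t x) := analyticAt_kap_comp (p := fun q : ℂ × ℂ × ℂ => q.1)
        (z := fun q => q.2.1) (t := fun q => q.2.2) (by fun_prop) (by fun_prop) (by fun_prop)
        hτ h1 h2
  have hp := hv.sub (ht.const_mul s)
  have hB : HasDerivAt (fun w => kap ⟨b, s, v x - s * t x⟩ w (t x))
      (zkap ⟨b, s, v x - s * t x⟩ (z x) (t x)) (z x) :=
    (analyticAt_kap_comp (b := b) (p := fun _ => v x - s * t x) (z := fun w => w)
      (t := fun _ => t x) analyticAt_const
      analyticAt_id analyticAt_const hτ h1 h2).differentiableAt.hasDerivAt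
  cases b with
  | true =>
    refine (hasFDerivAt_comp_three (p := fun y => v y - s * t y) hK
      (hasDerivAt_const (v x - s * t x) (E1 (z x) (t x))) hB (hasDerivAt_E1_tau hτ h2) hp hz ht).congr_fderiv ?_
    ext w
    simp [zdkap, dkap]
  | false =>
    have h3 := h1 rfl
    refine (hasFDerivAt_comp_three (p := fun y => v y - s * t y) hK
      ((hasDerivAt_phi hτ (z x) h3).const_mul (ee (-(s * z x)))) hB
      ((hasDerivAt_phi_tau hτ h3 h2).const_mul (ee (-(s * z x)))) hp hz ht).congr_fderiv ?_
    rw [zdkap_false hτ h3 h2]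
    ext w
    have := two_pi_I_ne_zero'
    simp [dkap, dtw]
    generalize ee (-(s * z x)) = A
    field_simp
    ring

/-- The `τ`-derivative is left as an unspecified constant `C`: the commutators contain `∂_τ` of the
r-matrix but not of `f`. -/
theorem hasFDerivAt_dkap_comp (hv : HasFDerivAt v v' x) (hz : HasFDerivAt z z' x)
    (ht : HasFDerivAt t t' x) (hτ : 0 < (t x).im)
    (h1 : b = false → theta (v x - s * t x) (t x) ≠ 0) (h2 : theta (z x) (t x) ≠ 0) :
    ∃ C : ℂ, HasFDerivAt (fun y => dkap ⟨b, s, v y - s * t y⟩ (z y) (t y))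
      (ddkap ⟨b, s, v x - s * t x⟩ (z x) (t x) • v' +
        zdkap ⟨b, s, v x - s * t x⟩ (z x) (t x) • z' + C • t') x := by
  have hK : AnalyticAt ℂ (fun q : ℂ × ℂ × ℂ => dkap ⟨b, s, q.1⟩ q.2.1 q.2.2)
      (v x - s * t x, z x, t x) := analyticAt_dkap_comp (p := fun q : ℂ × ℂ × ℂ => q.1)
        (z := fun q => q.2.1) (t := fun q => q.2.2) (by fun_prop) (by fun_prop) (by fun_prop)
        hτ h1 h2
  have hp := hv.sub (ht.const_mul s)
  have hA : HasDerivAt (fun w => dkap ⟨b, s, w⟩ (z x) (t x))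
      (ddkap ⟨b, s, v x - s * t x⟩ (z x) (t x)) (v x - s * t x) := by
    cases b with
    | true => exact hasDerivAt_const _ _
    | false => exact (hasDerivAt_dphi hτ (z x) (h1 rfl)).const_mul (ee (-(s * z x)))
  have hB : HasDerivAt (fun w => dkap ⟨b, s, v x - s * t x⟩ w (t x))
      (zdkap ⟨b, s, v x - s * t x⟩ (z x) (t x)) (z x) :=
    (analyticAt_dkap_comp (b := b) (p := fun _ => v x - s * t x) (z := fun w => w)
      (t := fun _ => t x) analyticAt_const
      analyticAt_id analyticAt_const hτ h1 h2).differentiableAt.hasDerivAt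
  have hC : DifferentiableAt ℂ (fun w => dkap ⟨b, s, v x - s * t x⟩ (z x) w) (t x) :=
    (analyticAt_dkap_comp (b := b) (p := fun _ => v x - s * t x) (z := fun _ => z x)
      (t := fun w => w) analyticAt_const
      analyticAt_const analyticAt_id hτ h1 h2).differentiableAt
  refine ⟨deriv (fun w => dkap ⟨b, s, v x - s * t x⟩ (z x) w) (t x) -
      s * ddkap ⟨b, s, v x - s * t x⟩ (z x) (t x), (hasFDerivAt_comp_three (p := fun y => v y - s * t y) hK
      hA hB hC.hasDerivAt hp hz ht).congr_fderiv ?_⟩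
  ext w
  simp
  ring

theorem hasFDerivAt_ekap_comp (hv : HasFDerivAt v v' x)
    (ht : HasFDerivAt t t' x) (hτ : 0 < (t x).im)
    (h1 : b = false → theta (v x - s * t x) (t x) ≠ 0) :
    ∃ C : ℂ, HasFDerivAt (fun y => ekap ⟨b, s, v y - s * t y⟩ (t y))
      (dekap ⟨b, s, v x - s * t x⟩ (t x) • v' + C • t') x := by
  have hK : AnalyticAt ℂ (fun q : ℂ × ℂ × ℂ => ekap ⟨b, s, q.1⟩ q.2.2)
      (v x - s * t x, 0, t x) := analyticAt_ekap_comp (p := fun q : ℂ × ℂ × ℂ => q.1)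
        (t := fun q => q.2.2) (by fun_prop) (by fun_prop) hτ h1
  have hp := hv.sub (ht.const_mul s)
  have hA : HasDerivAt (fun w => ekap ⟨b, s, w⟩ (t x))
      (dekap ⟨b, s, v x - s * t x⟩ (t x)) (v x - s * t x) := by
    cases b with
    | true => exact hasDerivAt_const _ _
    | false => exact (differentiableAt_E2 hτ (h1 rfl)).hasDerivAt.neg
  have hC : DifferentiableAt ℂ (fun w => ekap ⟨b, s, v x - s * t x⟩ w) (t x) :=
    (analyticAt_ekap_comp (b := b) (p := fun _ => v x - s * t x)
      (t := fun w => w) analyticAt_const analyticAt_id hτ h1).differentiableAt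
  refine ⟨deriv (fun w => ekap ⟨b, s, v x - s * t x⟩ w) (t x) -
      s * dekap ⟨b, s, v x - s * t x⟩ (t x), (hasFDerivAt_comp_three (p := fun y => v y - s * t y) (z := fun _ => 0) hK
      hA (hasDerivAt_const (0 : ℂ) (ekap ⟨b, s, v x - s * t x⟩ (t x))) hC.hasDerivAt hp (hasFDerivAt_const _ _) ht).congr_fderiv ?_⟩
  ext w
  simp
  ring

end

/-- A holomorphic branch of `zOf`, up to the periods of the coefficient functions. -/
theorem exists_zOf_branch {r : ℕ} (hr : 0 < r) {t₁ t₂ : E → ℂ} {x : E} (h1 : AnalyticAt ℂ t₁ x)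
    (h2 : AnalyticAt ℂ t₂ x) (n1 : t₁ x ≠ 0) (n2 : t₂ x ≠ 0) :
    ∃ z : E → ℂ, z x = zOf r (t₁ x / t₂ x) ∧ AnalyticAt ℂ z x ∧
      (HasFDerivAt z (((r : ℂ) / (2 * Real.pi * I)) •
        ((t₁ x)⁻¹ • fderiv ℂ t₁ x - (t₂ x)⁻¹ • fderiv ℂ t₂ x)) x) ∧
      ∀ᶠ y in 𝓝 x, ∃ k : ℤ, zOf r (t₁ y / t₂ y) = z y + r * k := by
  have n12 : t₁ x / t₂ x ≠ 0 := div_ne_zero n1 n2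
  have ha : AnalyticAt ℂ (fun y => t₁ y / t₂ y / (t₁ x / t₂ x)) x :=
    (h1.div h2 n2).div analyticAt_const n12
  have hx : t₁ x / t₂ x / (t₁ x / t₂ x) = 1 := div_self n12
  have hl : AnalyticAt ℂ (fun y => Complex.log (t₁ y / t₂ y / (t₁ x / t₂ x))) x :=
    ha.clog (by rw [hx]; exact Complex.one_mem_slitPlane)
  -- Normalising the ratio by its value at `x` moves the argument of the principal logarithm to `1`,
  -- away from the cut.
  refine ⟨fun y => r / (2 * Real.pi * I) * Complex.log (t₁ y / t₂ y / (t₁ x / t₂ x)) +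
    zOf r (t₁ x / t₂ x), ?_, ?_, ?_, ?_⟩
  · simp [hx]
  · exact (analyticAt_const.mul hl).add analyticAt_const
  · have d1 := h1.differentiableAt.hasFDerivAt
    have d2 := h2.differentiableAt.hasFDerivAt
    have h3 : HasDerivAt (fun y : ℂ => Complex.log (y / (t₁ x / t₂ x))) (t₁ x / t₂ x)⁻¹
        (t₁ x / t₂ x) := by
      have h4 := (hasDerivAt_id (t₁ x / t₂ x)).div_const (t₁ x / t₂ x)
      refine (h4.clog (by simp only [id]; rw [hx]; exact Complex.one_mem_slitPlane)).congr_deriv ?_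
      simp only [id, hx, div_one, one_div]
    have h5 : HasFDerivAt (fun y => t₁ y * (t₂ y)⁻¹) _ x :=
      d1.mul ((hasDerivAt_inv n2).comp_hasFDerivAt x d2)
    simp only [← div_eq_mul_inv] at h5
    refine (((h3.comp_hasFDerivAt x h5).const_mul ((r : ℂ) / (2 * Real.pi * I))).add_const
      _).congr_fderiv ?_
    ext w
    simp
    field_simp
    ring
  · filter_upwards [h1.continuousAt.eventually_ne n1, h2.continuousAt.eventually_ne n2] with y m1 m2
    apply exists_eq_zOf_add hr
    have hr' : (r : ℂ) ≠ 0 := by exact_mod_cast hr.ne'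
    have hne : t₁ y / t₂ y / (t₁ x / t₂ x) ≠ 0 := div_ne_zero (div_ne_zero m1 m2) n12
    rw [add_div, ee_add, ee_zOf hr n12, ee]
    have : 2 * Real.pi * I * (r / (2 * Real.pi * I) *
        Complex.log (t₁ y / t₂ y / (t₁ x / t₂ x)) / r) =
        Complex.log (t₁ y / t₂ y / (t₁ x / t₂ x)) := by
      have := two_pi_I_ne_zero'
      generalize (2 * Real.pi * I : ℂ) = P at this ⊢
      field_simp
    rw [this, Complex.exp_log hne]
    field_simp

end

end TwistedKZB
end

noncomputable section
namespace TwistedKZB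
open Complex Metric Set Filter Topology

/-! ### Dual frames acting at several sites -/

theorem sum_smul_commutator {R ι κ : Type*} [Ring R] [Algebra ℂ R] [Fintype ι] [Fintype κ]
    (p : ι → ℂ) (q : κ → ℂ) (A : ι → R) (B : κ → R) :
    (∑ i, p i • A i) * (∑ j, q j • B j) - (∑ j, q j • B j) * (∑ i, p i • A i) =
      ∑ i, ∑ j, (p i * q j) • (A i * B j - B j * A i) := by
  rw [Finset.sum_mul_sum, Finset.sum_mul_sum, Finset.sum_comm (f := fun j i => q j • B j * p i • A i),
    ← Finset.sum_sub_distrib]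
  refine Finset.sum_congr rfl fun i _ => ?_
  rw [← Finset.sum_sub_distrib]
  refine Finset.sum_congr rfl fun j _ => ?_
  rw [smul_mul_smul_comm, smul_mul_smul_comm, mul_comm (q j), smul_sub]

/-- A family of operators `Y a i` at the sites `a`, indexed by a dual frame of a Lie algebra with
an invariant form; the indices `inl k` belong to an orthonormal basis of a commutative subalgebra
with respect to which the other members of the frame are weight vectors. -/
structure Frame (R S J : Type*) (n : ℕ) [Ring R] [Algebra ℂ R] [Fintype J] where
  star : Fin n ⊕ J → Fin n ⊕ J
  star_star : ∀ i, star (star i) = i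
  star_inl : ∀ k, star (Sum.inl k) = Sum.inl k
  Y : S → Fin n ⊕ J → R
  C : Fin n ⊕ J → Fin n ⊕ J → Fin n ⊕ J → ℂ
  w : Fin n → Fin n ⊕ J → ℂ
  C_cyc : ∀ i j k, C i j k = C j k i
  C_anti : ∀ i j k, C i j k = -C j i k
  brk : ∀ a i j, Y a i * Y a j - Y a j * Y a i = ∑ k, C i j k • Y a (star k)
  comm : ∀ {a b}, a ≠ b → ∀ i j, Y a i * Y b j = Y b j * Y a i
  wt : ∀ a k i, Y a (Sum.inl k) * Y a i - Y a i * Y a (Sum.inl k) = w k i • Y a i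
  w_star : ∀ k i, w k (star i) = -w k i

namespace Frame

variable {R S J : Type*} {n : ℕ} [Ring R] [Algebra ℂ R] [Fintype J] (P : Frame R S J n)

/-- The operator `∑ pᵢ yᵢ ⊗ yᵢ*` at the sites `a`, `b`. -/
def op (a b : S) (p : Fin n ⊕ J → ℂ) : R := ∑ i, p i • (P.Y a i * P.Y b (P.star i))

/-- The weight of `yⱼ`, acting as an element of the commutative subalgebra. -/
def h (s : S) (j : Fin n ⊕ J) : R := ∑ k, P.w k j • P.Y s (Sum.inl k)

/-- Such terms arise in two ways: from brackets in which one member lies in `𝔥₀` (`tri_ind`), and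
from `𝔥₀` acting at `s` on the `u`-derivative of `op` (`hop_eq`). Flatness comes from matching the
two. -/
def hop (s a b : S) (p : Fin n ⊕ J → ℂ) : R :=
  ∑ j, p j • (P.h s j * (P.Y a j * P.Y b (P.star j)))

/-- The common form of all brackets that involve three distinct sites. The symmetries of `C` allow
the sites to be permuted, so different brackets can be compared coefficient by coefficient. -/
def tri (a b c : S) (t : Fin n ⊕ J → Fin n ⊕ J → Fin n ⊕ J → ℂ) : R :=
  ∑ i, ∑ j, ∑ k, (P.C i j k * t i j k) • (P.Y a (P.star i) * P.Y b (P.star j) * P.Y c (P.star k))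

/-- The indicator function of the commutative subalgebra. -/
def ind : Fin n ⊕ J → ℂ := Sum.elim (fun _ => 1) fun _ => 0

/-- The square of the length of the weight of `yⱼ`. -/
def sq (j : Fin n ⊕ J) : ℂ := ∑ k, P.w k j * P.w k j

theorem sum_star {M : Type*} [AddCommMonoid M] (f : Fin n ⊕ J → M) :
    ∑ i, f (P.star i) = ∑ i, f i :=
  Equiv.sum_comp (Function.Involutive.toPerm P.star P.star_star) f

theorem sum_ind {M : Type*} [AddCommGroup M] [Module ℂ M] (f : Fin n ⊕ J → M) :
    ∑ i, (ind i : ℂ) • f i = ∑ k, f (Sum.inl k) := by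
  simp [Fintype.sum_sum_type, ind]

theorem op_smul (a b : S) (c : ℂ) (p : Fin n ⊕ J → ℂ) : P.op a b (c • p) = c • P.op a b p := by
  simp [op, mul_smul, Finset.smul_sum]

theorem op_neg (a b : S) (p : Fin n ⊕ J → ℂ) : P.op a b (-p) = -P.op a b p := by
  simp [op]

theorem op_swap {a b : S} (hab : a ≠ b) {p q : Fin n ⊕ J → ℂ} (hpq : ∀ i, p (P.star i) = q i) :
    P.op b a p = P.op a b q := by
  rw [op, ← P.sum_star, op]
  refine Finset.sum_congr rfl fun i _ => ?_
  rw [P.star_star, hpq, P.comm hab]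

theorem op_swap_neg {a b : S} (hab : a ≠ b) {p q : Fin n ⊕ J → ℂ}
    (hpq : ∀ i, p (P.star i) = -q i) : P.op b a p = -P.op a b q := by
  rw [← op_neg]
  exact P.op_swap hab hpq

theorem h_star (s : S) (j : Fin n ⊕ J) : P.h s (P.star j) = -P.h s j := by
  simp [h, P.w_star]

theorem sq_star (j : Fin n ⊕ J) : P.sq (P.star j) = P.sq j := by
  simp [sq, P.w_star]

theorem h_comm {s a : S} (hs : s ≠ a) (j i : Fin n ⊕ J) : P.h s j * P.Y a i = P.Y a i * P.h s j := by
  simp only [h, Finset.sum_mul, Finset.mul_sum, smul_mul_assoc, mul_smul_comm, P.comm hs]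

theorem h_brk (a : S) (j i : Fin n ⊕ J) :
    P.h a j * P.Y a i - P.Y a i * P.h a j = (∑ k, P.w k j * P.w k i) • P.Y a i := by
  simp only [h, Finset.sum_mul, Finset.mul_sum, smul_mul_assoc, mul_smul_comm,
    ← Finset.sum_sub_distrib, ← smul_sub, P.wt, smul_smul, Finset.sum_smul]

theorem hop_swap {a b : S} (hab : a ≠ b) {p q : Fin n ⊕ J → ℂ} (hpq : ∀ i, p (P.star i) = q i)
    (s : S) : P.hop s b a p = -P.hop s a b q := by
  rw [hop, ← P.sum_star, hop, ← Finset.sum_neg_distrib]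
  refine Finset.sum_congr rfl fun i _ => ?_
  rw [P.star_star, hpq, P.comm hab, P.h_star, neg_mul, smul_neg]

theorem hop_swap_neg {a b : S} (hab : a ≠ b) {p q : Fin n ⊕ J → ℂ}
    (hpq : ∀ i, p (P.star i) = -q i) (s : S) : P.hop s b a p = P.hop s a b q := by
  rw [P.hop_swap hab hpq s, hop, hop, ← Finset.sum_neg_distrib]
  simp

theorem tri_cyc {a b c : S} (hab : a ≠ b) (hac : a ≠ c)
    (t : Fin n ⊕ J → Fin n ⊕ J → Fin n ⊕ J → ℂ) :
    P.tri a b c t = P.tri b c a fun j k i => t i j k := by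
  rw [tri, tri, Finset.sum_comm]
  refine Finset.sum_congr rfl fun j _ => ?_
  rw [Finset.sum_comm]
  refine Finset.sum_congr rfl fun k _ => Finset.sum_congr rfl fun i _ => ?_
  rw [P.C_cyc i j k, P.comm hab, mul_assoc, P.comm hac, mul_assoc]

theorem tri_swap {a b : S} (c : S) (hab : a ≠ b) (t : Fin n ⊕ J → Fin n ⊕ J → Fin n ⊕ J → ℂ) :
    P.tri a b c t = -P.tri b a c fun j i k => t i j k := by
  rw [tri, tri, Finset.sum_comm, ← Finset.sum_neg_distrib]
  refine Finset.sum_congr rfl fun j _ => ?_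
  rw [← Finset.sum_neg_distrib]
  refine Finset.sum_congr rfl fun i _ => ?_
  rw [← Finset.sum_neg_distrib]
  refine Finset.sum_congr rfl fun k _ => ?_
  rw [P.C_anti i j k, P.comm hab, neg_mul, neg_smul]

theorem tri_congr {a b c : S} {t t' : Fin n ⊕ J → Fin n ⊕ J → Fin n ⊕ J → ℂ}
    (h : ∀ i j k, P.C i j k ≠ 0 → t i j k = t' i j k) : P.tri a b c t = P.tri a b c t' := by
  refine Finset.sum_congr rfl fun i _ => Finset.sum_congr rfl fun j _ =>
    Finset.sum_congr rfl fun k _ => ?_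
  by_cases hC : P.C i j k = 0
  · simp [hC]
  · rw [h i j k hC]

theorem tri_add (a b c : S) (t t' : Fin n ⊕ J → Fin n ⊕ J → Fin n ⊕ J → ℂ) :
    P.tri a b c (fun i j k => t i j k + t' i j k) = P.tri a b c t + P.tri a b c t' := by
  simp only [tri, mul_add, add_smul, Finset.sum_add_distrib]

theorem tri_smul (a b c : S) (x : ℂ) (t : Fin n ⊕ J → Fin n ⊕ J → Fin n ⊕ J → ℂ) :
    P.tri a b c (fun i j k => x * t i j k) = x • P.tri a b c t := by
  simp only [tri, Finset.smul_sum, smul_smul]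
  refine Finset.sum_congr rfl fun i _ => Finset.sum_congr rfl fun j _ =>
    Finset.sum_congr rfl fun k _ => ?_
  congr 1
  ring

theorem sum_C_inl (a : S) (k : Fin n) (j : Fin n ⊕ J) :
    ∑ i, P.C (Sum.inl k) j i • P.Y a (P.star i) = P.w k j • P.Y a j := by
  rw [← P.brk, P.wt]

theorem sum_C_inl' (a : S) (k : Fin n) (j : Fin n ⊕ J) :
    ∑ i, P.C i j (Sum.inl k) • P.Y a (P.star i) = -(P.w k j • P.Y a j) := by
  rw [← sum_C_inl, ← Finset.sum_neg_distrib]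
  refine Finset.sum_congr rfl fun i _ => ?_
  rw [P.C_cyc, P.C_anti, neg_smul]

/-- With the third member in `𝔥₀`, contraction with the structure constants is the adjoint action of
`𝔥₀`, which multiplies by the weight. -/
theorem tri_ind {a b c : S} (hac : a ≠ c) (hbc : b ≠ c) (q : Fin n ⊕ J → ℂ) :
    P.tri a b c (fun _ j k => ind k * q j) = -P.hop c a b q := by
  rw [tri, Finset.sum_comm, hop, ← Finset.sum_neg_distrib]
  refine Finset.sum_congr rfl fun j _ => ?_
  have h1 : ∀ i k, (P.C i j k * (ind k * q j)) •
      (P.Y a (P.star i) * P.Y b (P.star j) * P.Y c (P.star k)) =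
      (ind k : ℂ) • ((q j * P.C i j k) • (P.Y a (P.star i) * P.Y b (P.star j) * P.Y c (P.star k))) :=
    fun i k => by
      rw [smul_smul]
      congr 1
      ring
  simp only [h1, sum_ind, P.star_inl]
  rw [Finset.sum_comm, ← smul_neg, h, Finset.sum_mul, ← Finset.sum_neg_distrib, Finset.smul_sum]
  refine Finset.sum_congr rfl fun k _ => ?_
  simp only [mul_smul, ← Finset.smul_sum]
  congr 1
  simp only [← smul_mul_assoc, ← Finset.sum_mul]
  rw [sum_C_inl', neg_mul, neg_mul, smul_mul_assoc, smul_mul_assoc, smul_mul_assoc, mul_assoc,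
    P.comm hbc, ← mul_assoc, P.comm hac, mul_assoc]

/-- The operators meet only at the site `a`, so the commutator is the bracket there, expanded with
structure constants. -/
theorem op_commutator {a b c : S} (hab : a ≠ b) (hac : a ≠ c) (hbc : b ≠ c)
    (p q : Fin n ⊕ J → ℂ) : P.op a b p * P.op a c q - P.op a c q * P.op a b p =
      P.tri a b c fun _ j k => p j * q k := by
  have hba := hab.symm
  rw [op, op, sum_smul_commutator, P.tri_cyc hab hac, tri]
  refine Finset.sum_congr rfl fun j _ => Finset.sum_congr rfl fun k _ => ?_
  have h1 : P.Y a j * P.Y b (P.star j) * (P.Y a k * P.Y c (P.star k)) -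
      P.Y a k * P.Y c (P.star k) * (P.Y a j * P.Y b (P.star j)) =
      (P.Y a j * P.Y a k - P.Y a k * P.Y a j) * (P.Y b (P.star j) * P.Y c (P.star k)) := by
    rw [sub_mul]
    congr 1
    · rw [mul_assoc, ← mul_assoc (P.Y b _), P.comm hba, mul_assoc, mul_assoc]
    · rw [mul_assoc, ← mul_assoc (P.Y c _), P.comm hac.symm, P.comm hbc]
      simp only [mul_assoc]
  rw [h1, P.brk, Finset.sum_mul, Finset.smul_sum]
  refine Finset.sum_congr rfl fun i _ => ?_
  rw [smul_mul_assoc, smul_smul, ← mul_assoc, P.comm hab, mul_assoc (P.Y b _), P.comm hac,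
    ← mul_assoc, mul_comm (p j * q k)]

theorem op_commute {a b c d : S} (hac : a ≠ c) (had : a ≠ d) (hbc : b ≠ c) (hbd : b ≠ d)
    (p q : Fin n ⊕ J → ℂ) : P.op a b p * P.op c d q - P.op c d q * P.op a b p = 0 := by
  rw [op, op, sum_smul_commutator]
  refine Finset.sum_eq_zero fun i _ => Finset.sum_eq_zero fun j _ => ?_
  have c1 : ∀ i j, Commute (P.Y a i) (P.Y c j) := P.comm hac
  have c2 : ∀ i j, Commute (P.Y a i) (P.Y d j) := P.comm had
  have c3 : ∀ i j, Commute (P.Y b i) (P.Y c j) := P.comm hbc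
  have c4 : ∀ i j, Commute (P.Y b i) (P.Y d j) := P.comm hbd
  have := ((c1 i j).mul_right (c2 i (P.star j))).mul_left
    ((c3 (P.star i) j).mul_right (c4 (P.star i) (P.star j)))
  rw [this.eq, sub_self, smul_zero]

/-! ### Weights of the operators -/

theorem inl_op_left {a b : S} (hab : a ≠ b) (k : Fin n) (p : Fin n ⊕ J → ℂ) :
    P.Y a (Sum.inl k) * P.op a b p - P.op a b p * P.Y a (Sum.inl k) =
      P.op a b fun i => P.w k i * p i := by
  simp only [op, Finset.mul_sum, Finset.sum_mul, ← Finset.sum_sub_distrib]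
  refine Finset.sum_congr rfl fun i _ => ?_
  rw [mul_smul_comm, smul_mul_assoc, ← smul_sub, mul_assoc (P.Y a i), P.comm hab.symm, ← mul_assoc,
    ← mul_assoc, ← sub_mul, P.wt, smul_mul_assoc, smul_smul, mul_comm]

theorem inl_op_right {a b : S} (hab : a ≠ b) (k : Fin n) (p : Fin n ⊕ J → ℂ) :
    P.Y b (Sum.inl k) * P.op a b p - P.op a b p * P.Y b (Sum.inl k) =
      -P.op a b fun i => P.w k i * p i := by
  simp only [op, Finset.mul_sum, Finset.sum_mul, ← Finset.sum_sub_distrib, ← Finset.sum_neg_distrib]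
  refine Finset.sum_congr rfl fun i _ => ?_
  rw [mul_smul_comm, smul_mul_assoc, ← smul_sub, ← mul_assoc, P.comm hab.symm, mul_assoc, mul_assoc,
    ← mul_sub, P.wt, P.w_star, neg_smul, mul_neg, mul_smul_comm, smul_neg, smul_smul, mul_comm]

theorem inl_op_of_ne {s a b : S} (hsa : s ≠ a) (hsb : s ≠ b) (k : Fin n) (p : Fin n ⊕ J → ℂ) :
    P.Y s (Sum.inl k) * P.op a b p - P.op a b p * P.Y s (Sum.inl k) = 0 := by
  simp only [op, Finset.mul_sum, Finset.sum_mul, ← Finset.sum_sub_distrib]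
  refine Finset.sum_eq_zero fun i _ => ?_
  rw [mul_smul_comm, smul_mul_assoc, ← mul_assoc, P.comm hsa, mul_assoc, P.comm hsb, mul_assoc,
    sub_self]

theorem inl_op_self (a : S) (k : Fin n) (p : Fin n ⊕ J → ℂ) :
    P.Y a (Sum.inl k) * P.op a a p - P.op a a p * P.Y a (Sum.inl k) = 0 := by
  simp only [op, Finset.mul_sum, Finset.sum_mul, ← Finset.sum_sub_distrib]
  refine Finset.sum_eq_zero fun i _ => ?_
  have h1 := P.wt a k i
  have h2 := P.wt a k (P.star i)
  rw [P.w_star, neg_smul] at h2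
  rw [mul_smul_comm, smul_mul_assoc, ← smul_sub]
  have : P.Y a (Sum.inl k) * (P.Y a i * P.Y a (P.star i)) -
      P.Y a i * P.Y a (P.star i) * P.Y a (Sum.inl k) =
      (P.Y a (Sum.inl k) * P.Y a i - P.Y a i * P.Y a (Sum.inl k)) * P.Y a (P.star i) +
      P.Y a i * (P.Y a (Sum.inl k) * P.Y a (P.star i) - P.Y a (P.star i) * P.Y a (Sum.inl k)) := by
    noncomm_ring
  rw [this, h1, h2]
  simp

variable [Fintype S]

/-- The total action of the commutative subalgebra. -/
def tot (k : Fin n) : R := ∑ s, P.Y s (Sum.inl k)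

theorem tot_pair [DecidableEq S] (a b : S) (k : Fin n) (i : Fin n ⊕ J) :
    P.tot k * (P.Y a i * P.Y b (P.star i)) = P.Y a i * P.Y b (P.star i) * P.tot k := by
  have h1 : ∀ c j, P.tot k * P.Y c j - P.Y c j * P.tot k = P.w k j • P.Y c j := by
    intro c j
    rw [tot, Finset.sum_mul, Finset.mul_sum, ← Finset.sum_sub_distrib, Finset.sum_eq_single c]
    · exact P.wt c k j
    · intro s _ hs
      rw [P.comm hs, sub_self]
    · simp
  have : P.tot k * (P.Y a i * P.Y b (P.star i)) - P.Y a i * P.Y b (P.star i) * P.tot k =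
      (P.tot k * P.Y a i - P.Y a i * P.tot k) * P.Y b (P.star i) +
      P.Y a i * (P.tot k * P.Y b (P.star i) - P.Y b (P.star i) * P.tot k) := by
    noncomm_ring
  rw [h1, h1, P.w_star] at this
  rw [← sub_eq_zero, this]
  simp

theorem tot_op [DecidableEq S] (a b : S) (k : Fin n) (p : Fin n ⊕ J → ℂ) :
    P.tot k * P.op a b p = P.op a b p * P.tot k := by
  rw [op, Finset.mul_sum, Finset.sum_mul]
  refine Finset.sum_congr rfl fun i _ => ?_
  rw [mul_smul_comm, smul_mul_assoc, P.tot_pair]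

/-- Summed over all sites, the Cartan element becomes the total action, which commutes with `y_j ⊗
y_{j*}` because the weights are opposite. Standing on the right, it kills the zero weight space. -/
theorem sum_hop [DecidableEq S] (a b : S) (p : Fin n ⊕ J → ℂ) :
    ∑ s, P.hop s a b p =
      ∑ k, (P.op a b fun i => P.w k i * p i) * P.tot k := by
  have h1 : ∀ j, ∑ s, P.h s j = ∑ k, P.w k j • P.tot k := by
    intro j
    simp only [h, tot, Finset.smul_sum]
    exact Finset.sum_comm
  simp only [hop]
  rw [Finset.sum_comm]
  simp only [← Finset.smul_sum, ← Finset.sum_mul, h1, op]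
  simp only [Finset.sum_mul, Finset.smul_sum]
  rw [Finset.sum_comm]
  refine Finset.sum_congr rfl fun k _ => Finset.sum_congr rfl fun j _ => ?_
  rw [smul_mul_assoc, P.tot_pair, smul_mul_assoc, smul_smul, mul_comm]

end Frame

end TwistedKZB
end

/-! ### Abstract coefficient functions at a point. -/

noncomputable section
namespace TwistedKZB
open Complex Metric Set Filter Topology

/-- The values at a point of the coefficient functions of the connection, with the identities
satisfied by them. -/
structure Frame.Coeffs {R S J : Type*} {n : ℕ} [Ring R] [Algebra ℂ R] [Fintype J]
    (P : Frame R S J n) where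
  κ : S → S → Fin n ⊕ J → ℂ
  g : S → S → Fin n ⊕ J → ℂ
  g2 : S → S → Fin n ⊕ J → ℂ
  e : Fin n ⊕ J → ℂ
  e' : Fin n ⊕ J → ℂ
  κ_star : ∀ {a b}, a ≠ b → ∀ i, κ b a (P.star i) = -κ a b i
  g_star : ∀ {a b}, a ≠ b → ∀ i, g b a (P.star i) = g a b i
  g2_star : ∀ {a b}, a ≠ b → ∀ i, g2 b a (P.star i) = -g2 a b i
  e_star : ∀ i, e (P.star i) = e i
  e'_star : ∀ i, e' (P.star i) = -e' i
  κ_fay : ∀ {a b c}, a ≠ b → a ≠ c → b ≠ c → ∀ i j k, P.C i j k ≠ 0 →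
    κ a b j * κ a c k + κ b a i * κ b c k + κ c a i * κ c b j =
      Frame.ind i * g b c k + Frame.ind j * g c a i + Frame.ind k * g a b j
  g_fay : ∀ {a b c}, a ≠ b → a ≠ c → b ≠ c → ∀ i j k, P.C i j k ≠ 0 →
    κ a b j * g a c k - g a b j * κ a c k + κ b a i * g b c k - κ c a i * g c b j =
      Frame.ind i * g2 b c k + Frame.ind j * (g2 a c k / 2) - Frame.ind k * (g2 a b j / 2)
  e_fay : ∀ {a c}, a ≠ c → ∀ i j k, P.C i j k ≠ 0 →
    κ a c j * g a c k - κ a c k * g a c j + κ a c (P.star i) * (e j - e k) =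
      -(Frame.ind i * e' j) + Frame.ind j * (g2 a c k / 2) - Frame.ind k * (g2 a c j / 2)

namespace Frame

variable {R S J : Type*} {n : ℕ} [Ring R] [Algebra ℂ R] [Fintype J] (P : Frame R S J n)

/-! ### Two sites -/

/-- The operator `∑ C_{ijk} t_{ijk} yᵢ* ⊗ (yⱼ* yₖ* + yₖ* yⱼ*)` at the sites `a`, `c`. -/
def duo (a c : S) (t : Fin n ⊕ J → Fin n ⊕ J → Fin n ⊕ J → ℂ) : R :=
  ∑ i, ∑ j, ∑ k, (P.C i j k * t i j k) • (P.Y a (P.star i) *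
    (P.Y c (P.star j) * P.Y c (P.star k) + P.Y c (P.star k) * P.Y c (P.star j)))

theorem duo_congr {a c : S} {t t' : Fin n ⊕ J → Fin n ⊕ J → Fin n ⊕ J → ℂ}
    (h : ∀ i j k, P.C i j k ≠ 0 → t i j k = t' i j k) : P.duo a c t = P.duo a c t' := by
  refine Finset.sum_congr rfl fun i _ => Finset.sum_congr rfl fun j _ =>
    Finset.sum_congr rfl fun k _ => ?_
  by_cases hC : P.C i j k = 0
  · simp [hC]
  · rw [h i j k hC]

theorem duo_add (a c : S) (t t' : Fin n ⊕ J → Fin n ⊕ J → Fin n ⊕ J → ℂ) :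
    P.duo a c (fun i j k => t i j k + t' i j k) = P.duo a c t + P.duo a c t' := by
  simp only [duo, mul_add, add_smul, Finset.sum_add_distrib]

theorem duo_smul (a c : S) (x : ℂ) (t : Fin n ⊕ J → Fin n ⊕ J → Fin n ⊕ J → ℂ) :
    P.duo a c (fun i j k => x * t i j k) = x • P.duo a c t := by
  simp only [duo, Finset.smul_sum, smul_smul]
  refine Finset.sum_congr rfl fun i _ => Finset.sum_congr rfl fun j _ =>
    Finset.sum_congr rfl fun k _ => ?_
  congr 1
  ring

theorem C_anti' (i j k : Fin n ⊕ J) : P.C i j k = -P.C i k j := by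
  rw [P.C_cyc i j k, P.C_anti j k i, ← P.C_cyc i k j]

theorem duo_swap (a c : S) (t : Fin n ⊕ J → Fin n ⊕ J → Fin n ⊕ J → ℂ) :
    P.duo a c (fun i k j => t i j k) = -P.duo a c t := by
  rw [duo, duo, ← Finset.sum_neg_distrib]
  refine Finset.sum_congr rfl fun i _ => ?_
  rw [Finset.sum_comm, ← Finset.sum_neg_distrib]
  refine Finset.sum_congr rfl fun j _ => ?_
  rw [← Finset.sum_neg_distrib]
  refine Finset.sum_congr rfl fun k _ => ?_
  rw [P.C_anti' i k j, neg_mul, neg_smul, add_comm (P.Y c (P.star k) * _)]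

/-- When both sites are shared, `AD - BE = ½ ((A - B)(D + E) + (D - E)(A + B))` splits the
commutator into a bracket at one site times a symmetrised product at the other. -/
theorem op_op_self {a c : S} (hac : a ≠ c) (p q : Fin n ⊕ J → ℂ) :
    P.op a c p * P.op a c q - P.op a c q * P.op a c p =
      (1 / 2 : ℂ) • P.duo a c (fun _ j k => p j * q k) +
        (1 / 2 : ℂ) • P.duo c a (fun _ j k => p (P.star j) * q (P.star k)) := by
  have h1 : ∀ j k, P.Y a j * P.Y c (P.star j) * (P.Y a k * P.Y c (P.star k)) -
      P.Y a k * P.Y c (P.star k) * (P.Y a j * P.Y c (P.star j)) =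
      (1 / 2 : ℂ) • ((P.Y a j * P.Y a k - P.Y a k * P.Y a j) *
        (P.Y c (P.star j) * P.Y c (P.star k) + P.Y c (P.star k) * P.Y c (P.star j))) +
      (1 / 2 : ℂ) • ((P.Y c (P.star j) * P.Y c (P.star k) - P.Y c (P.star k) * P.Y c (P.star j)) *
        (P.Y a j * P.Y a k + P.Y a k * P.Y a j)) := by
    intro j k
    have c1 : ∀ i j, Commute (P.Y c i) (P.Y a j) := P.comm hac.symm
    have e1 : P.Y a j * P.Y c (P.star j) * (P.Y a k * P.Y c (P.star k)) =
        P.Y a j * P.Y a k * (P.Y c (P.star j) * P.Y c (P.star k)) := by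
      rw [mul_assoc, ← mul_assoc (P.Y c _), (c1 _ k).eq]
      simp only [mul_assoc]
    have e2 : P.Y a k * P.Y c (P.star k) * (P.Y a j * P.Y c (P.star j)) =
        P.Y a k * P.Y a j * (P.Y c (P.star k) * P.Y c (P.star j)) := by
      rw [mul_assoc, ← mul_assoc (P.Y c _), (c1 _ j).eq]
      simp only [mul_assoc]
    have c2 : Commute (P.Y c (P.star j) * P.Y c (P.star k) - P.Y c (P.star k) * P.Y c (P.star j))
        (P.Y a j * P.Y a k + P.Y a k * P.Y a j) := by
      refine Commute.sub_left ?_ ?_ <;> refine Commute.add_right ?_ ?_ <;>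
        exact Commute.mul_left (Commute.mul_right (c1 _ _) (c1 _ _))
          (Commute.mul_right (c1 _ _) (c1 _ _))
    rw [e1, e2, c2.eq, ← smul_add]
    generalize P.Y a j * P.Y a k = A
    generalize P.Y a k * P.Y a j = B
    generalize P.Y c (P.star j) * P.Y c (P.star k) = D
    generalize P.Y c (P.star k) * P.Y c (P.star j) = E
    have : (A - B) * (D + E) + (A + B) * (D - E) = (2 : ℂ) • (A * D - B * E) := by
      rw [two_smul]
      noncomm_ring
    rw [this, smul_smul]
    norm_num
  rw [op, op, sum_smul_commutator]
  simp only [h1, smul_add, Finset.sum_add_distrib]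
  congr 1
  · simp only [smul_comm _ (1 / 2 : ℂ), ← Finset.smul_sum]
    congr 1
    rw [duo]
    have e : ∀ f : Fin n ⊕ J → Fin n ⊕ J → Fin n ⊕ J → R,
        ∑ i, ∑ j, ∑ k, f i j k = ∑ j, ∑ k, ∑ i, f i j k := fun f => by
      rw [Finset.sum_comm]
      exact Finset.sum_congr rfl fun _ _ => Finset.sum_comm
    rw [e]
    refine Finset.sum_congr rfl fun j _ => Finset.sum_congr rfl fun k _ => ?_
    rw [P.brk, Finset.sum_mul, Finset.smul_sum]
    refine Finset.sum_congr rfl fun i _ => ?_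
    rw [smul_mul_assoc, smul_smul, P.C_cyc i j k, mul_comm (p j * q k)]
  · simp only [smul_comm _ (1 / 2 : ℂ), ← Finset.smul_sum]
    congr 1
    rw [duo]
    have e : ∀ f : Fin n ⊕ J → Fin n ⊕ J → Fin n ⊕ J → R,
        ∑ i, ∑ j, ∑ k, f i j k = ∑ j, ∑ k, ∑ i, f i j k := fun f => by
      rw [Finset.sum_comm]
      exact Finset.sum_congr rfl fun _ _ => Finset.sum_comm
    rw [e, ← P.sum_star]
    refine Finset.sum_congr rfl fun j _ => ?_
    rw [← P.sum_star]
    refine Finset.sum_congr rfl fun k _ => ?_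
    rw [P.star_star, P.star_star, P.brk, Finset.sum_mul, Finset.smul_sum]
    refine Finset.sum_congr rfl fun i _ => ?_
    rw [smul_mul_assoc, smul_smul, P.C_cyc i j k, mul_comm (p _ * q _)]

/-- The Leibniz rule gives two terms at `c`. Replacing `j` by `j*` in the second, which the symmetry
of `q` permits, turns them into one symmetrised product. -/
theorem op_op_diag_right {a c : S} (hac : a ≠ c) (p q : Fin n ⊕ J → ℂ)
    (hq : ∀ i, q (P.star i) = q i) :
    P.op a c p * P.op c c q - P.op c c q * P.op a c p =
      P.duo a c (fun i j _ => p (P.star i) * q j) := by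
  rw [op, op, sum_smul_commutator, ← P.sum_star, duo]
  refine Finset.sum_congr rfl fun i _ => ?_
  have h1 : ∀ j, P.Y a (P.star i) * P.Y c (P.star (P.star i)) * (P.Y c j * P.Y c (P.star j)) -
      P.Y c j * P.Y c (P.star j) * (P.Y a (P.star i) * P.Y c (P.star (P.star i))) =
      P.Y a (P.star i) * ((P.Y c i * P.Y c j - P.Y c j * P.Y c i) * P.Y c (P.star j)) +
      P.Y a (P.star i) * (P.Y c j *
        (P.Y c i * P.Y c (P.star j) - P.Y c (P.star j) * P.Y c i)) := by
    intro j
    have c1 : ∀ i j, Commute (P.Y c i) (P.Y a j) := P.comm hac.symm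
    rw [P.star_star, ← mul_assoc (P.Y c j * _), ((c1 _ _).mul_left (c1 _ _)).eq]
    noncomm_ring
  simp only [h1, smul_add, Finset.sum_add_distrib]
  rw [← P.sum_star (fun j => (p (P.star i) * q j) • (P.Y a (P.star i) * (P.Y c j *
        (P.Y c i * P.Y c (P.star j) - P.Y c (P.star j) * P.Y c i)))), ← Finset.sum_add_distrib]
  refine Finset.sum_congr rfl fun j _ => ?_
  rw [P.star_star, hq, P.brk, Finset.sum_mul, Finset.mul_sum, Finset.mul_sum, Finset.mul_sum,
    Finset.smul_sum, Finset.smul_sum, ← Finset.sum_add_distrib]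
  refine Finset.sum_congr rfl fun k _ => ?_
  rw [smul_mul_assoc, mul_smul_comm, mul_smul_comm, mul_smul_comm, smul_smul, smul_smul, mul_add,
    smul_add, add_comm, mul_comm (P.C i j k)]

theorem op_op_diag_left {a c : S} (hac : a ≠ c) (p q : Fin n ⊕ J → ℂ)
    (hq : ∀ i, q (P.star i) = q i) :
    P.op a c p * P.op a a q - P.op a a q * P.op a c p =
      P.duo c a (fun i j _ => p i * q j) := by
  have h1 : P.op a c p = P.op c a fun i => p (P.star i) :=
    P.op_swap hac.symm fun i => rfl
  rw [h1, P.op_op_diag_right hac.symm _ _ hq]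
  simp only [P.star_star]

theorem duo_ind_first (a c : S) (q : Fin n ⊕ J → ℂ)
    (hq : ∀ i, q (P.star i) = -q i) :
    P.duo a c (fun i j _ => ind i * q j) = (2 : ℂ) • P.hop a c c q := by
  have h1 : ∀ i j k, (P.C i j k * (ind i * q j)) • (P.Y a (P.star i) *
      (P.Y c (P.star j) * P.Y c (P.star k) + P.Y c (P.star k) * P.Y c (P.star j))) =
      (ind i : ℂ) • ((q j * P.C i j k) • (P.Y a (P.star i) *
      (P.Y c (P.star j) * P.Y c (P.star k) + P.Y c (P.star k) * P.Y c (P.star j)))) :=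
    fun i j k => by
      rw [smul_smul]
      congr 1
      ring
  simp only [duo, h1, ← Finset.smul_sum]
  rw [sum_ind, Finset.sum_comm, two_smul]
  have h2 : P.hop a c c q = ∑ j, q j • (P.h a j * (P.Y c (P.star j) * P.Y c j)) := by
    rw [hop, ← P.sum_star]
    refine Finset.sum_congr rfl fun j _ => ?_
    rw [hq, P.h_star, P.star_star, neg_mul, smul_neg, neg_smul, neg_neg]
  nth_rw 1 [h2]
  rw [hop, ← Finset.sum_add_distrib]
  refine Finset.sum_congr rfl fun j _ => ?_
  rw [← smul_add, ← mul_add, h, Finset.sum_mul, Finset.smul_sum]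
  refine Finset.sum_congr rfl fun k _ => ?_
  rw [P.star_inl]
  simp only [mul_smul, ← Finset.smul_sum]
  congr 1
  have h3 : ∀ x, P.C (Sum.inl k) j x • (P.Y a (Sum.inl k) *
      (P.Y c (P.star j) * P.Y c (P.star x) + P.Y c (P.star x) * P.Y c (P.star j))) =
      P.Y a (Sum.inl k) * (P.Y c (P.star j) * (P.C (Sum.inl k) j x • P.Y c (P.star x)) +
        (P.C (Sum.inl k) j x • P.Y c (P.star x)) * P.Y c (P.star j)) := fun x => by
    rw [mul_smul_comm, smul_mul_assoc, ← smul_add, mul_smul_comm]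
  simp only [h3, ← Finset.mul_sum, Finset.sum_add_distrib, ← Finset.sum_mul]
  rw [sum_C_inl, mul_smul_comm, smul_mul_assoc, ← smul_add, mul_smul_comm, smul_mul_assoc]

/-- Here the symmetrised product contains the Cartan element at the same site as the weight vector.
Reordering it costs the squared length of the weight; this correction becomes the Laplacian of the
r-matrix. -/
theorem duo_ind_last {a c : S} (hac : a ≠ c) (q : Fin n ⊕ J → ℂ) :
    P.duo a c (fun _ j k => ind k * q j) =
      -((2 : ℂ) • P.hop c a c q + P.op a c fun i => P.sq i * q i) := by
  have h1 : ∀ i j k, (P.C i j k * (ind k * q j)) • (P.Y a (P.star i) *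
      (P.Y c (P.star j) * P.Y c (P.star k) + P.Y c (P.star k) * P.Y c (P.star j))) =
      (ind k : ℂ) • ((q j * P.C i j k) • (P.Y a (P.star i) *
      (P.Y c (P.star j) * P.Y c (P.star k) + P.Y c (P.star k) * P.Y c (P.star j)))) :=
    fun i j k => by
      rw [smul_smul]
      congr 1
      ring
  simp only [duo, h1, sum_ind]
  rw [Finset.sum_comm, op, hop, Finset.smul_sum, ← Finset.sum_add_distrib,
    ← Finset.sum_neg_distrib]
  refine Finset.sum_congr rfl fun j _ => ?_
  have h2 := P.h_brk c j (P.star j)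
  have h3 : ∑ k, P.w k j * P.w k (P.star j) = -P.sq j := by simp [sq, P.w_star]
  rw [h3, neg_smul] at h2
  have h4 : P.Y a j * (P.Y c (P.star j) * P.h c j + P.h c j * P.Y c (P.star j)) =
      (2 : ℂ) • (P.h c j * (P.Y a j * P.Y c (P.star j))) +
        P.sq j • (P.Y a j * P.Y c (P.star j)) := by
    have h5 : P.Y c (P.star j) * P.h c j = P.h c j * P.Y c (P.star j) +
        P.sq j • P.Y c (P.star j) := by
      rw [← sub_eq_iff_eq_add', ← neg_sub, h2, neg_neg]
    rw [h5, ← mul_assoc, P.h_comm hac.symm, two_smul, mul_add, mul_add, mul_smul_comm]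
    simp only [mul_assoc]
    abel
  rw [mul_comm (P.sq j), mul_smul, smul_comm (2 : ℂ), ← smul_add, ← h4, Finset.sum_comm,
    ← smul_neg, h, Finset.mul_sum, Finset.sum_mul, ← Finset.sum_add_distrib, Finset.mul_sum,
    ← Finset.sum_neg_distrib, Finset.smul_sum]
  refine Finset.sum_congr rfl fun k _ => ?_
  simp only [mul_smul, ← Finset.smul_sum, P.star_inl]
  congr 1
  simp only [← smul_mul_assoc, ← Finset.sum_mul]
  rw [sum_C_inl', mul_smul_comm, smul_mul_assoc, ← smul_add, mul_smul_comm, neg_mul,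
    smul_mul_assoc]

end Frame

end TwistedKZB
end

/-! ### The dynamical Yang–Baxter equation and its analogues for `f`. -/

noncomputable section
namespace TwistedKZB
open Complex Metric Set Filter Topology

namespace Frame

variable {R S J : Type*} {n : ℕ} [Ring R] [Algebra ℂ R] [Fintype J] {P : Frame R S J n}
  (Q : P.Coeffs)

namespace Coeffs

theorem op_κ_swap {a b : S} (hab : a ≠ b) : P.op b a (Q.κ b a) = -P.op a b (Q.κ a b) :=
  P.op_swap_neg hab (Q.κ_star hab)

theorem op_g_swap {a b : S} (hab : a ≠ b) : P.op b a (Q.g b a) = P.op a b (Q.g a b) :=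
  P.op_swap hab (Q.g_star hab)

theorem hop_g_swap {a b : S} (hab : a ≠ b) (s : S) :
    P.hop s b a (Q.g b a) = -P.hop s a b (Q.g a b) :=
  P.hop_swap hab (Q.g_star hab) s

theorem hop_g2_swap {a b : S} (hab : a ≠ b) (s : S) :
    P.hop s b a (Q.g2 b a) = P.hop s a b (Q.g2 a b) :=
  P.hop_swap_neg hab (Q.g2_star hab) s

/-- The dynamical classical Yang–Baxter equation. -/
theorem cybe {a b c : S} (hab : a ≠ b) (hac : a ≠ c) (hbc : b ≠ c) :
    (P.op a b (Q.κ a b) * P.op a c (Q.κ a c) - P.op a c (Q.κ a c) * P.op a b (Q.κ a b)) +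
      (P.op a b (Q.κ a b) * P.op b c (Q.κ b c) - P.op b c (Q.κ b c) * P.op a b (Q.κ a b)) +
      (P.op a c (Q.κ a c) * P.op b c (Q.κ b c) - P.op b c (Q.κ b c) * P.op a c (Q.κ a c)) =
      -P.hop c a b (Q.g a b) - P.hop a b c (Q.g b c) + P.hop b a c (Q.g a c) := by
  have e1 := P.op_commutator hab hac hbc (Q.κ a b) (Q.κ a c)
  have e2 := P.op_commutator hab.symm hbc hac (Q.κ b a) (Q.κ b c)
  have e3 := P.op_commutator hac.symm hbc.symm hab (Q.κ c a) (Q.κ c b)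
  rw [Q.op_κ_swap hab, P.tri_swap c hab.symm] at e2
  rw [Q.op_κ_swap hac, Q.op_κ_swap hbc, P.tri_cyc hac.symm hbc.symm] at e3
  -- Where `C` is nonzero, the Fay identity replaces the products of coefficients by terms supported
  -- on `𝔥₀`. Cyclic moves bring the Cartan slot to the last place, where `tri_ind` applies.
  have h1 := P.tri_congr (a := a) (b := b) (c := c)
    (t := fun i j k => Q.κ a b j * Q.κ a c k + Q.κ b a i * Q.κ b c k + Q.κ c a i * Q.κ c b j)
    (t' := fun i j k => ind i * Q.g b c k + ind j * Q.g c a i + ind k * Q.g a b j)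
    fun i j k h => Q.κ_fay hab hac hbc i j k h
  rw [P.tri_add, P.tri_add, P.tri_add, P.tri_add, P.tri_ind hac hbc,
    P.tri_cyc hab hac (fun i _ k => ind i * Q.g b c k), P.tri_ind hab.symm hac.symm,
    ← P.tri_cyc hac.symm hbc.symm (fun k i j => ind j * Q.g c a i), P.tri_ind hbc.symm hab,
    Q.hop_g_swap hac] at h1
  simp only [neg_mul, mul_neg, neg_neg] at *
  linear_combination (norm := module) e1 - e2 + e3 + h1

/-- The contributions of three sites to the commutator of `∇_a` and `∇_τ`. -/
theorem three_site {a b c : S} (hab : a ≠ b) (hac : a ≠ c) (hbc : b ≠ c) :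
    (P.op a b (Q.κ a b) * P.op a c (Q.g a c) - P.op a c (Q.g a c) * P.op a b (Q.κ a b)) +
      (P.op a c (Q.κ a c) * P.op a b (Q.g a b) - P.op a b (Q.g a b) * P.op a c (Q.κ a c)) +
      (P.op a b (Q.κ a b) * P.op b c (Q.g b c) - P.op b c (Q.g b c) * P.op a b (Q.κ a b)) +
      (P.op a c (Q.κ a c) * P.op c b (Q.g c b) - P.op c b (Q.g c b) * P.op a c (Q.κ a c)) =
      -P.hop a b c (Q.g2 b c) + (1 / 2 : ℂ) • P.hop b a c (Q.g2 a c) +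
        (1 / 2 : ℂ) • P.hop c a b (Q.g2 a b) := by
  have e1 := P.op_commutator hab hac hbc (Q.κ a b) (Q.g a c)
  have e2 := P.op_commutator hab hac hbc (Q.g a b) (Q.κ a c)
  have e3 := P.op_commutator hab.symm hbc hac (Q.κ b a) (Q.g b c)
  have e4 := P.op_commutator hac.symm hbc.symm hab (Q.κ c a) (Q.g c b)
  rw [Q.op_κ_swap hab, P.tri_swap c hab.symm] at e3
  rw [Q.op_κ_swap hac, P.tri_cyc hac.symm hbc.symm] at e4
  have h1 := P.tri_congr (a := a) (b := b) (c := c)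
    (t := fun i j k => Q.κ a b j * Q.g a c k + (-1) * (Q.g a b j * Q.κ a c k) +
      Q.κ b a i * Q.g b c k + (-1) * (Q.κ c a i * Q.g c b j))
    (t' := fun i j k => ind i * Q.g2 b c k + (1 / 2) * (ind j * Q.g2 a c k) +
      (-1 / 2) * (ind k * Q.g2 a b j))
    fun i j k h => by linear_combination Q.g_fay hab hac hbc i j k h
  rw [P.tri_add, P.tri_add, P.tri_add, P.tri_add, P.tri_add, P.tri_smul, P.tri_smul, P.tri_smul,
    P.tri_smul, P.tri_ind hac hbc,
    P.tri_cyc hab hac (fun i _ k => ind i * Q.g2 b c k), P.tri_ind hab.symm hac.symm,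
    P.tri_cyc hab hac (fun i j k => ind j * Q.g2 a c k),
    P.tri_swap a hbc (fun j k i => ind j * Q.g2 a c k),
    P.tri_cyc hbc.symm hac.symm (fun k j i => ind j * Q.g2 a c k),
    P.tri_cyc hab.symm hbc (fun j i k => ind j * Q.g2 a c k), P.tri_ind hab hbc.symm] at h1
  simp only [neg_mul, mul_neg, neg_neg] at *
  linear_combination (norm := module) e1 - e2 - e3 - e4 + h1

/-- The contributions of two sites, for one of the two orderings. -/
theorem duo_eq {a c : S} (hac : a ≠ c) :
    (1 / 2 : ℂ) • P.duo a c (fun _ j k => Q.κ a c j * Q.g a c k) +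
      (1 / 2 : ℂ) • P.duo a c (fun i j _ => Q.κ a c (P.star i) * Q.e j) =
      -((1 / 2 : ℂ) • P.hop a c c Q.e') + (1 / 2 : ℂ) • P.hop c a c (Q.g2 a c) +
        (1 / 4 : ℂ) • P.op a c (fun i => P.sq i * Q.g2 a c i) := by
  -- Exchanging `j` and `k` changes the sign of `duo`, so antisymmetrising the coefficients doubles
  -- the operator; hence the factor `1/4` at the end.
  have h1 := P.duo_congr (a := a) (c := c)
    (t := fun i j k => Q.κ a c j * Q.g a c k + (-1) * (Q.κ a c k * Q.g a c j) +
      Q.κ a c (P.star i) * Q.e j + (-1) * (Q.κ a c (P.star i) * Q.e k))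
    (t' := fun i j k => (-1) * (ind i * Q.e' j) + (1 / 2) * (ind j * Q.g2 a c k) +
      (-1 / 2) * (ind k * Q.g2 a c j))
    fun i j k h => by linear_combination Q.e_fay hac i j k h
  rw [P.duo_add, P.duo_add, P.duo_add, P.duo_add, P.duo_add, P.duo_smul, P.duo_smul, P.duo_smul,
    P.duo_smul, P.duo_smul, P.duo_ind_first a c Q.e' Q.e'_star,
    P.duo_swap a c (fun _ j k => Q.κ a c j * Q.g a c k),
    P.duo_swap a c (fun i j _ => Q.κ a c (P.star i) * Q.e j),
    P.duo_swap a c (fun _ j k => ind k * Q.g2 a c j), P.duo_ind_last hac] at h1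
  linear_combination (norm := module) (1 / 4 : ℂ) • h1

/-- The contributions of two sites to the commutator of `∇_a` and `∇_τ`. -/
theorem two_site {a c : S} (hac : a ≠ c) :
    (P.op a c (Q.κ a c) * P.op a c (Q.g a c) - P.op a c (Q.g a c) * P.op a c (Q.κ a c)) +
      (1 / 2 : ℂ) • (P.op a c (Q.κ a c) * P.op a a Q.e - P.op a a Q.e * P.op a c (Q.κ a c)) +
      (1 / 2 : ℂ) • (P.op a c (Q.κ a c) * P.op c c Q.e - P.op c c Q.e * P.op a c (Q.κ a c)) =
      (1 / 2 : ℂ) • P.op a c (fun i => P.sq i * Q.g2 a c i) - (1 / 2 : ℂ) • P.hop a c c Q.e' +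
        (1 / 2 : ℂ) • P.hop c a a Q.e' + (1 / 2 : ℂ) • P.hop c a c (Q.g2 a c) -
        (1 / 2 : ℂ) • P.hop a a c (Q.g2 a c) := by
  have h1 := Q.duo_eq hac
  have h2 := Q.duo_eq hac.symm
  have h3 : P.duo c a (fun _ j k => Q.κ a c (P.star j) * Q.g a c (P.star k)) =
      (-1 : ℂ) • P.duo c a (fun _ j k => Q.κ c a j * Q.g c a k) := by
    rw [← P.duo_smul]
    refine P.duo_congr fun i j k _ => ?_
    rw [Q.κ_star hac.symm, Q.g_star hac.symm]
    ring
  have h4 : P.duo c a (fun i j _ => Q.κ a c i * Q.e j) =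
      (-1 : ℂ) • P.duo c a (fun i j _ => Q.κ c a (P.star i) * Q.e j) := by
    rw [← P.duo_smul]
    refine P.duo_congr fun i j k _ => ?_
    rw [Q.κ_star hac]
    ring
  have h5 : P.op c a (fun i => P.sq i * Q.g2 c a i) = -P.op a c (fun i => P.sq i * Q.g2 a c i) :=
    P.op_swap_neg hac fun i => by rw [P.sq_star, Q.g2_star hac, mul_neg]
  rw [P.op_op_self hac, P.op_op_diag_left hac _ _ Q.e_star, P.op_op_diag_right hac _ _ Q.e_star, h3,
    h4]
  rw [h5, Q.hop_g2_swap hac] at h2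
  linear_combination (norm := module) h1 - h2

end Coeffs
end Frame
end TwistedKZB
end

/-! ### Summation over the sites. -/

noncomputable section
namespace TwistedKZB
open Complex Metric Set Filter Topology

theorem sum_sum_eq_add_offDiag {ι M : Type*} [DecidableEq ι] [AddCommMonoid M] (s : Finset ι)
    (f : ι → ι → M) :
    ∑ i ∈ s, ∑ j ∈ s, f i j = ∑ i ∈ s, f i i + ∑ p ∈ s.offDiag, f p.1 p.2 := by
  rw [← Finset.sum_product', ← Finset.diag_union_offDiag,
    Finset.sum_union (Finset.disjoint_diag_offDiag s), Finset.sum_diag]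

theorem sum_offDiag_swap {ι M : Type*} [DecidableEq ι] [AddCommMonoid M] (s : Finset ι)
    (f : ι → ι → M) : ∑ p ∈ s.offDiag, f p.2 p.1 = ∑ p ∈ s.offDiag, f p.1 p.2 :=
  Finset.sum_bij' (fun p _ => p.swap) (fun p _ => p.swap)
    (by simp +contextual [eq_comm, Finset.mem_offDiag]) (by simp +contextual [eq_comm])
    (by simp) (by simp) (by simp)

section

variable {R ι : Type*} [Ring R]

theorem sum_bracket (s : Finset ι) (f : ι → R) (y : R) : ⁅∑ i ∈ s, f i, y⁆ = ∑ i ∈ s, ⁅f i, y⁆ := by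
  simp only [Ring.lie_def, Finset.sum_mul, Finset.mul_sum, Finset.sum_sub_distrib]

theorem bracket_sum (s : Finset ι) (f : ι → R) (y : R) : ⁅y, ∑ i ∈ s, f i⁆ = ∑ i ∈ s, ⁅y, f i⁆ := by
  simp only [Ring.lie_def, Finset.sum_mul, Finset.mul_sum, Finset.sum_sub_distrib]

theorem bracket_add (x y z : R) : ⁅x, y + z⁆ = ⁅x, y⁆ + ⁅x, z⁆ := by
  simp only [Ring.lie_def]
  noncomm_ring

theorem bracket_smul [Algebra ℂ R] (c : ℂ) (x y : R) : ⁅x, c • y⁆ = c • ⁅x, y⁆ := by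
  simp only [Ring.lie_def, mul_smul_comm, smul_mul_assoc, smul_sub]

end

namespace Frame

variable {R S J : Type*} {n : ℕ} [Ring R] [Algebra ℂ R] [Fintype J] {P : Frame R S J n}
  (Q : P.Coeffs)

namespace Coeffs

variable [DecidableEq S]

/-- The coefficients of `f`. -/
def gAll (b d : S) : Fin n ⊕ J → ℂ := if b = d then Q.e else Q.g b d

/-- The derivatives of the coefficients of `f`. -/
def g2All (b d : S) : Fin n ⊕ J → ℂ := if b = d then Q.e' else Q.g2 b d

theorem gAll_self (b : S) : Q.gAll b b = Q.e := if_pos rfl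

theorem gAll_of_ne {b d : S} (h : b ≠ d) : Q.gAll b d = Q.g b d := if_neg h

theorem g2All_self (b : S) : Q.g2All b b = Q.e' := if_pos rfl

theorem g2All_of_ne {b d : S} (h : b ≠ d) : Q.g2All b d = Q.g2 b d := if_neg h

variable [Fintype S]

/-- The potential of `∇_a`. -/
def M (a : S) : R := ∑ c ∈ Finset.univ.erase a, P.op a c (Q.κ a c)

/-- The potential of `∇_τ`. -/
def N : R := (1 / 2 : ℂ) • ∑ b, ∑ d, P.op b d (Q.gAll b d)

/-- For each third site `c` the brackets combine into `cybe`, and those with disjoint sites vanish.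
The two sums of `hop` on the left are the contributions of the `u`-derivatives of the potentials.
What is left is a full sum over the sites, to which `sum_hop` applies. -/
theorem commutator_M {a b : S} (hab : a ≠ b) :
    ⁅Q.M a, Q.M b⁆ + ∑ d ∈ Finset.univ.erase b, P.hop a b d (Q.g b d) -
      ∑ d ∈ Finset.univ.erase a, P.hop b a d (Q.g a d) = -∑ s, P.hop s a b (Q.g a b) := by
  set T := (Finset.univ.erase a).erase b
  have hT : T = (Finset.univ.erase b).erase a := Finset.erase_right_comm
  have s1 : ∀ f : S → R, ∑ c ∈ Finset.univ.erase a, f c = f b + ∑ c ∈ T, f c := fun f =>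
    (Finset.add_sum_erase _ f (Finset.mem_erase.2 ⟨hab.symm, Finset.mem_univ b⟩)).symm
  have s2 : ∀ f : S → R, ∑ c ∈ Finset.univ.erase b, f c = f a + ∑ c ∈ T, f c := fun f => by
    rw [hT]
    exact (Finset.add_sum_erase _ f (Finset.mem_erase.2 ⟨hab, Finset.mem_univ a⟩)).symm
  have s3 : ∑ s, P.hop s a b (Q.g a b) = P.hop a a b (Q.g a b) + (P.hop b a b (Q.g a b) +
      ∑ s ∈ T, P.hop s a b (Q.g a b)) := by
    rw [← Finset.add_sum_erase _ _ (Finset.mem_univ a), s1]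
  have key : ∑ c ∈ T, (⁅P.op a b (Q.κ a b), P.op a c (Q.κ a c)⁆ +
      ⁅P.op a b (Q.κ a b), P.op b c (Q.κ b c)⁆ + ⁅P.op a c (Q.κ a c), P.op b c (Q.κ b c)⁆) =
      ∑ c ∈ T, (-P.hop c a b (Q.g a b) - P.hop a b c (Q.g b c) + P.hop b a c (Q.g a c)) := by
    refine Finset.sum_congr rfl fun c hc => ?_
    simp only [T, Finset.mem_erase, Finset.mem_univ, and_true] at hc
    exact Q.cybe hab (Ne.symm hc.2) (Ne.symm hc.1)
  have h2 : ⁅∑ c ∈ T, P.op a c (Q.κ a c), ∑ d ∈ T, P.op b d (Q.κ b d)⁆ =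
      ∑ c ∈ T, ⁅P.op a c (Q.κ a c), P.op b c (Q.κ b c)⁆ := by
    rw [sum_bracket]
    refine Finset.sum_congr rfl fun c hc => ?_
    rw [bracket_sum]
    refine Finset.sum_eq_single_of_mem c hc fun d hd hdc => ?_
    simp only [T, Finset.mem_erase, Finset.mem_univ, and_true] at hc hd
    exact P.op_commute hab (Ne.symm hd.2) hc.1 hdc.symm _ _
  have h3 : ⁅Q.M a, Q.M b⁆ = ∑ c ∈ T, (⁅P.op a b (Q.κ a b), P.op a c (Q.κ a c)⁆ +
      ⁅P.op a b (Q.κ a b), P.op b c (Q.κ b c)⁆ + ⁅P.op a c (Q.κ a c), P.op b c (Q.κ b c)⁆) := by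
    rw [M, M, s1, s2, Q.op_κ_swap hab, Finset.sum_add_distrib, Finset.sum_add_distrib, ← bracket_sum,
      ← bracket_sum, ← h2]
    simp only [Ring.lie_def]
    noncomm_ring
  rw [h3, key, s2, s1, s3, Q.hop_g_swap hab]
  simp only [Finset.sum_add_distrib, Finset.sum_sub_distrib, Finset.sum_neg_distrib]
  abel

/-- The brackets are sorted by the number of sites they involve and evaluated by `two_site` and
`three_site`. On the left, the term with `sq` is the Laplacian of `M a` and the double sum of `hop`
stems from the `u`-derivatives of `N`. The right side is again a sum over all sites. -/
theorem commutator_M_N (a : S) :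
    ⁅Q.M a, Q.N⁆ - (1 / 2 : ℂ) • ∑ c ∈ Finset.univ.erase a, P.op a c (fun i => P.sq i * Q.g2 a c i) +
      (1 / 2 : ℂ) • ∑ b, ∑ d, P.hop a b d (Q.g2All b d) =
      (1 / 2 : ℂ) • ∑ c, ∑ s, P.hop s a c (Q.g2All a c) := by
  set T := Finset.univ.erase a
  have hT : ∀ {c}, c ∈ T → a ≠ c := fun {c} hc => (Finset.mem_erase.1 hc).1.symm
  have hO : ∀ {p : S × S}, p ∈ T.offDiag → a ≠ p.1 ∧ a ≠ p.2 ∧ p.1 ≠ p.2 := fun {p} hp => by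
    rw [Finset.mem_offDiag] at hp
    exact ⟨hT hp.1, hT hp.2.1, hp.2.2⟩
  have s1 : ∀ f : S → R, ∑ c, f c = f a + ∑ c ∈ T, f c := fun f =>
    (Finset.add_sum_erase _ f (Finset.mem_univ a)).symm
  have s2 : ∀ f : S → S → R, ∑ b, ∑ d, f b d = f a a + ∑ c ∈ T, (f a c + f c a + f c c) +
      ∑ p ∈ T.offDiag, f p.1 p.2 := fun f => by
    simp only [s1, Finset.sum_add_distrib, sum_sum_eq_add_offDiag]
    abel
  set K : S → R := fun c => P.op a c (Q.κ a c) with hK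
  set G : S → S → R := fun b d => P.op b d (Q.gAll b d) with hG
  have hGswap : ∀ b d, G b d = G d b := fun b d => by
    by_cases h : b = d
    · rw [h]
    · simp only [hG]
      rw [Q.gAll_of_ne h, Q.gAll_of_ne (Ne.symm h), Q.op_g_swap h]
  -- the commutator, sorted by the number of sites
  have hM : Q.M a = ∑ c ∈ T, K c := rfl
  have c1 : ⁅∑ c ∈ T, K c, G a a⁆ = ∑ c ∈ T, ⁅K c, G a a⁆ := by rw [sum_bracket]
  have c2 : ⁅∑ c ∈ T, K c, ∑ c ∈ T, (G a c + G c a + G c c)⁆ =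
      ∑ c ∈ T, ((2 : ℂ) • ⁅K c, G a c⁆ + ⁅K c, G c c⁆) +
        (2 : ℂ) • ∑ p ∈ T.offDiag, ⁅K p.1, G a p.2⁆ := by
    rw [sum_bracket]
    simp only [bracket_sum]
    rw [sum_sum_eq_add_offDiag, Finset.smul_sum]
    congr 1
    · refine Finset.sum_congr rfl fun c hc => ?_
      rw [hGswap c a, bracket_add, bracket_add, two_smul]
    · refine Finset.sum_congr rfl fun p hp => ?_
      obtain ⟨h1, h2, h3⟩ := hO hp
      have : ⁅K p.1, G p.2 p.2⁆ = 0 := P.op_commute h2 h2 h3 h3 _ _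
      rw [hGswap p.2 a, bracket_add, bracket_add, this, two_smul, add_zero]
  have c3 : ⁅∑ c ∈ T, K c, ∑ p ∈ T.offDiag, G p.1 p.2⁆ =
      (2 : ℂ) • ∑ p ∈ T.offDiag, ⁅K p.1, G p.1 p.2⁆ := by
    have h1 : ∀ p ∈ T.offDiag, ⁅∑ c ∈ T, K c, G p.1 p.2⁆ =
        ⁅K p.1, G p.1 p.2⁆ + ⁅K p.2, G p.2 p.1⁆ := by
      intro p hp
      obtain ⟨h1, h2, h3⟩ := hO hp
      have hp' := Finset.mem_offDiag.1 hp
      rw [sum_bracket, Finset.sum_eq_add_of_mem p.1 p.2 hp'.1 hp'.2.1 h3, hGswap p.2 p.1]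
      rintro c hc ⟨h4, h5⟩
      exact P.op_commute h1 h2 h4 h5 _ _
    rw [bracket_sum, Finset.sum_congr rfl h1, Finset.sum_add_distrib,
      sum_offDiag_swap T fun b d => ⁅K b, G b d⁆, two_smul]
  have hN : ⁅Q.M a, Q.N⁆ = ∑ c ∈ T, (⁅K c, G a c⁆ + (1 / 2 : ℂ) • ⁅K c, G a a⁆ +
      (1 / 2 : ℂ) • ⁅K c, G c c⁆) +
      ∑ p ∈ T.offDiag, (⁅K p.1, G a p.2⁆ + ⁅K p.1, G p.1 p.2⁆) := by
    rw [N, bracket_smul, hM, s2 G, bracket_add, bracket_add, c1, c2, c3]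
    simp only [Finset.sum_add_distrib, ← Finset.smul_sum]
    module
  have h2site : ∑ c ∈ T, (⁅K c, G a c⁆ + (1 / 2 : ℂ) • ⁅K c, G a a⁆ +
      (1 / 2 : ℂ) • ⁅K c, G c c⁆) =
      ∑ c ∈ T, ((1 / 2 : ℂ) • P.op a c (fun i => P.sq i * Q.g2 a c i) -
        (1 / 2 : ℂ) • P.hop a c c Q.e' +
        (1 / 2 : ℂ) • P.hop c a a Q.e' + (1 / 2 : ℂ) • P.hop c a c (Q.g2 a c) -
        (1 / 2 : ℂ) • P.hop a a c (Q.g2 a c)) := by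
    refine Finset.sum_congr rfl fun c hc => ?_
    rw [← Q.two_site (hT hc)]
    simp only [hG, gAll_self, Q.gAll_of_ne (hT hc)]
    rfl
  have h3site : ∑ p ∈ T.offDiag, (⁅K p.1, G a p.2⁆ + ⁅K p.1, G p.1 p.2⁆) =
      -((1 / 2 : ℂ) • ∑ p ∈ T.offDiag, P.hop a p.1 p.2 (Q.g2 p.1 p.2)) +
        (1 / 2 : ℂ) • ∑ p ∈ T.offDiag, P.hop p.2 a p.1 (Q.g2 a p.1) := by
    -- `three_site` evaluates the sum over both orders of the pair, so it is applied to the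
    -- symmetrised sum and then halved.
    have h1 : ∑ p ∈ T.offDiag, (⁅K p.1, G a p.2⁆ + ⁅K p.2, G a p.1⁆ + ⁅K p.1, G p.1 p.2⁆ +
        ⁅K p.2, G p.2 p.1⁆) = ∑ p ∈ T.offDiag, (-P.hop a p.1 p.2 (Q.g2 p.1 p.2) +
          (1 / 2 : ℂ) • P.hop p.1 a p.2 (Q.g2 a p.2) +
          (1 / 2 : ℂ) • P.hop p.2 a p.1 (Q.g2 a p.1)) := by
      refine Finset.sum_congr rfl fun p hp => ?_
      obtain ⟨h1, h2, h3⟩ := hO hp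
      rw [← Q.three_site h1 h2 h3]
      simp only [hG, Q.gAll_of_ne h1, Q.gAll_of_ne h2, Q.gAll_of_ne h3, Q.gAll_of_ne h3.symm]
      rfl
    simp only [Finset.sum_add_distrib, Finset.sum_neg_distrib, ← Finset.smul_sum] at h1 ⊢
    rw [sum_offDiag_swap T fun b d => ⁅K b, G a d⁆, sum_offDiag_swap T fun b d => ⁅K b, G b d⁆,
      sum_offDiag_swap T fun b d => P.hop d a b (Q.g2 a b)] at h1
    linear_combination (norm := module) (1 / 2 : ℂ) • h1
  have r1 : ∑ b, ∑ d, P.hop a b d (Q.g2All b d) = P.hop a a a Q.e' +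
      ∑ c ∈ T, ((2 : ℂ) • P.hop a a c (Q.g2 a c) + P.hop a c c Q.e') +
      ∑ p ∈ T.offDiag, P.hop a p.1 p.2 (Q.g2 p.1 p.2) := by
    rw [s2 fun b d => P.hop a b d (Q.g2All b d), Q.g2All_self]
    congr 1
    · congr 1
      refine Finset.sum_congr rfl fun c hc => ?_
      rw [Q.g2All_of_ne (hT hc), Q.g2All_of_ne (hT hc).symm, Q.g2All_self, Q.hop_g2_swap (hT hc),
        two_smul]
    · refine Finset.sum_congr rfl fun p hp => ?_
      rw [Q.g2All_of_ne (hO hp).2.2]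
  have r2 : ∑ c, ∑ s, P.hop s a c (Q.g2All a c) = P.hop a a a Q.e' +
      ∑ c ∈ T, (P.hop a a c (Q.g2 a c) + P.hop c a a Q.e' + P.hop c a c (Q.g2 a c)) +
      ∑ p ∈ T.offDiag, P.hop p.2 a p.1 (Q.g2 a p.1) := by
    rw [s2 fun c s => P.hop s a c (Q.g2All a c), Q.g2All_self]
    congr 1
    · congr 1
      refine Finset.sum_congr rfl fun c hc => ?_
      rw [Q.g2All_of_ne (hT hc)]
      abel
    · refine Finset.sum_congr rfl fun p hp => ?_
      rw [Q.g2All_of_ne (hO hp).1]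
  rw [hN, h2site, h3site, r1, r2]
  simp only [Finset.sum_add_distrib, Finset.sum_sub_distrib, ← Finset.smul_sum]
  module

end Coeffs
end Frame
end TwistedKZB
end

noncomputable section
namespace TwistedKZB
open Complex Metric Set Filter Topology

/-! ### Commutators of first and second order operators with operator potentials -/

section

variable {E G H : Type*} [NormedAddCommGroup E] [NormedSpace ℂ E] [NormedAddCommGroup G]
  [NormedSpace ℂ G] [NormedAddCommGroup H] [NormedSpace ℂ H]

/-- The derivative in the direction `v`. -/
def D (v : E) (F : E → G) (x : E) : G := fderiv ℂ F x v

variable {F F' : E → G} {x : E}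

theorem D_congr (v : E) (h : F =ᶠ[𝓝 x] F') : D v F x = D v F' x := by
  rw [D, D, h.fderiv_eq]

theorem analyticAt_D [CompleteSpace G] (hF : AnalyticAt ℂ F x) (v : E) : AnalyticAt ℂ (D v F) x :=
  analyticAt_fderiv_apply hF v

theorem D_comm [CompleteSpace G] (hF : AnalyticAt ℂ F x) (v w : E) :
    D w (D v F) x = D v (D w F) x := fderiv_fderiv_comm hF v w

theorem D_add (v : E) (hF : AnalyticAt ℂ F x) (hF' : AnalyticAt ℂ F' x) :
    D v (fun y => F y + F' y) x = D v F x + D v F' x := by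
  rw [D, fderiv_fun_add hF.differentiableAt hF'.differentiableAt]
  rfl

theorem D_sub (v : E) (hF : AnalyticAt ℂ F x) (hF' : AnalyticAt ℂ F' x) :
    D v (fun y => F y - F' y) x = D v F x - D v F' x := by
  rw [D, fderiv_fun_sub hF.differentiableAt hF'.differentiableAt]
  rfl

theorem D_sum {ι : Type*} (s : Finset ι) {F : ι → E → G} (v : E)
    (hF : ∀ i ∈ s, AnalyticAt ℂ (F i) x) :
    D v (fun y => ∑ i ∈ s, F i y) x = ∑ i ∈ s, D v (F i) x := by
  rw [D, fderiv_fun_sum fun i hi => (hF i hi).differentiableAt]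
  simp [D]

theorem D_const_smul (v : E) (c : ℂ) (hF : AnalyticAt ℂ F x) :
    D v (fun y => c • F y) x = c • D v F x := by
  rw [D, fderiv_fun_const_smul hF.differentiableAt]
  rfl

theorem D_smul_const (v : E) {p : E → ℂ} (hp : AnalyticAt ℂ p x) (A : G) :
    D v (fun y => p y • A) x = D v p x • A := by
  rw [D, fderiv_smul_const hp.differentiableAt]
  rfl

theorem D_clm (v : E) (A : G →L[ℂ] H) (hF : AnalyticAt ℂ F x) :
    D v (fun y => A (F y)) x = A (D v F x) := by
  have h := (A.hasFDerivAt.comp x hF.differentiableAt.hasFDerivAt).fderiv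
  rw [D]
  exact congrArg (fun L => L v) h

theorem D_coord_smul (v : E) (t : E →L[ℂ] ℂ) (hF : AnalyticAt ℂ F x) :
    D v (fun y => t y • F y) x = t v • F x + t x • D v F x := by
  have h := (t.hasFDerivAt (x := x)).fun_smul hF.differentiableAt.hasFDerivAt
  rw [D, h.fderiv]
  simp [D, add_comm]

theorem analyticAt_clm (A : G →L[ℂ] H) (hF : AnalyticAt ℂ F x) :
    AnalyticAt ℂ (fun y => A (F y)) x := (A.analyticAt _).comp hF

theorem D_apply (v : E) {A : E → G →L[ℂ] H} (hA : AnalyticAt ℂ A x) (hF : AnalyticAt ℂ F x) :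
    D v (fun y => A y (F y)) x = D v A x (F x) + A x (D v F x) := by
  have h := hA.differentiableAt.hasFDerivAt.clm_apply hF.differentiableAt.hasFDerivAt
  rw [D, h.fderiv]
  simp [D, add_comm]

theorem analyticAt_apply {A : E → G →L[ℂ] H} (hA : AnalyticAt ℂ A x) (hF : AnalyticAt ℂ F x) :
    AnalyticAt ℂ (fun y => A y (F y)) x :=
  AnalyticAt.comp (f := fun y => (A y, F y))
    ((ContinuousLinearMap.id ℂ (G →L[ℂ] H)).analyticAt_bilinear (A x, F x)) (hA.prod hF)

theorem analyticAt_coord_smul (t : E →L[ℂ] ℂ) (hF : AnalyticAt ℂ F x) :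
    AnalyticAt ℂ (fun y => t y • F y) x := (t.analyticAt x).smul hF

theorem analyticAt_const_smul (c : ℂ) (hF : AnalyticAt ℂ F x) :
    AnalyticAt ℂ (fun y => c • F y) x := analyticAt_const.smul hF

theorem clm_mul_apply (A B : G →L[ℂ] G) (w : G) : (A * B) w = A (B w) := rfl

end

/-- The data from which a connection with operator potentials is built. -/
structure ConnData (E W S : Type*) (n : ℕ) [NormedAddCommGroup E] [NormedSpace ℂ E]
    [NormedAddCommGroup W] [NormedSpace ℂ W] where
  t : S → E →L[ℂ] ℂ
  vT : S → E
  vU : Fin n → E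
  v0 : E
  t_vT : ∀ {a b}, a ≠ b → t a (vT b) = 0
  t_vU : ∀ a k, t a (vU k) = 0
  t_v0 : ∀ a, t a v0 = 0
  c1 : ℂ
  c0 : ℂ
  Y : S → Fin n → W →L[ℂ] W
  M : S → E → W →L[ℂ] W
  N : E → W →L[ℂ] W

namespace ConnData

variable {E W S : Type*} {n : ℕ} [NormedAddCommGroup E] [NormedSpace ℂ E]
  [NormedAddCommGroup W] [NormedSpace ℂ W] (X : ConnData E W S n)

def nab (a : S) (F : E → W) (x : E) : W :=
  X.t a x • D (X.vT a) F x - X.c1 • ∑ k, X.Y a k (D (X.vU k) F x) + X.c1 • X.M a x (F x)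

def nabT (F : E → W) (x : E) : W :=
  X.c0 • D X.v0 F x + (1 / 2 : ℂ) • ∑ k, D (X.vU k) (D (X.vU k) F) x + X.N x (F x)

variable [CompleteSpace W] {X} {F : E → W} {x : E}

theorem analyticAt_sum {ι : Type*} (s : Finset ι) {G : Type*} [NormedAddCommGroup G]
    [NormedSpace ℂ G] {f : ι → E → G} (h : ∀ i ∈ s, AnalyticAt ℂ (f i) x) :
    AnalyticAt ℂ (fun y => ∑ i ∈ s, f i y) x := s.analyticAt_fun_sum h

theorem analyticAt_nab {a : S} (hM : AnalyticAt ℂ (X.M a) x) (hF : AnalyticAt ℂ F x) :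
    AnalyticAt ℂ (X.nab a F) x :=
  ((analyticAt_coord_smul (X.t a) (analyticAt_D hF _)).fun_sub
    (analyticAt_const_smul _ (analyticAt_sum _ fun _ _ => analyticAt_clm _ (analyticAt_D hF _)))).fun_add
    (analyticAt_const_smul _ (analyticAt_apply hM hF))

theorem analyticAt_nabT (hN : AnalyticAt ℂ X.N x) (hF : AnalyticAt ℂ F x) :
    AnalyticAt ℂ (X.nabT F) x :=
  ((analyticAt_const_smul _ (analyticAt_D hF _)).fun_add
    (analyticAt_const_smul _ (analyticAt_sum _ fun _ _ => analyticAt_D (analyticAt_D hF _) _))).fun_add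
    (analyticAt_apply hN hF)

theorem D_nab {a : S} (hM : AnalyticAt ℂ (X.M a) x) (hF : AnalyticAt ℂ F x) (v : E) :
    D v (X.nab a F) x = X.t a v • D (X.vT a) F x + X.t a x • D v (D (X.vT a) F) x -
      X.c1 • ∑ k, X.Y a k (D v (D (X.vU k) F) x) +
      X.c1 • (D v (X.M a) x (F x) + X.M a x (D v F x)) := by
  have h1 := fun k => analyticAt_D hF (X.vU k)
  have h2 := analyticAt_D hF (X.vT a)
  have h3 : AnalyticAt ℂ (fun y => ∑ k, X.Y a k (D (X.vU k) F y)) x :=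
    analyticAt_sum _ fun k _ => analyticAt_clm _ (h1 k)
  have h4 := analyticAt_apply hM hF
  unfold nab
  rw [D_add v ((analyticAt_coord_smul (X.t a) h2).fun_sub (analyticAt_const_smul _ h3))
    (analyticAt_const_smul _ h4), D_sub v (analyticAt_coord_smul (X.t a) h2) (analyticAt_const_smul _ h3),
    D_coord_smul v _ h2, D_const_smul v _ h3, D_const_smul v _ h4, D_apply v hM hF,
    D_sum _ v fun k _ => analyticAt_clm _ (h1 k)]
  simp only [D_clm v _ (h1 _)]

theorem D_nabT (hN : AnalyticAt ℂ X.N x) (hF : AnalyticAt ℂ F x) (v : E) :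
    D v (X.nabT F) x = X.c0 • D v (D X.v0 F) x +
      (1 / 2 : ℂ) • ∑ k, D v (D (X.vU k) (D (X.vU k) F)) x +
      (D v X.N x (F x) + X.N x (D v F x)) := by
  have h1 := fun k => analyticAt_D (analyticAt_D hF (X.vU k)) (X.vU k)
  have h2 := analyticAt_D hF X.v0
  have h3 : AnalyticAt ℂ (fun y => ∑ k, D (X.vU k) (D (X.vU k) F) y) x :=
    analyticAt_sum _ fun k _ => h1 k
  have h4 := analyticAt_apply hN hF
  unfold nabT
  rw [D_add v ((analyticAt_const_smul _ h2).fun_add (analyticAt_const_smul _ h3)) h4,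
    D_add v (analyticAt_const_smul _ h2) (analyticAt_const_smul _ h3),
    D_const_smul v _ h2, D_const_smul v _ h3, D_apply v hN hF, D_sum _ v fun k _ => h1 k]

theorem D_D_nab {a : S} (hM : AnalyticAt ℂ (X.M a) x) (hF : AnalyticAt ℂ F x) {v : E}
    (hv : X.t a v = 0) :
    D v (D v (X.nab a F)) x = X.t a x • D v (D v (D (X.vT a) F)) x -
      X.c1 • ∑ k, X.Y a k (D v (D v (D (X.vU k) F)) x) +
      X.c1 • (D v (D v (X.M a)) x (F x) + (2 : ℂ) • D v (X.M a) x (D v F x) +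
        X.M a x (D v (D v F) x)) := by
  have e : D v (X.nab a F) =ᶠ[𝓝 x] fun y => X.t a y • D v (D (X.vT a) F) y -
      X.c1 • ∑ k, X.Y a k (D v (D (X.vU k) F) y) +
      X.c1 • (D v (X.M a) y (F y) + X.M a y (D v F y)) := by
    filter_upwards [hM.eventually_analyticAt, hF.eventually_analyticAt] with y h1 h2
    rw [D_nab h1 h2, hv, zero_smul, zero_add]
  have h1 := fun k => analyticAt_D (analyticAt_D hF (X.vU k)) v
  have h2 := analyticAt_D (analyticAt_D hF (X.vT a)) v
  have h3 : AnalyticAt ℂ (fun y => ∑ k, X.Y a k (D v (D (X.vU k) F) y)) x :=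
    analyticAt_sum _ fun k _ => analyticAt_clm _ (h1 k)
  have h4 := analyticAt_apply (analyticAt_D hM v) hF
  have h5 := analyticAt_apply hM (analyticAt_D hF v)
  rw [D_congr v e, D_add v ((analyticAt_coord_smul (X.t a) h2).fun_sub (analyticAt_const_smul _ h3))
    (analyticAt_const_smul _ (h4.fun_add h5)),
    D_sub v (analyticAt_coord_smul (X.t a) h2) (analyticAt_const_smul _ h3),
    D_coord_smul v _ h2, D_const_smul v _ h3, D_const_smul v _ (h4.fun_add h5), D_add v h4 h5,
    D_apply v (analyticAt_D hM v) hF, D_apply v hM (analyticAt_D hF v),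
    D_sum _ v fun k _ => analyticAt_clm _ (h1 k), hv, zero_smul, zero_add]
  simp only [D_clm v _ (h1 _)]
  module

/-- Sort by derivatives of `F`: the second order terms cancel since the operators `Y` at different
sites commute, `h2` removes the first order terms, and `h1` and `h3` the terms without derivatives.
Only `h3` is evaluated on `F x`, and only there does the zero weight condition enter. -/
theorem nab_comm {a b : S} (hab : a ≠ b) (hMa : AnalyticAt ℂ (X.M a) x)
    (hMb : AnalyticAt ℂ (X.M b) x) (hF : AnalyticAt ℂ F x)
    (hY : ∀ k m, X.Y a k * X.Y b m = X.Y b m * X.Y a k)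
    (h1 : X.t a x • D (X.vT a) (X.M b) x = X.t b x • D (X.vT b) (X.M a) x)
    (h2 : ∀ k, ⁅X.Y a k, X.M b x⁆ = ⁅X.Y b k, X.M a x⁆)
    (h3 : (⁅X.M a x, X.M b x⁆ - ∑ k, X.Y a k * D (X.vU k) (X.M b) x +
      ∑ k, X.Y b k * D (X.vU k) (X.M a) x) (F x) = 0) :
    X.nab a (X.nab b F) x = X.nab b (X.nab a F) x := by
  have e1 : X.nab a (X.nab b F) x = X.t a x • D (X.vT a) (X.nab b F) x -
    X.c1 • ∑ k, X.Y a k (D (X.vU k) (X.nab b F) x) + X.c1 • X.M a x (X.nab b F x) := rfl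
  have e2 : X.nab b (X.nab a F) x = X.t b x • D (X.vT b) (X.nab a F) x -
    X.c1 • ∑ k, X.Y b k (D (X.vU k) (X.nab a F) x) + X.c1 • X.M b x (X.nab a F x) := rfl
  have f1 := congrArg (fun L : W →L[ℂ] W => L (F x)) h1
  have f2 : ∑ k, (X.Y a k (X.M b x (D (X.vU k) F x)) - X.M b x (X.Y a k (D (X.vU k) F x))) =
      ∑ k, (X.Y b k (X.M a x (D (X.vU k) F x)) - X.M a x (X.Y b k (D (X.vU k) F x))) :=
    Finset.sum_congr rfl fun k _ => congrArg (fun L : W →L[ℂ] W => L (D (X.vU k) F x)) (h2 k)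
  have f3 : ∑ k, ∑ m, X.Y a k (X.Y b m (D (X.vU k) (D (X.vU m) F) x)) =
      ∑ k, ∑ m, X.Y b k (X.Y a m (D (X.vU k) (D (X.vU m) F) x)) := by
    rw [Finset.sum_comm]
    refine Finset.sum_congr rfl fun k _ => Finset.sum_congr rfl fun m _ => ?_
    rw [D_comm hF]
    exact congrArg (fun L : W →L[ℂ] W => L _) (hY m k)
  simp only [Ring.lie_def, add_apply, sub_apply,
    clm_mul_apply, sum_apply] at h3
  simp only [smul_apply] at f1
  rw [e1, e2]
  simp only [D_nab hMa hF, D_nab hMb hF, X.t_vT hab, X.t_vT hab.symm, X.t_vU, zero_smul, zero_add]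
  rw [nab, nab]
  simp only [map_add, map_sub, map_smul, map_sum, Finset.sum_add_distrib, Finset.sum_sub_distrib,
    ← Finset.smul_sum, fun k => D_comm hF (X.vT b) (X.vU k),
    fun k => D_comm hF (X.vT a) (X.vU k)] at f2 f3 h3 ⊢
  rw [D_comm hF (X.vT b) (X.vT a)]
  linear_combination (norm := module) X.c1 • f1 - X.c1 ^ 2 • f2 + X.c1 ^ 2 • f3 + X.c1 ^ 2 • h3

/-- Second derivatives in `u` applied to `M F` produce the cross term `∑ ∂M ∂F`, which `h2` balances
against the commutator of the Cartan derivatives with `N`. The remaining zeroth order terms are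
`h1`, the heat equation, and `h3`. -/
theorem nab_nabT_comm {a : S} (hM : AnalyticAt ℂ (X.M a) x)
    (hN : AnalyticAt ℂ X.N x) (hF : AnalyticAt ℂ F x)
    (h1 : X.t a x • D (X.vT a) X.N x = (X.c1 * X.c0) • D X.v0 (X.M a) x)
    (h2 : ∀ k, ⁅X.Y a k, X.N x⁆ = -D (X.vU k) (X.M a) x)
    (h3 : (⁅X.M a x, X.N x⁆ - ∑ k, X.Y a k * D (X.vU k) X.N x -
      (1 / 2 : ℂ) • ∑ k, D (X.vU k) (D (X.vU k) (X.M a)) x) (F x) = 0) :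
    X.nab a (X.nabT F) x = X.nabT (X.nab a F) x := by
  have e1 : X.nab a (X.nabT F) x = X.t a x • D (X.vT a) (X.nabT F) x -
    X.c1 • ∑ k, X.Y a k (D (X.vU k) (X.nabT F) x) + X.c1 • X.M a x (X.nabT F x) := rfl
  have e2 : X.nabT (X.nab a F) x = X.c0 • D X.v0 (X.nab a F) x +
    (1 / 2 : ℂ) • ∑ k, D (X.vU k) (D (X.vU k) (X.nab a F)) x + X.N x (X.nab a F x) := rfl
  have f1 := congrArg (fun L : W →L[ℂ] W => L (F x)) h1
  have f2 : ∑ k, (X.Y a k (X.N x (D (X.vU k) F x)) - X.N x (X.Y a k (D (X.vU k) F x))) =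
      ∑ k, -(D (X.vU k) (X.M a) x (D (X.vU k) F x)) :=
    Finset.sum_congr rfl fun k _ => congrArg (fun L : W →L[ℂ] W => L (D (X.vU k) F x)) (h2 k)
  have d3 : ∀ v w : E, D w (D v (D v F)) x = D v (D v (D w F)) x := by
    intro v w
    rw [D_comm (analyticAt_D hF v)]
    refine D_congr v ?_
    filter_upwards [hF.eventually_analyticAt] with y hy
    exact D_comm hy v w
  have f3 : ∑ k, ∑ m, X.Y a k (D (X.vU k) (D (X.vU m) (D (X.vU m) F)) x) =
      ∑ k, ∑ m, X.Y a m (D (X.vU k) (D (X.vU k) (D (X.vU m) F)) x) := by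
    rw [Finset.sum_comm]
    refine Finset.sum_congr rfl fun k _ => Finset.sum_congr rfl fun m _ => ?_
    rw [d3]
  simp only [Ring.lie_def, sub_apply, clm_mul_apply, sum_apply, smul_apply] at h3
  simp only [smul_apply] at f1
  rw [e1, e2]
  simp only [D_nab hM hF, D_nabT hN hF, D_D_nab hM hF (X.t_vU a _), X.t_v0, zero_smul, zero_add]
  rw [nab, nabT]
  simp only [map_add, map_sub, map_smul, map_sum, Finset.sum_add_distrib, Finset.sum_sub_distrib,
    ← Finset.smul_sum, Finset.sum_neg_distrib, d3 _ (X.vT a), D_comm hF X.v0] at f2 f3 h3 ⊢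
  linear_combination (norm := module) f1 - X.c1 • f2 - ((1 / 2 : ℂ) * X.c1) • f3 + X.c1 • h3

end ConnData

end TwistedKZB
end

noncomputable section
namespace TwistedKZB
open Complex Metric Set Filter Topology

/-! ### Graded frames and their coefficient functions -/

namespace Frame

theorem hop_eq {R S J : Type*} {n : ℕ} [Ring R] [Algebra ℂ R] [Fintype J] (P : Frame R S J n)
    (s a b : S) (p : Fin n ⊕ J → ℂ) :
    P.hop s a b p = ∑ k, P.Y s (Sum.inl k) * P.op a b fun i => P.w k i * p i := by
  simp only [hop, h, op, Finset.sum_mul, Finset.mul_sum, Finset.smul_sum]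
  rw [Finset.sum_comm]
  refine Finset.sum_congr rfl fun k _ => Finset.sum_congr rfl fun j _ => ?_
  rw [smul_mul_assoc, mul_smul_comm, smul_smul, mul_comm]

/-- A grading of a frame by `ℤ / r`, together with shifts of the arguments, compatible with the
structure constants. -/
structure Grading {R S J : Type*} {n : ℕ} [Ring R] [Algebra ℂ R] [Fintype J]
    (P : Frame R S J n) (r : ℕ) where
  m : Fin n ⊕ J → ℤ
  v0 : Fin n ⊕ J → ℂ
  m_inl : ∀ k, m (Sum.inl k) = 0
  v0_inl : ∀ k, v0 (Sum.inl k) = 0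
  m_star : ∀ i, ∃ k : ℤ, m i + m (P.star i) = r * k
  v0_star : ∀ i, v0 (P.star i) = -v0 i
  m_sum : ∀ i j k, P.C i j k ≠ 0 → ∃ q : ℤ, m i + m j + m k = r * q
  v0_sum : ∀ i j k, P.C i j k ≠ 0 → v0 i + v0 j + v0 k = 0
  w_sum : ∀ i j k, P.C i j k ≠ 0 → ∀ q, P.w q i + P.w q j + P.w q k = 0
  C_inl : ∀ a b k, P.C (Sum.inl a) (Sum.inl b) k = 0

namespace Grading

section

variable {R J : Type*} {l n : ℕ} [Ring R] [Algebra ℂ R] [Fintype J]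
  {P : Frame R (Fin l) J n} {r : ℕ} (G : P.Grading r)

/-- The value of the weight of the `i`-th member of the frame. -/
def v (i : Fin n ⊕ J) (x : Pt l n) : ℂ := G.v0 i - ∑ k, P.w k i * x.2.2 k

/-- The flag marks the members of `𝔥₀`, not all members of degree `0`: root components of degree `0`
have a genuine elliptic argument. -/
def chan (i : Fin n ⊕ J) (x : Pt l n) : Channel :=
  ⟨i.isLeft, G.m i / r, G.v i x - G.m i / r * x.1⟩

/-- The points at which the coefficient functions are regular. -/
def reg : Set (Pt l n) :=
  {x | 0 < x.1.im ∧ (∀ a, x.2.1 a ≠ 0) ∧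
    (∀ a b, a ≠ b → ∀ k : ℤ, (x.2.1 a / x.2.1 b) ^ r ≠ ee (k * x.1)) ∧
    ∀ j : J, theta (G.chan (Sum.inr j) x).p x.1 ≠ 0}

def kapF (a b : Fin l) (i : Fin n ⊕ J) (x : Pt l n) : ℂ :=
  kap (G.chan i x) (zOf r (x.2.1 a / x.2.1 b)) x.1

def dkapF (a b : Fin l) (i : Fin n ⊕ J) (x : Pt l n) : ℂ :=
  dkap (G.chan i x) (zOf r (x.2.1 a / x.2.1 b)) x.1

def ddkapF (a b : Fin l) (i : Fin n ⊕ J) (x : Pt l n) : ℂ :=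
  ddkap (G.chan i x) (zOf r (x.2.1 a / x.2.1 b)) x.1

def zkapF (a b : Fin l) (i : Fin n ⊕ J) (x : Pt l n) : ℂ :=
  zkap (G.chan i x) (zOf r (x.2.1 a / x.2.1 b)) x.1

def zdkapF (a b : Fin l) (i : Fin n ⊕ J) (x : Pt l n) : ℂ :=
  zdkap (G.chan i x) (zOf r (x.2.1 a / x.2.1 b)) x.1

def ekapF (i : Fin n ⊕ J) (x : Pt l n) : ℂ := ekap (G.chan i x) x.1

def dekapF (i : Fin n ⊕ J) (x : Pt l n) : ℂ := dekap (G.chan i x) x.1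

def gF (b d : Fin l) (i : Fin n ⊕ J) (x : Pt l n) : ℂ :=
  if b = d then G.ekapF i x else G.dkapF b d i x

theorem gF_self (b : Fin l) : G.gF b b = G.ekapF := by
  funext i x
  exact if_pos rfl

theorem gF_of_ne {b d : Fin l} (h : b ≠ d) : G.gF b d = G.dkapF b d := by
  funext i x
  exact if_neg h

theorem w_inl (k j : Fin n) : P.w k (Sum.inl j) = 0 := by
  have h := P.w_star k (Sum.inl j)
  rw [P.star_inl] at h
  linear_combination (1 / 2 : ℂ) * h

theorem exists_star_inr (j : J) : ∃ j', P.star (Sum.inr j) = Sum.inr j' := by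
  rcases h : P.star (Sum.inr j) with k | j'
  · have h1 := P.star_star (Sum.inr j)
    rw [h, P.star_inl] at h1
    cases h1
  · exact ⟨j', rfl⟩

theorem isLeft_star (i : Fin n ⊕ J) : (P.star i).isLeft = i.isLeft := by
  rcases i with k | j
  · rw [P.star_inl]
  · obtain ⟨j', h⟩ := exists_star_inr (P := P) j
    rw [h]
    rfl

variable {G}

theorem chan_torsion (hr : 0 < r) (i : Fin n ⊕ J) (x : Pt l n) : (G.chan i x).Torsion r :=
  ⟨G.m i, div_mul_cancel₀ _ (by exact_mod_cast hr.ne')⟩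

theorem chan_opp (hr : 0 < r) (i : Fin n ⊕ J) (x : Pt l n) :
    (G.chan i x).Opp x.1 (G.chan (P.star i) x) := by
  have hr' : (r : ℂ) ≠ 0 := by exact_mod_cast hr.ne'
  obtain ⟨k, hk⟩ := G.m_star i
  have hk' : (G.m i + G.m (P.star i) : ℂ) = r * k := by exact_mod_cast hk
  have h1 : (G.m i / r + G.m (P.star i) / r : ℂ) = k := by
    rw [← add_div, hk', mul_div_cancel_left₀ _ hr']
  have h2 : G.v (P.star i) x = -G.v i x := by
    simp only [v, G.v0_star, P.w_star, neg_mul, Finset.sum_neg_distrib]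
    ring
  refine ⟨(isLeft_star i).symm, k, h1, ?_⟩
  change G.v i x - G.m i / r * x.1 + (G.v (P.star i) x - G.m (P.star i) / r * x.1) = _
  rw [h2]
  linear_combination -x.1 * h1

theorem chan_sum (hr : 0 < r) {i j k : Fin n ⊕ J} (hC : P.C i j k ≠ 0) (x : Pt l n) :
    Channel.Sum x.1 (G.chan i x) (G.chan j x) (G.chan k x) := by
  have hr' : (r : ℂ) ≠ 0 := by exact_mod_cast hr.ne'
  obtain ⟨q, hq⟩ := G.m_sum i j k hC
  have hq' : (G.m i + G.m j + G.m k : ℂ) = r * q := by exact_mod_cast hq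
  have h1 : (G.m i / r + G.m j / r + G.m k / r : ℂ) = q := by
    rw [← add_div, ← add_div, hq', mul_div_cancel_left₀ _ hr']
  have h2 : G.v i x + G.v j x + G.v k x = 0 := by
    have e1 := G.v0_sum i j k hC
    have e2 : ∑ s, P.w s i * x.2.2 s + ∑ s, P.w s j * x.2.2 s + ∑ s, P.w s k * x.2.2 s = 0 := by
      rw [← Finset.sum_add_distrib, ← Finset.sum_add_distrib]
      refine Finset.sum_eq_zero fun s _ => ?_
      linear_combination x.2.2 s * G.w_sum i j k hC s
    simp only [v]
    linear_combination e1 - e2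
  have h3 : ∀ {a b c : Fin n ⊕ J}, P.C a b c ≠ 0 → ¬(a.isLeft ∧ b.isLeft) := by
    intro a b c h hab
    rcases a with a | a
    · rcases b with b | b
      · exact h (G.C_inl a b c)
      · cases hab.2
    · cases hab.1
  refine ⟨h3 hC, h3 (c := i) (by rwa [← P.C_cyc]), h3 (c := j) (by rwa [P.C_cyc]), q, h1, ?_⟩
  change G.v i x - G.m i / r * x.1 + (G.v j x - G.m j / r * x.1) +
    (G.v k x - G.m k / r * x.1) = _
  linear_combination h2 - x.1 * h1

theorem chan_regular {x : Pt l n} (hx : x ∈ G.reg) (i : Fin n ⊕ J) :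
    (G.chan i x).Regular x.1 := by
  rcases i with k | j
  · refine ⟨fun _ => ?_, fun h => absurd rfl h⟩
    simp [chan, v, G.m_inl, G.v0_inl, w_inl]
  · exact ⟨fun h => (by cases h), fun _ => hx.2.2.2 j⟩

theorem chan_ne {x : Pt l n} (hx : x ∈ G.reg) (i : Fin n ⊕ J) (h : i.isLeft = false) :
    theta (G.v i x - G.m i / r * x.1) x.1 ≠ 0 :=
  (chan_regular hx i).2 (by simp [chan, h])

theorem ite_chan (i : Fin n ⊕ J) (x : Pt l n) (z : ℂ) :
    (if (G.chan i x).isZero then z else 0) = ind i * z := by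
  rcases i with i | i <;> simp [chan, ind]

section

variable {x : Pt l n} (hr : 0 < r) (hx : x ∈ G.reg)
include hr hx

/-- The addition identities need arguments that are exact differences of site coordinates. Principal
logarithms of ratios provide this only modulo `r`, a period of the kernels. -/
theorem exists_zOf_ratio (a b : Fin l) : ∃ k : ℤ,
    zOf r (x.2.1 a / x.2.1 b) = zOf r (x.2.1 a) - zOf r (x.2.1 b) + r * k :=
  exists_eq_zOf_add hr (ee_zOf_sub hr (hx.2.1 a) (hx.2.1 b))

theorem theta_sub_ne {a b : Fin l} (hab : a ≠ b) :
    theta (zOf r (x.2.1 a) - zOf r (x.2.1 b)) x.1 ≠ 0 :=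
  theta_zOf_ne_zero hr hx.1 (ee_zOf_sub hr (hx.2.1 a) (hx.2.1 b)) (hx.2.2.1 a b hab)

theorem theta_ratio_ne {a b : Fin l} (hab : a ≠ b) :
    theta (zOf r (x.2.1 a / x.2.1 b)) x.1 ≠ 0 :=
  theta_zOf_ne_zero hr hx.1 (ee_zOf hr (div_ne_zero (hx.2.1 a) (hx.2.1 b))) (hx.2.2.1 a b hab)

theorem kapF_eq (a b : Fin l) (i : Fin n ⊕ J) :
    G.kapF a b i x = kap (G.chan i x) (zOf r (x.2.1 a) - zOf r (x.2.1 b)) x.1 := by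
  obtain ⟨k, hk⟩ := exists_zOf_ratio hr hx a b
  rw [kapF, hk, kap_add_period (chan_torsion hr i x)]

theorem dkapF_eq (a b : Fin l) (i : Fin n ⊕ J) :
    G.dkapF a b i x = dkap (G.chan i x) (zOf r (x.2.1 a) - zOf r (x.2.1 b)) x.1 := by
  obtain ⟨k, hk⟩ := exists_zOf_ratio hr hx a b
  rw [dkapF, hk, dkap_add_period (chan_torsion hr i x)]

theorem ddkapF_eq (a b : Fin l) (i : Fin n ⊕ J) :
    G.ddkapF a b i x = ddkap (G.chan i x) (zOf r (x.2.1 a) - zOf r (x.2.1 b)) x.1 := by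
  obtain ⟨k, hk⟩ := exists_zOf_ratio hr hx a b
  rw [ddkapF, hk, ddkap_add_period (chan_torsion hr i x)]

theorem zkapF_star (a b : Fin l) (i : Fin n ⊕ J) :
    G.zkapF b a (P.star i) x = G.zkapF a b i x := by
  obtain ⟨k, hk⟩ := exists_zOf_ratio hr hx a b
  obtain ⟨k', hk'⟩ := exists_zOf_ratio hr hx b a
  rw [zkapF, zkapF, hk, hk', zkap_add_period (chan_torsion hr i x),
    zkap_add_period (chan_torsion hr _ x), zkap_opp (chan_opp hr i x), neg_sub]

theorem zdkapF_star (a b : Fin l) (i : Fin n ⊕ J) :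
    G.zdkapF b a (P.star i) x = -G.zdkapF a b i x := by
  obtain ⟨k, hk⟩ := exists_zOf_ratio hr hx a b
  obtain ⟨k', hk'⟩ := exists_zOf_ratio hr hx b a
  rw [zdkapF, zdkapF, hk, hk', zdkap_add_period (chan_torsion hr i x),
    zdkap_add_period (chan_torsion hr _ x), zdkap_opp (chan_opp hr i x), neg_sub]

/-- The values of the coefficient functions at a regular point. -/
def coeffs : P.Coeffs where
  κ a b i := G.kapF a b i x
  g a b i := G.dkapF a b i x
  g2 a b i := G.ddkapF a b i x
  e i := G.ekapF i x
  e' i := G.dekapF i x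
  κ_star _ i := by
    rw [kapF_eq hr hx, kapF_eq hr hx, kap_opp (chan_opp hr i x), neg_sub]
  g_star _ i := by
    rw [dkapF_eq hr hx, dkapF_eq hr hx, dkap_opp (chan_opp hr i x), neg_sub]
  g2_star _ i := by
    rw [ddkapF_eq hr hx, ddkapF_eq hr hx, ddkap_opp (chan_opp hr i x), neg_sub]
  e_star i := ekap_opp hx.1 (chan_opp hr i x) (chan_regular hx i)
  e'_star i := dekap_opp hx.1 (chan_opp hr i x) (chan_regular hx i)
  κ_fay {a b c} hab hac hbc i j k hC := by
    simp only [kapF_eq hr hx, dkapF_eq hr hx]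
    rw [kap_identity hx.1 (chan_sum hr hC x) (chan_regular hx i) (chan_regular hx j)
      (chan_regular hx k) (theta_sub_ne hr hx hab) (theta_sub_ne hr hx hac)
      (theta_sub_ne hr hx hbc), ite_chan, ite_chan, ite_chan]
  g_fay {a b c} hab hac hbc i j k hC := by
    simp only [kapF_eq hr hx, dkapF_eq hr hx, ddkapF_eq hr hx]
    rw [dkap_identity hx.1 (chan_sum hr hC x) (chan_regular hx i) (chan_regular hx j)
      (chan_regular hx k) (theta_sub_ne hr hx hab) (theta_sub_ne hr hx hac)
      (theta_sub_ne hr hx hbc), ite_chan, ite_chan, ite_chan]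
  e_fay {a c} hac i j k hC := by
    simp only [kapF, dkapF, ddkapF, ekapF, dekapF]
    rw [ekap_identity hx.1 (chan_sum hr hC x) (chan_opp hr i x) (chan_regular hx i)
      (chan_regular hx j) (chan_regular hx k) (theta_ratio_ne hr hx hac), ite_chan,
      ite_chan, ite_chan, mul_neg]

end

end

end Grading
end Frame
end TwistedKZB
end

/-! ### Coordinates and coordinate vectors on the base. -/

noncomputable section
namespace TwistedKZB
open Complex Metric Set Filter Topology

section

variable {l n : ℕ}

/-- The coordinate `t_a`. -/
def prT (a : Fin l) : Pt l n →L[ℂ] ℂ :=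
  (ContinuousLinearMap.proj a).comp
    ((ContinuousLinearMap.fst ℂ (Fin l → ℂ) (Fin n → ℂ)).comp (ContinuousLinearMap.snd ℂ ℂ _))

/-- The coordinate `u_k`. -/
def prU (k : Fin n) : Pt l n →L[ℂ] ℂ :=
  (ContinuousLinearMap.proj k).comp
    ((ContinuousLinearMap.snd ℂ (Fin l → ℂ) (Fin n → ℂ)).comp (ContinuousLinearMap.snd ℂ ℂ _))

/-- The coordinate `τ`. -/
def prTau : Pt l n →L[ℂ] ℂ := ContinuousLinearMap.fst ℂ ℂ _

theorem prT_apply (a : Fin l) (x : Pt l n) : prT a x = x.2.1 a := rfl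

theorem prU_apply (k : Fin n) (x : Pt l n) : prU k x = x.2.2 k := rfl

def vecT (a : Fin l) : Pt l n := (0, Pi.single a 1, 0)

def vecU (k : Fin n) : Pt l n := (0, 0, Pi.single k 1)

def vecTau : Pt l n := (1, 0, 0)

theorem prTau_vecT (a : Fin l) : prTau (vecT a : Pt l n) = 0 := rfl

theorem prTau_vecU (k : Fin n) : prTau (vecU k : Pt l n) = 0 := rfl

theorem prTau_vecTau : prTau (vecTau : Pt l n) = 1 := rfl

end

namespace Frame.Grading

variable {R J : Type*} {l n : ℕ} [Ring R] [Algebra ℂ R] [Fintype J]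
  {P : Frame R (Fin l) J n} {r : ℕ} {G : P.Grading r}

/-! ### Derivatives of the coefficient functions -/

def vL (P : Frame R (Fin l) J n) (i : Fin n ⊕ J) : Pt l n →L[ℂ] ℂ := -∑ k, P.w k i • prU k

def zL (r : ℕ) (a b : Fin l) (x : Pt l n) : Pt l n →L[ℂ] ℂ :=
  ((r : ℂ) / (2 * Real.pi * I)) • ((x.2.1 a)⁻¹ • prT a - (x.2.1 b)⁻¹ • prT b)

theorem hasFDerivAt_v (i : Fin n ⊕ J) (x : Pt l n) : HasFDerivAt (G.v i) (vL P i) x := by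
  have h : HasFDerivAt (fun y : Pt l n => G.v0 i + vL P i y) (vL P i) x :=
    (vL P i).hasFDerivAt.const_add _
  convert! h using 2 with y
  simp [v, vL, prU_apply, sub_eq_add_neg]

theorem analyticAt_v (i : Fin n ⊕ J) (x : Pt l n) : AnalyticAt ℂ (G.v i) x := by
  have h : AnalyticAt ℂ (fun y : Pt l n => G.v0 i + vL P i y) x :=
    analyticAt_const.add ((vL P i).analyticAt x)
  convert! h using 2 with y
  simp [v, vL, prU_apply, sub_eq_add_neg]

theorem analyticAt_arg (i : Fin n ⊕ J) (x : Pt l n) :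
    AnalyticAt ℂ (fun y => G.v i y - G.m i / r * y.1) x :=
  (analyticAt_v i x).sub (analyticAt_const.mul (prTau.analyticAt x))

theorem exists_branch (hr : 0 < r) {x : Pt l n} (hx : x ∈ G.reg) (a b : Fin l) :
    ∃ z : Pt l n → ℂ, z x = zOf r (x.2.1 a / x.2.1 b) ∧ AnalyticAt ℂ z x ∧
      HasFDerivAt z (zL r a b x) x ∧
      ∀ᶠ y in 𝓝 x, ∃ k : ℤ, zOf r (y.2.1 a / y.2.1 b) = z y + r * k := by
  have h := exists_zOf_branch hr ((prT a).analyticAt x) ((prT b).analyticAt x) (hx.2.1 a) (hx.2.1 b)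
  simpa only [ContinuousLinearMap.fderiv, prT_apply, zL] using h

section

variable {x : Pt l n} (hr : 0 < r) (hx : x ∈ G.reg) {a b : Fin l}
include hr hx

theorem hasFDerivAt_kapF (hab : a ≠ b) (i : Fin n ⊕ J) :
    AnalyticAt ℂ (G.kapF a b i) x ∧ HasFDerivAt (G.kapF a b i)
      ((if i.isLeft then 0 else G.dkapF a b i x) • vL P i + G.zkapF a b i x • zL r a b x +
        (G.zdkapF a b i x / (2 * Real.pi * I)) • prTau) x := by
  obtain ⟨z, hz, hza, hzd, he⟩ := exists_branch hr hx a b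
  have h2 := theta_ratio_ne hr hx hab
  have e : G.kapF a b i =ᶠ[𝓝 x] fun y => kap ⟨i.isLeft, G.m i / r, G.v i y - G.m i / r * y.1⟩
      (z y) y.1 := by
    filter_upwards [he] with y ⟨k, hk⟩
    rw [kapF, hk, kap_add_period (chan_torsion hr i y)]
    rfl
  rw [← hz] at h2
  refine ⟨(analyticAt_kap_comp (analyticAt_arg i x) hza (prTau.analyticAt x) hx.1
    (chan_ne hx i) h2).congr e.symm, ?_⟩
  have h := (hasFDerivAt_kap_comp (hasFDerivAt_v i x) hzd (prTau.hasFDerivAt (x := x)) hx.1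
    (chan_ne hx i) h2).congr_of_eventuallyEq e
  rw [hz] at h
  exact h

theorem hasFDerivAt_dkapF (hab : a ≠ b) (i : Fin n ⊕ J) :
    AnalyticAt ℂ (G.dkapF a b i) x ∧ ∃ C : ℂ, HasFDerivAt (G.dkapF a b i)
      (G.ddkapF a b i x • vL P i + G.zdkapF a b i x • zL r a b x + C • prTau) x := by
  obtain ⟨z, hz, hza, hzd, he⟩ := exists_branch hr hx a b
  have h2 := theta_ratio_ne hr hx hab
  have e : G.dkapF a b i =ᶠ[𝓝 x] fun y => dkap ⟨i.isLeft, G.m i / r, G.v i y - G.m i / r * y.1⟩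
      (z y) y.1 := by
    filter_upwards [he] with y ⟨k, hk⟩
    rw [dkapF, hk, dkap_add_period (chan_torsion hr i y)]
    rfl
  rw [← hz] at h2
  refine ⟨(analyticAt_dkap_comp (analyticAt_arg i x) hza (prTau.analyticAt x) hx.1
    (chan_ne hx i) h2).congr e.symm, ?_⟩
  obtain ⟨C, h⟩ := hasFDerivAt_dkap_comp (hasFDerivAt_v i x) hzd (prTau.hasFDerivAt (x := x)) hx.1
    (chan_ne hx i) h2
  refine ⟨C, ?_⟩
  have h' := h.congr_of_eventuallyEq e
  rw [hz] at h'
  exact h'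

omit hr in
theorem hasFDerivAt_ekapF (i : Fin n ⊕ J) :
    AnalyticAt ℂ (G.ekapF i) x ∧ ∃ C : ℂ, HasFDerivAt (G.ekapF i)
      (G.dekapF i x • vL P i + C • prTau) x :=
  ⟨analyticAt_ekap_comp (analyticAt_arg i x) (prTau.analyticAt x) hx.1 (chan_ne hx i),
    hasFDerivAt_ekap_comp (hasFDerivAt_v i x) (prTau.hasFDerivAt (x := x)) hx.1 (chan_ne hx i)⟩

end

theorem vL_vecU (i : Fin n ⊕ J) (k : Fin n) : vL P i (vecU k) = -P.w k i := by
  simp [vL, vecU, prU_apply, Pi.single_apply]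

theorem vL_vecT (i : Fin n ⊕ J) (a : Fin l) : vL P i (vecT a) = 0 := by
  simp [vL, vecT, prU_apply]

theorem vL_vecTau (i : Fin n ⊕ J) : vL P i vecTau = 0 := by
  simp [vL, vecTau, prU_apply]

theorem zL_vecU (a b : Fin l) (x : Pt l n) (k : Fin n) : zL r a b x (vecU k) = 0 := by
  simp [zL, vecU, prT_apply]

theorem zL_vecTau (a b : Fin l) (x : Pt l n) : zL r a b x vecTau = 0 := by
  simp [zL, vecTau, prT_apply]

theorem zL_vecT_left {a b : Fin l} (hab : a ≠ b) (x : Pt l n) :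
    zL r a b x (vecT a) = r / (2 * Real.pi * I) * (x.2.1 a)⁻¹ := by
  simp [zL, vecT, prT_apply, hab.symm]

theorem zL_vecT_right {a b : Fin l} (hab : a ≠ b) (x : Pt l n) :
    zL r a b x (vecT b) = -(r / (2 * Real.pi * I) * (x.2.1 b)⁻¹) := by
  simp [zL, vecT, prT_apply, hab]

theorem zL_vecT_of_ne {a b c : Fin l} (ha : c ≠ a) (hb : c ≠ b) (x : Pt l n) :
    zL r a b x (vecT c) = 0 := by
  simp [zL, vecT, prT_apply, ha.symm, hb.symm]

section

variable {x : Pt l n} (hr : 0 < r) (hx : x ∈ G.reg) {a b : Fin l}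
include hr hx

theorem D_vecU_kapF (hab : a ≠ b) (i : Fin n ⊕ J) (k : Fin n) :
    D (vecU k) (G.kapF a b i) x = -(P.w k i * G.dkapF a b i x) := by
  rw [D, (hasFDerivAt_kapF hr hx hab i).2.fderiv]
  -- For a member of `𝔥₀` both sides vanish: the kernel does not depend on `u`, and the weight is
  -- `0`. This makes the formula uniform although `dkap` is not the derivative of `kap` there.
  rcases i with i | i
  · simp [zL_vecU, w_inl, prTau_vecU]
  · simp [vL_vecU, zL_vecU, prTau_vecU, mul_comm]

theorem D_vecU_dkapF (hab : a ≠ b) (i : Fin n ⊕ J) (k : Fin n) :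
    D (vecU k) (G.dkapF a b i) x = -(P.w k i * G.ddkapF a b i x) := by
  obtain ⟨C, h⟩ := (hasFDerivAt_dkapF hr hx hab i).2
  rw [D, h.fderiv]
  simp [vL_vecU, zL_vecU, prTau_vecU, mul_comm]

omit hr in
theorem D_vecU_ekapF (i : Fin n ⊕ J) (k : Fin n) :
    D (vecU k) (G.ekapF i) x = -(P.w k i * G.dekapF i x) := by
  obtain ⟨C, h⟩ := (hasFDerivAt_ekapF hx i).2
  rw [D, h.fderiv]
  simp [vL_vecU, prTau_vecU, mul_comm]

theorem D_vecTau_kapF (hab : a ≠ b) (i : Fin n ⊕ J) :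
    D vecTau (G.kapF a b i) x = G.zdkapF a b i x / (2 * Real.pi * I) := by
  rw [D, (hasFDerivAt_kapF hr hx hab i).2.fderiv]
  simp only [add_apply, smul_apply, vL_vecTau, zL_vecTau, prTau_vecTau, smul_eq_mul]
  ring

theorem D_vecT_kapF_right (hab : a ≠ b) (i : Fin n ⊕ J) :
    x.2.1 b * D (vecT b) (G.kapF a b i) x = -(r / (2 * Real.pi * I) * G.zkapF a b i x) := by
  have h0 := hx.2.1 b
  rw [D, (hasFDerivAt_kapF hr hx hab i).2.fderiv]
  simp only [add_apply, smul_apply, vL_vecT, zL_vecT_right hab, prTau_vecT, smul_eq_mul]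
  linear_combination -(r / (2 * Real.pi * I) * G.zkapF a b i x) * mul_inv_cancel₀ h0

theorem D_vecT_kapF_of_ne (hab : a ≠ b) {c : Fin l} (ha : c ≠ a) (hb : c ≠ b) (i : Fin n ⊕ J) :
    D (vecT c) (G.kapF a b i) x = 0 := by
  rw [D, (hasFDerivAt_kapF hr hx hab i).2.fderiv]
  simp only [add_apply, smul_apply, vL_vecT, zL_vecT_of_ne ha hb, prTau_vecT, smul_eq_mul, mul_zero, add_zero]

theorem D_vecT_dkapF_left (hab : a ≠ b) (i : Fin n ⊕ J) :
    x.2.1 a * D (vecT a) (G.dkapF a b i) x = r / (2 * Real.pi * I) * G.zdkapF a b i x := by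
  have h0 := hx.2.1 a
  obtain ⟨C, h⟩ := (hasFDerivAt_dkapF hr hx hab i).2
  rw [D, h.fderiv]
  simp only [add_apply, smul_apply, vL_vecT, zL_vecT_left hab, prTau_vecT, smul_eq_mul]
  linear_combination (r / (2 * Real.pi * I) * G.zdkapF a b i x) * mul_inv_cancel₀ h0

theorem D_vecT_dkapF_right (hab : a ≠ b) (i : Fin n ⊕ J) :
    x.2.1 b * D (vecT b) (G.dkapF a b i) x = -(r / (2 * Real.pi * I) * G.zdkapF a b i x) := by
  have h0 := hx.2.1 b
  obtain ⟨C, h⟩ := (hasFDerivAt_dkapF hr hx hab i).2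
  rw [D, h.fderiv]
  simp only [add_apply, smul_apply, vL_vecT, zL_vecT_right hab, prTau_vecT, smul_eq_mul]
  linear_combination -(r / (2 * Real.pi * I) * G.zdkapF a b i x) * mul_inv_cancel₀ h0

theorem D_vecT_dkapF_of_ne (hab : a ≠ b) {c : Fin l} (ha : c ≠ a) (hb : c ≠ b) (i : Fin n ⊕ J) :
    D (vecT c) (G.dkapF a b i) x = 0 := by
  obtain ⟨C, h⟩ := (hasFDerivAt_dkapF hr hx hab i).2
  rw [D, h.fderiv]
  simp only [add_apply, smul_apply, vL_vecT, zL_vecT_of_ne ha hb, prTau_vecT, smul_eq_mul, mul_zero, add_zero]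

omit hr in
theorem D_vecT_ekapF (c : Fin l) (i : Fin n ⊕ J) : D (vecT c) (G.ekapF i) x = 0 := by
  obtain ⟨C, h⟩ := (hasFDerivAt_ekapF hx i).2
  rw [D, h.fderiv]
  simp only [add_apply, smul_apply, vL_vecT, prTau_vecT, smul_eq_mul, mul_zero, add_zero]

end

end Frame.Grading
end TwistedKZB
end

noncomputable section
namespace TwistedKZB
open Complex Metric Set Filter Topology

/-! ### The connection attached to a graded frame -/

/-- A symmetric double sum supported on the pairs that contain `a` exactly once. -/
theorem half_sum_sum {S M : Type*} [Fintype S] [DecidableEq S] [AddCommGroup M] [Module ℂ M]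
    (a : S) (f : S → S → M) (h0 : f a a = 0) (h1 : ∀ b d, b ≠ a → d ≠ a → f b d = 0)
    (h2 : ∀ b, b ≠ a → f b a = f a b) :
    (1 / 2 : ℂ) • ∑ b, ∑ d, f b d = ∑ d ∈ Finset.univ.erase a, f a d := by
  have e1 : ∀ b ∈ Finset.univ.erase a, ∑ d, f b d = f a b := fun b hb => by
    rw [← h2 b (Finset.ne_of_mem_erase hb)]
    exact Finset.sum_eq_single_of_mem a (Finset.mem_univ a) fun d _ hd =>
      h1 b d (Finset.ne_of_mem_erase hb) hd
  rw [← Finset.add_sum_erase _ _ (Finset.mem_univ a), Finset.sum_congr rfl e1,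
    ← Finset.add_sum_erase _ (f a) (Finset.mem_univ a), h0]
  module

namespace Frame

section

variable {W S J : Type*} {n : ℕ} [NormedAddCommGroup W] [NormedSpace ℂ W] [Fintype J]
  {P : Frame (W →L[ℂ] W) S J n} {E : Type*} [NormedAddCommGroup E] [NormedSpace ℂ E]
  {f : Fin n ⊕ J → E → ℂ} {x : E}

theorem analyticAt_op (a b : S) (hf : ∀ i, AnalyticAt ℂ (f i) x) :
    AnalyticAt ℂ (fun y => P.op a b fun i => f i y) x :=
  Finset.analyticAt_fun_sum _ fun i _ => (hf i).smul analyticAt_const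

theorem D_op (a b : S) (v : E) (hf : ∀ i, AnalyticAt ℂ (f i) x) :
    D v (fun y => P.op a b fun i => f i y) x = P.op a b fun i => D v (f i) x := by
  unfold op
  rw [D_sum (F := fun i y => f i y • (P.Y a i * P.Y b (P.star i))) _ v fun i _ =>
    (hf i).fun_smul analyticAt_const]
  exact Finset.sum_congr rfl fun i _ => D_smul_const v (hf i) _

end

namespace Grading

variable {W J : Type*} {l n : ℕ} [NormedAddCommGroup W] [NormedSpace ℂ W] [Fintype J]
  {P : Frame (W →L[ℂ] W) (Fin l) J n} {r : ℕ} (G : P.Grading r)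

/-- The factor `r / 2πi` common to `∂̂^a` and the r-matrix is put into `c1`, so `M` carries the bare
kernels. -/
def conn : ConnData (Pt l n) W (Fin l) n where
  t := prT
  vT := vecT
  vU := vecU
  v0 := vecTau
  t_vT h := by simp [prT_apply, vecT, h]
  t_vU _ _ := by simp [prT_apply, vecU]
  t_v0 _ := by simp [prT_apply, vecTau]
  c1 := r / (2 * Real.pi * I)
  c0 := 2 * Real.pi * I
  Y a k := P.Y a (Sum.inl k)
  M a x := ∑ c ∈ Finset.univ.erase a, P.op a c fun i => G.kapF a c i x
  N x := (1 / 2 : ℂ) • ∑ b, ∑ d, P.op b d fun i => G.gF b d i x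

variable {G} {x : Pt l n} (hr : 0 < r)

section
variable (hx : x ∈ G.reg)
include hr hx

theorem analyticAt_gF (b d : Fin l) (i : Fin n ⊕ J) : AnalyticAt ℂ (G.gF b d i) x := by
  by_cases h : b = d
  · rw [h, gF_self]
    exact (hasFDerivAt_ekapF hx i).1
  · rw [gF_of_ne _ h]
    exact (hasFDerivAt_dkapF hr hx h i).1

theorem analyticAt_conn_M (a : Fin l) : AnalyticAt ℂ (G.conn.M a) x :=
  ConnData.analyticAt_sum (f := fun c y => P.op a c fun i => G.kapF a c i y)
    (Finset.univ.erase a) fun c hc =>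
    analyticAt_op a c fun i => (hasFDerivAt_kapF hr hx (Finset.ne_of_mem_erase hc).symm i).1

theorem analyticAt_conn_N : AnalyticAt ℂ G.conn.N x :=
  analyticAt_const_smul _ (ConnData.analyticAt_sum _ fun b _ => ConnData.analyticAt_sum _ fun d _ =>
    analyticAt_op b d (analyticAt_gF hr hx b d))

theorem D_conn_M (a : Fin l) (v : Pt l n) : D v (G.conn.M a) x =
    ∑ c ∈ Finset.univ.erase a, P.op a c fun i => D v (G.kapF a c i) x := by
  have h : ∀ c ∈ Finset.univ.erase a, ∀ i, AnalyticAt ℂ (G.kapF a c i) x := fun c hc i =>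
    (hasFDerivAt_kapF hr hx (Finset.ne_of_mem_erase hc).symm i).1
  refine (D_sum _ v fun c hc => analyticAt_op _ _ (h c hc)).trans ?_
  exact Finset.sum_congr rfl fun c hc => D_op _ _ _ (h c hc)

theorem D_conn_N (v : Pt l n) : D v G.conn.N x =
    (1 / 2 : ℂ) • ∑ b, ∑ d, P.op b d fun i => D v (G.gF b d i) x := by
  have h := fun b d => analyticAt_op (P := P) b d (analyticAt_gF hr hx b d)
  refine (D_const_smul v _ (ConnData.analyticAt_sum _ fun b _ => ConnData.analyticAt_sum _ fun d _ => h b d)).trans ?_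
  rw [D_sum _ v fun b _ => ConnData.analyticAt_sum _ fun d _ => h b d]
  congr 1
  refine Finset.sum_congr rfl fun b _ => ?_
  rw [D_sum _ v fun d _ => h b d]
  exact Finset.sum_congr rfl fun d _ => D_op b d v (analyticAt_gF hr hx b d)

theorem D_vecU_conn_M (a : Fin l) (k : Fin n) : D (vecU k) (G.conn.M a) x =
    -∑ c ∈ Finset.univ.erase a, P.op a c fun i => P.w k i * G.dkapF a c i x := by
  rw [D_conn_M hr hx, ← Finset.sum_neg_distrib]
  refine Finset.sum_congr rfl fun c hc => ?_
  rw [← op_neg]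
  congr 1
  funext i
  exact D_vecU_kapF hr hx (Finset.ne_of_mem_erase hc).symm i k

theorem D_vecU_conn_N (k : Fin n) : D (vecU k) G.conn.N x =
    -(1 / 2 : ℂ) • ∑ b, ∑ d, P.op b d fun i => P.w k i * (coeffs hr hx).g2All b d i := by
  rw [D_conn_N hr hx, neg_smul, ← smul_neg, ← Finset.sum_neg_distrib]
  congr 1
  refine Finset.sum_congr rfl fun b _ => ?_
  rw [← Finset.sum_neg_distrib]
  refine Finset.sum_congr rfl fun d _ => ?_
  rw [← op_neg]
  congr 1
  funext i
  by_cases h : b = d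
  · subst h
    rw [Coeffs.g2All_self, gF_self]
    exact D_vecU_ekapF hx i k
  · rw [Coeffs.g2All_of_ne _ h, gF_of_ne _ h]
    exact D_vecU_dkapF hr hx h i k

theorem conn_M_eq (a : Fin l) : G.conn.M a x = (coeffs hr hx).M a := rfl

theorem conn_N_eq : G.conn.N x = (coeffs hr hx).N := by
  simp only [conn, Coeffs.N]
  congr 1
  refine Finset.sum_congr rfl fun b _ => Finset.sum_congr rfl fun d _ => ?_
  congr 1
  funext i
  by_cases h : b = d <;> simp [gF, Coeffs.gAll, h, coeffs]

theorem smul_D_vecT_conn_M {a b : Fin l} (hab : a ≠ b) :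
    G.conn.t a x • D (vecT a) (G.conn.M b) x =
      -((r : ℂ) / (2 * Real.pi * I)) • P.op a b fun i => G.zkapF a b i x := by
  have hne : ∀ c ∈ Finset.univ.erase b, c ≠ a →
      (P.op b c fun i => D (vecT a) (G.kapF b c i) x) = 0 := fun c hc hca => by
    simp only [D_vecT_kapF_of_ne hr hx (Finset.ne_of_mem_erase hc).symm hab hca.symm]
    simp [op]
  rw [D_conn_M hr hx, Finset.sum_eq_single_of_mem a
    (Finset.mem_erase.2 ⟨hab, Finset.mem_univ a⟩) hne, ← op_smul, ← op_smul]
  refine P.op_swap hab fun i => ?_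
  simp only [Pi.smul_apply, smul_eq_mul]
  rw [← zkapF_star hr hx, neg_mul]
  exact D_vecT_kapF_right hr hx hab.symm (P.star i)

theorem smul_D_vecT_conn_N (a : Fin l) : G.conn.t a x • D (vecT a) G.conn.N x =
    ((r : ℂ) / (2 * Real.pi * I)) •
      ∑ c ∈ Finset.univ.erase a, P.op a c fun i => G.zdkapF a c i x := by
  have e : ∀ b d, (fun i => D (vecT a) (G.gF b d i) x) =
      fun i => if b = d then 0 else D (vecT a) (G.dkapF b d i) x := fun b d => by
    funext i
    by_cases h : b = d
    · rw [h, gF_self, if_pos rfl]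
      exact D_vecT_ekapF hx a i
    · rw [gF_of_ne _ h, if_neg h]
  have hz : ∀ b d, (P.op b d fun _ => 0) = 0 := fun b d => by simp [op]
  rw [D_conn_N hr hx, smul_comm]
  simp only [e, Finset.smul_sum (r := G.conn.t a x)]
  rw [half_sum_sum a]
  · rw [Finset.smul_sum]
    refine Finset.sum_congr rfl fun c hc => ?_
    have hac := (Finset.ne_of_mem_erase hc).symm
    rw [← op_smul, ← op_smul]
    congr 1
    funext i
    simp only [hac, if_false]
    exact D_vecT_dkapF_left hr hx hac i
  · simp [hz]
  · intro b d hb hd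
    by_cases h : b = d
    · simp [h, hz]
    · simp only [h, if_false, D_vecT_dkapF_of_ne hr hx h hb.symm hd.symm, hz, smul_zero]
  · intro b hb
    rw [← op_smul, ← op_smul]
    refine P.op_swap hb.symm fun i => ?_
    simp only [Pi.smul_apply, hb, hb.symm, if_false]
    refine (D_vecT_dkapF_right hr hx hb (P.star i)).trans ?_
    rw [zdkapF_star hr hx, mul_neg, neg_neg]
    exact (D_vecT_dkapF_left hr hx hb.symm i).symm

/-- The mixed heat equation for the coefficients. The same sum appears in `smul_D_vecT_conn_N`,
since `t_a ∂_{t_a}` acts on functions of `z_{ac}` as `(r / 2πi) ∂_z`. -/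
theorem D_vecTau_conn_M (a : Fin l) : D vecTau (G.conn.M a) x = (2 * Real.pi * I : ℂ)⁻¹ •
    ∑ c ∈ Finset.univ.erase a, P.op a c fun i => G.zdkapF a c i x := by
  rw [D_conn_M hr hx, Finset.smul_sum]
  refine Finset.sum_congr rfl fun c hc => ?_
  rw [← op_smul]
  congr 1
  funext i
  rw [D_vecTau_kapF hr hx (Finset.ne_of_mem_erase hc).symm, div_eq_inv_mul]
  rfl

theorem inl_bracket_conn_M {a b : Fin l} (hab : a ≠ b) (k : Fin n) :
    ⁅P.Y a (Sum.inl k), G.conn.M b x⁆ = -P.op a b fun i => P.w k i * G.kapF a b i x := by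
  rw [conn_M_eq hr hx, Coeffs.M, bracket_sum, Finset.sum_eq_single_of_mem a
    (Finset.mem_erase.2 ⟨hab, Finset.mem_univ a⟩)]
  · rw [Ring.lie_def, P.inl_op_right hab.symm, P.op_swap hab]
    intro i
    rw [P.w_star, (coeffs hr hx).κ_star hab, neg_mul_neg]
    rfl
  · intro c hc hca
    exact P.inl_op_of_ne hab hca.symm k _

theorem inl_bracket_conn_M_self (a b : Fin l) (hab : a ≠ b) (k : Fin n) :
    ⁅P.Y a (Sum.inl k), G.conn.M b x⁆ = ⁅P.Y b (Sum.inl k), G.conn.M a x⁆ := by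
  rw [inl_bracket_conn_M hr hx hab, inl_bracket_conn_M hr hx hab.symm]
  congr 1
  refine (P.op_swap hab fun i => ?_).symm
  rw [P.w_star, neg_mul]
  have := (coeffs hr hx).κ_star hab i
  change G.kapF b a (P.star i) x = -G.kapF a b i x at this
  rw [this, mul_neg, neg_neg]

/-- Both sides multiply the `i`-th coefficient of `f` by its weight: the left through the adjoint
action of `𝔥₀`, the right through the chain rule. Pairs of sites without `a` commute with `Y a`, and
at the pair `(a, a)` opposite weights cancel. -/
theorem inl_bracket_conn_N (a : Fin l) (k : Fin n) :
    ⁅P.Y a (Sum.inl k), G.conn.N x⁆ = -D (vecU k) (G.conn.M a) x := by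
  rw [D_vecU_conn_M hr hx, neg_neg, conn_N_eq hr hx, Coeffs.N, bracket_smul, bracket_sum]
  simp only [bracket_sum]
  rw [half_sum_sum a]
  · refine Finset.sum_congr rfl fun c hc => ?_
    have hac := (Finset.ne_of_mem_erase hc).symm
    rw [Ring.lie_def, P.inl_op_left hac, Coeffs.gAll_of_ne _ hac]
    rfl
  · exact P.inl_op_self a k _
  · intro b d hb hd
    exact P.inl_op_of_ne hb.symm hd.symm k _
  · intro b hb
    rw [Ring.lie_def, Ring.lie_def, P.inl_op_right hb, P.inl_op_left hb.symm, Coeffs.gAll_of_ne _ hb,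
      Coeffs.gAll_of_ne _ hb.symm, ← op_neg]
    refine P.op_swap hb.symm fun i => ?_
    simp only [Pi.neg_apply]
    rw [P.w_star, (coeffs hr hx).g_star hb.symm, neg_mul, neg_neg]

end

include hr in
theorem D_D_conn_M (hx : ∀ᶠ y in 𝓝 x, y ∈ G.reg) (a : Fin l) (k : Fin n) :
    D (vecU k) (D (vecU k) (G.conn.M a)) x =
      ∑ c ∈ Finset.univ.erase a, P.op a c fun i => P.w k i * P.w k i * (G.ddkapF a c i x) := by
  have e : D (vecU k) (G.conn.M a) =ᶠ[𝓝 x] fun y => -∑ c ∈ Finset.univ.erase a,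
      P.op a c fun i => P.w k i * G.dkapF a c i y := by
    filter_upwards [hx] with y hy
    exact D_vecU_conn_M hr hy a k
  have hx' := hx.self_of_nhds
  have hg : ∀ c ∈ Finset.univ.erase a, ∀ i, AnalyticAt ℂ (G.dkapF a c i) x := fun c hc i =>
    (hasFDerivAt_dkapF hr hx' (Finset.ne_of_mem_erase hc).symm i).1
  have e' : (fun y => -∑ c ∈ Finset.univ.erase a, P.op a c fun i => P.w k i * G.dkapF a c i y) =
      fun y => ∑ c ∈ Finset.univ.erase a, P.op a c fun i => -P.w k i • G.dkapF a c i y := by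
    funext y
    rw [← Finset.sum_neg_distrib]
    refine Finset.sum_congr rfl fun c _ => ?_
    rw [← op_neg]
    congr 1
    funext i
    simp
  have hg' : ∀ c ∈ Finset.univ.erase a, ∀ i, AnalyticAt ℂ (fun y => -P.w k i • G.dkapF a c i y) x :=
    fun c hc i => analyticAt_const_smul _ (hg c hc i)
  rw [D_congr _ e, e', D_sum _ _ fun c hc => analyticAt_op a c (hg' c hc)]
  refine Finset.sum_congr rfl fun c hc => ?_
  rw [D_op a c _ (hg' c hc)]
  congr 1
  funext i
  rw [D_const_smul _ _ (hg c hc i), D_vecU_dkapF hr hx' (Finset.ne_of_mem_erase hc).symm,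
    smul_eq_mul]
  ring

theorem sum_hop_apply (a b : Fin l) (p : Fin n ⊕ J → ℂ) {w : W} (hw : ∀ k, P.tot k w = 0) :
    (∑ s, P.hop s a b p) w = 0 := by
  rw [P.sum_hop, sum_apply]
  refine Finset.sum_eq_zero fun k _ => ?_
  rw [clm_mul_apply, hw, map_zero]

variable [CompleteSpace W] {F : Pt l n → W}

include hr in
theorem conn_nab_comm (hx : x ∈ G.reg) (hF : AnalyticAt ℂ F x) (hw : ∀ k, P.tot k (F x) = 0)
    (a b : Fin l) : G.conn.nab a (G.conn.nab b F) x = G.conn.nab b (G.conn.nab a F) x := by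
  rcases eq_or_ne a b with rfl | hab
  · rfl
  refine ConnData.nab_comm hab (analyticAt_conn_M hr hx a) (analyticAt_conn_M hr hx b) hF
    (fun k m => P.comm hab _ _) ?_ (inl_bracket_conn_M_self hr hx a b hab) ?_
  · refine (smul_D_vecT_conn_M hr hx hab).trans ?_
    refine Eq.trans ?_ (smul_D_vecT_conn_M hr hx hab.symm).symm
    congr 1
    exact (P.op_swap hab (zkapF_star hr hx a b)).symm
  · have h := (coeffs hr hx).commutator_M hab
    have e : ∀ a b : Fin l, ∑ k, P.Y a (Sum.inl k) * D (vecU k) (G.conn.M b) x =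
        -∑ d ∈ Finset.univ.erase b, P.hop a b d fun i => G.dkapF b d i x := fun a b => by
      simp only [D_vecU_conn_M hr hx, P.hop_eq, mul_neg, Finset.mul_sum, Finset.sum_neg_distrib]
      rw [Finset.sum_comm]
    have h' : ⁅G.conn.M a x, G.conn.M b x⁆ - ∑ k, P.Y a (Sum.inl k) * D (vecU k) (G.conn.M b) x +
        ∑ k, P.Y b (Sum.inl k) * D (vecU k) (G.conn.M a) x =
        -∑ s, P.hop s a b ((coeffs hr hx).g a b) := by
      rw [e, e, ← h, sub_neg_eq_add, ← sub_eq_add_neg]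
      rfl
    refine (congrArg (fun L : W →L[ℂ] W => L (F x)) h').trans ?_
    change -((∑ s, P.hop s a b ((coeffs hr hx).g a b)) (F x)) = 0
    rw [sum_hop_apply a b _ hw, neg_zero]

-- Regularity is required in a neighbourhood because the Laplacian of the r-matrix enters: the
-- formula for its first derivative is differentiated once more.
include hr in
theorem conn_nab_nabT_comm (hx : ∀ᶠ y in 𝓝 x, y ∈ G.reg) (hF : AnalyticAt ℂ F x)
    (hw : ∀ k, P.tot k (F x) = 0) (a : Fin l) :
    G.conn.nab a (G.conn.nabT F) x = G.conn.nabT (G.conn.nab a F) x := by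
  have hx' := hx.self_of_nhds
  refine ConnData.nab_nabT_comm (analyticAt_conn_M hr hx' a) (analyticAt_conn_N hr hx') hF ?_
    (inl_bracket_conn_N hr hx' a) ?_
  · refine (smul_D_vecT_conn_N hr hx' a).trans ?_
    change _ = ((r : ℂ) / (2 * Real.pi * I) * (2 * Real.pi * I)) • D vecTau (G.conn.M a) x
    rw [D_vecTau_conn_M hr hx', smul_smul, mul_inv_cancel_right₀ two_pi_I_ne_zero']
  · have h := (coeffs hr hx').commutator_M_N a
    have e1 : ∑ k, P.Y a (Sum.inl k) * D (vecU k) G.conn.N x = -(1 / 2 : ℂ) •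
        ∑ b, ∑ d, P.hop a b d ((coeffs hr hx').g2All b d) := by
      simp only [D_vecU_conn_N hr hx', P.hop_eq, mul_smul_comm, ← Finset.smul_sum, Finset.mul_sum]
      congr 1
      rw [Finset.sum_comm]
      refine Finset.sum_congr rfl fun b _ => ?_
      rw [Finset.sum_comm]
    have e2 : ∑ k, D (vecU k) (D (vecU k) (G.conn.M a)) x = ∑ c ∈ Finset.univ.erase a,
        P.op a c fun i => P.sq i * (coeffs hr hx').g2 a c i := by
      simp only [D_D_conn_M hr hx]
      rw [Finset.sum_comm]
      refine Finset.sum_congr rfl fun c _ => ?_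
      simp only [op]
      rw [Finset.sum_comm]
      refine Finset.sum_congr rfl fun i _ => ?_
      rw [← Finset.sum_smul, sq, Finset.sum_mul]
      rfl
    have h' : ⁅G.conn.M a x, G.conn.N x⁆ - ∑ k, P.Y a (Sum.inl k) * D (vecU k) G.conn.N x -
        (1 / 2 : ℂ) • ∑ k, D (vecU k) (D (vecU k) (G.conn.M a)) x =
        (1 / 2 : ℂ) • ∑ c, ∑ s, P.hop s a c ((coeffs hr hx').g2All a c) := by
      rw [e1, e2, ← h, conn_M_eq hr hx', conn_N_eq hr hx']
      module
    refine (congrArg (fun L : W →L[ℂ] W => L (F x)) h').trans ?_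
    rw [smul_apply, sum_apply, Finset.sum_eq_zero fun c _ => sum_hop_apply a c _ hw, smul_zero]

end Grading
end Frame
end TwistedKZB
end

noncomputable section
namespace TwistedKZB
open Complex Metric Set Filter Topology

/-! ### Eigenprojections of a finite order automorphism -/

section

variable {𝔤 : Type*} [LieRing 𝔤] [LieAlgebra ℂ 𝔤]

/-- The projection to the eigenspace of `ν` for the eigenvalue `𝐞(m/r)`. -/
def eigProj (ν : 𝔤 ≃ₗ⁅ℂ⁆ 𝔤) (r : ℕ) (m : ℤ) : 𝔤 →ₗ[ℂ] 𝔤 :=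
  (1 / (r : ℂ)) • ∑ j ∈ Finset.range r, ee (-(j * m) / r) • ν.toLinearEquiv.toLinearMap ^ j

variable {ν : 𝔤 ≃ₗ⁅ℂ⁆ 𝔤} {r : ℕ}

theorem eigProj_apply (m : ℤ) (x : 𝔤) : eigProj ν r m x = (1 / (r : ℂ)) • eigSum ν r m x := by
  simp only [eigProj, eigSum, LinearMap.smul_apply, LinearMap.sum_apply, Module.End.pow_apply]
  rfl

theorem eigSum_eq (hr : 0 < r) (m : ℤ) (x : 𝔤) : eigSum ν r m x = (r : ℂ) • eigProj ν r m x := by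
  have hr' : (r : ℂ) ≠ 0 := by exact_mod_cast hr.ne'
  rw [eigProj_apply, smul_smul, mul_one_div_cancel hr', one_smul]

theorem eigSum_add_period (hr : 0 < r) (m k : ℤ) (x : 𝔤) :
    eigSum ν r (m + r * k) x = eigSum ν r m x := by
  have hr' : (r : ℂ) ≠ 0 := by exact_mod_cast hr.ne'
  refine Finset.sum_congr rfl fun j _ => ?_
  congr 1
  have : (-(j * ((m + r * k : ℤ) : ℂ)) / r : ℂ) = -(j * m) / r + ((-(j * k) : ℤ) : ℂ) := by
    push_cast
    field_simp
    ring
  rw [this, ee_add, ee_intCast, mul_one]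

theorem eigProj_add_period (hr : 0 < r) (m k : ℤ) : eigProj ν r (m + r * k) = eigProj ν r m := by
  ext x
  rw [eigProj_apply, eigProj_apply, eigSum_add_period hr]

theorem map_eigSum (hr : 0 < r) (hν : ∀ x, ν^[r] x = x) (m : ℤ) (x : 𝔤) :
    ν (eigSum ν r m x) = ee (m / r) • eigSum ν r m x := by
  have hr' : (r : ℂ) ≠ 0 := by exact_mod_cast hr.ne'
  have h1 : ∀ j : ℕ, ν (ee (-(j * m) / r) • ν^[j] x) =
      ee (m / r) • (ee (-((j + 1 : ℕ) * m) / r) • ν^[j + 1] x) := fun j => by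
    rw [map_smul, smul_smul, ← ee_add, Function.iterate_succ_apply']
    congr 2
    push_cast
    field_simp
    ring
  rw [eigSum, map_sum, Finset.sum_congr rfl fun j _ => h1 j, ← Finset.smul_sum]
  congr 1
  have h2 := Finset.sum_range_succ' (fun j : ℕ => ee (-(j * m) / r) • ν^[j] x) r
  rw [Finset.sum_range_succ, hν] at h2
  have h3 : ee (-(r * m) / r) = 1 := by
    rw [show (-(r * m) / r : ℂ) = ((-m : ℤ) : ℂ) by push_cast; field_simp, ee_intCast]
  have h4 : ee (-((0 : ℕ) * m) / r) = 1 := by simp [ee]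
  rw [h3, h4, Function.iterate_zero_apply] at h2
  exact (add_right_cancel h2).symm

theorem map_eigProj (hr : 0 < r) (hν : ∀ x, ν^[r] x = x) (m : ℤ) (x : 𝔤) :
    ν (eigProj ν r m x) = ee (m / r) • eigProj ν r m x := by
  rw [eigProj_apply, map_smul, map_eigSum hr hν, smul_comm]

theorem iterate_of_eigen {a : ℂ} {x : 𝔤} (h : ν x = a • x) (j : ℕ) : ν^[j] x = a ^ j • x := by
  induction j with
  | zero => simp
  | succ j ih => rw [Function.iterate_succ_apply', ih, map_smul, h, smul_smul, pow_succ]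

theorem eigProj_of_eigen (hr : 0 < r) {m : ℤ} {x : 𝔤} (h : ν x = ee (m / r) • x) :
    eigProj ν r m x = x := by
  have hr' : (r : ℂ) ≠ 0 := by exact_mod_cast hr.ne'
  have h1 : ∀ j ∈ Finset.range r, ee (-(j * m) / r) • ν^[j] x = x := fun j _ => by
    rw [iterate_of_eigen h, smul_smul, ← ee_natCast_mul, ← ee_add,
      show (-(j * m) / r + j * (m / r) : ℂ) = 0 by ring]
    simp [ee]
  rw [eigProj_apply, eigSum, Finset.sum_congr rfl h1, Finset.sum_const, Finset.card_range,
    ← Nat.cast_smul_eq_nsmul ℂ, smul_smul, one_div_mul_cancel hr', one_smul]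

theorem sum_eigProj (hr : 0 < r) (x : 𝔤) : ∑ m ∈ Finset.range r, eigProj ν r m x = x := by
  have hr' : (r : ℂ) ≠ 0 := by exact_mod_cast hr.ne'
  have h1 : ∀ j ∈ Finset.range r, j ≠ 0 →
      ∑ m ∈ Finset.range r, ee (-(j * m) / r) • ν^[j] x = 0 := fun j hj hj0 => by
    have h2 : ∀ m : ℕ, ee (-(j * m) / r) = ee (-j / r) ^ m := fun m => by
      rw [← ee_natCast_mul]
      ring_nf
    have h3 : ee (-j / r) ≠ 1 := by
      rw [ee, Ne, Complex.exp_eq_one_iff]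
      rintro ⟨k, hk⟩
      have h4 : (-j / r : ℂ) = k := by
        have := two_pi_I_ne_zero'
        apply mul_left_cancel₀ this
        rw [hk, mul_comm]
      rw [div_eq_iff hr'] at h4
      have h5 : (-(j : ℤ)) = k * r := by exact_mod_cast h4
      have h6 : (r : ℤ) ∣ j := ⟨-k, by linarith⟩
      have := Nat.le_of_dvd (Nat.pos_of_ne_zero hj0) (by exact_mod_cast h6)
      rw [Finset.mem_range] at hj
      omega
    have h4 : ee (-j / r) ^ r = 1 := by
      rw [← ee_natCast_mul, show (r * (-j / r) : ℂ) = ((-j : ℤ) : ℂ) by push_cast; field_simp,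
        ee_intCast]
    rw [← Finset.sum_smul, Finset.sum_congr rfl fun m _ => h2 m, geom_sum_eq h3, h4, sub_self,
      zero_div, zero_smul]
  have h0 : ∑ m ∈ Finset.range r, ee (-((0 : ℕ) * m) / r) • ν^[0] x = (r : ℂ) • x := by
    simp [ee, ← Nat.cast_smul_eq_nsmul ℂ]
  simp only [eigProj_apply, eigSum, ← Finset.smul_sum, Int.cast_natCast]
  rw [Finset.sum_comm, Finset.sum_eq_single_of_mem 0 (Finset.mem_range.2 hr) h1, h0, smul_smul,
    one_div_mul_cancel hr', one_smul]

theorem eq_zero_of_ee_smul (hr : 0 < r) {m : ℤ} {z : ℂ} (h : ee (m / r) * z = z) (hz : z ≠ 0) :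
    ∃ k : ℤ, m = r * k := by
  have hr' : (r : ℂ) ≠ 0 := by exact_mod_cast hr.ne'
  have h1 : ee (m / r) = 1 := by
    apply mul_right_cancel₀ hz
    rw [h, one_mul]
  rw [ee, Complex.exp_eq_one_iff] at h1
  obtain ⟨k, hk⟩ := h1
  have h4 : (m / r : ℂ) = k := by
    apply mul_left_cancel₀ two_pi_I_ne_zero'
    rw [hk, mul_comm]
  rw [div_eq_iff hr'] at h4
  exact ⟨k, by rw [mul_comm]; exact_mod_cast h4⟩

section Form

variable {B : 𝔤 →ₗ[ℂ] 𝔤 →ₗ[ℂ] ℂ} (hB : ∀ x y, B (ν x) (ν y) = B x y)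
include hB

theorem form_eigProj_right (hr : 0 < r) {m : ℤ} {x : 𝔤} (h : ν x = ee (m / r) • x) (y : 𝔤) :
    B x (eigProj ν r (-m) y) = B x y := by
  have hr' : (r : ℂ) ≠ 0 := by exact_mod_cast hr.ne'
  have h0 : ∀ j : ℕ, ee (j * (m / r)) * B x (ν^[j] y) = B x y := fun j => by
    induction j with
    | zero => simp [ee]
    | succ j ih =>
      rw [← ih, ← hB x (ν^[j] y), h, map_smul, LinearMap.smul_apply, smul_eq_mul, ← mul_assoc, ← ee_add,
        Function.iterate_succ_apply']
      rw [show ((j + 1 : ℕ) * (m / r) : ℂ) = j * (m / r) + m / r by push_cast; ring]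
  have h1 : ∀ j ∈ Finset.range r, ee (-(j * ((-m : ℤ) : ℂ)) / r) • B x (ν^[j] y) = B x y :=
    fun j _ => by
      rw [← h0 j, smul_eq_mul]
      push_cast
      ring_nf
  rw [eigProj_apply, map_smul, eigSum, map_sum]
  simp only [map_smul]
  rw [Finset.sum_congr rfl h1, Finset.sum_const, Finset.card_range,
    ← Nat.cast_smul_eq_nsmul ℂ, smul_smul, one_div_mul_cancel hr', one_smul]

/-- By invariance the eigenspaces of degrees `m` and `m'` are orthogonal unless `m + m'` is
divisible by `r`, so the adjoint of a projection is the projection to the opposite degree. -/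
theorem form_eigProj (hr : 0 < r) (hν : ∀ x, ν^[r] x = x) (hs : ∀ x y, B x y = B y x) (m : ℤ)
    (x y : 𝔤) : B (eigProj ν r m x) y = B x (eigProj ν r (-m) y) := by
  rw [← form_eigProj_right hB hr (map_eigProj hr hν m x) y, hs x, hs _ (eigProj ν r (-m) y)]
  have h := form_eigProj_right hB hr (map_eigProj hr hν (-m) y) x
  rw [neg_neg] at h
  exact h

end Form

end

/-! ### Expansion in root vectors -/

section

variable {𝔤 : Type*} [LieRing 𝔤] [LieAlgebra ℂ 𝔤] [FiniteDimensional ℂ 𝔤]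
  {H : LieSubalgebra ℂ 𝔤} [H.IsCartanSubalgebra]
  {c : ℂ}

/-- The invariant form. -/
def form (𝔤 : Type*) [LieRing 𝔤] [LieAlgebra ℂ 𝔤] [FiniteDimensional ℂ 𝔤] (c : ℂ) :
    𝔤 →ₗ[ℂ] 𝔤 →ₗ[ℂ] ℂ := c • killingForm ℂ 𝔤

theorem form_apply (x y : 𝔤) : form 𝔤 c x y = c * killingForm ℂ 𝔤 x y := rfl

theorem form_comm (x y : 𝔤) : form 𝔤 c x y = form 𝔤 c y x := by
  rw [form_apply, form_apply, killingForm, LieModule.traceForm_comm]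

theorem form_lie (x y z : 𝔤) : form 𝔤 c ⁅x, y⁆ z = form 𝔤 c x ⁅y, z⁆ := by
  rw [form_apply, form_apply, killingForm, LieModule.traceForm_apply_lie_apply]

theorem form_map (ν : 𝔤 ≃ₗ⁅ℂ⁆ 𝔤) (x y : 𝔤) : form 𝔤 c (ν x) (ν y) = form 𝔤 c x y := by
  rw [form_apply, form_apply, LieAlgebra.killingForm_of_equiv_apply]

theorem form_eq_zero {α β : H → ℂ} {x y : 𝔤} (hx : x ∈ LieAlgebra.rootSpace H α)
    (hy : y ∈ LieAlgebra.rootSpace H β) (h : α + β ≠ 0) : form 𝔤 c x y = 0 := by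
  rw [form_apply, LieAlgebra.killingForm_apply_eq_zero_of_mem_rootSpace_of_add_ne_zero ℂ 𝔤 H hx hy h,
    mul_zero]

omit [FiniteDimensional ℂ 𝔤] in
theorem mem_rootSpace_zero (x : H) : (x : 𝔤) ∈ LieAlgebra.rootSpace H (0 : H → ℂ) :=
  LieAlgebra.toLieSubmodule_le_rootSpace_zero ℂ 𝔤 H x.2

variable [LieAlgebra.IsSimple ℂ 𝔤] {ν : 𝔤 ≃ₗ⁅ℂ⁆ 𝔤} {N n : ℕ}

theorem sum_eps_cartan (A : AdaptedBasis H ν c N n) (x : H) :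
    ∑ k, form 𝔤 c x (A.eps k : 𝔤) • (A.eps k : 𝔤) = x := by
  have h : ∀ k, form 𝔤 c x (A.eps k : 𝔤) = A.eps.repr x k := fun k => by
    conv_lhs => rw [← A.eps.sum_repr x]
    rw [AddSubmonoidClass.coe_finsetSum, map_sum, LinearMap.sum_apply, Finset.sum_eq_single k]
    · rw [Submodule.coe_smul, map_smul, LinearMap.smul_apply, form_apply, A.eps_orthonormal, if_pos rfl,
        smul_eq_mul, mul_one]
    · intro j _ hj
      rw [Submodule.coe_smul, map_smul, LinearMap.smul_apply, form_apply, A.eps_orthonormal, if_neg hj,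
        smul_zero]
    · simp
  conv_rhs => rw [← A.eps.sum_repr x]
  rw [AddSubmonoidClass.coe_finsetSum]
  refine Finset.sum_congr rfl fun k _ => ?_
  rw [h]
  rfl

theorem neg_mem_root {α : LieModule.Weight ℂ H 𝔤} (hα : α ∈ H.root) : -α ∈ H.root := by
  simpa [LieSubalgebra.root] using hα

/-- It suffices to check root spaces and the Cartan subalgebra, which span. Weight spaces pair to
zero unless their weights are opposite, so one term survives on a root space; root spaces are lines
and `E` is normalised. -/
theorem sum_root_vectors (A : AdaptedBasis H ν c N n) (x : 𝔤) :
    ∑ α ∈ H.root, form 𝔤 c x (A.E (-α)) • A.E α + ∑ k, form 𝔤 c x (A.eps k : 𝔤) • (A.eps k : 𝔤) =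
      x := by
  set f : 𝔤 →ₗ[ℂ] 𝔤 := ∑ α ∈ H.root, ((form 𝔤 c).flip (A.E (-α))).smulRight (A.E α) +
    ∑ k, ((form 𝔤 c).flip (A.eps k : 𝔤)).smulRight (A.eps k : 𝔤) with hf
  have hfx : ∀ x, f x = ∑ α ∈ H.root, form 𝔤 c x (A.E (-α)) • A.E α +
      ∑ k, form 𝔤 c x (A.eps k : 𝔤) • (A.eps k : 𝔤) := fun x => by
    simp [hf]
  rw [← hfx]
  have key : ∀ χ : LieModule.Weight ℂ H 𝔤,
      (LieAlgebra.rootSpace H χ).toSubmodule ≤ LinearMap.eqLocus f LinearMap.id := by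
    intro χ y hy
    change f y = y
    rw [hfx]
    by_cases hχ : χ.IsZero
    · have hy' : y ∈ LieAlgebra.rootSpace H (0 : H → ℂ) := by
        have : (χ : H → ℂ) = 0 := hχ
        rwa [this] at hy
      have hyH : y ∈ H := by
        rw [LieAlgebra.rootSpace_zero_eq] at hy'
        exact hy'
      rw [Finset.sum_eq_zero, zero_add]
      · exact sum_eps_cartan A ⟨y, hyH⟩
      · intro α hα
        rw [form_eq_zero hy' (A.E_mem _ (neg_mem_root hα)), zero_smul]
        rw [zero_add]
        have h2 : (-α).IsNonZero := by simpa [LieSubalgebra.root] using hα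
        exact h2
    · have hχ' : χ ∈ H.root := by simpa [LieSubalgebra.root] using hχ
      have h1 : ∑ k, form 𝔤 c y (A.eps k : 𝔤) • (A.eps k : 𝔤) = 0 :=
        Finset.sum_eq_zero fun k _ => by
          rw [form_eq_zero hy (mem_rootSpace_zero (A.eps k)), zero_smul]
          rw [add_zero]
          exact hχ
      have h2 : ∀ α ∈ H.root, α ≠ χ → form 𝔤 c y (A.E (-α)) • A.E α = 0 := fun α hα hne => by
        rw [form_eq_zero hy (A.E_mem _ (neg_mem_root hα)), zero_smul]
        rw [LieModule.Weight.coe_neg, ← sub_eq_add_neg, sub_ne_zero]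
        exact fun h => hne (DFunLike.coe_injective h.symm)
      rw [h1, add_zero, Finset.sum_eq_single_of_mem χ hχ' h2]
      have hE : A.E χ ≠ 0 := fun h => by
        have := A.E_pair χ hχ'
        simp [h] at this
      obtain ⟨s, hs⟩ := (finrank_eq_one_iff_of_nonzero' (⟨A.E χ, A.E_mem χ hχ'⟩ :
        LieAlgebra.rootSpace H χ) (fun h => hE (congrArg Subtype.val h))).1
        (LieAlgebra.IsKilling.finrank_rootSpace_eq_one χ hχ) ⟨y, hy⟩
      have hs' : s • A.E χ = y := congrArg Subtype.val hs
      rw [← hs', map_smul, LinearMap.smul_apply, form_apply, A.E_pair χ hχ', smul_eq_mul, mul_one]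
  have htop : (⊤ : Submodule ℂ 𝔤) ≤ LinearMap.eqLocus f LinearMap.id := by
    have := LieModule.iSup_genWeightSpace_eq_top' ℂ H 𝔤
    rw [← LieSubmodule.toSubmodule_inj, LieSubmodule.iSup_toSubmodule,
      LieSubmodule.top_toSubmodule] at this
    rw [← this]
    exact iSup_le key
  exact htop (Submodule.mem_top (x := x))

end

end TwistedKZB
end

noncomputable section
namespace TwistedKZB
open Complex Metric Set Filter Topology

/-! ### The frame adapted to a diagram automorphism -/

theorem exists_val_neg {r : ℕ} [NeZero r] (m : Fin r) :
    ∃ k : ℤ, (((-m : Fin r) : ℕ) : ℤ) = -((m : ℕ) : ℤ) + r * k := by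
  rw [Fin.val_neg']
  have h := Nat.div_add_mod (r - m) r
  have hm := m.2
  refine ⟨1 - ((r - m) / r : ℕ), ?_⟩
  zify [hm.le] at h
  push_cast [Nat.cast_sub hm.le]
  linarith

section

variable {𝔤 : Type*} [LieRing 𝔤] [LieAlgebra ℂ 𝔤] [FiniteDimensional ℂ 𝔤]
  [LieAlgebra.IsSimple ℂ 𝔤] {H : LieSubalgebra ℂ 𝔤} [H.IsCartanSubalgebra]
  {ν : 𝔤 ≃ₗ⁅ℂ⁆ 𝔤} {c : ℂ} {N n : ℕ} (A : AdaptedBasis H ν c N n) (r : ℕ) [NeZero r]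

/-- The indices of the nonzero eigencomponents of root vectors. -/
abbrev RootIndex : Type _ :=
  {p : Fin r × LieModule.Weight ℂ H 𝔤 // p.2 ∈ H.root ∧ A.t r ((p.1 : ℕ) : ℤ) p.2 ≠ 0 ∧
    A.t r (-((p.1 : ℕ) : ℤ)) (-p.2) ≠ 0}

/-- The indices of the eigencomponents of nonzero degree of the basis of the Cartan subalgebra. -/
abbrev CartanIndex (N r : ℕ) [NeZero r] : Type := {m : Fin r // m ≠ 0} × Fin N

instance : Fintype (RootIndex A r) := Fintype.ofFinite _

abbrev FrameIndex : Type _ := Fin n ⊕ (RootIndex A r ⊕ CartanIndex N r)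

variable {A r}

/-- The members of the frame. -/
def vec : FrameIndex A r → 𝔤
  | Sum.inl k => ((A.e0 k : H) : 𝔤)
  | Sum.inr (Sum.inl p) => eigProj ν r ((p.1.1 : ℕ) : ℤ) (A.E p.1.2)
  | Sum.inr (Sum.inr p) => eigProj ν r ((p.1.1 : ℕ) : ℤ) (A.eps p.2 : 𝔤)

theorem t_neg_val (m : Fin r) (α : LieModule.Weight ℂ H 𝔤) :
    A.t r (((-m : Fin r) : ℕ) : ℤ) α = A.t r (-((m : ℕ) : ℤ)) α := by
  obtain ⟨k, hk⟩ := exists_val_neg m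
  rw [hk, AdaptedBasis.t, eigSum_add_period (NeZero.pos r)]
  rfl

theorem t_neg_neg_val (m : Fin r) (α : LieModule.Weight ℂ H 𝔤) :
    A.t r (-(((-m : Fin r) : ℕ) : ℤ)) α = A.t r ((m : ℕ) : ℤ) α := by
  obtain ⟨k, hk⟩ := exists_val_neg m
  rw [hk, AdaptedBasis.t, show -(-((m : ℕ) : ℤ) + r * k) = (m : ℕ) + r * (-k) by ring,
    eigSum_add_period (NeZero.pos r)]
  rfl

omit [FiniteDimensional ℂ 𝔤] [LieAlgebra.IsSimple ℂ 𝔤] in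
theorem eigProj_neg_val (m : Fin r) :
    eigProj ν r (((-m : Fin r) : ℕ) : ℤ) = eigProj ν r (-((m : ℕ) : ℤ)) := by
  obtain ⟨k, hk⟩ := exists_val_neg m
  rw [hk, eigProj_add_period (NeZero.pos r)]

/-- The dual index. -/
def dual : FrameIndex A r → FrameIndex A r
  | Sum.inl k => Sum.inl k
  | Sum.inr (Sum.inl p) => Sum.inr (Sum.inl ⟨(-p.1.1, -p.1.2), neg_mem_root p.2.1,
      by rw [t_neg_val]; exact p.2.2.2, by rw [t_neg_neg_val, neg_neg]; exact p.2.2.1⟩)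
  | Sum.inr (Sum.inr p) => Sum.inr (Sum.inr (⟨-p.1.1, neg_ne_zero.2 p.1.2⟩, p.2))

theorem dual_dual (i : FrameIndex A r) : dual (dual i) = i := by
  rcases i with k | p | p
  · rfl
  · simp only [dual, neg_neg]
  · simp only [dual, neg_neg]

/-- The degree of a member of the frame. -/
def deg : FrameIndex A r → ℤ
  | Sum.inl _ => 0
  | Sum.inr (Sum.inl p) => (p.1.1 : ℕ)
  | Sum.inr (Sum.inr p) => (p.1.1 : ℕ)

/-- The weight of a member of the frame. -/
def wgt : FrameIndex A r → invCartan H ν →ₗ[ℂ] ℂ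
  | Sum.inl _ => 0
  | Sum.inr (Sum.inl p) => p.1.2.toLinear ∘ₗ (invCartan H ν).subtype
  | Sum.inr (Sum.inr _) => 0

theorem wgt_dual (i : FrameIndex A r) : wgt (dual i) = -wgt i := by
  rcases i with k | p | p
  · simp [dual, wgt]
  · simp [dual, wgt, LinearMap.neg_comp]
  · simp [dual, wgt]

theorem deg_dual (i : FrameIndex A r) : ∃ k : ℤ, deg i + deg (dual i) = r * k := by
  rcases i with k | p | p
  · exact ⟨0, by simp [dual, deg]⟩
  · obtain ⟨k, hk⟩ := exists_val_neg p.1.1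
    exact ⟨k, by simp only [dual, deg]; rw [hk]; ring⟩
  · obtain ⟨k, hk⟩ := exists_val_neg p.1.1
    exact ⟨k, by simp only [dual, deg]; rw [hk]; ring⟩

omit [FiniteDimensional ℂ 𝔤] [LieAlgebra.IsSimple ℂ 𝔤] [H.IsCartanSubalgebra] in
theorem map_invCartan (h : invCartan H ν) : ν ((h : H) : 𝔤) = (h : H) := h.2

-- As `ν` fixes `h`, all iterates `ν^j x` have the same `h`-eigenvalue as `x`.
omit [NeZero r] [FiniteDimensional ℂ 𝔤] [LieAlgebra.IsSimple ℂ 𝔤] [H.IsCartanSubalgebra] in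
theorem lie_invCartan (h : invCartan H ν) {x : 𝔤} {a : ℂ} (hx : ⁅((h : H) : 𝔤), x⁆ = a • x)
    (m : ℤ) : ⁅((h : H) : 𝔤), eigProj ν r m x⁆ = a • eigProj ν r m x := by
  have h1 : ∀ j : ℕ, ⁅((h : H) : 𝔤), ν^[j] x⁆ = a • ν^[j] x := fun j => by
    induction j with
    | zero => exact hx
    | succ j ih =>
      rw [Function.iterate_succ_apply', ← map_invCartan h, ← LieEquiv.map_lie, ih, map_smul]
  rw [eigProj_apply, lie_smul, eigSum, lie_sum, smul_comm, Finset.smul_sum (r := a)]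
  congr 1
  refine Finset.sum_congr rfl fun j _ => ?_
  rw [lie_smul, h1, smul_comm]

theorem lie_cartan (x y : H) : ⁅(x : 𝔤), (y : 𝔤)⁆ = 0 := by
  have : ⁅x, y⁆ = 0 := trivial_lie_zero H H x y
  exact congrArg Subtype.val this

theorem lie_vec (h : invCartan H ν) (i : FrameIndex A r) :
    ⁅((h : H) : 𝔤), vec i⁆ = wgt i h • vec i := by
  rcases i with k | p | p
  · simp [vec, wgt, lie_cartan]
  · refine lie_invCartan h ?_ _
    exact LieAlgebra.IsKilling.lie_eq_smul_of_mem_rootSpace (A.E_mem _ p.2.1) (h : H)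
  · refine lie_invCartan h ?_ _
    simp [wgt, lie_cartan]

section

variable (hν : ∀ x, ν^[r] x = x)
include hν

theorem map_vec (i : FrameIndex A r) : ν (vec i) = ee (deg i / r) • vec i := by
  rcases i with k | p | p
  · simp [vec, deg, map_invCartan, ee_zero]
  · exact map_eigProj (NeZero.pos r) hν _ _
  · exact map_eigProj (NeZero.pos r) hν _ _

variable (hH : ∀ x ∈ H, ν x ∈ H)
include hH

omit [FiniteDimensional ℂ 𝔤] [LieAlgebra.IsSimple ℂ 𝔤] [H.IsCartanSubalgebra] in
theorem eigProj_zero_mem (x : H) : ∃ h : invCartan H ν, eigProj ν r 0 (x : 𝔤) = (h : H) := by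
  have h1 : ∀ j : ℕ, ν^[j] (x : 𝔤) ∈ H := fun j => by
    induction j with
    | zero => exact x.2
    | succ j ih =>
      rw [Function.iterate_succ_apply']
      exact hH _ ih
  have h2 : eigProj ν r 0 (x : 𝔤) ∈ H := by
    rw [eigProj_apply]
    exact H.smul_mem _ (sum_mem fun j _ => H.smul_mem _ (h1 j))
  have h3 : ν (eigProj ν r 0 (x : 𝔤)) = eigProj ν r 0 (x : 𝔤) := by
    rw [map_eigProj (NeZero.pos r) hν]
    simp [ee_zero]
  exact ⟨⟨⟨_, h2⟩, h3⟩, rfl⟩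

omit [NeZero r] hν hH in
theorem sum_e0 (A : AdaptedBasis H ν c N n) (h : invCartan H ν) :
    ∑ j, form 𝔤 c ((h : H) : 𝔤) ((A.e0 j : H) : 𝔤) • ((A.e0 j : H) : 𝔤) = (h : H) := by
  have e : ∀ g : invCartan H ν, ((g : H) : 𝔤) = ∑ j, A.e0.repr g j • ((A.e0 j : H) : 𝔤) := fun g => by
    have h := congrArg (H.toSubmodule.subtype ∘ₗ (invCartan H ν).subtype) (A.e0.sum_repr g)
    simp only [map_sum, map_smul] at h
    exact h.symm
  conv_rhs => rw [e]
  refine Finset.sum_congr rfl fun k _ => ?_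
  congr 1
  conv_lhs => rw [e h]
  rw [map_sum, LinearMap.sum_apply, Finset.sum_eq_single k]
  · rw [map_smul, LinearMap.smul_apply, form_apply, A.e0_orthonormal, if_pos rfl, smul_eq_mul,
      mul_one]
  · intro j _ hj
    rw [map_smul, LinearMap.smul_apply, form_apply, A.e0_orthonormal, if_neg hj, smul_zero]
  · simp

variable {M : Type*} [AddCommGroup M] [Module ℂ M]

/-- Both sides evaluate `f` on the canonical tensor of `𝔥₀`. The projected basis of the Cartan
subalgebra is replaced by an orthonormal basis of `𝔥₀`, whose members are their own duals. -/
theorem sum_cartan_zero (f : 𝔤 →ₗ[ℂ] 𝔤 →ₗ[ℂ] M) :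
    ∑ k, f (eigProj ν r 0 (A.eps k : 𝔤)) (eigProj ν r 0 (A.eps k : 𝔤)) =
      ∑ j, f ((A.e0 j : H) : 𝔤) ((A.e0 j : H) : 𝔤) := by
  have hfix : ∀ j, eigProj ν r 0 ((A.e0 j : H) : 𝔤) = ((A.e0 j : H) : 𝔤) := fun j =>
    eigProj_of_eigen (NeZero.pos r) (by simp [map_invCartan, ee_zero])
  have h1 : ∀ k, eigProj ν r 0 (A.eps k : 𝔤) =
      ∑ j, form 𝔤 c ((A.e0 j : H) : 𝔤) (A.eps k : 𝔤) • ((A.e0 j : H) : 𝔤) := fun k => by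
    obtain ⟨h, hh⟩ := eigProj_zero_mem hν hH (A.eps k)
    rw [hh, ← sum_e0 A h]
    refine Finset.sum_congr rfl fun j _ => ?_
    congr 1
    rw [← hh, form_eigProj (form_map ν) (NeZero.pos r) hν form_comm, neg_zero, hfix, form_comm]
  have h2 : ∀ k, f (eigProj ν r 0 (A.eps k : 𝔤)) (eigProj ν r 0 (A.eps k : 𝔤)) =
      ∑ j, f ((A.e0 j : H) : 𝔤) (eigProj ν r 0
        (form 𝔤 c ((A.e0 j : H) : 𝔤) (A.eps k : 𝔤) • (A.eps k : 𝔤))) := fun k => by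
    have h3 : ∀ z, f (eigProj ν r 0 (A.eps k : 𝔤)) z = ∑ j,
        form 𝔤 c ((A.e0 j : H) : 𝔤) (A.eps k : 𝔤) • f ((A.e0 j : H) : 𝔤) z := fun z => by
      rw [h1 k, map_sum, LinearMap.sum_apply]
      simp only [map_smul, LinearMap.smul_apply]
    rw [h3]
    simp only [map_smul]
  rw [Finset.sum_congr rfl fun k _ => h2 k, Finset.sum_comm]
  refine Finset.sum_congr rfl fun j _ => ?_
  rw [← map_sum, ← map_sum, sum_eps_cartan A (A.e0 j : H), hfix]

/-- The sum over the frame, in terms of the original vectors. -/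
theorem sum_frame (f : 𝔤 →ₗ[ℂ] 𝔤 →ₗ[ℂ] M) (p : FrameIndex A r → ℂ)
    (pR : ℕ → LieModule.Weight ℂ H 𝔤 → ℂ) (pC : ℕ → ℂ) (h0 : ∀ k, p (Sum.inl k) = pC 0)
    (h1 : ∀ j : RootIndex A r, p (Sum.inr (Sum.inl j)) = pR j.1.1 j.1.2)
    (h2 : ∀ j : CartanIndex N r, p (Sum.inr (Sum.inr j)) = pC j.1.1) :
    ∑ i, p i • f (vec i) (vec (dual i)) = ∑ m ∈ Finset.range r,
      (∑ α ∈ H.root, pR m α • f (eigProj ν r m (A.E α)) (eigProj ν r (-m) (A.E (-α))) +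
        ∑ k, pC m • f (eigProj ν r m (A.eps k : 𝔤)) (eigProj ν r (-m) (A.eps k : 𝔤))) := by
  classical
  have e0 : ∑ j : CartanIndex N r, p (Sum.inr (Sum.inr j)) •
      f (vec (A := A) (Sum.inr (Sum.inr j))) (vec (A := A) (dual (Sum.inr (Sum.inr j)))) =
      ∑ m ∈ Finset.univ.erase (0 : Fin r), ∑ k, pC m •
        f (eigProj ν r ((m : ℕ) : ℤ) (A.eps k : 𝔤)) (eigProj ν r (-((m : ℕ) : ℤ)) (A.eps k : 𝔤)) := by
    refine (Fintype.sum_prod_type _).trans ?_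
    rw [Finset.sum_subtype (Finset.univ.erase (0 : Fin r)) (p := fun m => m ≠ 0) (by simp)]
    refine Finset.sum_congr rfl fun m _ => Finset.sum_congr rfl fun k _ => ?_
    rw [h2, ← eigProj_neg_val]
    rfl
  have e1 : ∑ j : RootIndex A r, p (Sum.inr (Sum.inl j)) •
      f (vec (Sum.inr (Sum.inl j))) (vec (dual (Sum.inr (Sum.inl j)))) =
      ∑ m : Fin r, ∑ α ∈ H.root, pR m α • f (eigProj ν r ((m : ℕ) : ℤ) (A.E α))
        (eigProj ν r (-((m : ℕ) : ℤ)) (A.E (-α))) := by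
    rw [← Finset.sum_product' (f := fun (m : Fin r) α => pR m α • f (eigProj ν r ((m : ℕ) : ℤ) (A.E α))
        (eigProj ν r (-((m : ℕ) : ℤ)) (A.E (-α))))]
    -- Pairs for which a member or its dual vanishes contribute nothing and are left out of the
    -- frame. This matters for regularity, as `𝐮` avoids a hyperplane only if the corresponding
    -- eigencomponent is nonzero.
    rw [← Finset.sum_filter_of_ne (p := fun q : Fin r × LieModule.Weight ℂ H 𝔤 =>
      A.t r ((q.1 : ℕ) : ℤ) q.2 ≠ 0 ∧ A.t r (-((q.1 : ℕ) : ℤ)) (-q.2) ≠ 0)]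
    · rw [Finset.sum_subtype _ (p := fun q : Fin r × LieModule.Weight ℂ H 𝔤 =>
        q.2 ∈ H.root ∧ A.t r ((q.1 : ℕ) : ℤ) q.2 ≠ 0 ∧ A.t r (-((q.1 : ℕ) : ℤ)) (-q.2) ≠ 0)
        (by intro q; rw [Finset.mem_filter, Finset.mem_product]; simp only [Finset.mem_univ, true_and])]
      refine Fintype.sum_equiv (Equiv.refl _) _ _ fun j => ?_
      rw [h1]
      simp only [vec, dual, eigProj_neg_val]
      rfl
    · intro q _ hq
      constructor <;> intro h0 <;> apply hq
      · rw [eigProj_apply, show eigSum ν r ((q.1 : ℕ) : ℤ) (A.E q.2) = 0 from h0]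
        simp
      · rw [eigProj_apply _ (A.E (-q.2)),
          show eigSum ν r (-((q.1 : ℕ) : ℤ)) (A.E (-q.2)) = 0 from h0]
        simp
  have e2 : ∑ k, p (Sum.inl k) • f (vec (A := A) (r := r) (Sum.inl k))
      (vec (A := A) (r := r) (dual (Sum.inl k))) =
      ∑ k, pC 0 • f (eigProj ν r ((0 : ℕ) : ℤ) (A.eps k : 𝔤))
        (eigProj ν r (-((0 : ℕ) : ℤ)) (A.eps k : 𝔤)) := by
    simp only [h0, ← Finset.smul_sum, Nat.cast_zero, neg_zero]
    rw [sum_cartan_zero hν hH]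
    rfl
  rw [Fintype.sum_sum_type, Fintype.sum_sum_type, e0, e1, e2, Finset.sum_range, Finset.sum_add_distrib,
    ← Finset.add_sum_erase Finset.univ (fun m : Fin r => ∑ k, pC m •
        f (eigProj ν r ((m : ℕ) : ℤ) (A.eps k : 𝔤)) (eigProj ν r (-((m : ℕ) : ℤ)) (A.eps k : 𝔤)))
      (Finset.mem_univ 0)]
  simp only [Fin.val_zero]
  abel

/-- The expansion of a vector in the frame. -/
theorem sum_vec (A : AdaptedBasis H ν c N n) (x : 𝔤) :
    ∑ i : FrameIndex A r, form 𝔤 c x (vec i) • vec (dual i) = x := by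
  have h := sum_frame hν hH (A := A) (r := r)
    ((LinearMap.lsmul ℂ 𝔤).flip.compl₂ (form 𝔤 c x)) (fun _ => 1) (fun _ _ => 1) (fun _ => 1)
    (fun _ => rfl) (fun _ => rfl) (fun _ => rfl)
  simp only [one_smul, LinearMap.compl₂_apply, LinearMap.flip_apply, LinearMap.lsmul_apply] at h
  have h' : ∑ i : FrameIndex A r, form 𝔤 c x (vec i) • vec (dual i) =
      ∑ i : FrameIndex A r, form 𝔤 c x (vec (dual i)) • vec i := by
    refine Fintype.sum_equiv (Function.Involutive.toPerm dual dual_dual) _ _ fun i => ?_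
    change _ = form 𝔤 c x (vec (dual (dual i))) • vec (dual i)
    rw [dual_dual]
  rw [h', h]
  conv_rhs => rw [← sum_eigProj (ν := ν) (NeZero.pos r) x]
  refine Finset.sum_congr rfl fun m _ => ?_
  have hm := map_eigProj (NeZero.pos r) hν m x
  -- The degree `m` part is expanded in the untwisted basis and projected once more. Moving the
  -- inner projection to the other side of the form gives the dual members.
  conv_rhs => rw [← eigProj_of_eigen (NeZero.pos r) hm, ← sum_root_vectors A (eigProj ν r m x)]
  simp only [map_add, map_sum, map_smul, form_eigProj (form_map ν) (NeZero.pos r) hν form_comm]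

end

end

end TwistedKZB
end

/-! ### The twisted frame of operators in commuting representations. -/

noncomputable section
namespace TwistedKZB
open Complex Metric Set Filter Topology

/-- Commuting representations of a Lie algebra, indexed by the sites. -/
structure SiteRep (𝔤 R : Type*) (l : ℕ) [LieRing 𝔤] [LieAlgebra ℂ 𝔤] [Ring R] [Algebra ℂ R] where
  act : Fin l → 𝔤 →ₗ[ℂ] R
  act_lie : ∀ a x y, act a ⁅x, y⁆ = act a x * act a y - act a y * act a x
  act_comm : ∀ {a b}, a ≠ b → ∀ x y, act a x * act b y = act b y * act a x

section

variable {𝔤 : Type*} [LieRing 𝔤] [LieAlgebra ℂ 𝔤] [FiniteDimensional ℂ 𝔤]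
  [LieAlgebra.IsSimple ℂ 𝔤] {H : LieSubalgebra ℂ 𝔤} [H.IsCartanSubalgebra]
  {ν : 𝔤 ≃ₗ⁅ℂ⁆ 𝔤} {c : ℂ} {N n : ℕ} (A : AdaptedBasis H ν c N n) {r : ℕ} [NeZero r]
  (hν : ∀ x, ν^[r] x = x) (hH : ∀ x ∈ H, ν x ∈ H) {R : Type*} [Ring R] [Algebra ℂ R] {l : ℕ}
  (σ : SiteRep 𝔤 R l)

/-- The structure constants of the frame. -/
def structC (i j k : FrameIndex A r) : ℂ := form 𝔤 c ⁅vec i, vec j⁆ (vec k)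

/-- The frame of operators at the sites given by representations of the Lie algebra. -/
def twistedFrame : Frame R (Fin l) (RootIndex A r ⊕ CartanIndex N r) n where
  star := dual
  star_star := dual_dual
  star_inl _ := rfl
  Y a i := σ.act a (vec i)
  C := structC A
  w k i := wgt i (A.e0 k)
  C_cyc i j k := by rw [structC, structC, form_lie, form_comm]
  C_anti i j k := by rw [structC, structC, ← lie_skew, map_neg, LinearMap.neg_apply]
  brk a i j := by
    rw [← σ.act_lie]
    conv_lhs => rw [← sum_vec hν hH A ⁅vec i, vec j⁆]
    simp only [map_sum, map_smul]
    rfl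
  comm h _ _ := σ.act_comm h _ _
  wt a k i := by
    rw [← σ.act_lie]
    change σ.act a ⁅((A.e0 k : H) : 𝔤), vec i⁆ = _
    rw [lie_vec, map_smul]
  w_star k i := by rw [wgt_dual, LinearMap.neg_apply]

variable {A}

/-- Invariance of the trilinear form `([x, y], z)` under the adjoint action of `𝔥₀`; the statement
on degrees is its invariance under `ν`. -/
theorem structC_wgt {i j k : FrameIndex A r} (h : structC A i j k ≠ 0) (x : invCartan H ν) :
    wgt i x + wgt j x + wgt k x = 0 := by
  have h1 : form 𝔤 c ⁅((x : H) : 𝔤), ⁅vec i, vec j⁆⁆ (vec k) =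
      (wgt i x + wgt j x) * structC A i j k := by
    rw [leibniz_lie, lie_vec, lie_vec, smul_lie, lie_smul, ← add_smul, map_smul,
      LinearMap.smul_apply, smul_eq_mul, structC]
  have h2 : form 𝔤 c ⁅((x : H) : 𝔤), ⁅vec i, vec j⁆⁆ (vec k) = -(wgt k x * structC A i j k) := by
    rw [← lie_skew, map_neg, LinearMap.neg_apply, form_lie, lie_vec, map_smul, smul_eq_mul, structC]
  apply mul_right_cancel₀ h
  linear_combination h2 - h1

include hν in
theorem structC_deg {i j k : FrameIndex A r} (h : structC A i j k ≠ 0) :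
    ∃ q : ℤ, deg i + deg j + deg k = r * q := by
  refine eq_zero_of_ee_smul (NeZero.pos r) (z := structC A i j k) ?_ h
  conv_rhs => rw [structC, ← form_map ν, LieEquiv.map_lie, map_vec hν, map_vec hν, map_vec hν]
  simp only [smul_lie, lie_smul, map_smul, LinearMap.smul_apply, smul_eq_mul]
  rw [← structC, ← mul_assoc, ← mul_assoc, ← ee_add, ← ee_add]
  congr 2
  push_cast
  ring

/-- The grading of the frame by the eigenvalues of the automorphism. -/
def twistedGrading (ϖ : invCartan H ν) : (twistedFrame A hν hH σ).Grading r where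
  m := deg
  v0 i := -wgt i ϖ
  m_inl _ := rfl
  v0_inl _ := by simp [wgt]
  m_star := deg_dual
  v0_star i := by
    change -wgt (dual i) ϖ = _
    rw [wgt_dual, LinearMap.neg_apply]
  m_sum _ _ _ h := structC_deg hν h
  v0_sum _ _ _ h := by linear_combination -structC_wgt h ϖ
  w_sum _ _ _ h q := structC_wgt h (A.e0 q)
  C_inl a b k := by
    change form 𝔤 c ⁅((A.e0 a : H) : 𝔤), ((A.e0 b : H) : 𝔤)⁆ (vec k) = 0
    rw [lie_cartan, map_zero, LinearMap.zero_apply]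

variable {ϖ : invCartan H ν}

local notation "𝒢" => twistedGrading (A := A) hν hH σ ϖ

theorem twistedGrading_v (i : FrameIndex A r) (x : Pt l n) :
    (𝒢).v i x = -wgt i (A.pt x.2.2 + ϖ) := by
  change -wgt i ϖ - ∑ k, wgt i (A.e0 k) * x.2.2 k = _
  rw [AdaptedBasis.pt, map_add, map_sum]
  simp only [map_smul, smul_eq_mul, mul_comm (x.2.2 _)]
  ring

/-- For root indices a lattice point is excluded by the condition on `𝐮`. For Cartan indices the
argument is `-mτ/r` with `0 < m < r`, never a lattice point because `τ` is not real. -/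
theorem regularSet_subset_reg : regularSet A r l ϖ ⊆ (𝒢).reg := by
  rintro x ⟨h1, h2, h3, h4⟩
  refine ⟨h1, h2, h3, ?_⟩
  have hr : (r : ℂ) ≠ 0 := NeZero.ne _
  rintro (p | p)
  · rw [Ne, theta_eq_zero_iff h1]
    rintro ⟨j, k, hjk⟩
    refine h4 p.1.1 p.1.1.2 p.1.2 p.2.1 p.2.2.1 (-j) (-k) ?_
    change (𝒢).v _ x - (((p.1.1 : ℕ) : ℤ) : ℂ) / r * x.1 = j + k * x.1 at hjk
    rw [twistedGrading_v] at hjk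
    change -p.1.2 ((A.pt x.2.2 + ϖ : invCartan H ν) : H) - (((p.1.1 : ℕ) : ℤ) : ℂ) / r * x.1 =
      j + k * x.1 at hjk
    push_cast at hjk ⊢
    linear_combination -hjk
  · rw [Ne, theta_eq_zero_iff h1]
    rintro ⟨j, k, hjk⟩
    change (𝒢).v _ x - (((p.1.1 : ℕ) : ℤ) : ℂ) / r * x.1 = j + k * x.1 at hjk
    rw [twistedGrading_v] at hjk
    change -(0 : ℂ) - (((p.1.1 : ℕ) : ℤ) : ℂ) / r * x.1 = j + k * x.1 at hjk
    have e1 : ((k : ℂ) * r + (p.1.1 : ℕ)) * x.1 = -(j * r) := by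
      push_cast at hjk
      field_simp at hjk
      linear_combination -hjk
    have e2 : ((k * r + (p.1.1 : ℕ) : ℤ) : ℂ) * x.1 = ((-(j * r) : ℤ) : ℂ) := by
      push_cast
      exact e1
    have e3 := congrArg Complex.im e2
    rw [Complex.intCast_im, ← Complex.ofReal_intCast, Complex.im_ofReal_mul] at e3
    have e4 : (k * r + (p.1.1 : ℕ) : ℤ) = 0 := by
      rcases mul_eq_zero.1 e3 with h | h
      · exact_mod_cast h
      · exact absurd h h1.ne'
    have hp : (p.1.1 : ℕ) ≠ 0 := fun h => p.1.2 (Fin.ext h)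
    have hlt := p.1.1.2
    have hdvd : (r : ℤ) ∣ ((p.1.1 : ℕ) : ℤ) := ⟨-k, by linarith⟩
    have := Nat.le_of_dvd (Nat.pos_of_ne_zero hp) (by exact_mod_cast hdvd)
    omega

/-- The operators of the frame in terms of the original vectors. -/
theorem twistedFrame_op (a b : Fin l) (p : FrameIndex A r → ℂ)
    (pR : ℕ → LieModule.Weight ℂ H 𝔤 → ℂ) (pC : ℕ → ℂ) (h0 : ∀ k, p (Sum.inl k) = pC 0)
    (h1 : ∀ j : RootIndex A r, p (Sum.inr (Sum.inl j)) = pR j.1.1 j.1.2)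
    (h2 : ∀ j : CartanIndex N r, p (Sum.inr (Sum.inr j)) = pC j.1.1) :
    (twistedFrame A hν hH σ).op a b p = ∑ m ∈ Finset.range r,
      ((∑ α ∈ H.root, (1 / (r : ℂ) ^ 2 * pR m α) • (σ.act a (A.t r m α) * σ.act b (A.t r (-m) (-α)))) +
        ∑ k, pC m • (σ.act a (A.e r m k) * σ.act b (A.e r (-m) k))) := by
  have hr : (r : ℂ) ≠ 0 := NeZero.ne _
  have h := sum_frame hν hH ((LinearMap.mul ℂ R).compl₁₂ (σ.act a) (σ.act b))
    p pR pC h0 h1 h2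
  refine h.trans (Finset.sum_congr rfl fun m _ => ?_)
  congr 1
  · refine Finset.sum_congr rfl fun α _ => ?_
    rw [AdaptedBasis.t, AdaptedBasis.t, eigSum_eq (NeZero.pos r), eigSum_eq (NeZero.pos r)]
    simp only [LinearMap.compl₁₂_apply, LinearMap.mul_apply', map_smul, smul_mul_smul_comm, smul_smul]
    congr 1
    field_simp
  · refine Finset.sum_congr rfl fun k _ => ?_
    rw [AdaptedBasis.e, AdaptedBasis.e, ← eigProj_apply, ← eigProj_apply]
    rfl

theorem op_kapF (a b : Fin l) (x : Pt l n) :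
    (twistedFrame A hν hH σ).op a b (fun i => (𝒢).kapF a b i x) = ∑ m ∈ Finset.range r,
      ((∑ α ∈ H.root,
        (1 / (r : ℂ) ^ 2 * rootCoeff r m (-α ((A.pt x.2.2 + ϖ : invCartan H ν) : H))
          (x.2.1 a / x.2.1 b) x.1) • (σ.act a (A.t r m α) * σ.act b (A.t r (-m) (-α)))) +
      ∑ k, cartanCoeff r m (x.2.1 a / x.2.1 b) x.1 • (σ.act a (A.e r m k) * σ.act b (A.e r (-m) k))) := by
  have key : ∀ (m : ℕ) (v : ℂ), tw (((m : ℤ) : ℂ) / r) (v - ((m : ℤ) : ℂ) / r * x.1)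
      (zOf r (x.2.1 a / x.2.1 b)) x.1 = rootCoeff r m v (x.2.1 a / x.2.1 b) x.1 := fun m v => by
    rw [tw, rootCoeff, phiM]
    push_cast
    congr 2 <;> ring
  refine twistedFrame_op hν hH σ a b _
    (fun m α => rootCoeff r m (-α ((A.pt x.2.2 + ϖ : invCartan H ν) : H)) (x.2.1 a / x.2.1 b) x.1)
    (fun m => cartanCoeff r m (x.2.1 a / x.2.1 b) x.1) (fun k => rfl) (fun j => ?_) (fun j => ?_)
  · rw [← key]
    change tw _ ((𝒢).v _ x - _) _ _ = _
    rw [twistedGrading_v]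
    rfl
  · have hp : (j.1.1 : ℕ) ≠ 0 := fun h => j.1.2 (Fin.ext h)
    simp only [cartanCoeff, hp, if_false]
    rw [← key]
    change tw _ ((𝒢).v _ x - _) _ _ = _
    rw [twistedGrading_v]
    change tw _ (-(0 : ℂ) - _) _ _ = _
    rw [neg_zero]
    rfl

theorem op_gF {x : Pt l n} (hx : x ∈ (𝒢).reg) (b d : Fin l) :
    (twistedFrame A hν hH σ).op b d (fun i => (𝒢).gF b d i x) = ∑ m ∈ Finset.range r,
      ((∑ α ∈ H.root,
        (1 / (r : ℂ) ^ 2 * dRootCoeff r m (-α ((A.pt x.2.2 + ϖ : invCartan H ν) : H))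
          (x.2.1 b / x.2.1 d) x.1) • (σ.act b (A.t r m α) * σ.act d (A.t r (-m) (-α)))) +
      ∑ k, dCartanCoeff r m (x.2.1 b / x.2.1 d) x.1 • (σ.act b (A.e r m k) * σ.act d (A.e r (-m) k))) := by
  -- The coefficients of `f` test whether the ratio is `1`, those of the frame whether the sites
  -- agree. On the regular set these coincide: `k = 0` in the condition on the marked points
  -- excludes ratio `1` for different sites.
  have hone : x.2.1 b / x.2.1 d = 1 ↔ b = d := by
    constructor
    · intro h
      by_contra hbd
      refine hx.2.2.1 b d hbd 0 ?_
      simp [h, ee_zero]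
    · rintro rfl
      exact div_self (hx.2.1 b)
  have key : ∀ (m : ℕ) (v : ℂ), (if b = d then -E2 (v - ((m : ℤ) : ℂ) / r * x.1) x.1 else
      dtw (((m : ℤ) : ℂ) / r) (v - ((m : ℤ) : ℂ) / r * x.1) (zOf r (x.2.1 b / x.2.1 d)) x.1) =
      dRootCoeff r m v (x.2.1 b / x.2.1 d) x.1 := fun m v => by
    simp only [dRootCoeff, hone]
    split_ifs
    · push_cast
      ring_nf
    · simp only [phiM]
      rw [deriv_const_mul_field, dtw, dphi]
      rw [deriv_comp_add_const (fun w => phi w (zOf r (x.2.1 b / x.2.1 d)) x.1)]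
      push_cast
      congr 2 <;> ring
  refine twistedFrame_op hν hH σ b d _
    (fun m α => dRootCoeff r m (-α ((A.pt x.2.2 + ϖ : invCartan H ν) : H)) (x.2.1 b / x.2.1 d) x.1)
    (fun m => dCartanCoeff r m (x.2.1 b / x.2.1 d) x.1) (fun k => ?_) (fun j => ?_) (fun j => ?_)
  · simp only [dCartanCoeff, if_true, hone]
    rfl
  · rw [← key]
    change (if b = d then -E2 ((𝒢).v _ x - _) _ else dtw _ ((𝒢).v _ x - _) _ _) = _
    rw [twistedGrading_v]
    rfl
  · have hp : (j.1.1 : ℕ) ≠ 0 := fun h => j.1.2 (Fin.ext h)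
    simp only [dCartanCoeff, hp, if_false]
    rw [← key]
    change (if b = d then -E2 ((𝒢).v _ x - _) _ else dtw _ ((𝒢).v _ x - _) _ _) = _
    rw [twistedGrading_v]
    change (if b = d then -E2 (-(0 : ℂ) - _) _ else dtw _ (-(0 : ℂ) - _) _ _) = _
    rw [neg_zero]
    rfl

end

end TwistedKZB
end

noncomputable section
namespace TwistedKZB
open Complex Metric Set Filter Topology

/-! ### Sections of the connection -/

namespace ConnData

variable {E W S : Type*} {n : ℕ} [NormedAddCommGroup E] [NormedSpace ℂ E]
  [NormedAddCommGroup W] [NormedSpace ℂ W] {X : ConnData E W S n} {F F' : E → W} {x : E}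

theorem nab_congr (a : S) (h : F =ᶠ[𝓝 x] F') : X.nab a F x = X.nab a F' x := by
  simp only [nab, D_congr _ h, h.eq_of_nhds]

variable [CompleteSpace W] {T : W →L[ℂ] W}

-- A constant linear map commutes with differentiation. Zero weight therefore passes to derivatives,
-- and the potentials preserve it since they commute with `tot`.
omit [CompleteSpace W] in
theorem apply_D_eq_zero (hF : ∀ᶠ y in 𝓝 x, AnalyticAt ℂ F y) (hT : ∀ᶠ y in 𝓝 x, T (F y) = 0)
    (v : E) : ∀ᶠ y in 𝓝 x, T (D v F y) = 0 := by
  filter_upwards [hF, hT.eventually_nhds] with y h1 h2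
  have h3 : (fun y => T (F y)) =ᶠ[𝓝 y] fun _ => (0 : W) := h2
  rw [← D_clm v T h1, D_congr v h3, D]
  simp

omit [CompleteSpace W] in
theorem apply_nab_eq_zero {a : S} (hF : ∀ᶠ y in 𝓝 x, AnalyticAt ℂ F y)
    (hT : ∀ᶠ y in 𝓝 x, T (F y) = 0) (hY : ∀ k, T * X.Y a k = X.Y a k * T)
    (hM : T * X.M a x = X.M a x * T) : T (X.nab a F x) = 0 := by
  have h1 : ∀ v, T (D v F x) = 0 := fun v => (apply_D_eq_zero hF hT v).self_of_nhds
  have h2 : ∀ k w, T (X.Y a k w) = X.Y a k (T w) := fun k w =>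
    congrArg (fun L : W →L[ℂ] W => L w) (hY k)
  have h3 : ∀ w, T (X.M a x w) = X.M a x (T w) := fun w =>
    congrArg (fun L : W →L[ℂ] W => L w) hM
  simp [nab, h1, h2, h3, hT.self_of_nhds]

theorem apply_nabT_eq_zero (hF : ∀ᶠ y in 𝓝 x, AnalyticAt ℂ F y)
    (hT : ∀ᶠ y in 𝓝 x, T (F y) = 0) (hN : T * X.N x = X.N x * T) : T (X.nabT F x) = 0 := by
  have h1 : ∀ v, T (D v F x) = 0 := fun v => (apply_D_eq_zero hF hT v).self_of_nhds
  have h2 : ∀ v, T (D v (D v F) x) = 0 := fun v =>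
    (apply_D_eq_zero (hF.mono fun _ h => analyticAt_D h v) (apply_D_eq_zero hF hT v)
      v).self_of_nhds
  have h3 : ∀ w, T (X.N x w) = X.N x (T w) := fun w =>
    congrArg (fun L : W →L[ℂ] W => L w) hN
  simp [nabT, h1, h2, h3, hT.self_of_nhds]

end ConnData

namespace Frame

variable {R J : Type*} {l n : ℕ} [Ring R] [Algebra ℂ R] [Fintype J] {P : Frame R (Fin l) J n}

theorem tot_inl (k : Fin n) (a : Fin l) (j : Fin n) :
    P.tot k * P.Y a (Sum.inl j) = P.Y a (Sum.inl j) * P.tot k := by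
  simp only [tot, Finset.sum_mul, Finset.mul_sum]
  refine Finset.sum_congr rfl fun s _ => ?_
  rcases eq_or_ne s a with rfl | h
  · have h := P.wt s k (Sum.inl j)
    rwa [Grading.w_inl, zero_smul, sub_eq_zero] at h
  · exact P.comm h _ _

end Frame

namespace Frame.Grading

variable {W J : Type*} {l n : ℕ} [NormedAddCommGroup W] [NormedSpace ℂ W] [Fintype J]
  {P : Frame (W →L[ℂ] W) (Fin l) J n} {r : ℕ} {G : P.Grading r}

theorem tot_conn_M (k : Fin n) (a : Fin l) (x : Pt l n) :
    P.tot k * G.conn.M a x = G.conn.M a x * P.tot k := by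
  simp only [conn, Finset.sum_mul, Finset.mul_sum, P.tot_op]

theorem tot_conn_N (k : Fin n) (x : Pt l n) : P.tot k * G.conn.N x = G.conn.N x * P.tot k := by
  simp only [conn, Finset.sum_mul, Finset.mul_sum, P.tot_op, mul_smul_comm, smul_mul_assoc]

end Frame.Grading

/-! ### Actions on tensor products -/

section

variable {l : ℕ} {V : Fin l → Type*} [∀ a, AddCommGroup (V a)] [∀ a, Module ℂ (V a)]
  {W : Type*} [AddCommGroup W] [Module ℂ W]

/-- The action of an endomorphism of the `a`-th factor. -/
def siteEnd (e : (PiTensorProduct ℂ fun a => V a) ≃ₗ[ℂ] W) (a : Fin l) :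
    Module.End ℂ (V a) →ₗ[ℂ] Module.End ℂ W where
  toFun f := e.toLinearMap ∘ₗ PiTensorProduct.map
    (Function.update (fun b => (LinearMap.id : V b →ₗ[ℂ] V b)) a f) ∘ₗ e.symm.toLinearMap
  map_add' f g := by
    rw [PiTensorProduct.map_update_add, LinearMap.add_comp, LinearMap.comp_add]
  map_smul' c f := by
    rw [PiTensorProduct.map_update_smul, LinearMap.smul_comp, LinearMap.comp_smul, RingHom.id_apply]

variable (e : (PiTensorProduct ℂ fun a => V a) ≃ₗ[ℂ] W)

theorem siteEnd_mul_eq {a b : Fin l} (f : Module.End ℂ (V a)) (g : Module.End ℂ (V b)) :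
    siteEnd e a f * siteEnd e b g = e.toLinearMap ∘ₗ PiTensorProduct.map (fun i =>
      Function.update (fun b => (LinearMap.id : V b →ₗ[ℂ] V b)) a f i *
        Function.update (fun b => (LinearMap.id : V b →ₗ[ℂ] V b)) b g i) ∘ₗ
      e.symm.toLinearMap := by
  rw [PiTensorProduct.map_mul]
  ext w
  simp [siteEnd]

theorem siteEnd_mul (a : Fin l) (f g : Module.End ℂ (V a)) :
    siteEnd e a (f * g) = siteEnd e a f * siteEnd e a g := by
  rw [siteEnd_mul_eq]
  change e.toLinearMap ∘ₗ PiTensorProduct.map _ ∘ₗ _ = _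
  congr 3
  funext i
  rcases eq_or_ne i a with rfl | h
  · simp
  · simp [h]
    rfl

theorem siteEnd_comm {a b : Fin l} (hab : a ≠ b) (f : Module.End ℂ (V a)) (g : Module.End ℂ (V b)) :
    siteEnd e a f * siteEnd e b g = siteEnd e b g * siteEnd e a f := by
  rw [siteEnd_mul_eq, siteEnd_mul_eq]
  congr 3
  funext i
  rcases eq_or_ne i a with rfl | h
  · simp [hab]
    rfl
  · rcases eq_or_ne i b with rfl | h'
    · simp [h]
      rfl
    · simp [h, h']

end

section

variable {𝔤 : Type*} [LieRing 𝔤] [LieAlgebra ℂ 𝔤] {l : ℕ} {V : Fin l → Type*}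
  [∀ a, AddCommGroup (V a)] [∀ a, Module ℂ (V a)] [∀ a, LieRingModule 𝔤 (V a)]
  [∀ a, LieModule ℂ 𝔤 (V a)] {W : Type*} [NormedAddCommGroup W] [NormedSpace ℂ W]
  [FiniteDimensional ℂ W]

/-- The action of the Lie algebra on the factors of a tensor product. -/
def siteRep (e : (PiTensorProduct ℂ fun a => V a) ≃ₗ[ℂ] W) : SiteRep 𝔤 (W →L[ℂ] W) l where
  act a := (Module.End.toContinuousLinearMap W).toLinearMap ∘ₗ siteEnd e a ∘ₗ
    (LieModule.toEnd ℂ 𝔤 (V a) : 𝔤 →ₗ[ℂ] Module.End ℂ (V a))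
  act_lie a x y := by
    change Module.End.toContinuousLinearMap W (siteEnd e a (LieModule.toEnd ℂ 𝔤 (V a) ⁅x, y⁆)) =
      Module.End.toContinuousLinearMap W (siteEnd e a (LieModule.toEnd ℂ 𝔤 (V a) x)) *
      Module.End.toContinuousLinearMap W (siteEnd e a (LieModule.toEnd ℂ 𝔤 (V a) y)) -
      Module.End.toContinuousLinearMap W (siteEnd e a (LieModule.toEnd ℂ 𝔤 (V a) y)) *
      Module.End.toContinuousLinearMap W (siteEnd e a (LieModule.toEnd ℂ 𝔤 (V a) x))
    have h : LieModule.toEnd ℂ 𝔤 (V a) ⁅x, y⁆ =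
        LieModule.toEnd ℂ 𝔤 (V a) x * LieModule.toEnd ℂ 𝔤 (V a) y -
          LieModule.toEnd ℂ 𝔤 (V a) y * LieModule.toEnd ℂ 𝔤 (V a) x := by
      ext v
      exact lie_lie x y v
    rw [h, map_sub, siteEnd_mul, siteEnd_mul, map_sub, map_mul, map_mul]
  act_comm h x y := by
    change Module.End.toContinuousLinearMap W _ * Module.End.toContinuousLinearMap W _ =
      Module.End.toContinuousLinearMap W _ * Module.End.toContinuousLinearMap W _
    rw [← map_mul, ← map_mul]
    exact congrArg _ (siteEnd_comm e h _ _)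

theorem siteRep_act (e : (PiTensorProduct ℂ fun a => V a) ≃ₗ[ℂ] W) (a : Fin l) (x : 𝔤) :
    (siteRep e).act a x = Module.End.toContinuousLinearMap W (siteAct e a x) := rfl

end

end TwistedKZB
end

noncomputable section
namespace TwistedKZB
open Complex Metric Set Filter Topology

/-! ### The twisted connection -/

section

variable {𝔤 : Type*} [LieRing 𝔤] [LieAlgebra ℂ 𝔤] [FiniteDimensional ℂ 𝔤]
  [LieAlgebra.IsSimple ℂ 𝔤] {H : LieSubalgebra ℂ 𝔤} [H.IsCartanSubalgebra]
  {ν : 𝔤 ≃ₗ⁅ℂ⁆ 𝔤} {c : ℂ} {N n : ℕ} {A : AdaptedBasis H ν c N n} {r : ℕ} [NeZero r]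
  (hν : ∀ x, ν^[r] x = x) (hH : ∀ x ∈ H, ν x ∈ H) {l : ℕ} {V : Fin l → Type*}
  [∀ a, AddCommGroup (V a)] [∀ a, Module ℂ (V a)] [∀ a, LieRingModule 𝔤 (V a)]
  [∀ a, LieModule ℂ 𝔤 (V a)] {W : Type*} [NormedAddCommGroup W] [NormedSpace ℂ W]
  [FiniteDimensional ℂ W] (e : (PiTensorProduct ℂ fun a => V a) ≃ₗ[ℂ] W) {ϖ : invCartan H ν}

/-- The graded frame acting on a tensor product. -/
def siteGrading (ϖ : invCartan H ν) : (twistedFrame A hν hH (siteRep (𝔤 := 𝔤) e)).Grading r :=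
  twistedGrading hν hH (siteRep e) ϖ

theorem toContinuousLinearMap_apply (f : Module.End ℂ W) (w : W) :
    Module.End.toContinuousLinearMap W f w = f w := rfl

theorem rMat_apply (a b : Fin l) (x : Pt l n) (w : W) : rMat A r ϖ (siteAct e) a b x w =
    ((r : ℂ) / (2 * Real.pi * I)) • (twistedFrame A hν hH (siteRep (𝔤 := 𝔤) e)).op a b
      (fun i => (siteGrading hν hH e ϖ).kapF a b i x) w := by
  rw [siteGrading, op_kapF, ← toContinuousLinearMap_apply, rMat, map_smul, smul_apply]
  simp only [map_sum, map_add, map_smul, map_mul, siteRep_act]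

theorem fMat_apply {x : Pt l n} (hx : x ∈ regularSet A r l ϖ) (b d : Fin l) (w : W) :
    fMat A r ϖ (siteAct e) b d x w = (twistedFrame A hν hH (siteRep (𝔤 := 𝔤) e)).op b d
      (fun i => (siteGrading hν hH e ϖ).gF b d i x) w := by
  rw [siteGrading, op_gF _ _ _ (regularSet_subset_reg hν hH (siteRep e) hx),
    ← toContinuousLinearMap_apply, fMat]
  simp only [map_sum, map_add, map_smul, map_mul, siteRep_act]

theorem nabla_eq (a : Fin l) (F : Pt l n → W) :
    nabla A r ϖ (siteAct e) a F = (siteGrading (A := A) hν hH e ϖ).conn.nab a F := by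
  funext x
  have h : ∑ b ∈ Finset.univ.erase a, rMat A r ϖ (siteAct e) a b x (F x) =
      ((r : ℂ) / (2 * Real.pi * I)) • (siteGrading (A := A) hν hH e ϖ).conn.M a x (F x) := by
    rw [Finset.sum_congr rfl fun b _ => rMat_apply hν hH e a b x (F x), ← Finset.smul_sum]
    congr 1
    exact (sum_apply ..).symm
  rw [nabla, h, dHat, neg_smul, ← sub_eq_add_neg]
  rfl

theorem nablaTau_eq {x : Pt l n} (hx : x ∈ regularSet A r l ϖ) (F : Pt l n → W) :
    nablaTau A r ϖ (siteAct e) F x = (siteGrading (A := A) hν hH e ϖ).conn.nabT F x := by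
  have h : (1 / 2 : ℂ) • ∑ b, ∑ d, fMat A r ϖ (siteAct e) b d x (F x) =
      (siteGrading (A := A) hν hH e ϖ).conn.N x (F x) := by
    simp only [fMat_apply hν hH e hx, Frame.Grading.conn, smul_apply, sum_apply]
  rw [nablaTau, h]
  rfl

/-- It is enough to test the orthonormal basis of `𝔥₀`, in which every element expands by `sum_e0`.
-/
theorem mem_zeroWeight_iff (w : W) : w ∈ zeroWeight H ν (siteAct e) ↔
    ∀ k, (twistedFrame A hν hH (siteRep (𝔤 := 𝔤) e)).tot k w = 0 := by
  have h1 : ∀ h : invCartan H ν, ∑ a, siteAct e a ((h : H) : 𝔤) w =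
      (∑ a, (siteRep (𝔤 := 𝔤) e).act a ((h : H) : 𝔤)) w := fun h =>
    (sum_apply Finset.univ (fun a => (siteRep (𝔤 := 𝔤) e).act a ((h : H) : 𝔤)) w).symm
  constructor
  · intro hw k
    exact (h1 (A.e0 k)).symm.trans (hw (A.e0 k))
  · intro hw h
    have h2 : ∑ a, (siteRep (𝔤 := 𝔤) e).act a ((h : H) : 𝔤) =
        ∑ k, form 𝔤 c ((h : H) : 𝔤) ((A.e0 k : H) : 𝔤) •
          (twistedFrame A hν hH (siteRep (𝔤 := 𝔤) e)).tot k := by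
      conv_lhs => rw [← sum_e0 A h]
      simp only [map_sum, map_smul]
      rw [Finset.sum_comm]
      exact Finset.sum_congr rfl fun k _ => Finset.smul_sum.symm
    rw [h1, h2, sum_apply]
    refine Finset.sum_eq_zero fun k _ => ?_
    rw [smul_apply, hw, smul_zero]

end

end TwistedKZB
end

/-! ### Flatness of the twisted connection. -/

open TwistedKZB in
theorem mainTheorem11
    {𝔤 : Type*} [LieRing 𝔤] [LieAlgebra ℂ 𝔤] [FiniteDimensional ℂ 𝔤] [LieAlgebra.IsSimple ℂ 𝔤]
    (H : LieSubalgebra ℂ 𝔤) [H.IsCartanSubalgebra]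
    (ν : 𝔤 ≃ₗ⁅ℂ⁆ 𝔤) (hν : IsDiagramAut H ν)
    (r : ℕ) (hr : 0 < r) (hνr : orderOf ν.toLinearEquiv = r)
    (c : ℂ) (hc : c ≠ 0) (N n : ℕ) (A : AdaptedBasis H ν c N n) (ϖ : invCartan H ν)
    (l : ℕ) (V : Fin l → Type*) [∀ a, AddCommGroup (V a)] [∀ a, Module ℂ (V a)]
    [∀ a, LieRingModule 𝔤 (V a)] [∀ a, LieModule ℂ 𝔤 (V a)] [∀ a, FiniteDimensional ℂ (V a)]
    (W : Type*) [NormedAddCommGroup W] [NormedSpace ℂ W]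
    (e : (PiTensorProduct ℂ fun a => V a) ≃ₗ[ℂ] W)
    (U : Set (Pt l n)) (hU : IsOpen U) (hUreg : U ⊆ regularSet A r l ϖ)
    (F : Pt l n → W) (hF : IsSection H ν (siteAct (𝔤 := 𝔤) e) U F) :
    (∀ a, IsSection H ν (siteAct e) U (nabla A r ϖ (siteAct e) a F)) ∧
    IsSection H ν (siteAct e) U (nablaTau A r ϖ (siteAct e) F) ∧
    (∀ a b, ∀ x ∈ U,
      nabla A r ϖ (siteAct e) a (nabla A r ϖ (siteAct e) b F) x =
        nabla A r ϖ (siteAct e) b (nabla A r ϖ (siteAct e) a F) x) ∧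
    (∀ a, ∀ x ∈ U,
      nabla A r ϖ (siteAct e) a (nablaTau A r ϖ (siteAct e) F) x =
        nablaTau A r ϖ (siteAct e) (nabla A r ϖ (siteAct e) a F) x) := by
  have hid : ∀ x, ν^[r] x = x := fun x => by
    have h : (ν.toLinearEquiv ^ r) x = x :=
      congrArg (fun g : 𝔤 ≃ₗ[ℂ] 𝔤 => g x) (hνr ▸ pow_orderOf_eq_one ν.toLinearEquiv)
    rw [LinearEquiv.pow_apply] at h
    exact h
  have hH : ∀ x ∈ H, ν x ∈ H := hν.1
  have : NeZero r := ⟨hr.ne'⟩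
  have : FiniteDimensional ℂ W := Module.Finite.equiv e
  have : CompleteSpace W := FiniteDimensional.complete ℂ W
  have hreg : ∀ y ∈ U, y ∈ (siteGrading (A := A) hid hH e ϖ).reg := fun y hy =>
    regularSet_subset_reg hid hH (siteRep e) (hUreg hy)
  have hnear : ∀ {x}, x ∈ U → ∀ᶠ y in nhds x, y ∈ U := fun hx => hU.mem_nhds hx
  have hw : ∀ y ∈ U, ∀ k, (twistedFrame A hid hH (siteRep (𝔤 := 𝔤) e)).tot k (F y) = 0 :=
    fun y hy => (mem_zeroWeight_iff hid hH e _).1 (hF.2 y hy)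
  refine ⟨fun a => ⟨fun x hx => ?_, fun x hx => ?_⟩, ⟨fun x hx => ?_, fun x hx => ?_⟩,
    fun a b x hx => ?_, fun a x hx => ?_⟩
  · rw [nabla_eq hid hH]
    exact ConnData.analyticAt_nab (Frame.Grading.analyticAt_conn_M hr (hreg x hx) a) (hF.1 x hx)
  · rw [nabla_eq hid hH, mem_zeroWeight_iff (A := A) hid hH]
    exact fun k => ConnData.apply_nab_eq_zero ((hnear hx).mono hF.1)
      ((hnear hx).mono fun y hy => hw y hy k) (Frame.tot_inl k a) (Frame.Grading.tot_conn_M k a x)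
  · refine AnalyticAt.congr (ConnData.analyticAt_nabT
      (Frame.Grading.analyticAt_conn_N hr (hreg x hx)) (hF.1 x hx)) ?_
    filter_upwards [hnear hx] with y hy
    exact (nablaTau_eq hid hH e (hUreg hy) F).symm
  · rw [nablaTau_eq hid hH e (hUreg hx), mem_zeroWeight_iff (A := A) hid hH]
    exact fun k => ConnData.apply_nabT_eq_zero ((hnear hx).mono hF.1)
      ((hnear hx).mono fun y hy => hw y hy k) (Frame.Grading.tot_conn_N k x)
  · simp only [nabla_eq hid hH]
    exact Frame.Grading.conn_nab_comm hr (hreg x hx) (hF.1 x hx) (hw x hx) a b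
  · rw [nablaTau_eq hid hH e (hUreg hx)]
    simp only [nabla_eq hid hH]
    -- The two forms of `∇_τ F` are identified only at regular points, so under the outer derivative
    -- they are exchanged by agreement near `x`.
    refine Eq.trans (ConnData.nab_congr a ?_) (Frame.Grading.conn_nab_nabT_comm hr
      ((hnear hx).mono hreg) (hF.1 x hx) (hw x hx) a)
    filter_upwards [hnear hx] with y hy
    exact nablaTau_eq hid hH e (hUreg hy) F
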